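/- **Setting.** Let $K$ be a commutative ring. Let $\Gamma$ be a loop-free quiver (possibly infinite) with vertex set $I$, with finitely many arrows between any two vertices, and let $\theta$ be an involution of the vertices and of the arrows that reverses arrows ($\theta(o(a))=t(\theta(a))$ for every arrow $a$ with origin $o(a)$ and target $t(a)$). Write $|i\to j|$ for the number of arrows from $i$ to $j$ and $i\cdot j=|i\to j|+|j\to i|$. Put $d(i,j)=i\cdot j$ if $i\ne j$, $d(i,i)=-2$; $Q_{ij}(u,v)=(-1)^{|i\to j|}(u-v)^{i\cdot j}$ if $i\neq j$, $Q_{ii}=0$. Let $\lambda\in\mathbb N^I$, $\gamma\in K^I$, and put $d(i)=\lambda_i+\lambda_{\theta(i)}$ if $\gamma_i=0$, $d(i)=-2$ otherwise. Assume for all $i$: $\theta(i)\ne i\Rightarrow\gamma_i=0$, and $\gamma_i=0\Rightarrow(\theta(i)\neq i$ or $d(i)=0)$. The group $B_n=(\mathbb Z/2)^n\rtimes\mathfrak S_n$ acts on $I^n$: $\mathfrak S_n$ permutes the entries and $r_0$ replaces $i_1$ by $\theta(i_1)$; let $r_a=(a,a+1)$. For a $B_n$-orbit $\beta\subseteq I^n$,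 $V_\beta(\Gamma,\lambda,\gamma)$ is the unital associative $K$-algebra with generators $y_1,\dots,y_n$, $\psi_0,\dots,\psi_{n-1}$, $e(\boldsymbol i)$ ($\boldsymbol i\in\beta$) and the following relations, for all indices and all $\boldsymbol i,\boldsymbol j\in\beta$ for which they make sense: - $\sum_{\boldsymbol i\in\beta} e(\boldsymbol i)=1$, $e(\boldsymbol i)e(\boldsymbol j)=\delta_{\boldsymbol i\boldsymbol j}e(\boldsymbol i)$, $y_ay_b=y_by_a$, $y_ae(\boldsymbol i)=e(\boldsymbol i)y_a$; - $\psi_ae(\boldsymbol i)=e(r_a\cdot\boldsymbol i)\psi_a$ for $0\le a\le n-1$, and $\psi_a\psi_b=\psi_b\psi_a$ if $|a-b|>1$; - for $a\ge1$: $(\psi_ay_b-y_{r_a(b)}\psi_a)e(\boldsymbol i)$ equals $-e(\boldsymbol i)$ if $b=a$, $i_a=i_{a+1}$; $e(\boldsymbol i)$ if $b=a+1$, $i_a=i_{a+1}$; and $0$ otherwise; - for $a\ge1$: $\psi_a^2e(\boldsymbol i)=Q_{i_ai_{a+1}}(y_a,y_{a+1})e(\boldsymbol i)$; - for $1\le b\le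 n-2$: $(\psi_{b+1}\psi_b\psi_{b+1}-\psi_b\psi_{b+1}\psi_b)e(\boldsymbol i)=\frac{Q_{i_bi_{b+1}}(y_b,y_{b+1})-Q_{i_bi_{b+1}}(y_{b+2},y_{b+1})}{y_b-y_{b+2}}e(\boldsymbol i)$ if $i_b=i_{b+2}$, and $0$ otherwise; - $(\psi_0y_1+y_1\psi_0)e(\boldsymbol i)=2\gamma_{i_1}e(\boldsymbol i)$, and $\psi_0y_a=y_a\psi_0$ for $a\ge2$; - $\psi_0^2e(\boldsymbol i)=(-1)^{\lambda_{\theta(i_1)}}y_1^{d(i_1)}e(\boldsymbol i)$ if $\gamma_{i_1}=0$, and $0$ otherwise; - $((\psi_0\psi_1)^2-(\psi_1\psi_0)^2)e(\boldsymbol i)$ equals $(-1)^{\lambda_{\theta(i_1)}}\frac{(-y_1)^{d(i_1)}-y_2^{d(i_1)}}{y_1+y_2}\psi_1e(\boldsymbol i)$ if $\gamma_{i_1}=0$ and $\theta(i_1)=i_2$, and otherwise equals $\gamma_{i_2}\frac{Q_{i_2i_1}(y_1,-y_2)-Q_{i_2i_1}(y_1,y_2)}{y_1y_2}(y_1\psi_0-\gamma_{i_1})e(\boldsymbol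 i)$ (which is a polynomial expression in the generators, understood as $0$ if $\gamma_{i_2}=0$). It is $\mathbb Z$-graded by $\deg e(\boldsymbol i)=0$, $\deg y_a=2$, $\deg\psi_0e(\boldsymbol i)=d(i_1)$, $\deg\psi_be(\boldsymbol i)=d(i_b,i_{b+1})$ for $b\ge1$. For a finitely supported $\Lambda=(\Lambda_i)_{i\in I}\in\mathbb N^{(I)}$, $V_\beta^\Lambda(\Gamma,\lambda,\gamma)$ is the (graded) quotient of $V_\beta(\Gamma,\lambda,\gamma)$ by the two-sided ideal generated by the elements $y_1^{\Lambda_{i_1}}e(\boldsymbol i)$, $\boldsymbol i\in\beta$ (for $n=0$ the ideal is $0$), and $V_n^\Lambda(\Gamma,\lambda,\gamma)=\bigoplus_\beta V_\beta^\Lambda(\Gamma,\lambda,\gamma)$, over all $B_n$-orbits $\beta\subseteq I^n$ (a possibly non-unital algebra). Let $d\ge1$ and $\Gamma=\coprod_{j=1}^d\Gamma^{(j)}$ be a decomposition into full $\theta$-stable subquivers, with no arrows between different $\Gamma^{(j)}$; let $I=\coprod_jI^{(j)}$ be the partition of the vertices, and $\lambda^{(j)},\gamma^{(j)},\Lambda^{(j)}$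 the restrictions to $I^{(j)}$. For a $B_n$-orbit $\beta$, let $n_j=n_j(\beta)$ be the number of entries in $I^{(j)}$ of any $\boldsymbol i\in\beta$, and let $\beta^{(j)}\subseteq(I^{(j)})^{n_j}$ be the $B_{n_j}$-orbit of the tuples obtained from the $\boldsymbol i\in\beta$ by removing the entries not in $I^{(j)}$. Matrix algebras are graded by the degrees of the entries, and tensor products (over $K$) and direct sums are graded as usual. **Statement.** Let $n\ge0$. (1) For every $B_n$-orbit $\beta\subseteq I^n$ there is an isomorphism of graded algebras $$\Theta:\ V_\beta(\Gamma,\lambda,\gamma)\ \simeq\ \mathrm{Mat}_{\binom{n}{n_1,\dots,n_d}}\Bigl(\bigotimes_{j=1}^dV_{\beta^{(j)}}(\Gamma^{(j)},\lambda^{(j)},\gamma^{(j)})\Bigr)$$ that descends to the cyclotomic quotients: for every finitely supported $\Lambda$ there is an isomorphism of graded algebras $$\Theta^\Lambda:\ V^\Lambda_\beta(\Gamma,\lambda,\gamma)\ \simeq\ \mathrm{Mat}_{\binom{n}{n_1,\dots,n_d}}\Bigl(\bigotimes_{j=1}^dV^{\Lambda^{(j)}}_{\beta^{(j)}}(\Gamma^{(j)},\lambda^{(j)},\gamma^{(j)})\Bigr)$$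 such that $\Theta$ and $\Theta^\Lambda$ commute with the quotient maps (applied to each tensor factor of each matrix entry on the right-hand sides). (2) For every finitely supported $\Lambda$ there is an isomorphism of graded (possibly non-unital) algebras $$V_n^\Lambda(\Gamma,\lambda,\gamma)\ \simeq\ \bigoplus_{\substack{n_1,\dots,n_d\ge0\\ n_1+\dots+n_d=n}}\mathrm{Mat}_{\binom{n}{n_1,\dots,n_d}}\Bigl(\bigotimes_{j=1}^dV_{n_j}^{\Lambda^{(j)}}(\Gamma^{(j)},\lambda^{(j)},\gamma^{(j)})\Bigr).$$ -/

import Mathlib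

namespace QuiverHeckeB

open scoped TensorProduct

noncomputable section

universe u v w

/-! ### Quivers with involution -/

/-- A loop-free quiver with vertex set `I` and arrow set `A`, with finitely many arrows between any
two vertices, together with an involution `θ` (on vertices and arrows) that reverses arrows. -/
structure InvQuiver (I : Type u) (A : Type v) where
  /-- origin of an arrow -/
  src : A → I
  /-- target of an arrow -/
  tgt : A → I
  loopless : ∀ a, src a ≠ tgt a
  finite_arrows : ∀ i j, {a | src a = i ∧ tgt a = j}.Finite
  /-- the involution on vertices -/
  inv : I → I
  inv_inv : ∀ i, inv (inv i) = i
  /-- the involution on arrows -/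
  invArrow : A → A
  invArrow_invArrow : ∀ a, invArrow (invArrow a) = a
  inv_src : ∀ a, inv (src a) = tgt (invArrow a)

namespace InvQuiver

variable {I : Type u} {A : Type v} (Γ : InvQuiver I A)

/-- `|i → j|`, the number of arrows from `i` to `j`. -/
def numArrows (i j : I) : ℕ := {a | Γ.src a = i ∧ Γ.tgt a = j}.ncard

/-- `i · j = |i → j| + |i ← j|`. -/
def dot (i j : I) : ℕ := Γ.numArrows i j + Γ.numArrows j i

open Classical in
/-- `d(i, j)`, equal to `i · j` if `i ≠ j` and to `-2` otherwise. -/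
def deg₂ (i j : I) : ℤ := if i = j then -2 else Γ.dot i j

open Classical in
/-- `Q_{ij}(u, v)`, equal to `(-1)^{|i → j|} (u - v)^{i · j}` if `i ≠ j` and to `0` otherwise. -/
def Q {R : Type*} [CommRing R] (i j : I) (u v : R) : R :=
  if i = j then 0 else (-1) ^ Γ.numArrows i j * (u - v) ^ Γ.dot i j

open Classical in
/-- `d(i)`, equal to `λ_i + λ_{θ(i)}` if `γ_i = 0` and to `-2` otherwise. -/
def deg₁ {K : Type*} [Zero K] (lam : I → ℕ) (gam : I → K) (i : I) : ℤ :=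
  if gam i = 0 then ((lam i + lam (Γ.inv i) : ℕ) : ℤ) else -2

/-- The two standing conditions on the weights: `θ(i) ≠ i` implies `γ_i = 0`, and `γ_i = 0` implies
`θ(i) ≠ i` or `d(i) = 0`. -/
def Admissible {K : Type*} [Zero K] (lam : I → ℕ) (gam : I → K) : Prop :=
  ∀ i, (Γ.inv i ≠ i → gam i = 0) ∧ (gam i = 0 → Γ.inv i ≠ i ∨ Γ.deg₁ lam gam i = 0)

/-- The full subquiver on a `θ`-stable set `S` of vertices, with the restricted involution. -/
def full (S : Set I) (hS : ∀ i ∈ S, Γ.inv i ∈ S) :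
    InvQuiver S {a : A // Γ.src a ∈ S ∧ Γ.tgt a ∈ S} where
  src a := ⟨Γ.src a.1, a.2.1⟩
  tgt a := ⟨Γ.tgt a.1, a.2.2⟩
  loopless a h := Γ.loopless a.1 (congrArg Subtype.val h)
  finite_arrows i j :=
    ((Γ.finite_arrows i.1 j.1).preimage Subtype.val_injective.injOn).subset
      fun _ h => ⟨congrArg Subtype.val h.1, congrArg Subtype.val h.2⟩
  inv i := ⟨Γ.inv i.1, hS i.1 i.2⟩
  inv_inv i := Subtype.ext (Γ.inv_inv i.1)
  invArrow a := ⟨Γ.invArrow a.1, by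
    have h1 := Γ.inv_src a.1
    have h2 := Γ.inv_src (Γ.invArrow a.1)
    rw [Γ.invArrow_invArrow] at h2
    refine ⟨?_, h1 ▸ hS _ a.2.1⟩
    rw [← Γ.inv_inv (Γ.src _), h2]
    exact hS _ a.2.2⟩
  invArrow_invArrow a := Subtype.ext (Γ.invArrow_invArrow a.1)
  inv_src a := Subtype.ext (Γ.inv_src a.1)

/-- A decomposition `Γ = Γ^(1) ⊔ … ⊔ Γ^(d)` into full `θ`-stable subquivers without arrows between
different parts: `comp i` is the index of the part that contains the vertex `i`. -/
structure Decomposition (d : ℕ) where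
  comp : I → Fin d
  comp_inv : ∀ i, comp (Γ.inv i) = comp i
  comp_src : ∀ a, comp (Γ.src a) = comp (Γ.tgt a)

namespace Decomposition

variable {Γ} {d : ℕ} (D : Γ.Decomposition d)

/-- The vertex set `I^(j)`. -/
def verts (j : Fin d) : Set I := {i | D.comp i = j}

/-- The subquiver `Γ^(j)`. -/
def part (j : Fin d) :
    InvQuiver (D.verts j) {a : A // Γ.src a ∈ D.verts j ∧ Γ.tgt a ∈ D.verts j} :=
  Γ.full (D.verts j) fun i hi => (D.comp_inv i).trans hi

end Decomposition

/-! ### Orbits of the group `B_n ≃ (ℤ/2)^n ⋊ 𝔖_n` on `I^n` -/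

/-- `i'` and `i` are in the same `B_n`-orbit: `i' = (g₁ · i_{w⁻¹(1)}, …, g_n · i_{w⁻¹(n)})` for some
`w ∈ 𝔖_n` and `g₁, …, g_n ∈ {1, θ}` (`g k = true` stands for `θ`). -/
def SameBOrbit {n : ℕ} (i i' : Fin n → I) : Prop :=
  ∃ (g : Fin n → Bool) (w : Equiv.Perm (Fin n)),
    ∀ k, i' k = if g k then Γ.inv (i (w⁻¹ k)) else i (w⁻¹ k)

/-- `β ⊆ I^n` is a `B_n`-orbit. -/
def IsBOrbit {n : ℕ} (β : Set (Fin n → I)) : Prop :=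
  ∃ i, β = {i' | Γ.SameBOrbit i i'}

/-- The type of `B_n`-orbits in `I^n`. -/
abbrev BOrbit (n : ℕ) : Type u := {β : Set (Fin n → I) // Γ.IsBOrbit β}

namespace Decomposition

variable {Γ} {d : ℕ} (D : Γ.Decomposition d) {n : ℕ}

/-- `n_j(β)`: the number of entries in `I^(j)` of a tuple of `β` (for a `B_n`-orbit `β` this number
is the same for all tuples of `β`, so the infimum is taken over a one-element set). -/
def size (β : Set (Fin n → I)) (j : Fin d) : ℕ :=
  sInf {m | ∃ i ∈ β, m = {k | D.comp (i k) = j}.ncard}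

/-- `β^(j)`: the set of the tuples `i^(j)`, for `i ∈ β`, where `i^(j)` is obtained from `i` by
removing the entries that are not in `I^(j)` (the remaining entries, at the positions enumerated
increasingly by `f`, are kept in their order). -/
def sub (β : Set (Fin n → I)) (j : Fin d) : Set (Fin (D.size β j) → D.verts j) :=
  {i' | ∃ i ∈ β, ∃ f : Fin (D.size β j) → Fin n, StrictMono f ∧
    Set.range f = {k | D.comp (i k) = j} ∧ ∀ k, (i' k : I) = i (f k)}

end Decomposition

end InvQuiver

/-! ### Polynomial expressions in commuting generators -/

open Classical in
/-- Exact quotient `P / D` of polynomials (`0` if `D` does not divide `P`). -/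
def exactDiv {R : Type*} [CommRing R] (P D : R) : R :=
  if h : ∃ F, F * D = P then h.choose else 0

theorem exactDiv_eq {R : Type*} [CommRing R] {P D F : R} (hD : IsRightRegular D)
    (h : F * D = P) : exactDiv P D = F := by
  have hex : ∃ F, F * D = P := ⟨F, h⟩
  rw [exactDiv, dif_pos hex]
  exact hD (hex.choose_spec.trans h.symm)

/-- The value `F(y₁, …, y_n)` of a polynomial at elements of an algebra, each monomial being written
in increasing order of the variables. -/
def polyEval {K : Type*} [CommRing K] {B : Type*} [Ring B] [Algebra K B] {n : ℕ} (y : Fin n → B)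
    (F : MvPolynomial (Fin n) K) : B :=
  ∑ s ∈ F.support, F.coeff s • (List.ofFn fun a => y a ^ s a).prod

/-! ### The algebra `V_β(Γ, λ, γ)` -/

/-- The generators. Positions `1, …, n` are represented by `Fin n`, so that `y_{a+1}` is `y a`. The
generator `psi b` is `ψ_b` for `0 ≤ b ≤ n - 1`: thus `psi 0` is `ψ₀`, and for `b ≥ 1`, `psi b`
belongs to the transposition of the entries `b - 1` and `b` of `Fin n`. -/
inductive Gen {I : Type u} {n : ℕ} (β : Set (Fin n → I)) : Type u
  | e (i : β)
  | y (a : Fin n)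
  | psi (b : Fin n)

section V

variable (K : Type w) [CommRing K] {I : Type u} {A : Type v} (Γ : InvQuiver I A)
  (lam : I → ℕ) (gam : I → K) {n : ℕ} (β : Set (Fin n → I))

section Free

variable {β}

/-- `e(i)` in the free algebra. -/
abbrev fe (i : β) : FreeAlgebra K (Gen β) := FreeAlgebra.ι K (Gen.e i)

variable (β)

/-- `y_{a+1}` in the free algebra. -/
abbrev fy (a : Fin n) : FreeAlgebra K (Gen β) := FreeAlgebra.ι K (Gen.y a)

/-- `ψ_b` in the free algebra. -/
abbrev fpsi (b : Fin n) : FreeAlgebra K (Gen β) := FreeAlgebra.ι K (Gen.psi b)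

end Free

open Classical MvPolynomial in
/-- The defining relations of `V_β(Γ, λ, γ)`. Two or three letters `a, b, c` with `a + 1 = b` and
`b + 1 = c` are consecutive positions, `o` is the first and `t` the second position. -/
inductive VRel : FreeAlgebra K (Gen β) → FreeAlgebra K (Gen β) → Prop
  | sum_e : VRel (∑ᶠ i : β, fe K i) 1
  | e_mul_self (i : β) : VRel (fe K i * fe K i) (fe K i)
  | e_mul_ne (i j : β) (h : i ≠ j) : VRel (fe K i * fe K j) 0
  | y_comm (a b : Fin n) : VRel (fy K β a * fy K β b) (fy K β b * fy K β a)
  | y_e (a : Fin n) (i : β) : VRel (fy K β a * fe K i) (fe K i * fy K β a)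
  | psi_e (a b : Fin n) (hab : a.val + 1 = b.val) (i j : β) (hj : j.1 = i.1 ∘ Equiv.swap a b) :
      VRel (fpsi K β b * fe K i) (fe K j * fpsi K β b)
  | psi_y (a b : Fin n) (hab : a.val + 1 = b.val) (c : Fin n) (i : β) :
      VRel ((fpsi K β b * fy K β c - fy K β (Equiv.swap a b c) * fpsi K β b) * fe K i)
        (if c = a ∧ i.1 a = i.1 b then -fe K i
          else if c = b ∧ i.1 a = i.1 b then fe K i else 0)
  /- for `a = 0` this is the commutation of `ψ₀` with `ψ_b`, `b ≥ 2` -/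
  | psi_comm (a b : Fin n) (hab : a.val + 1 < b.val) :
      VRel (fpsi K β a * fpsi K β b) (fpsi K β b * fpsi K β a)
  | psi_sq (a b : Fin n) (hab : a.val + 1 = b.val) (i : β) :
      VRel (fpsi K β b ^ 2 * fe K i)
        (polyEval (fy K β) (Γ.Q (i.1 a) (i.1 b) (X a) (X b) : MvPolynomial (Fin n) K) * fe K i)
  | braid3 (a b c : Fin n) (hab : a.val + 1 = b.val) (hbc : b.val + 1 = c.val) (i : β) :
      VRel
        ((fpsi K β c * fpsi K β b * fpsi K β c - fpsi K β b * fpsi K β c * fpsi K β b) * fe K i)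
        (if i.1 a = i.1 c then
          polyEval (fy K β) (exactDiv
            (Γ.Q (i.1 a) (i.1 b) (X a) (X b) - Γ.Q (i.1 a) (i.1 b) (X c) (X b) :
              MvPolynomial (Fin n) K) (X a - X c)) * fe K i
          else 0)
  | psi0_e (o : Fin n) (ho : o.val = 0) (i j : β)
      (hj : j.1 = Function.update i.1 o (Γ.inv (i.1 o))) :
      VRel (fpsi K β o * fe K i) (fe K j * fpsi K β o)
  | psi0_y1 (o : Fin n) (ho : o.val = 0) (i : β) :
      VRel ((fpsi K β o * fy K β o + fy K β o * fpsi K β o) * fe K i)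
        ((2 * gam (i.1 o)) • fe K i)
  | psi0_y (o : Fin n) (ho : o.val = 0) (a : Fin n) (ha : a ≠ o) :
      VRel (fpsi K β o * fy K β a) (fy K β a * fpsi K β o)
  | psi0_sq (o : Fin n) (ho : o.val = 0) (i : β) :
      VRel (fpsi K β o ^ 2 * fe K i)
        (if gam (i.1 o) = 0 then
          (-1) ^ lam (Γ.inv (i.1 o)) * fy K β o ^ (lam (i.1 o) + lam (Γ.inv (i.1 o))) * fe K i
          else 0)
  | braid4_theta (o t : Fin n) (ho : o.val = 0) (ht : t.val = 1) (i : β)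
      (h : gam (i.1 o) = 0 ∧ Γ.inv (i.1 o) = i.1 t) :
      VRel
        (((fpsi K β o * fpsi K β t) ^ 2 - (fpsi K β t * fpsi K β o) ^ 2) * fe K i)
        ((-1) ^ lam (Γ.inv (i.1 o)) * polyEval (fy K β) (exactDiv
            ((-X o) ^ (lam (i.1 o) + lam (Γ.inv (i.1 o)))
              - X t ^ (lam (i.1 o) + lam (Γ.inv (i.1 o))) : MvPolynomial (Fin n) K)
            (X o + X t)) * fpsi K β t * fe K i)
  /- The right-hand side is `γ_{i₂} (F / (y₁ y₂)) (y₁ ψ₀ - γ_{i₁}) e(i)` with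
  `F = Q_{i₂ i₁}(y₁, -y₂) - Q_{i₂ i₁}(y₁, y₂)`, read as
  `γ_{i₂} ((F y₁ / (y₁ y₂)) ψ₀ - γ_{i₁} (F / (y₁ y₂))) e(i)`. The first quotient is always a
  polynomial, the second one is a polynomial whenever `γ_{i₁}` and `γ_{i₂}` are non-zero. -/
  | braid4_other (o t : Fin n) (ho : o.val = 0) (ht : t.val = 1) (i : β)
      (h : ¬(gam (i.1 o) = 0 ∧ Γ.inv (i.1 o) = i.1 t)) :
      VRel
        (((fpsi K β o * fpsi K β t) ^ 2 - (fpsi K β t * fpsi K β o) ^ 2) * fe K i)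
        (gam (i.1 t) •
          ((polyEval (fy K β) (exactDiv
              ((Γ.Q (i.1 t) (i.1 o) (X o) (-X t) - Γ.Q (i.1 t) (i.1 o) (X o) (X t)) * X o :
                MvPolynomial (Fin n) K) (X o * X t)) * fpsi K β o
            - gam (i.1 o) • polyEval (fy K β) (exactDiv
              (Γ.Q (i.1 t) (i.1 o) (X o) (-X t) - Γ.Q (i.1 t) (i.1 o) (X o) (X t) :
                MvPolynomial (Fin n) K) (X o * X t))) * fe K i))

/-- The algebra `V_β(Γ, λ, γ)`. -/
def V : Type (max u w) := RingQuot (VRel K Γ lam gam β)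

instance : Ring (V K Γ lam gam β) := inferInstanceAs (Ring (RingQuot (VRel K Γ lam gam β)))

instance : Algebra K (V K Γ lam gam β) :=
  inferInstanceAs (Algebra K (RingQuot (VRel K Γ lam gam β)))

namespace V

/-- The class of an element of the free algebra. -/
def mk : FreeAlgebra K (Gen β) →ₐ[K] V K Γ lam gam β :=
  RingQuot.mkAlgHom K (VRel K Γ lam gam β)

/-- The generator `e(i)`. -/
def e (i : β) : V K Γ lam gam β := mk K Γ lam gam β (fe K i)

/-- The generator `y_{a+1}`. -/
def y (a : Fin n) : V K Γ lam gam β := mk K Γ lam gam β (fy K β a)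

/-- The generator `ψ_b`. -/
def psi (b : Fin n) : V K Γ lam gam β := mk K Γ lam gam β (fpsi K β b)

/-- Products of the homogeneous elements `e(i)`, `y_a`, `ψ_b e(i)`, with their degrees. -/
inductive HomogWord : ℤ → V K Γ lam gam β → Prop
  | e (i : β) : HomogWord 0 (e K Γ lam gam β i)
  | y (a : Fin n) : HomogWord 2 (y K Γ lam gam β a)
  | psi0 (o : Fin n) (ho : o.val = 0) (i : β) :
      HomogWord (Γ.deg₁ lam gam (i.1 o)) (psi K Γ lam gam β o * e K Γ lam gam β i)
  | psi (a b : Fin n) (hab : a.val + 1 = b.val) (i : β) :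
      HomogWord (Γ.deg₂ (i.1 a) (i.1 b)) (psi K Γ lam gam β b * e K Γ lam gam β i)
  | mul (k l : ℤ) (x x' : V K Γ lam gam β) (hx : HomogWord k x) (hx' : HomogWord l x') :
      HomogWord (k + l) (x * x')

/-- The homogeneous component of degree `k` of `V_β(Γ, λ, γ)`. -/
def grade (k : ℤ) : Submodule K (V K Γ lam gam β) :=
  Submodule.span K {x | HomogWord K Γ lam gam β k x}

end V

/-! ### The cyclotomic quotient `V_β^Λ(Γ, λ, γ)` -/

variable (Lam : I → ℕ)

/-- The cyclotomic relations `y₁^{Λ_{i₁}} e(i) = 0`, `i ∈ β` (no relation if `n = 0`). -/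
inductive CycRel : V K Γ lam gam β → V K Γ lam gam β → Prop
  | mk (o : Fin n) (ho : o.val = 0) (i : β) :
      CycRel (V.y K Γ lam gam β o ^ Lam (i.1 o) * V.e K Γ lam gam β i) 0

/-- The algebra `V_β^Λ(Γ, λ, γ)`: the quotient of `V_β(Γ, λ, γ)` by the two-sided ideal generated by
the elements `y₁^{Λ_{i₁}} e(i)`, `i ∈ β`. -/
def VCyc : Type (max u w) := RingQuot (CycRel K Γ lam gam β Lam)

instance : Ring (VCyc K Γ lam gam β Lam) :=
  inferInstanceAs (Ring (RingQuot (CycRel K Γ lam gam β Lam)))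

instance : Algebra K (VCyc K Γ lam gam β Lam) :=
  inferInstanceAs (Algebra K (RingQuot (CycRel K Γ lam gam β Lam)))

namespace VCyc

/-- The quotient map `V_β(Γ, λ, γ) → V_β^Λ(Γ, λ, γ)`. -/
def mk : V K Γ lam gam β →ₐ[K] VCyc K Γ lam gam β Lam :=
  RingQuot.mkAlgHom K (CycRel K Γ lam gam β Lam)

/-- The homogeneous component of degree `k` of `V_β^Λ(Γ, λ, γ)`. -/
def grade (k : ℤ) : Submodule K (VCyc K Γ lam gam β Lam) :=
  (V.grade K Γ lam gam β k).map (mk K Γ lam gam β Lam).toLinearMap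

end VCyc

end V

/-! ### Graded algebras, direct sums and tensor products -/

section Graded

variable {K : Type*} [CommRing K]

/-- `𝒜` is a `ℤ`-grading of the (possibly non-unital) `K`-algebra `B`. -/
def IsAlgGrading {B : Type*} [NonUnitalNonAssocSemiring B] [Module K B]
    (𝒜 : ℤ → Submodule K B) : Prop :=
  DirectSum.IsInternal 𝒜 ∧ ∀ k l, ∀ x ∈ 𝒜 k, ∀ y ∈ 𝒜 l, x * y ∈ 𝒜 (k + l)

/-- `𝒜` and `ℬ` are gradings, and `f` is a bijection that maps each homogeneous component onto the
component of the same degree; so an algebra homomorphism `f` with this property is an isomorphism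
of graded algebras. -/
def IsGradedBijection {B C : Type*} [NonUnitalNonAssocSemiring B] [Module K B]
    [NonUnitalNonAssocSemiring C] [Module K C]
    (𝒜 : ℤ → Submodule K B) (ℬ : ℤ → Submodule K C) (f : B → C) : Prop :=
  IsAlgGrading 𝒜 ∧ IsAlgGrading ℬ ∧ Function.Bijective f ∧ ∀ k x, f x ∈ ℬ k ↔ x ∈ 𝒜 k

/-- The direct sum of a family of (possibly non-unital) algebras: the families with finitely many
non-zero components, with componentwise operations. -/
def DSum (K : Type*) [CommRing K] {ι : Type*} (B : ι → Type*) [∀ i, NonUnitalSemiring (B i)]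
    [∀ i, Module K (B i)] : NonUnitalSubalgebra K (∀ i, B i) where
  carrier := {x | {i | x i ≠ 0}.Finite}
  zero_mem' := by simp
  add_mem' {x y} hx hy := (Set.Finite.union hx hy).subset fun i hi => by
    by_contra h
    simp only [Set.mem_union, Set.mem_ofPred_eq, not_or, not_not] at h
    exact hi (by simp [h.1, h.2])
  mul_mem' {x y} hx _ := Set.Finite.subset hx fun i hi h => hi (by simp [h])
  smul_mem' c x hx := Set.Finite.subset hx fun i hi h => hi (by simp [h])

/-- The grading of a direct sum. -/
def dsumGrade {ι : Type*} {B : ι → Type*} [∀ i, NonUnitalSemiring (B i)]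
    [∀ i, Module K (B i)] (𝒜 : ∀ i, ℤ → Submodule K (B i)) (k : ℤ) : Submodule K (DSum K B) where
  carrier := {x | ∀ i, x.1 i ∈ 𝒜 i k}
  zero_mem' i := (𝒜 i k).zero_mem
  add_mem' hx hy i := (𝒜 i k).add_mem (hx i) (hy i)
  smul_mem' c _ hx i := (𝒜 i k).smul_mem c (hx i)

/-- The grading of a tensor product: the component of degree `k` is spanned by the pure tensors of
homogeneous elements whose degrees have the sum `k`. -/
def tensorGrade {d : ℕ} {B : Fin d → Type*} [∀ j, AddCommMonoid (B j)] [∀ j, Module K (B j)]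
    (𝒜 : ∀ j, ℤ → Submodule K (B j)) (k : ℤ) : Submodule K (⨂[K] j, B j) :=
  Submodule.span K {x | ∃ (l : Fin d → ℤ) (b : ∀ j, B j), ∑ j, l j = k ∧ (∀ j, b j ∈ 𝒜 j (l j)) ∧
    x = PiTensorProduct.tprod K b}

/-- The grading of a matrix algebra by the degrees of the entries. -/
def matGrade {N : ℕ} {B : Type*} [AddCommMonoid B] [Module K B] (𝒜 : ℤ → Submodule K B) (k : ℤ) :
    Submodule K (Matrix (Fin N) (Fin N) B) :=
  (𝒜 k).matrix

end Graded

/-! ### The algebra `V_n^Λ(Γ, λ, γ)` -/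

section Vn

variable (K : Type w) [CommRing K] {I : Type u} {A : Type v} (Γ : InvQuiver I A)
  (lam : I → ℕ) (gam : I → K) (n : ℕ) (Lam : I → ℕ)

/-- `V_n^Λ(Γ, λ, γ)`, the direct sum of the algebras `V_β^Λ(Γ, λ, γ)` over all `B_n`-orbits `β` in
`I^n`. It is not unital in general. -/
abbrev VnCyc : Type (max u w) :=
  DSum K fun β : Γ.BOrbit n => VCyc K Γ lam gam β.1 Lam

/-- The homogeneous component of degree `k` of `V_n^Λ(Γ, λ, γ)`. -/
def VnCyc.grade (k : ℤ) : Submodule K (VnCyc K Γ lam gam n Lam) :=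
  dsumGrade (fun β : Γ.BOrbit n => VCyc.grade K Γ lam gam β.1 Lam) k

end Vn

/-! ### The algebras attached to the parts of a decomposition -/

section Parts

variable (K : Type w) [CommRing K] {I : Type u} {A : Type v} {Γ : InvQuiver I A}
  {d : ℕ} (D : Γ.Decomposition d) (lam : I → ℕ) (gam : I → K)

/-- `V_{β^(j)}(Γ^(j), λ^(j), γ^(j))`. -/
abbrev VPart {n : ℕ} (β : Set (Fin n → I)) (j : Fin d) : Type (max u w) :=
  V K (D.part j) (fun i => lam i) (fun i => gam i) (D.sub β j)

/-- `V_{β^(j)}^{Λ^(j)}(Γ^(j), λ^(j), γ^(j))`. -/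
abbrev VCycPart {n : ℕ} (β : Set (Fin n → I)) (Lam : I → ℕ) (j : Fin d) : Type (max u w) :=
  VCyc K (D.part j) (fun i => lam i) (fun i => gam i) (D.sub β j) (fun i => Lam i)

/-- `V_m^{Λ^(j)}(Γ^(j), λ^(j), γ^(j))`. -/
abbrev VnCycPart (Lam : I → ℕ) (j : Fin d) (m : ℕ) : Type (max u w) :=
  VnCyc K (D.part j) (fun i => lam i) (fun i => gam i) m (fun i => Lam i)

/-- `Mat_N(⊗_j V_{β^(j)}(Γ^(j), λ^(j), γ^(j)))` with `N = n! / (n₁! ⋯ n_d!)`, `n_j = n_j(β)`. -/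
abbrev MatV {n : ℕ} (β : Set (Fin n → I)) : Type (max u w) :=
  Matrix (Fin (Nat.multinomial Finset.univ (D.size β)))
    (Fin (Nat.multinomial Finset.univ (D.size β))) (⨂[K] j, VPart K D lam gam β j)

/-- The grading of `Mat_N(⊗_j V_{β^(j)}(Γ^(j), λ^(j), γ^(j)))`. -/
def MatV.grade {n : ℕ} (β : Set (Fin n → I)) : ℤ → Submodule K (MatV K D lam gam β) :=
  matGrade (tensorGrade fun j =>
    V.grade K (D.part j) (fun i => lam i) (fun i => gam i) (D.sub β j))

/-- `Mat_N(⊗_j V_{β^(j)}^{Λ^(j)}(Γ^(j), λ^(j), γ^(j)))` with `N = n! / (n₁! ⋯ n_d!)`,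
`n_j = n_j(β)`. -/
abbrev MatVCyc {n : ℕ} (β : Set (Fin n → I)) (Lam : I → ℕ) : Type (max u w) :=
  Matrix (Fin (Nat.multinomial Finset.univ (D.size β)))
    (Fin (Nat.multinomial Finset.univ (D.size β))) (⨂[K] j, VCycPart K D lam gam β Lam j)

/-- The grading of `Mat_N(⊗_j V_{β^(j)}^{Λ^(j)}(Γ^(j), λ^(j), γ^(j)))`. -/
def MatVCyc.grade {n : ℕ} (β : Set (Fin n → I)) (Lam : I → ℕ) :
    ℤ → Submodule K (MatVCyc K D lam gam β Lam) :=
  matGrade (tensorGrade fun j =>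
    VCyc.grade K (D.part j) (fun i => lam i) (fun i => gam i) (D.sub β j) (fun i => Lam i))

/-- The entrywise quotient map `Mat_N(⊗_j V_{β^(j)}) → Mat_N(⊗_j V_{β^(j)}^{Λ^(j)})`. -/
def MatV.toCyc {n : ℕ} (β : Set (Fin n → I)) (Lam : I → ℕ) (M : MatV K D lam gam β) :
    MatVCyc K D lam gam β Lam :=
  M.map (PiTensorProduct.map fun j =>
    (VCyc.mk K (D.part j) (fun i => lam i) (fun i => gam i) (D.sub β j)
      (fun i => Lam i)).toLinearMap)

/-- The compositions `n = n₁ + ⋯ + n_d` with `n_j ≥ 0`. -/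
abbrev Compositions (d n : ℕ) : Type := {c : Fin d → ℕ // ∑ j, c j = n}

/-- `Mat_N(⊗_j V_{n_j}^{Λ^(j)}(Γ^(j), λ^(j), γ^(j)))` with `N = n! / (n₁! ⋯ n_d!)`. -/
abbrev MatVnCyc (Lam : I → ℕ) (c : Fin d → ℕ) : Type (max u w) :=
  Matrix (Fin (Nat.multinomial Finset.univ c)) (Fin (Nat.multinomial Finset.univ c))
    (⨂[K] j, VnCycPart K D lam gam Lam j (c j))

/-- The direct sum over `n₁ + ⋯ + n_d = n` of `Mat_N(⊗_j V_{n_j}^{Λ^(j)}(Γ^(j), λ^(j), γ^(j)))`. -/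
abbrev SumMatVnCyc (Lam : I → ℕ) (n : ℕ) : Type (max u w) :=
  DSum K fun c : Compositions d n => MatVnCyc K D lam gam Lam c.1

/-- The grading of the direct sum over `n₁ + ⋯ + n_d = n`. -/
def SumMatVnCyc.grade (Lam : I → ℕ) (n : ℕ) :
    ℤ → Submodule K (SumMatVnCyc K D lam gam Lam n) :=
  dsumGrade fun c : Compositions d n => matGrade (tensorGrade fun j =>
    VnCyc.grade K (D.part j) (fun i => lam i) (fun i => gam i) (c.1 j) (fun i => Lam i))

end Parts

end

end QuiverHeckeB

namespace QuiverHeckeB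

open scoped TensorProduct

noncomputable section

universe u v w

/-! ### Explicit quotients of polynomials -/

/-! Sort the tuples of $\beta$ by their words: the word of $i$ records for each position the part of
$\Gamma$ that contains the entry. There are $\binom{n}{n_1,\dots,n_d}$ words, and a tuple of $\beta$
amounts to a word together with one tuple of each $\beta^{(j)}$ (`glue_mem_iff`). No arrows join
different parts, so across parts $Q=1$ and the correction terms of the braid relations vanish. Hence
$\psi_b$, applied to a word with different letters in the two positions that it exchanges, is
invertible of degree $0$ and identifies the components of two words. This makes $V_\beta$ a matrix
algebra over the corner of one word, and that corner is $\bigotimes_jV_{\beta^{(j)}}$.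

In one direction the map is explicit (`isRep_mat`): $e(i)$ and $y_a$ go to diagonal matrices, and
$\psi_b$ goes to the permutation matrix of the exchange, with the entry $1$ where the exchanged
letters differ and a $\psi_k$ of a tensor factor where they agree. The generator $\psi_0$ always
counts as the second case; it becomes the $\psi_0$ of the factor named by the first letter.

The inverse is built from two ingredients. The first is a system of matrix units
(`exists_wordUnits`): products of the $\psi_b$ that sort a word do not depend on the chosen chain of
descents (`IsDown.unique`) and are invertible. The second is a family of commuting copies of the
$V_{\beta^{(j)}}$ inside $V_\beta$ (`exists_partHom`, `IsPartHom.commute`). At a word in which the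
letters $j$ come first, the relations of $V_{\beta^{(j)}}$, including those of $\psi_0$, are
literally relations of $V_\beta$; conjugation by the matrix units spreads this copy over all words.
Different copies commute because this can be tested at one convenient word. The delicate pair is two
elements $\psi_0$, which commute by the braid relation of length four. The two homomorphisms are
inverse to each other on generators, so no basis theorem is needed.

The relations are homogeneous, so $x\mapsto xT^{\deg x}$ defines an algebra homomorphism, and it
separates the degrees; this argument passes to cyclotomic quotients. The gradings on the matrix side
are transported from $V_\beta$ instead of being treated separately. The cyclotomic relations
correspond to each other because the first position of a tuple is the first position of one of its
restrictions. The second assertion follows by summing over $\beta$: orbits in $I^n$ correspond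
bijectively to families of orbits in the parts (`partOrbits`), and matrices and tensor products
distribute over direct sums. -/

/-- The complete homogeneous sum `∑_{r < m} u^r v^{m-1-r}`, equal to `(u^m - v^m) / (u - v)`. -/
def homSum {R : Type*} [Ring R] (m : ℕ) (u v : R) : R :=
  ∑ r ∈ Finset.range m, u ^ r * v ^ (m - 1 - r)

theorem homSum_mul_sub {R : Type*} [CommRing R] (m : ℕ) (u v : R) :
    homSum m u v * (u - v) = u ^ m - v ^ m :=
  geom_sum₂_mul u v m

theorem map_homSum {R S F : Type*} [Ring R] [Ring S] [FunLike F R S] [RingHomClass F R S] (f : F)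
    (m : ℕ) (u v : R) : f (homSum m u v) = homSum m (f u) (f v) := by
  simp [homSum]

@[simp]
theorem homSum_zero {R : Type*} [Ring R] (u v : R) : homSum 0 u v = 0 := by
  simp [homSum]

namespace InvQuiver

variable {I : Type u} {A : Type v} (Γ : InvQuiver I A)

theorem deg₂_comm (i j : I) : Γ.deg₂ i j = Γ.deg₂ j i := by
  unfold deg₂ dot
  by_cases h : i = j
  · rw [h]
  · rw [if_neg h, if_neg (Ne.symm h), add_comm]

theorem deg₂_self (i : I) : Γ.deg₂ i i = -2 := by simp [deg₂]

theorem deg₂_of_ne {i j : I} (h : i ≠ j) : Γ.deg₂ i j = Γ.dot i j := by simp [deg₂, h]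

theorem inv_injective : Function.Injective Γ.inv := fun i j h => by
  rw [← Γ.inv_inv i, h, Γ.inv_inv]

theorem inv_tgt (a : A) : Γ.inv (Γ.tgt a) = Γ.src (Γ.invArrow a) := by
  rw [← Γ.inv_inv (Γ.src _), Γ.inv_src, Γ.invArrow_invArrow]

theorem numArrows_inv (i j : I) : Γ.numArrows (Γ.inv i) (Γ.inv j) = Γ.numArrows j i := by
  refine Set.ncard_congr (fun a _ => Γ.invArrow a) ?_ ?_ ?_
  · rintro a ⟨h1, h2⟩
    refine ⟨?_, ?_⟩
    · rw [← Γ.inv_tgt, h2, Γ.inv_inv]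
    · rw [← Γ.inv_src, h1, Γ.inv_inv]
  · intro a b _ _ h
    rw [← Γ.invArrow_invArrow a, h, Γ.invArrow_invArrow]
  · rintro a ⟨h1, h2⟩
    exact ⟨Γ.invArrow a, ⟨by rw [← Γ.inv_tgt, h2], by rw [← Γ.inv_src, h1]⟩,
      Γ.invArrow_invArrow a⟩

theorem dot_comm (i j : I) : Γ.dot i j = Γ.dot j i := add_comm _ _

theorem dot_inv (i j : I) : Γ.dot (Γ.inv i) (Γ.inv j) = Γ.dot i j := by
  simp [dot, numArrows_inv, add_comm]

theorem deg₂_inv (i j : I) : Γ.deg₂ (Γ.inv i) (Γ.inv j) = Γ.deg₂ i j := by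
  by_cases h : i = j
  · rw [h, deg₂_self, deg₂_self]
  · rw [Γ.deg₂_of_ne h, Γ.deg₂_of_ne (Γ.inv_injective.ne h), dot_inv]

open Classical in
/-- `Q_{ij}` at arbitrary elements of a ring. -/
def ringQ {R : Type*} [Ring R] (i j : I) (u v : R) : R :=
  if i = j then 0 else (-1) ^ Γ.numArrows i j * (u - v) ^ Γ.dot i j

open Classical in
/-- The divided difference `(Q_{ij}(u, v) - Q_{ij}(w, v)) / (u - w)`. -/
def divQ {R : Type*} [Ring R] (i j : I) (u v w : R) : R :=
  if i = j then 0 else (-1) ^ Γ.numArrows i j * homSum (Γ.dot i j) (u - v) (w - v)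

open Classical in
/-- The quotient `(Q_{ij}(u, -v) - Q_{ij}(u, v)) / v`. -/
def oddQ {R : Type*} [Ring R] (i j : I) (u v : R) : R :=
  if i = j then 0 else 2 * (-1) ^ Γ.numArrows i j * homSum (Γ.dot i j) (u + v) (u - v)

open Classical in
/-- The quotient `(Q_{ij}(u, -v) - Q_{ij}(u, v)) / (u v)` when `i · j` is even. -/
def oddQ' {R : Type*} [Ring R] (i j : I) (u v : R) : R :=
  if i = j then 0 else
    4 * (-1) ^ Γ.numArrows i j * homSum (Γ.dot i j / 2) ((u + v) ^ 2) ((u - v) ^ 2)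

section Maps

variable {R S F : Type*} [Ring R] [Ring S] [FunLike F R S] [RingHomClass F R S] (f : F)

theorem map_ringQ (i j : I) (u v : R) : f (Γ.ringQ i j u v) = Γ.ringQ i j (f u) (f v) := by
  unfold ringQ; split_ifs <;> simp

theorem map_divQ (i j : I) (u v w : R) :
    f (Γ.divQ i j u v w) = Γ.divQ i j (f u) (f v) (f w) := by
  unfold divQ; split_ifs <;> simp [map_homSum]

theorem map_oddQ (i j : I) (u v : R) : f (Γ.oddQ i j u v) = Γ.oddQ i j (f u) (f v) := by
  unfold oddQ; split_ifs <;> simp [map_homSum, map_ofNat f 2]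

theorem map_oddQ' (i j : I) (u v : R) : f (Γ.oddQ' i j u v) = Γ.oddQ' i j (f u) (f v) := by
  unfold oddQ'; split_ifs <;> simp [map_homSum, map_ofNat f 4]

end Maps

section Divisions

variable {R : Type*} [CommRing R]

theorem divQ_mul (i j : I) (u v w : R) :
    Γ.divQ i j u v w * (u - w) = Γ.Q i j u v - Γ.Q i j w v := by
  unfold divQ Q
  split_ifs
  · simp
  · have := homSum_mul_sub (Γ.dot i j) (u - v) (w - v)
    rw [show u - v - (w - v) = u - w by ring] at this
    rw [mul_assoc, this]; ring

theorem oddQ_mul (i j : I) (u v : R) :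
    Γ.oddQ i j u v * (u * v) = (Γ.Q i j u (-v) - Γ.Q i j u v) * u := by
  unfold oddQ Q
  split_ifs
  · simp
  · have := homSum_mul_sub (Γ.dot i j) (u + v) (u - v)
    rw [show u + v - (u - v) = 2 * v by ring] at this
    rw [sub_neg_eq_add, ← mul_sub, ← this]; ring

theorem oddQ'_mul (i j : I) (h : Even (Γ.dot i j)) (u v : R) :
    Γ.oddQ' i j u v * (u * v) = Γ.Q i j u (-v) - Γ.Q i j u v := by
  unfold oddQ' Q
  split_ifs
  · simp
  -- The constant $4$ in `oddQ'` comes from $(u+v)^2-(u-v)^2=4uv$.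
  · have := homSum_mul_sub (Γ.dot i j / 2) ((u + v) ^ 2) ((u - v) ^ 2)
    rw [← pow_mul, ← pow_mul, Nat.two_mul_div_two_of_even h] at this
    rw [sub_neg_eq_add, ← mul_sub, ← this]; ring

/-- The involution exchanges the arrows $i\to j$ with the arrows $\theta(j)\to\theta(i)$, which for
fixed vertices are the arrows $j\to i$; so the two counts in $i\cdot j$ agree. -/
theorem even_dot {i j : I} (hi : Γ.inv i = i) (hj : Γ.inv j = j) : Even (Γ.dot i j) := by
  refine ⟨Γ.numArrows j i, ?_⟩
  have := Γ.numArrows_inv i j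
  rw [hi, hj] at this
  rw [dot, this]

end Divisions

end InvQuiver

/-! ### Evaluation of polynomials at commuting elements -/

section Eval

variable {K : Type*} [CommRing K] {B : Type*} [Ring B] [Algebra K B] {n : ℕ}

/-- The ambient algebra is not commutative, but the subalgebra generated by the $y_a$ is, and there
the ordered monomials of `polyEval` are the usual ones. Thus polynomial identities may be
transported to the $y_a$. -/
theorem exists_evalHom (y : Fin n → B) (h : ∀ a b, y a * y b = y b * y a) :
    ∃ φ : MvPolynomial (Fin n) K →ₐ[K] B, (∀ a, φ (MvPolynomial.X a) = y a) ∧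
      ∀ F, polyEval y F = φ F := by
  have hc : IsMulCommutative (Algebra.adjoin K (Set.range y)) :=
    Algebra.isMulCommutative_adjoin K (by rintro _ ⟨a, rfl⟩ _ ⟨b, rfl⟩; exact h a b)
  let _ : CommRing (Algebra.adjoin K (Set.range y)) :=
    { (inferInstance : Ring (Algebra.adjoin K (Set.range y))) with
      mul_comm := fun a b => hc.is_comm.comm a b }
  let z : Fin n → Algebra.adjoin K (Set.range y) := fun a =>
    ⟨y a, Algebra.subset_adjoin ⟨a, rfl⟩⟩
  refine ⟨(Algebra.adjoin K (Set.range y)).val.comp (MvPolynomial.aeval z), fun a => ?_,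
    fun F => ?_⟩
  · rw [AlgHom.comp_apply, MvPolynomial.aeval_X]; rfl
  · rw [AlgHom.comp_apply, MvPolynomial.aeval_def, MvPolynomial.eval₂_eq', map_sum, polyEval]
    refine Finset.sum_congr rfl fun s _ => ?_
    rw [map_mul, AlgHom.commutes, Algebra.smul_def, ← List.prod_ofFn, map_list_prod,
      List.map_ofFn]
    rfl

theorem map_polyEval {C : Type*} [Ring C] [Algebra K C] (f : B →ₐ[K] C) (y : Fin n → B)
    (F : MvPolynomial (Fin n) K) : f (polyEval y F) = polyEval (fun a => f (y a)) F := by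
  simp only [polyEval, map_sum, map_smul, map_list_prod, List.map_ofFn]
  congr! 6
  simp

open MvPolynomial

/-- The change of variables `X_a ↦ X_a + k X_c`, where `a ≠ c`. -/
def shear {n : ℕ} {a c : Fin n} (hac : a ≠ c) (k : K) :
    MvPolynomial (Fin n) K ≃ₐ[K] MvPolynomial (Fin n) K :=
  AlgEquiv.ofAlgHom (aeval fun b => if b = a then X a + C k * X c else X b)
    (aeval fun b => if b = a then X a - C k * X c else X b)
    (by ext b : 1; by_cases hb : b = a <;> simp [hb, hac.symm])
    (by ext b : 1; by_cases hb : b = a <;> simp [hb, hac.symm])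

/-- Since $K$ may have zero divisors, the argument is not by integrality: an automorphism carries
the variable $X_a$, which is always regular, to this linear form. Regular divisors make the value of
`exactDiv` unambiguous. -/
theorem isRegular_X_add_C_mul_X {a c : Fin n} (hac : a ≠ c) (k : K) :
    IsRegular (X a + C k * X c : MvPolynomial (Fin n) K) := by
  have h : shear hac k (X a) = X a + C k * X c := by simp [shear]
  rw [← isLeftRegular_iff_isRegular, ← h]
  intro F G hFG
  apply (shear hac k).symm.injective
  apply (isRegular_X (R := K) (n := a)).left
  have := congrArg (shear hac k).symm hFG
  simpa using this

theorem isRegular_X_sub_X {a c : Fin n} (hac : a ≠ c) :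
    IsRegular (X a - X c : MvPolynomial (Fin n) K) := by
  simpa [sub_eq_add_neg] using isRegular_X_add_C_mul_X hac (-1 : K)

theorem isRegular_X_add_X {a c : Fin n} (hac : a ≠ c) :
    IsRegular (X a + X c : MvPolynomial (Fin n) K) := by
  simpa using isRegular_X_add_C_mul_X hac (1 : K)

end Eval

/-! ### The defining relations with explicit polynomials -/

section Rep

variable (K : Type w) [CommRing K] {I : Type u} {A : Type v} (Γ : InvQuiver I A)
  (lam : I → ℕ) (gam : I → K) {n : ℕ} (β : Set (Fin n → I))

/-- The elements `E i`, `Y a`, `P b` of an algebra satisfy the defining relations of `V_β(Γ, λ, γ)`,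
except that the sum of the idempotents `E i` is `ε`. -/
structure IsRep {B : Type*} [Ring B] [Algebra K B] (E : (Fin n → I) → B) (Y P : Fin n → B)
    (ε : B) : Prop where
  E_off : ∀ i, i ∉ β → E i = 0
  sum_E : ∑ᶠ i, E i = ε
  E_mul_self : ∀ i, E i * E i = E i
  E_mul_ne : ∀ i j, i ≠ j → E i * E j = 0
  y_comm : ∀ a b, Y a * Y b = Y b * Y a
  y_e : ∀ a i, Y a * E i = E i * Y a
  psi_e : ∀ a b : Fin n, a.val + 1 = b.val → ∀ i, P b * E i = E (i ∘ Equiv.swap a b) * P b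
  psi_y_left : ∀ a b : Fin n, a.val + 1 = b.val → ∀ i, i a = i b →
    P b * Y a * E i = Y b * P b * E i - E i
  psi_y_right : ∀ a b : Fin n, a.val + 1 = b.val → ∀ i, i a = i b →
    P b * Y b * E i = Y a * P b * E i + E i
  psi_y : ∀ a b : Fin n, a.val + 1 = b.val → ∀ c i, (i a = i b → c ≠ a ∧ c ≠ b) →
    P b * Y c * E i = Y (Equiv.swap a b c) * P b * E i
  psi_comm : ∀ a b : Fin n, a.val + 1 < b.val → P a * P b = P b * P a
  psi_sq : ∀ a b : Fin n, a.val + 1 = b.val → ∀ i,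
    P b * P b * E i = Γ.ringQ (i a) (i b) (Y a) (Y b) * E i
  braid3_eq : ∀ a b c : Fin n, a.val + 1 = b.val → b.val + 1 = c.val → ∀ i, i a = i c →
    P c * P b * P c * E i = P b * P c * P b * E i
      + Γ.divQ (i a) (i b) (Y a) (Y b) (Y c) * E i
  braid3_ne : ∀ a b c : Fin n, a.val + 1 = b.val → b.val + 1 = c.val → ∀ i, i a ≠ i c →
    P c * P b * P c * E i = P b * P c * P b * E i
  psi0_e : ∀ o : Fin n, o.val = 0 → ∀ i,
    P o * E i = E (Function.update i o (Γ.inv (i o))) * P o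
  psi0_y1 : ∀ o : Fin n, o.val = 0 → ∀ i,
    P o * Y o * E i = (2 * gam (i o)) • E i - Y o * P o * E i
  psi0_y : ∀ o : Fin n, o.val = 0 → ∀ a, a ≠ o → P o * Y a = Y a * P o
  psi0_sq : ∀ o : Fin n, o.val = 0 → ∀ i, gam (i o) = 0 →
    P o * P o * E i = (-1) ^ lam (Γ.inv (i o)) * Y o ^ (lam (i o) + lam (Γ.inv (i o))) * E i
  psi0_sq_zero : ∀ o : Fin n, o.val = 0 → ∀ i, gam (i o) ≠ 0 → P o * P o * E i = 0
  braid4_theta : ∀ o t : Fin n, o.val = 0 → t.val = 1 → ∀ i, gam (i o) = 0 →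
    Γ.inv (i o) = i t → P o * P t * P o * P t * E i = P t * P o * P t * P o * E i
      - (-1) ^ lam (Γ.inv (i o)) *
        homSum (lam (i o) + lam (Γ.inv (i o))) (-Y o) (Y t) * P t * E i
  braid4_other : ∀ o t : Fin n, o.val = 0 → t.val = 1 → ∀ i,
    ¬(gam (i o) = 0 ∧ Γ.inv (i o) = i t) →
    P o * P t * P o * P t * E i = P t * P o * P t * P o * E i
      + gam (i t) • ((Γ.oddQ (i t) (i o) (Y o) (Y t) * P o
        - gam (i o) • Γ.oddQ' (i t) (i o) (Y o) (Y t)) * E i)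

namespace IsRep

variable {K Γ lam gam β} {B C : Type*} [Ring B] [Algebra K B] [Ring C] [Algebra K C]
  {E : (Fin n → I) → B} {Y P : Fin n → B} {ε : B}

theorem finite_support (h : IsRep K Γ lam gam β E Y P ε) (hβ : β.Finite) :
    (Function.support E).Finite :=
  hβ.subset fun i hi => by
    by_contra hn
    exact hi (h.E_off i hn)

theorem map (h : IsRep K Γ lam gam β E Y P ε) (hβ : β.Finite) (f : B →ₐ[K] C) :
    IsRep K Γ lam gam β (fun i => f (E i)) (fun a => f (Y a)) (fun b => f (P b)) (f ε) where
  E_off i hi := by simp [h.E_off i hi]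
  sum_E := by
    rw [← h.sum_E]
    exact (f.toLinearMap.toAddMonoidHom.map_finsum (h.finite_support hβ)).symm
  E_mul_self i := by simp only [← map_mul, h.E_mul_self]
  E_mul_ne i j hij := by rw [← map_mul, h.E_mul_ne i j hij, map_zero]
  y_comm a b := by simp only [← map_mul, h.y_comm a b]
  y_e a i := by simp only [← map_mul, h.y_e a i]
  psi_e a b hab i := by simp only [← map_mul, h.psi_e a b hab i]
  psi_y_left a b hab i hi := by simp only [← map_mul, ← map_sub, h.psi_y_left a b hab i hi]
  psi_y_right a b hab i hi := by simp only [← map_mul, ← map_add, h.psi_y_right a b hab i hi]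
  psi_y a b hab c i hi := by simp only [← map_mul, h.psi_y a b hab c i hi]
  psi_comm a b hab := by simp only [← map_mul, h.psi_comm a b hab]
  psi_sq a b hab i := by simp only [← map_mul, h.psi_sq a b hab i, ← Γ.map_ringQ f]
  braid3_eq a b c hab hbc i hi := by
    simp only [← map_mul, h.braid3_eq a b c hab hbc i hi, ← Γ.map_divQ f, ← map_add]
  braid3_ne a b c hab hbc i hi := by simp only [← map_mul, h.braid3_ne a b c hab hbc i hi]
  psi0_e o ho i := by simp only [← map_mul, h.psi0_e o ho i]
  psi0_y1 o ho i := by simp only [← map_mul, h.psi0_y1 o ho i, ← map_smul, ← map_sub]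
  psi0_y o ho a ha := by simp only [← map_mul, h.psi0_y o ho a ha]
  psi0_sq o ho i hi := by
    simpa only [map_mul, map_pow, map_neg, map_one] using congrArg f (h.psi0_sq o ho i hi)
  psi0_sq_zero o ho i hi := by simp only [← map_mul, h.psi0_sq_zero o ho i hi, map_zero]
  braid4_theta o t ho ht i h1 h2 := by
    simpa only [map_mul, map_sub, map_pow, map_neg, map_one, map_homSum f] using
      congrArg f (h.braid4_theta o t ho ht i h1 h2)
  braid4_other o t ho ht i hi := by
    simpa only [map_mul, map_sub, map_smul, map_add, Γ.map_oddQ f, Γ.map_oddQ' f] using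
      congrArg f (h.braid4_other o t ho ht i hi)

/-- Relations may be tested after an embedding. This is applied to a subalgebra of $V_\beta$, with
$\varepsilon$ an idempotent different from $1$. -/
theorem of_map (f : B →ₐ[K] C) (hf : Function.Injective f) (hβ : β.Finite)
    (h : IsRep K Γ lam gam β (fun i => f (E i)) (fun a => f (Y a)) (fun b => f (P b)) (f ε)) :
    IsRep K Γ lam gam β E Y P ε where
  E_off i hi := hf (by simp [h.E_off i hi])
  sum_E := by
    apply hf
    rw [← h.sum_E]
    refine f.toLinearMap.toAddMonoidHom.map_finsum (hβ.subset fun i hi => ?_)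
    by_contra hn
    exact hi (hf (by simp [h.E_off i hn]))
  E_mul_self i := hf (by simp only [map_mul, h.E_mul_self])
  E_mul_ne i j hij := hf (by rw [map_mul, h.E_mul_ne i j hij, map_zero])
  y_comm a b := hf (by simp only [map_mul, h.y_comm a b])
  y_e a i := hf (by simp only [map_mul, h.y_e a i])
  psi_e a b hab i := hf (by simp only [map_mul, h.psi_e a b hab i])
  psi_y_left a b hab i hi := hf (by simp only [map_mul, map_sub, h.psi_y_left a b hab i hi])
  psi_y_right a b hab i hi := hf (by simp only [map_mul, map_add, h.psi_y_right a b hab i hi])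
  psi_y a b hab c i hi := hf (by simp only [map_mul, h.psi_y a b hab c i hi])
  psi_comm a b hab := hf (by simp only [map_mul, h.psi_comm a b hab])
  psi_sq a b hab i := hf (by simp only [map_mul, h.psi_sq a b hab i, Γ.map_ringQ f])
  braid3_eq a b c hab hbc i hi := hf (by
    simp only [map_mul, h.braid3_eq a b c hab hbc i hi, Γ.map_divQ f, map_add])
  braid3_ne a b c hab hbc i hi := hf (by simp only [map_mul, h.braid3_ne a b c hab hbc i hi])
  psi0_e o ho i := hf (by simp only [map_mul, h.psi0_e o ho i])
  psi0_y1 o ho i := hf (by simp only [map_mul, h.psi0_y1 o ho i, map_smul, map_sub])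
  psi0_y o ho a ha := hf (by simp only [map_mul, h.psi0_y o ho a ha])
  psi0_sq o ho i hi := hf (by
    simp only [map_mul, h.psi0_sq o ho i hi, map_pow, map_neg, map_one])
  psi0_sq_zero o ho i hi := hf (by simp only [map_mul, h.psi0_sq_zero o ho i hi, map_zero])
  braid4_theta o t ho ht i h1 h2 := hf (by
    simp only [map_mul, h.braid4_theta o t ho ht i h1 h2, map_sub, map_pow, map_neg, map_one,
      map_homSum f])
  braid4_other o t ho ht i hi := hf (by
    simp only [map_mul, h.braid4_other o t ho ht i hi, map_sub, map_smul, map_add,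
      Γ.map_oddQ f, Γ.map_oddQ' f])

end IsRep

end Rep

/-! ### Orbits -/

namespace InvQuiver

variable {I : Type u} {A : Type v} (Γ : InvQuiver I A)

/-- The `θ`-orbit of a vertex. -/
def cls (x : I) : Sym2 I := s(x, Γ.inv x)

theorem cls_eq_iff {x y : I} : Γ.cls x = Γ.cls y ↔ x = y ∨ x = Γ.inv y := by
  unfold cls
  rw [Sym2.eq_iff]
  constructor
  · rintro (h | h)
    exacts [Or.inl h.1, Or.inr h.1]
  · rintro (h | h)
    · exact Or.inl ⟨h, by rw [h]⟩
    · exact Or.inr ⟨h, by rw [h, Γ.inv_inv]⟩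

theorem cls_inv (x : I) : Γ.cls (Γ.inv x) = Γ.cls x := Γ.cls_eq_iff.2 (Or.inr rfl)

variable {Γ} {n : ℕ}

/-- The signs can be chosen independently at each position, so the orbit of a tuple is determined by
the multiset of the $\theta$-classes of its entries. -/
theorem sameBOrbit_iff {i i' : Fin n → I} :
    Γ.SameBOrbit i i' ↔ ∃ w : Equiv.Perm (Fin n), ∀ k, Γ.cls (i' k) = Γ.cls (i (w k)) := by
  classical
  constructor
  · rintro ⟨g, w, h⟩
    refine ⟨w⁻¹, fun k => ?_⟩
    rw [Γ.cls_eq_iff, h k]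
    cases g k <;> simp
  · rintro ⟨w, h⟩
    refine ⟨fun k => decide (i' k ≠ i (w k)), w⁻¹, fun k => ?_⟩
    rw [_root_.inv_inv]
    split_ifs with h2
    · exact (Γ.cls_eq_iff.1 (h k)).resolve_left (of_decide_eq_true h2)
    · exact not_not.1 fun h3 => h2 (decide_eq_true h3)

theorem SameBOrbit.trans {i j k : Fin n → I} (h : Γ.SameBOrbit i j) (h' : Γ.SameBOrbit j k) :
    Γ.SameBOrbit i k := by
  rw [sameBOrbit_iff] at *
  obtain ⟨w, hw⟩ := h
  obtain ⟨w', hw'⟩ := h'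
  exact ⟨w'.trans w, fun x => (hw' x).trans (hw _)⟩

theorem SameBOrbit.symm {i j : Fin n → I} (h : Γ.SameBOrbit i j) : Γ.SameBOrbit j i := by
  rw [sameBOrbit_iff] at *
  obtain ⟨w, hw⟩ := h
  exact ⟨w.symm, fun x => by rw [hw, Equiv.apply_symm_apply]⟩

theorem SameBOrbit.refl (i : Fin n → I) : Γ.SameBOrbit i i :=
  sameBOrbit_iff.2 ⟨1, fun _ => rfl⟩

namespace IsBOrbit

variable {β : Set (Fin n → I)}

theorem mem_iff (hβ : Γ.IsBOrbit β) {i j : Fin n → I} (hi : i ∈ β) :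
    j ∈ β ↔ Γ.SameBOrbit i j := by
  obtain ⟨i₀, rfl⟩ := hβ
  exact ⟨fun h => hi.symm.trans h, fun h => SameBOrbit.trans hi h⟩

theorem nonempty (hβ : Γ.IsBOrbit β) : β.Nonempty := by
  obtain ⟨i₀, rfl⟩ := hβ
  exact ⟨i₀, SameBOrbit.refl _⟩

theorem finite (hβ : Γ.IsBOrbit β) : β.Finite := by
  obtain ⟨i₀, rfl⟩ := hβ
  refine (Set.finite_range fun p : (Fin n → Bool) × Equiv.Perm (Fin n) =>
    fun k => if p.1 k then Γ.inv (i₀ (p.2⁻¹ k)) else i₀ (p.2⁻¹ k)).subset ?_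
  rintro i ⟨g, w, h⟩
  exact ⟨(g, w), (funext h).symm⟩

theorem comp_perm_mem (hβ : Γ.IsBOrbit β) {i : Fin n → I} (w : Equiv.Perm (Fin n)) :
    i ∘ w ∈ β ↔ i ∈ β := by
  constructor
  · intro hi
    exact (hβ.mem_iff hi).2 (sameBOrbit_iff.2 ⟨w.symm, fun k => by simp⟩)
  · intro hi
    exact (hβ.mem_iff hi).2 (sameBOrbit_iff.2 ⟨w, fun k => rfl⟩)

theorem update_inv_mem (hβ : Γ.IsBOrbit β) {i : Fin n → I} (o : Fin n) :
    Function.update i o (Γ.inv (i o)) ∈ β ↔ i ∈ β := by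
  have key : ∀ k, Γ.cls (Function.update i o (Γ.inv (i o)) k) = Γ.cls (i k) := fun k => by
    by_cases hk : k = o
    · rw [hk, Function.update_self, Γ.cls_inv]
    · rw [Function.update_of_ne hk]
  constructor
  · intro hi
    exact (hβ.mem_iff hi).2 (sameBOrbit_iff.2 ⟨1, fun k => (key k).symm⟩)
  · intro hi
    exact (hβ.mem_iff hi).2 (sameBOrbit_iff.2 ⟨1, key⟩)

end IsBOrbit

end InvQuiver

theorem finsum_coe_eq {ι M : Type*} [AddCommMonoid M] {β : Set ι} {f : ι → M}
    (h : ∀ i, i ∉ β → f i = 0) : ∑ᶠ i : β, f i = ∑ᶠ i, f i := by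
  rw [finsum_set_coe_eq_finsum_mem]
  refine finsum_congr fun i => ?_
  by_cases hi : i ∈ β
  · simp [hi]
  · simp [hi, h i hi]

/-! ### The presentation of `V_β(Γ, λ, γ)` in explicit form -/

section Presentation

variable (K : Type w) [CommRing K] {I : Type u} {A : Type v} (Γ : InvQuiver I A)
  (lam : I → ℕ) (gam : I → K) {n : ℕ} (β : Set (Fin n → I))

namespace V

open Classical in
/-- `e(i)`, for an arbitrary tuple `i`; it is `0` if `i ∉ β`. -/
def idem (i : Fin n → I) : V K Γ lam gam β := if h : i ∈ β then e K Γ lam gam β ⟨i, h⟩ else 0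

variable {β}

theorem idem_of_mem {i : Fin n → I} (h : i ∈ β) :
    idem K Γ lam gam β i = e K Γ lam gam β ⟨i, h⟩ := dif_pos h

theorem idem_coe (i : β) : idem K Γ lam gam β i.1 = e K Γ lam gam β i := dif_pos i.2

theorem idem_of_notMem {i : Fin n → I} (h : i ∉ β) : idem K Γ lam gam β i = 0 := dif_neg h

variable {K Γ lam gam}

theorem rel {x y : FreeAlgebra K (Gen β)} (h : VRel K Γ lam gam β x y) :
    mk K Γ lam gam β x = mk K Γ lam gam β y :=
  RingQuot.mkAlgHom_rel K h

-- The divisors in the presentation are regular, so each `exactDiv` equals its explicit quotient.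
-- The admissibility of the weights enters only through the constant term of the last braid
-- relation.
open MvPolynomial in
theorem isRep (hβ : Γ.IsBOrbit β) (hadm : Γ.Admissible lam gam) :
    IsRep K Γ lam gam β (idem K Γ lam gam β) (y K Γ lam gam β) (psi K Γ lam gam β) 1 := by
  have hmk : ∀ b, mk K Γ lam gam β (fpsi K β b) = psi K Γ lam gam β b := fun _ => rfl
  have hmky : ∀ b, mk K Γ lam gam β (fy K β b) = y K Γ lam gam β b := fun _ => rfl
  have hmke : ∀ b, mk K Γ lam gam β (fe K b) = e K Γ lam gam β b := fun _ => rfl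
  have hy : ∀ a b, y K Γ lam gam β a * y K Γ lam gam β b = y K Γ lam gam β b * y K Γ lam gam β a :=
    fun a b => by simpa only [map_mul, hmk, hmky, hmke] using rel (VRel.y_comm (K := K) (β := β) (Γ := Γ) (lam := lam) (gam := gam) a b)
  obtain ⟨φ, hφX, hφ⟩ := exists_evalHom (K := K) (y K Γ lam gam β) hy
  have hpoly : ∀ F, mk K Γ lam gam β (polyEval (fy K β) F) = φ F := fun F => by
    rw [map_polyEval]; exact hφ F
  have hne : ∀ a b : Fin n, a.val + 1 = b.val → a ≠ b := fun a b h h' => by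
    rw [h'] at h; omega
  have lift : ∀ {x y : V K Γ lam gam β} (i : Fin n → I),
      (∀ hi : i ∈ β, x * e K Γ lam gam β ⟨i, hi⟩ = y * e K Γ lam gam β ⟨i, hi⟩) →
      x * idem K Γ lam gam β i = y * idem K Γ lam gam β i := fun i h => by
    by_cases hi : i ∈ β
    · rw [idem_of_mem K Γ lam gam hi, h hi]
    · rw [idem_of_notMem K Γ lam gam hi, mul_zero, mul_zero]
  have hQ : ∀ (i j : I) (a b : Fin n), φ (Γ.Q i j (X a) (X b)) =
      Γ.ringQ i j (y K Γ lam gam β a) (y K Γ lam gam β b) := fun i j a b => by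
    rw [← hφX, ← hφX, ← Γ.map_ringQ φ]; rfl
  refine
    { E_off := fun i hi => idem_of_notMem K Γ lam gam hi
      sum_E := ?_
      E_mul_self := fun i => ?_
      E_mul_ne := fun i j hij => ?_
      y_comm := hy
      y_e := fun a i => ?_
      psi_e := fun a b hab i => ?_
      psi_y_left := fun a b hab i hi => ?_
      psi_y_right := fun a b hab i hi => ?_
      psi_y := fun a b hab c i hi => ?_
      psi_comm := fun a b hab => by
        simpa only [map_mul, hmk, hmky, hmke] using rel
          (VRel.psi_comm (K := K) (β := β) (Γ := Γ) (lam := lam) (gam := gam) a b hab)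
      psi_sq := fun a b hab i => lift i fun hi => ?_
      braid3_eq := fun a b c hab hbc i hi => ?_
      braid3_ne := fun a b c hab hbc i hi => lift i fun hi' => ?_
      psi0_e := fun o ho i => ?_
      psi0_y1 := fun o ho i => ?_
      psi0_y := fun o ho a ha => by
        simpa only [map_mul, hmk, hmky, hmke] using rel
          (VRel.psi0_y (K := K) (β := β) (Γ := Γ) (lam := lam) (gam := gam) o ho a ha)
      psi0_sq := fun o ho i hi => lift i fun hi' => ?_
      psi0_sq_zero := fun o ho i hi => ?_
      braid4_theta := fun o t ho ht i h1 h2 => ?_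
      braid4_other := fun o t ho ht i hi => ?_ }
  · have h := rel (VRel.sum_e (K := K) (Γ := Γ) (lam := lam) (gam := gam) (β := β))
    have : Finite β := hβ.finite
    rw [map_one] at h
    rw [← h]
    refine Eq.trans ?_ ((mk K Γ lam gam β).toLinearMap.toAddMonoidHom.map_finsum
      (Set.toFinite _)).symm
    rw [← finsum_coe_eq (β := β) fun i hi => idem_of_notMem K Γ lam gam hi]
    exact finsum_congr fun i => idem_coe K Γ lam gam i
  · by_cases hi : i ∈ β
    · rw [idem_of_mem K Γ lam gam hi]
      simpa only [map_mul, hmke] using rel (VRel.e_mul_self (K := K) (Γ := Γ) (lam := lam) (gam := gam) ⟨i, hi⟩)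
    · rw [idem_of_notMem K Γ lam gam hi, mul_zero]
  · by_cases hi : i ∈ β
    · by_cases hj : j ∈ β
      · rw [idem_of_mem K Γ lam gam hi, idem_of_mem K Γ lam gam hj]
        simpa only [map_mul, map_zero, hmk, hmky, hmke] using rel (VRel.e_mul_ne (K := K) (Γ := Γ) (lam := lam) (gam := gam) ⟨i, hi⟩ ⟨j, hj⟩
          (fun h => hij (congrArg Subtype.val h)))
      · rw [idem_of_notMem K Γ lam gam hj, mul_zero]
    · rw [idem_of_notMem K Γ lam gam hi, zero_mul]
  · by_cases hi : i ∈ β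
    · rw [idem_of_mem K Γ lam gam hi]
      simpa only [map_mul, hmk, hmky, hmke] using rel (VRel.y_e (K := K) (Γ := Γ) (lam := lam) (gam := gam) a ⟨i, hi⟩)
    · rw [idem_of_notMem K Γ lam gam hi, mul_zero, zero_mul]
  · by_cases hi : i ∈ β
    · have hi' := (hβ.comp_perm_mem (Equiv.swap a b)).2 hi
      rw [idem_of_mem K Γ lam gam hi, idem_of_mem K Γ lam gam hi']
      simpa only [map_mul, hmk, hmky, hmke] using rel (VRel.psi_e (K := K) (Γ := Γ) (lam := lam) (gam := gam) a b hab ⟨i, hi⟩ ⟨_, hi'⟩ rfl)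
    · rw [idem_of_notMem K Γ lam gam hi, mul_zero, idem_of_notMem K Γ lam gam, zero_mul]
      rwa [hβ.comp_perm_mem]
  · by_cases hi' : i ∈ β
    · have h := rel (VRel.psi_y (K := K) (Γ := Γ) (lam := lam) (gam := gam) a b hab a ⟨i, hi'⟩)
      rw [if_pos ⟨rfl, hi⟩, Equiv.swap_apply_left] at h
      simp only [map_mul, map_sub, map_neg, hmk, hmky, hmke] at h
      rw [sub_mul, sub_eq_iff_eq_add] at h
      rw [idem_of_mem K Γ lam gam hi', h]; abel
    · simp [idem_of_notMem K Γ lam gam hi']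
  · by_cases hi' : i ∈ β
    · have h := rel (VRel.psi_y (K := K) (Γ := Γ) (lam := lam) (gam := gam) a b hab b ⟨i, hi'⟩)
      rw [if_neg (fun h => hne a b hab h.1.symm), if_pos ⟨rfl, hi⟩, Equiv.swap_apply_right] at h
      simp only [map_mul, map_sub, hmk, hmky, hmke] at h
      rw [sub_mul, sub_eq_iff_eq_add] at h
      rw [idem_of_mem K Γ lam gam hi', h]; abel
    · simp [idem_of_notMem K Γ lam gam hi']
  · refine lift i fun hi' => ?_
    have h := rel (VRel.psi_y (K := K) (Γ := Γ) (lam := lam) (gam := gam) a b hab c ⟨i, hi'⟩)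
    rw [if_neg (fun h => (hi h.2).1 h.1), if_neg (fun h => (hi h.2).2 h.1)] at h
    simp only [map_mul, map_sub, map_zero, hmk, hmky, hmke] at h
    rwa [sub_mul, sub_eq_zero] at h
  · have h := rel (VRel.psi_sq (K := K) (Γ := Γ) (lam := lam) (gam := gam) a b hab ⟨i, hi⟩)
    simpa only [map_mul, map_pow, hmk, hmke, hpoly, hQ, sq] using h
  · rw [← add_mul]
    refine lift i fun hi' => ?_
    have h := rel (VRel.braid3 (K := K) (Γ := Γ) (lam := lam) (gam := gam) a b c hab hbc ⟨i, hi'⟩)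
    have hac : a ≠ c := fun h => by rw [h] at hab; omega
    rw [if_pos hi, exactDiv_eq (isRegular_X_sub_X hac).right (Γ.divQ_mul _ _ _ _ _)] at h
    simp only [map_mul, map_sub, hmk, hmke, hpoly, Γ.map_divQ φ, hφX] at h
    rw [sub_mul, sub_eq_iff_eq_add] at h
    rw [h, add_mul, add_comm]
  · have h := rel (VRel.braid3 (K := K) (Γ := Γ) (lam := lam) (gam := gam) a b c hab hbc ⟨i, hi'⟩)
    rw [if_neg hi] at h
    simp only [map_mul, map_sub, map_zero, hmk, hmke] at h
    rwa [sub_mul, sub_eq_zero] at h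
  · by_cases hi : i ∈ β
    · have hi' := (hβ.update_inv_mem o).2 hi
      rw [idem_of_mem K Γ lam gam hi, idem_of_mem K Γ lam gam hi']
      simpa only [map_mul, hmk, hmky, hmke] using rel (VRel.psi0_e (K := K) (Γ := Γ) (lam := lam) (gam := gam) o ho ⟨i, hi⟩ ⟨_, hi'⟩ rfl)
    · rw [idem_of_notMem K Γ lam gam hi, mul_zero, idem_of_notMem K Γ lam gam, zero_mul]
      rwa [hβ.update_inv_mem]
  · rw [eq_sub_iff_add_eq, ← add_mul, ← one_mul (idem K Γ lam gam β i), ← mul_assoc, mul_one,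
      ← smul_mul_assoc]
    refine lift i fun hi' => ?_
    have h := rel (VRel.psi0_y1 (K := K) (Γ := Γ) (lam := lam) (gam := gam) o ho ⟨i, hi'⟩)
    simpa only [map_mul, map_add, map_smul, smul_mul_assoc, one_mul, hmk, hmky, hmke] using h
  · have h := rel (VRel.psi0_sq (K := K) (Γ := Γ) (lam := lam) (gam := gam) o ho ⟨i, hi'⟩)
    rw [if_pos hi] at h
    simpa only [map_mul, map_pow, map_neg, map_one, hmk, hmke, hmky, sq] using h
  · rw [← zero_mul (idem K Γ lam gam β i)]
    refine lift i fun hi' => ?_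
    have h := rel (VRel.psi0_sq (K := K) (Γ := Γ) (lam := lam) (gam := gam) o ho ⟨i, hi'⟩)
    rw [if_neg hi] at h
    simpa only [map_mul, map_pow, map_zero, zero_mul, hmk, hmke, hmky, sq] using h
  · rw [← sub_mul]
    refine lift i fun hi' => ?_
    have hot : o ≠ t := fun h => by rw [h] at ho; omega
    have h := rel (VRel.braid4_theta (K := K) (Γ := Γ) (lam := lam) (gam := gam) o t ho ht ⟨i, hi'⟩ ⟨h1, h2⟩)
    -- The sign arises because the denominator $X_o+X_t$ is the negative of $(-X_o)-X_t$.
    rw [exactDiv_eq (F := -homSum (lam (i o) + lam (Γ.inv (i o))) (-X o) (X t))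
      (isRegular_X_add_X hot).right (by rw [← homSum_mul_sub]; ring)] at h
    simp only [map_mul, map_sub, map_neg, map_pow, map_one, hmk, hmke, hpoly, map_homSum φ, hφX]
      at h
    rw [sub_mul, sub_eq_iff_eq_add] at h
    rw [sub_mul, eq_sub_iff_add_eq]
    simp only [sq, ← mul_assoc] at h
    rw [h]; noncomm_ring
  · rw [← smul_mul_assoc, ← add_mul]
    refine lift i fun hi' => ?_
    have h := rel (VRel.braid4_other (K := K) (Γ := Γ) (lam := lam) (gam := gam) o t ho ht ⟨i, hi'⟩ hi)
    rw [exactDiv_eq (isRegular_X.mul isRegular_X).right (Γ.oddQ_mul _ _ _ _)] at h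
    -- The quotient by $X_oX_t$ is known only for even $i\cdot j$. If one of the two weights is $0$,
    -- the scalar kills the term; otherwise both vertices are fixed by $\theta$ and `even_dot`
    -- applies.
    have h2 : gam (i t) • gam (i o) • φ (exactDiv
        (Γ.Q (i t) (i o) (X o) (-X t) - Γ.Q (i t) (i o) (X o) (X t)) (X o * X t)) =
        gam (i t) • gam (i o) •
          Γ.oddQ' (i t) (i o) (y K Γ lam gam β o) (y K Γ lam gam β t) := by
      by_cases g1 : gam (i t) = 0
      · rw [g1, zero_smul, zero_smul]
      by_cases g2 : gam (i o) = 0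
      · rw [g2, zero_smul, zero_smul]
      have e1 : Γ.inv (i t) = i t := by
        by_contra hc; exact g1 ((hadm _).1 hc)
      have e2 : Γ.inv (i o) = i o := by
        by_contra hc; exact g2 ((hadm _).1 hc)
      rw [exactDiv_eq (isRegular_X.mul isRegular_X).right
        (Γ.oddQ'_mul _ _ (Γ.even_dot e1 e2) _ _), Γ.map_oddQ' φ, hφX, hφX]
    simp only [map_mul, map_sub, map_smul, hmk, hmke, hpoly, Γ.map_oddQ φ, hφX] at h
    rw [sub_mul, sub_eq_iff_eq_add, ← smul_mul_assoc, smul_sub, h2, ← smul_sub, ← add_mul] at h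
    simp only [sq, ← mul_assoc, map_mul, hmk] at h
    rw [h, add_comm]

variable {B : Type*} [Ring B] [Algebra K B] {E : (Fin n → I) → B} {Y P : Fin n → B}

-- With `isRep` this is the universal property of $V_\beta$ in explicit form; the homomorphisms out
-- of $V_\beta$ and the $V_{\beta^{(j)}}$ are obtained from it.
open MvPolynomial in
theorem exists_lift (hβ : Γ.IsBOrbit β) (hadm : Γ.Admissible lam gam)
    (h : IsRep K Γ lam gam β E Y P 1) :
    ∃ f : V K Γ lam gam β →ₐ[K] B, (∀ i, f (idem K Γ lam gam β i) = E i) ∧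
      (∀ a, f (y K Γ lam gam β a) = Y a) ∧ ∀ b, f (psi K Γ lam gam β b) = P b := by
  let g : FreeAlgebra K (Gen β) →ₐ[K] B := FreeAlgebra.lift K fun
    | .e i => E i.1
    | .y a => Y a
    | .psi b => P b
  have ge : ∀ i, g (fe K i) = E i.1 := fun i => by simp [g]
  have gy : ∀ i, g (fy K β i) = Y i := fun i => by simp [g]
  have gp : ∀ i, g (fpsi K β i) = P i := fun i => by simp [g]
  obtain ⟨φ, hφX, hφ⟩ := exists_evalHom (K := K) Y h.y_comm
  have hpoly : ∀ F, g (polyEval (fy K β) F) = φ F := fun F => by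
    rw [map_polyEval, ← hφ]; simp only [gy]
  have hne : ∀ a b : Fin n, a.val + 1 = b.val → a ≠ b := fun a b h h' => by
    rw [h'] at h; omega
  have hQ : ∀ (i j : I) (a b : Fin n), φ (Γ.Q i j (X a) (X b)) = Γ.ringQ i j (Y a) (Y b) :=
    fun i j a b => by rw [← hφX, ← hφX, ← Γ.map_ringQ φ]; rfl
  have hg : ∀ x y, VRel K Γ lam gam β x y → g x = g y := by
    intro x y hxy
    cases hxy with
    | sum_e =>
      have : Finite β := hβ.finite
      rw [map_one, ← h.sum_E]
      refine ((g.toLinearMap.toAddMonoidHom.map_finsum (Set.toFinite _)).trans ?_)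
      rw [← finsum_coe_eq (β := β) h.E_off]
      exact finsum_congr ge
    | e_mul_self i => rw [map_mul, ge, h.E_mul_self]
    | e_mul_ne i j hij =>
      rw [map_mul, ge, ge, h.E_mul_ne _ _ fun h => hij (Subtype.ext h), map_zero]
    | y_comm a b => rw [map_mul, map_mul, gy, gy, h.y_comm]
    | y_e a i => rw [map_mul, map_mul, gy, ge, h.y_e]
    | psi_e a b hab i j hj => rw [map_mul, map_mul, gp, ge, ge, hj, h.psi_e a b hab]
    | psi_y a b hab c i =>
      simp only [map_mul, map_sub, gp, gy, ge, sub_mul]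
      split_ifs with h1 h2
      · rw [h1.1, h.psi_y_left a b hab _ h1.2, Equiv.swap_apply_left, map_neg, ge]; abel
      · rw [h2.1, h.psi_y_right a b hab _ h2.2, Equiv.swap_apply_right, ge]; abel
      · rw [h.psi_y a b hab c _ fun e => ⟨fun e' => h1 ⟨e', e⟩, fun e' => h2 ⟨e', e⟩⟩, sub_self,
          map_zero]
    | psi_comm a b hab => rw [map_mul, map_mul, gp, gp, h.psi_comm a b hab]
    | psi_sq a b hab i =>
      rw [map_mul, map_mul, map_pow, gp, ge, sq, h.psi_sq a b hab, hpoly, hQ]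
    | braid3 a b c hab hbc i =>
      have hac : a ≠ c := fun h => by rw [h] at hab; omega
      simp only [map_mul, map_sub, gp, ge, sub_mul]
      split_ifs with h1
      · rw [h.braid3_eq a b c hab hbc _ h1, map_mul, hpoly,
          exactDiv_eq (isRegular_X_sub_X hac).right (Γ.divQ_mul _ _ _ _ _), Γ.map_divQ φ, hφX,
          hφX, hφX, ge]; abel
      · rw [h.braid3_ne a b c hab hbc _ h1, map_zero, sub_self]
    | psi0_e o ho i j hj => rw [map_mul, map_mul, gp, ge, ge, hj, h.psi0_e o ho]
    | psi0_y1 o ho i =>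
      simp only [map_mul, map_add, map_smul, gp, gy, ge, add_mul]
      rw [h.psi0_y1 o ho]; abel
    | psi0_y o ho a ha => rw [map_mul, map_mul, gp, gy, h.psi0_y o ho a ha]
    | psi0_sq o ho i =>
      rw [map_mul, map_pow, gp, ge, sq]
      split_ifs with h1
      · rw [h.psi0_sq o ho _ h1]; simp [ge, gy]
      · rw [h.psi0_sq_zero o ho _ h1, map_zero]
    | braid4_theta o t ho ht i hi =>
      have hot : o ≠ t := fun h => by rw [h] at ho; omega
      rw [exactDiv_eq (F := -homSum (lam (i.1 o) + lam (Γ.inv (i.1 o))) (-X o) (X t))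
        (isRegular_X_add_X hot).right (by rw [← homSum_mul_sub]; ring)]
      simp only [map_mul, map_sub, map_pow, map_neg, map_one, gp, ge, sub_mul, sq, ← mul_assoc,
        h.braid4_theta o t ho ht i.1 hi.1 hi.2, hpoly, map_homSum φ, hφX]
      noncomm_ring
    | braid4_other o t ho ht i hi =>
      rw [exactDiv_eq (isRegular_X.mul isRegular_X).right (Γ.oddQ_mul _ _ _ _)]
      have h2 : gam (i.1 t) • gam (i.1 o) • φ (exactDiv
          (Γ.Q (i.1 t) (i.1 o) (X o) (-X t) - Γ.Q (i.1 t) (i.1 o) (X o) (X t)) (X o * X t)) =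
          gam (i.1 t) • gam (i.1 o) • Γ.oddQ' (i.1 t) (i.1 o) (Y o) (Y t) := by
        by_cases g1 : gam (i.1 t) = 0
        · rw [g1, zero_smul, zero_smul]
        by_cases g2 : gam (i.1 o) = 0
        · rw [g2, zero_smul, zero_smul]
        have e1 : Γ.inv (i.1 t) = i.1 t := by
          by_contra hc; exact g1 ((hadm _).1 hc)
        have e2 : Γ.inv (i.1 o) = i.1 o := by
          by_contra hc; exact g2 ((hadm _).1 hc)
        rw [exactDiv_eq (isRegular_X.mul isRegular_X).right
          (Γ.oddQ'_mul _ _ (Γ.even_dot e1 e2) _ _), Γ.map_oddQ' φ, hφX, hφX]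
      simp only [map_mul, map_sub, map_smul, gp, ge, sub_mul, sq, ← mul_assoc,
        h.braid4_other o t ho ht i.1 hi, hpoly, Γ.map_oddQ φ, hφX, add_sub_cancel_left,
        smul_sub, smul_mul_assoc]
      simp only [← smul_mul_assoc, h2]
  refine ⟨RingQuot.liftAlgHom K ⟨g, fun x y hxy => hg x y hxy⟩, fun i => ?_, fun a => ?_,
    fun b => ?_⟩
  · by_cases hi : i ∈ β
    · rw [idem_of_mem K Γ lam gam hi]
      exact (RingQuot.liftAlgHom_mkAlgHom_apply K _ _ _).trans (ge ⟨i, hi⟩)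
    · rw [idem_of_notMem K Γ lam gam hi, h.E_off i hi]
      exact map_zero (RingQuot.liftAlgHom K _)
  · exact (RingQuot.liftAlgHom_mkAlgHom_apply K _ _ _).trans (gy a)
  · exact (RingQuot.liftAlgHom_mkAlgHom_apply K _ _ _).trans (gp b)

/-- A subalgebra that contains the generators is everything. -/
theorem subalgebra_eq_top (S : Subalgebra K (V K Γ lam gam β))
    (he : ∀ i ∈ β, idem K Γ lam gam β i ∈ S) (hy : ∀ a, y K Γ lam gam β a ∈ S)
    (hp : ∀ b, psi K Γ lam gam β b ∈ S) (x : V K Γ lam gam β) : x ∈ S := by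
  obtain ⟨x, rfl⟩ := RingQuot.mkAlgHom_surjective K (VRel K Γ lam gam β) x
  change mk K Γ lam gam β x ∈ S
  induction x using FreeAlgebra.induction with
  | grade0 r => rw [AlgHom.commutes]; exact S.algebraMap_mem r
  | grade1 g =>
    cases g with
    | e i =>
      have h := he i.1 i.2
      rw [idem_coe] at h
      exact h
    | y a => exact hy a
    | psi b => exact hp b
  | mul a b ha hb => rw [map_mul]; exact S.mul_mem ha hb
  | add a b ha hb => rw [map_add]; exact S.add_mem ha hb

theorem algHom_ext {f g : V K Γ lam gam β →ₐ[K] B}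
    (he : ∀ i ∈ β, f (idem K Γ lam gam β i) = g (idem K Γ lam gam β i))
    (hy : ∀ a, f (y K Γ lam gam β a) = g (y K Γ lam gam β a))
    (hp : ∀ b, f (psi K Γ lam gam β b) = g (psi K Γ lam gam β b)) : f = g :=
  AlgHom.ext fun x => subalgebra_eq_top (AlgHom.equalizer f g) he hy hp x

end V

end Presentation

/-! ### Gradings defined by coactions -/

section Coaction

/-- A family of submodules that is multiplicative, exhausts the algebra and is separated by a
coaction `x ↦ x ⊗ T^k` is a grading. -/
theorem isAlgGrading_of_coaction {K B : Type*} [CommRing K] [Ring B] [Algebra K B]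
    (𝒜 : ℤ → Submodule K B) (δ : B →ₐ[K] AddMonoidAlgebra B ℤ)
    (hδ : ∀ k, ∀ x ∈ 𝒜 k, δ x = AddMonoidAlgebra.single k x)
    (hmul : ∀ k l, ∀ x ∈ 𝒜 k, ∀ y ∈ 𝒜 l, x * y ∈ 𝒜 (k + l)) (htop : ⨆ k, 𝒜 k = ⊤) :
    IsAlgGrading 𝒜 := by
  classical
  refine ⟨⟨?_, ?_⟩, hmul⟩
  -- The coefficient of $T^k$ in $\delta$ of a sum of homogeneous elements is its component of
  -- degree $k$, so the components are determined by the sum.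
  · have key : ∀ (x : DirectSum ℤ fun k => 𝒜 k) (k : ℤ),
        (δ (DirectSum.coeAddMonoidHom 𝒜 x)).coeff k = x k := by
      intro x k
      induction x using DirectSum.induction_on with
      | zero => simp
      | of l x =>
        rw [DirectSum.coeAddMonoidHom_of, hδ l x x.2, AddMonoidAlgebra.coeff_single,
          Finsupp.single_apply]
        split_ifs with h
        · subst h; simp
        · rw [DirectSum.of_eq_of_ne _ _ _ (Ne.symm h)]; rfl
      | add x y hx hy => simp [hx, hy]
    intro x y hxy
    refine DFinsupp.ext fun k => Subtype.ext ?_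
    rw [← key x, ← key y, hxy]
  · intro x
    have hx : x ∈ ⨆ k, 𝒜 k := htop ▸ Submodule.mem_top
    rw [← DirectSum.range_coeLinearMap] at hx
    obtain ⟨y, rfl⟩ := hx
    exact ⟨y, rfl⟩

/-- The supremum of a multiplicative family of submodules, as a subalgebra. -/
def supSubalgebra {K B : Type*} [CommRing K] [Ring B] [Algebra K B]
    (𝒜 : ℤ → Submodule K B) (hone : (1 : B) ∈ 𝒜 0)
    (hmul : ∀ k l, ∀ x ∈ 𝒜 k, ∀ y ∈ 𝒜 l, x * y ∈ 𝒜 (k + l)) : Subalgebra K B :=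
  (⨆ k, 𝒜 k).toSubalgebra (Submodule.mem_iSup_of_mem 0 hone) fun x y hx hy => by
    induction hx using Submodule.iSup_induction' with
    | zero => rw [zero_mul]; exact Submodule.zero_mem _
    | add a b _ _ ha hb => rw [add_mul]; exact Submodule.add_mem _ ha hb
    | mem k x hx =>
      induction hy using Submodule.iSup_induction' with
      | zero => rw [mul_zero]; exact Submodule.zero_mem _
      | add a b _ _ ha hb => rw [mul_add]; exact Submodule.add_mem _ ha hb
      | mem l y hy => exact Submodule.mem_iSup_of_mem _ (hmul k l x hx y hy)

end Coaction

/-! ### The explicit quotients at homogeneous arguments -/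

section Single

open AddMonoidAlgebra

variable {B : Type*} [Ring B]

theorem neg_one_pow_mul_single (m : ℕ) (k : ℤ) (x : B) :
    (-1) ^ m * (single k x : AddMonoidAlgebra B ℤ) = single k ((-1) ^ m * x) := by
  rcases neg_one_pow_eq_or (AddMonoidAlgebra B ℤ) m with h | h <;>
    rcases Nat.even_or_odd m with h' | h' <;>
      simp [h'.neg_one_pow, single_neg]

theorem natCast_mul_single (m : ℕ) (k : ℤ) (x : B) :
    (m : AddMonoidAlgebra B ℤ) * (single k x : AddMonoidAlgebra B ℤ) = single k ((m : B) * x) := by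
  rw [← nsmul_eq_mul, ← nsmul_eq_mul, smul_single]

theorem single_finset_sum {ι : Type*} (s : Finset ι) (k : ℤ) (f : ι → B) :
    (single k (∑ i ∈ s, f i) : AddMonoidAlgebra B ℤ) = ∑ i ∈ s, single k (f i) :=
  map_sum (singleAddHom k) f s

/-- Every summand has degree $m-1$ in the two arguments. For $m=0$ both sides are zero, so the
negative exponent does no harm. -/
theorem homSum_single (m : ℕ) (k : ℤ) (u v : B) :
    homSum m (single k u : AddMonoidAlgebra B ℤ) (single k v) =
      single (((m : ℤ) - 1) * k) (homSum m u v) := by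
  unfold homSum
  rw [single_finset_sum]
  refine Finset.sum_congr rfl fun r hr => ?_
  rw [Finset.mem_range] at hr
  rw [single_pow, single_pow, single_mul_single]
  congr 1
  rw [← add_smul, nsmul_eq_mul]
  congr 1
  push_cast [Nat.sub_sub, Nat.cast_sub (show 1 + r ≤ m by omega)]
  ring

variable {I : Type u} {A : Type v} (Γ : InvQuiver I A)

theorem ringQ_single {i j : I} (k : ℤ) (u v : B) :
    Γ.ringQ i j (single k u : AddMonoidAlgebra B ℤ) (single k v) =
      single (Γ.dot i j * k) (Γ.ringQ i j u v) := by
  unfold InvQuiver.ringQ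
  split_ifs
  · simp
  · rw [← single_sub, single_pow, neg_one_pow_mul_single, nsmul_eq_mul]

theorem divQ_single {i j : I} (k : ℤ) (u v w : B) :
    Γ.divQ i j (single k u : AddMonoidAlgebra B ℤ) (single k v) (single k w) =
      single ((Γ.dot i j - 1) * k) (Γ.divQ i j u v w) := by
  unfold InvQuiver.divQ
  split_ifs
  · simp
  · rw [← single_sub, ← single_sub, homSum_single, neg_one_pow_mul_single]

theorem oddQ_single {i j : I} (k : ℤ) (u v : B) :
    Γ.oddQ i j (single k u : AddMonoidAlgebra B ℤ) (single k v) =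
      single ((Γ.dot i j - 1) * k) (Γ.oddQ i j u v) := by
  unfold InvQuiver.oddQ
  split_ifs
  · simp
  · have := natCast_mul_single (B := B) 2
    push_cast at this
    rw [← single_sub, ← single_add, homSum_single, mul_assoc, neg_one_pow_mul_single, this,
      mul_assoc]

theorem oddQ'_single {i j : I} (h : Even (Γ.dot i j)) (k : ℤ) (u v : B) :
    Γ.oddQ' i j (single k u : AddMonoidAlgebra B ℤ) (single k v) =
      single ((Γ.dot i j - 2) * k) (Γ.oddQ' i j u v) := by
  unfold InvQuiver.oddQ'
  split_ifs
  · simp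
  · have := natCast_mul_single (B := B) 4
    push_cast at this
    rw [← single_sub, ← single_add, single_pow, single_pow, homSum_single, mul_assoc,
      neg_one_pow_mul_single, this, mul_assoc]
    congr 1
    have h2 : ((Γ.dot i j / 2 : ℕ) : ℤ) * 2 = Γ.dot i j := by
      exact_mod_cast Nat.div_two_mul_two_of_even h
    rw [nsmul_eq_mul, ← h2]
    push_cast
    ring

end Single

/-! ### The generators of $B_n$ acting on tuples, and the degrees of the $\psi_b$ -/

section Moves

variable {K : Type w} [CommRing K] {I : Type u} {A : Type v} (Γ : InvQuiver I A)
  (lam : I → ℕ) (gam : I → K) {n : ℕ}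

/-- The position before `b` (or `b` itself if `b` is the first position). -/
def prev (b : Fin n) : Fin n := ⟨b.val - 1, by omega⟩

theorem prev_eq {a b : Fin n} (hab : a.val + 1 = b.val) : prev b = a :=
  Fin.ext (by simp [prev]; omega)

theorem prev_first {o : Fin n} (ho : o.val = 0) : prev o = o := Fin.ext (by simp [prev]; omega)

theorem prev_add_one {b : Fin n} (hb : b.val ≠ 0) : (prev b).val + 1 = b.val := by
  simp [prev]; omega

/-- The tuple `r_b · i`. -/
def move (b : Fin n) (i : Fin n → I) : Fin n → I :=
  if b.val = 0 then Function.update i b (Γ.inv (i b)) else i ∘ Equiv.swap (prev b) b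

/-- The degree of `ψ_b e(i)`. -/
def psiDeg (b : Fin n) (i : Fin n → I) : ℤ :=
  if b.val = 0 then Γ.deg₁ lam gam (i b) else Γ.deg₂ (i (prev b)) (i b)

variable {Γ}

theorem move_of_succ {a b : Fin n} (hab : a.val + 1 = b.val) (i : Fin n → I) :
    move Γ b i = i ∘ Equiv.swap a b := by
  rw [move, if_neg (by omega), prev_eq hab]

theorem move_first {o : Fin n} (ho : o.val = 0) (i : Fin n → I) :
    move Γ o i = Function.update i o (Γ.inv (i o)) := by
  rw [move, if_pos ho]

theorem psiDeg_of_succ {a b : Fin n} (hab : a.val + 1 = b.val) (i : Fin n → I) :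
    psiDeg Γ lam gam b i = Γ.deg₂ (i a) (i b) := by
  rw [psiDeg, if_neg (by omega), prev_eq hab]

theorem psiDeg_first {o : Fin n} (ho : o.val = 0) (i : Fin n → I) :
    psiDeg Γ lam gam o i = Γ.deg₁ lam gam (i o) := by
  rw [psiDeg, if_pos ho]

theorem move_move (b : Fin n) (i : Fin n → I) : move Γ b (move Γ b i) = i := by
  by_cases hb : b.val = 0
  · rw [move_first hb, move_first hb]
    simp [Γ.inv_inv]
  · rw [move_of_succ (prev_add_one hb), move_of_succ (prev_add_one hb)]
    ext k
    simp

namespace IsRep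

variable {lam gam} {β : Set (Fin n → I)} {B : Type*} [Ring B] [Algebra K B]
  {E : (Fin n → I) → B} {Y P : Fin n → B} {ε : B}

theorem sum_toFinset (h : IsRep K Γ lam gam β E Y P ε) (hβ : β.Finite) :
    ∑ i ∈ hβ.toFinset, E i = ε := by
  rw [← h.sum_E]
  refine (finsum_eq_sum_of_support_subset _ fun i hi => ?_).symm
  by_contra hn
  exact hi (h.E_off i (by simpa using hn))

theorem ext_right (h : IsRep K Γ lam gam β E Y P 1) (hβ : β.Finite) {x y : B}
    (hxy : ∀ i ∈ β, x * E i = y * E i) : x = y := by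
  rw [← mul_one x, ← mul_one y, ← h.sum_toFinset hβ, Finset.mul_sum, Finset.mul_sum]
  exact Finset.sum_congr rfl fun i hi => hxy i (by simpa using hi)

theorem psi_E (h : IsRep K Γ lam gam β E Y P ε) (b : Fin n) (i : Fin n → I) :
    P b * E i = E (move Γ b i) * P b := by
  by_cases hb : b.val = 0
  · rw [move_first hb, h.psi0_e b hb]
  · rw [move_of_succ (prev_add_one hb), h.psi_e _ b (prev_add_one hb)]

end IsRep

end Moves

/-! ### The gradings of $V_\beta$ and of its cyclotomic quotients -/

section Grading

variable {K : Type w} [CommRing K] {I : Type u} {A : Type v} {Γ : InvQuiver I A}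
  {lam : I → ℕ} {gam : I → K} {n : ℕ} {β : Set (Fin n → I)}

namespace V

theorem idem_mem_grade (i : Fin n → I) : idem K Γ lam gam β i ∈ grade K Γ lam gam β 0 := by
  by_cases hi : i ∈ β
  · rw [idem_of_mem K Γ lam gam hi]
    exact Submodule.subset_span (HomogWord.e _)
  · rw [idem_of_notMem K Γ lam gam hi]
    exact Submodule.zero_mem _

theorem y_mem_grade (a : Fin n) : y K Γ lam gam β a ∈ grade K Γ lam gam β 2 :=
  Submodule.subset_span (HomogWord.y _)

theorem psi_mem_grade (b : Fin n) (i : Fin n → I) :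
    psi K Γ lam gam β b * idem K Γ lam gam β i ∈
      grade K Γ lam gam β (psiDeg Γ lam gam b i) := by
  by_cases hi : i ∈ β
  · rw [idem_of_mem K Γ lam gam hi]
    by_cases hb : b.val = 0
    · rw [psiDeg_first _ _ hb]
      exact Submodule.subset_span (HomogWord.psi0 b hb ⟨i, hi⟩)
    · rw [psiDeg_of_succ _ _ (prev_add_one hb)]
      exact Submodule.subset_span (HomogWord.psi _ b (prev_add_one hb) ⟨i, hi⟩)
  · rw [idem_of_notMem K Γ lam gam hi, mul_zero]
    exact Submodule.zero_mem _

theorem mul_mem_grade {k l : ℤ} {x x' : V K Γ lam gam β} (hx : x ∈ grade K Γ lam gam β k)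
    (hx' : x' ∈ grade K Γ lam gam β l) : x * x' ∈ grade K Γ lam gam β (k + l) := by
  unfold grade at hx hx'
  induction hx using Submodule.span_induction with
  | zero => rw [zero_mul]; exact Submodule.zero_mem _
  | add a b _ _ ha hb => rw [add_mul]; exact Submodule.add_mem _ ha hb
  | smul c a _ ha => rw [smul_mul_assoc]; exact Submodule.smul_mem _ c ha
  | mem x hx =>
    induction hx' using Submodule.span_induction with
    | zero => rw [mul_zero]; exact Submodule.zero_mem _
    | add a b _ _ ha hb => rw [mul_add]; exact Submodule.add_mem _ ha hb
    | smul c a _ ha => rw [mul_smul_comm]; exact Submodule.smul_mem _ c ha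
    | mem y hy => exact Submodule.subset_span (HomogWord.mul _ _ _ _ hx hy)

/-- A multiplicative property of homogeneous elements holds for all of them if it holds for the
homogeneous generators. -/
theorem grade_induction {p : ℤ → V K Γ lam gam β → Prop} (h0 : ∀ k, p k 0)
    (hadd : ∀ k x x', p k x → p k x' → p k (x + x'))
    (hsmul : ∀ k (c : K) x, p k x → p k (c • x))
    (he : ∀ i ∈ β, p 0 (idem K Γ lam gam β i)) (hy : ∀ a, p 2 (y K Γ lam gam β a))
    (hp : ∀ b, ∀ i ∈ β, p (psiDeg Γ lam gam b i) (psi K Γ lam gam β b * idem K Γ lam gam β i))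
    (hmul : ∀ k l x x', p k x → p l x' → p (k + l) (x * x'))
    {k : ℤ} {x : V K Γ lam gam β} (hx : x ∈ grade K Γ lam gam β k) : p k x := by
  unfold grade at hx
  induction hx using Submodule.span_induction with
  | zero => exact h0 _
  | add a b _ _ ha hb => exact hadd _ _ _ ha hb
  | smul c a _ ha => exact hsmul _ _ _ ha
  | mem x hx =>
    induction hx with
    | e i => rw [← idem_coe]; exact he _ i.2
    | y a => exact hy a
    | psi0 o ho i => rw [← idem_coe, ← psiDeg_first _ _ ho]; exact hp o _ i.2
    | psi a b hab i => rw [← idem_coe, ← psiDeg_of_succ lam gam hab]; exact hp b _ i.2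
    | mul k l x x' _ _ h h' => exact hmul _ _ _ _ h h'

theorem one_mem_grade (hβ : Γ.IsBOrbit β) (hadm : Γ.Admissible lam gam) :
    (1 : V K Γ lam gam β) ∈ grade K Γ lam gam β 0 := by
  rw [← (isRep hβ hadm).sum_toFinset hβ.finite]
  exact Submodule.sum_mem _ fun i _ => idem_mem_grade i

theorem gam_inv (hadm : Γ.Admissible lam gam) {i : I} (hi : gam i = 0) : gam (Γ.inv i) = 0 := by
  by_cases h : Γ.inv i = i
  · rwa [h]
  · exact (hadm _).1 fun h' => h (by rw [Γ.inv_inv] at h'; exact h'.symm)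

-- This is the homogeneity of the defining relations: multiplying each homogeneous generator by $T$
-- to its degree gives another representation. The element $\psi_b$ itself is not homogeneous, hence
-- the sum over the $\psi_be(i)$.
open AddMonoidAlgebra in
theorem isRep_single (hβ : Γ.IsBOrbit β) (hadm : Γ.Admissible lam gam) :
    IsRep K Γ lam gam β (fun i => single 0 (idem K Γ lam gam β i))
      (fun a => single 2 (y K Γ lam gam β a))
      (fun b => ∑ i ∈ hβ.finite.toFinset, single (psiDeg Γ lam gam b i)
        (psi K Γ lam gam β b * idem K Γ lam gam β i))
      (1 : AddMonoidAlgebra (V K Γ lam gam β) ℤ) := by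
  classical
  have h := isRep (K := K) (lam := lam) (gam := gam) hβ hadm
  set E := idem K Γ lam gam β with hE
  set Y := y K Γ lam gam β
  set P := psi K Γ lam gam β
  set P' : Fin n → AddMonoidAlgebra (V K Γ lam gam β) ℤ := fun b =>
    ∑ i ∈ hβ.finite.toFinset, single (psiDeg Γ lam gam b i) (P b * E i) with hP'
  -- the action of `P' b` on homogeneous elements
  have hP : ∀ b i k z, E i * z = z → P' b * single k z = single (psiDeg Γ lam gam b i + k) (P b * z) ∧
      E (move Γ b i) * (P b * z) = P b * z := by
    intro b i k z hz
    constructor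
    · rw [hP', Finset.sum_mul]
      by_cases hi : i ∈ β
      · rw [Finset.sum_eq_single i]
        · rw [single_mul_single, mul_assoc, hz]
        · intro j _ hji
          rw [single_mul_single, ← hz, mul_assoc, ← mul_assoc (E j), h.E_mul_ne j i hji, zero_mul,
            mul_zero, single_zero]
        · intro hn; exact absurd (by simpa using hi) hn
      · rw [← hz, h.E_off i hi]; simp
    · rw [← mul_assoc, ← h.psi_E, mul_assoc, hz]
  have hPs : ∀ a b : Fin n, a.val + 1 = b.val → ∀ i k z, E i * z = z →
      P' b * single k z = single (Γ.deg₂ (i a) (i b) + k) (P b * z) ∧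
      E (i ∘ Equiv.swap a b) * (P b * z) = P b * z := by
    intro a b hab i k z hz
    have := hP b i k z hz
    rwa [psiDeg_of_succ _ _ hab, move_of_succ hab] at this
  have hP0 : ∀ o : Fin n, o.val = 0 → ∀ i k z, E i * z = z →
      P' o * single k z = single (Γ.deg₁ lam gam (i o) + k) (P o * z) ∧
      E (Function.update i o (Γ.inv (i o))) * (P o * z) = P o * z := by
    intro o ho i k z hz
    have := hP o i k z hz
    rwa [psiDeg_first _ _ ho, move_first ho] at this
  -- The two facts `cs` and `c0` take and return the same kind of pair, an exponent together with
  -- the idempotent that absorbs the element, so they can be chained along a product of the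
  -- $\psi_b$.
  have cs : ∀ a b : Fin n, a.val + 1 = b.val → ∀ {i k z} {w : AddMonoidAlgebra _ ℤ},
      w = single k z ∧ E i * z = z →
      P' b * w = single (Γ.deg₂ (i a) (i b) + k) (P b * z) ∧
      E (i ∘ Equiv.swap a b) * (P b * z) = P b * z := by
    intro a b hab i k z w hw
    rw [hw.1]; exact hPs a b hab i k z hw.2
  have c0 : ∀ o : Fin n, o.val = 0 → ∀ {i k z} {w : AddMonoidAlgebra _ ℤ},
      w = single k z ∧ E i * z = z →
      P' o * w = single (Γ.deg₁ lam gam (i o) + k) (P o * z) ∧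
      E (Function.update i o (Γ.inv (i o))) * (P o * z) = P o * z := by
    intro o ho i k z w hw
    rw [hw.1]; exact hP0 o ho i k z hw.2
  have start : ∀ i, (single 0 (E i) : AddMonoidAlgebra (V K Γ lam gam β) ℤ) = single 0 (E i) ∧
      E i * E i = E i := fun i => ⟨rfl, h.E_mul_self i⟩
  have hne : ∀ a b : Fin n, a.val + 1 = b.val → a ≠ b := fun a b h h' => by
    rw [h'] at h; omega
  have ext : ∀ {x y : AddMonoidAlgebra (V K Γ lam gam β) ℤ},
      (∀ i, x * single 0 (E i) = y * single 0 (E i)) → x = y := by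
    intro x y hxy
    rw [← mul_one x, ← mul_one y, one_def, ← h.sum_toFinset hβ.finite, single_finset_sum,
      Finset.mul_sum, Finset.mul_sum]
    exact Finset.sum_congr rfl fun i _ => hxy i
  have hEE := h.E_mul_self
  have hEY : ∀ i a z, E i * z = z → E i * (Y a * z) = Y a * z := fun i a z hz => by
    rw [← mul_assoc, ← h.y_e, mul_assoc, hz]
  have hPE : ∀ b i, P' b * single 0 (E i) = single 0 (E (move Γ b i)) * P' b := by
    refine fun b i => ext fun l => ?_
    rw [mul_assoc, mul_assoc, single_mul_single, (hP b l _ _ (hEE l)).1, single_mul_single]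
    by_cases hl : i = l
    · rw [hl, hEE, (hP b l 0 _ (hEE l)).2, ← hEE l, (hP b l _ _ (by simp only [hEE])).1]
      simp
    · rw [h.E_mul_ne i l hl, h.psi_E, ← mul_assoc, h.E_mul_ne, zero_mul, single_zero, single_zero,
        mul_zero]
      intro he
      exact hl (by rw [← move_move (Γ := Γ) b i, he, move_move])
  refine
    { E_off := fun i hi => by simp only [h.E_off i hi, single_zero]
      sum_E := ?_
      E_mul_self := fun i => by simp only [single_mul_single, hEE, add_zero]
      E_mul_ne := fun i j hij => by simp only [single_mul_single, h.E_mul_ne i j hij, single_zero]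
      y_comm := fun a b => by simp only [single_mul_single, h.y_comm a b]
      y_e := fun a i => by simp only [single_mul_single, h.y_e a i, add_zero, zero_add]
      psi_e := fun a b hab i => ?_
      psi_y_left := fun a b hab i hi => ?_
      psi_y_right := fun a b hab i hi => ?_
      psi_y := fun a b hab c i hi => ?_
      psi_comm := fun a b hab => ext fun i => ?_
      psi_sq := fun a b hab i => ?_
      braid3_eq := fun a b c hab hbc i hi => ?_
      braid3_ne := fun a b c hab hbc i hi => ?_
      psi0_e := fun o ho i => ?_
      psi0_y1 := fun o ho i => ?_
      psi0_y := fun o ho a ha => ext fun i => ?_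
      psi0_sq := fun o ho i hi => ?_
      psi0_sq_zero := fun o ho i hi => ?_
      braid4_theta := fun o t ho ht i h1 h2 => ?_
      braid4_other := fun o t ho ht i hi => ?_ }
  · rw [one_def, ← h.sum_toFinset hβ.finite, single_finset_sum]
    refine finsum_eq_sum_of_support_subset _ fun i hi => ?_
    by_contra hn
    exact hi (by simp [h.E_off i (by simpa using hn)])
  · exact (move_of_succ (Γ := Γ) hab i) ▸ hPE b i
  · have := h.psi_y_left a b hab i hi
    simp only [mul_assoc] at this ⊢
    rw [single_mul_single, (hPs a b hab i _ _ (hEY i a _ (hEE i))).1,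
      (hPs a b hab i _ _ (hEE i)).1, single_mul_single, this, hi, Γ.deg₂_self, single_sub]
    norm_num
  · have := h.psi_y_right a b hab i hi
    simp only [mul_assoc] at this ⊢
    rw [single_mul_single, (hPs a b hab i _ _ (hEY i b _ (hEE i))).1,
      (hPs a b hab i _ _ (hEE i)).1, single_mul_single, this, hi, Γ.deg₂_self, single_add]
    norm_num
  · have := h.psi_y a b hab c i hi
    simp only [mul_assoc] at this ⊢
    rw [single_mul_single, (hPs a b hab i _ _ (hEY i c _ (hEE i))).1,
      (hPs a b hab i _ _ (hEE i)).1, single_mul_single, this]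
    congr 1; ring
  · simp only [mul_assoc]
    have hb : b.val - 1 + 1 = b.val := by omega
    have hpa : prev b ≠ a := fun h => by rw [← h] at hab; simp [prev] at hab; omega
    have hba : b ≠ a := fun h => by rw [← h] at hab; omega
    rw [(hP b i _ _ (hEE i)).1, (hP a i _ _ (hEE i)).1, (hP a _ _ _ (hP b i 0 _ (hEE i)).2).1,
      (hP b _ _ _ (hP a i 0 _ (hEE i)).2).1, ← mul_assoc, h.psi_comm a b hab, mul_assoc]
    congr 1
    have h1 : psiDeg Γ lam gam a (move Γ b i) = psiDeg Γ lam gam a i := by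
      have e : ∀ c : Fin n, c.val ≤ a.val → move Γ b i c = i c := fun c hc => by
        rw [move, if_neg (by omega), Function.comp_apply, Equiv.swap_apply_of_ne_of_ne]
        · intro h; rw [h] at hc; simp [prev] at hc; omega
        · intro h; rw [h] at hc; omega
      unfold psiDeg
      rw [e a le_rfl, e (prev a) (by simp [prev])]
    have h2 : psiDeg Γ lam gam b (move Γ a i) = psiDeg Γ lam gam b i := by
      have e : ∀ c : Fin n, a.val < c.val → move Γ a i c = i c := fun c hc => by
        unfold move
        split_ifs
        · rw [Function.update_of_ne]
          intro h; rw [h] at hc; omega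
        · rw [Function.comp_apply, Equiv.swap_apply_of_ne_of_ne]
          · intro h; rw [h] at hc; simp [prev] at hc; omega
          · intro h; rw [h] at hc; omega
      unfold psiDeg
      rw [e b (by omega), e (prev b) (by simp [prev]; omega)]
    rw [h1, h2]; ring
  · have := h.psi_sq a b hab i
    simp only [mul_assoc] at this ⊢
    have h1 := hPs a b hab i 0 _ (hEE i)
    rw [h1.1, (hPs a b hab _ _ _ h1.2).1, this, ringQ_single, single_mul_single]
    by_cases hi : i a = i b
    · simp [InvQuiver.ringQ, hi]
    · congr 1
      simp only [Function.comp_apply, Equiv.swap_apply_left, Equiv.swap_apply_right]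
      rw [Γ.deg₂_of_ne hi, Γ.deg₂_comm, Γ.deg₂_of_ne hi]; ring
  · have := h.braid3_eq a b c hab hbc i hi
    simp only [mul_assoc] at this ⊢
    have h1 := hPs b c hbc i 0 _ (hEE i)
    have h2 := hPs a b hab _ (Γ.deg₂ (i b) (i c) + 0) _ h1.2
    have h1' := hPs a b hab i 0 _ (hEE i)
    have h2' := hPs b c hbc _ (Γ.deg₂ (i a) (i b) + 0) _ h1'.2
    rw [h1.1, h2.1, (hPs b c hbc _ _ _ h2.2).1, h1'.1, h2'.1, (hPs a b hab _ _ _ h2'.2).1, this,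
      single_add, divQ_single, single_mul_single]
    have hac : a ≠ c := fun h => by rw [h] at hab; omega
    have hab' := hne a b hab
    have hbc' := hne b c hbc
    simp only [Function.comp_apply, Equiv.swap_apply_left, Equiv.swap_apply_right,
      Equiv.swap_apply_of_ne_of_ne hab' hac, Equiv.swap_apply_of_ne_of_ne hac.symm hbc'.symm]
    congr 1
    · congr 1; ring
    · by_cases hi' : i a = i b
      · simp [InvQuiver.divQ, hi']
      · congr 1
        rw [← hi, Γ.deg₂_of_ne hi', Γ.deg₂_self, Γ.deg₂_comm, Γ.deg₂_of_ne hi']; ring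
  · have := h.braid3_ne a b c hab hbc i hi
    simp only [mul_assoc] at this ⊢
    have h1 := hPs b c hbc i 0 _ (hEE i)
    have h2 := hPs a b hab _ (Γ.deg₂ (i b) (i c) + 0) _ h1.2
    have h1' := hPs a b hab i 0 _ (hEE i)
    have h2' := hPs b c hbc _ (Γ.deg₂ (i a) (i b) + 0) _ h1'.2
    rw [h1.1, h2.1, (hPs b c hbc _ _ _ h2.2).1, h1'.1, h2'.1, (hPs a b hab _ _ _ h2'.2).1, this]
    have hac : a ≠ c := fun h => by rw [h] at hab; omega
    have hab' := hne a b hab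
    have hbc' := hne b c hbc
    simp only [Function.comp_apply, Equiv.swap_apply_left, Equiv.swap_apply_right,
      Equiv.swap_apply_of_ne_of_ne hab' hac, Equiv.swap_apply_of_ne_of_ne hac.symm hbc'.symm]
    congr 1; ring
  · exact (move_first (Γ := Γ) ho i) ▸ hPE o i
  · have := h.psi0_y1 o ho i
    simp only [mul_assoc] at this ⊢
    rw [single_mul_single, (hP0 o ho i _ _ (hEY i o _ (hEE i))).1, (hP0 o ho i _ _ (hEE i)).1,
      single_mul_single, this, single_sub, smul_single]
    have e : Γ.deg₁ lam gam (i o) + (2 + 0) = 2 + (Γ.deg₁ lam gam (i o) + 0) := by ring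
    rw [e]
    congr 1
    -- The constant term $2\gamma$ has degree $0$. It is either absent or occurs with
    -- $\deg\psi_0=-2$, which cancels $\deg y_1=2$.
    by_cases hg : gam (i o) = 0
    · simp [hg]
    · simp [InvQuiver.deg₁, hg]
  · have := h.psi0_y o ho a ha
    rw [mul_assoc, mul_assoc, single_mul_single, (hP0 o ho i _ _ (hEY i a _ (hEE i))).1,
      (hP0 o ho i _ _ (hEE i)).1, single_mul_single, ← mul_assoc, this, mul_assoc]
    congr 1; ring
  · have := h.psi0_sq o ho i hi
    simp only [mul_assoc] at this ⊢
    have h1 := hP0 o ho i 0 _ (hEE i)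
    have hg := gam_inv hadm hi
    rw [h1.1, (hP0 o ho _ _ _ h1.2).1, this, single_pow, single_mul_single,
      neg_one_pow_mul_single]
    congr 1
    rw [Function.update_self, InvQuiver.deg₁, InvQuiver.deg₁, if_pos hi, if_pos hg, Γ.inv_inv,
      nsmul_eq_mul]
    push_cast; ring
  · have := h.psi0_sq_zero o ho i hi
    simp only [mul_assoc] at this ⊢
    have h1 := hP0 o ho i 0 _ (hEE i)
    rw [h1.1, (hP0 o ho _ _ _ h1.2).1, this, single_zero]
  · have := h.braid4_theta o t ho ht i h1 h2
    have hot : o.val + 1 = t.val := by omega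
    have hne' := hne o t hot
    simp only [mul_assoc] at this ⊢
    have a4 := c0 o ho (cs o t hot (c0 o ho (cs o t hot (start i))))
    have b4 := cs o t hot (c0 o ho (cs o t hot (c0 o ho (start i))))
    have a1 := cs o t hot (start i)
    rw [a4.1, b4.1, a1.1, this, ← single_neg, homSum_single, single_mul_single,
      neg_one_pow_mul_single, single_sub]
    simp only [Function.comp_apply, Equiv.swap_apply_left, Equiv.swap_apply_right,
      Function.update_self, Function.update_of_ne hne'.symm]
    have hd : Γ.deg₁ lam gam (Γ.inv (i o)) = Γ.deg₁ lam gam (i o) := by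
      rw [InvQuiver.deg₁, InvQuiver.deg₁, if_pos h1, if_pos (gam_inv hadm h1), Γ.inv_inv, add_comm]
    have hd' : Γ.deg₁ lam gam (i o) = lam (i o) + lam (Γ.inv (i o)) := by
      rw [InvQuiver.deg₁, if_pos h1]; push_cast; rfl
    rw [← h2, Γ.inv_inv, Γ.deg₂_self, Γ.deg₂_self, hd, hd']
    congr 2 <;> (push_cast; ring)
  · have := h.braid4_other o t ho ht i hi
    have hot : o.val + 1 = t.val := by omega
    have hne' := hne o t hot
    simp only [mul_assoc] at this
    simp only [mul_assoc, sub_mul, smul_mul_assoc]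
    have a4 := c0 o ho (cs o t hot (c0 o ho (cs o t hot (start i))))
    have b4 := cs o t hot (c0 o ho (cs o t hot (c0 o ho (start i))))
    have b1 := c0 o ho (start i)
    rw [a4.1, b4.1, b1.1, this, single_add]
    simp only [Function.comp_apply, Equiv.swap_apply_left, Equiv.swap_apply_right,
      Function.update_self, Function.update_of_ne hne'.symm]
    -- Both sides of the length-four relation contain $\psi_1$ at two different tuples; the
    -- invariance of $d(i,j)$ under $\theta$ and under exchange matches their degrees.
    have e1 : Γ.deg₂ (Γ.inv (i t)) (Γ.inv (i o)) = Γ.deg₂ (i o) (i t) := by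
      rw [Γ.deg₂_inv, Γ.deg₂_comm]
    have e2 : Γ.deg₂ (Γ.inv (i t)) (i o) = Γ.deg₂ (Γ.inv (i o)) (i t) := by
      rw [← Γ.deg₂_inv, Γ.inv_inv, Γ.deg₂_comm]
    rw [e1, e2]
    congr 1
    · congr 1; ring
    -- The correction term is present only for $\gamma_{i_2}\ne0$; then $i_2$ is fixed by $\theta$
    -- and $\psi_0e(i)$ has degree $-2$ when $i_2$ stands first.
    by_cases g2 : gam (i t) = 0
    · simp [g2]
    have f2 : Γ.inv (i t) = i t := by
      by_contra hc; exact g2 ((hadm _).1 hc)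
    by_cases hio : i t = i o
    · simp [InvQuiver.oddQ, InvQuiver.oddQ', hio]
    have e3 : Γ.deg₂ (Γ.inv (i o)) (i t) = Γ.deg₂ (i o) (i t) := by rw [← e2, f2, Γ.deg₂_comm]
    have e4 : Γ.deg₁ lam gam (i t) = -2 := by rw [InvQuiver.deg₁, if_neg g2]
    rw [oddQ_single, single_mul_single, ← smul_single]
    congr 1
    rw [sub_mul, single_sub, smul_mul_assoc, mul_assoc, e3, e4, Γ.deg₂_of_ne (Ne.symm hio),
      Γ.dot_comm (i t)]
    congr 1
    · congr 1; ring
    by_cases g1 : gam (i o) = 0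
    · simp [g1]
    have f1 : Γ.inv (i o) = i o := by
      by_contra hc; exact g1 ((hadm _).1 hc)
    rw [oddQ'_single _ (Γ.even_dot f2 f1), single_mul_single, smul_single, Γ.dot_comm (i t),
      InvQuiver.deg₁, if_neg g1]
    congr 1; ring

-- The homomorphism comes from the twisted generators of `isRep_single`. The elements $x$ that it
-- sends to $xT^k$ are closed under sums, scalars and products with the appropriate degrees, so the
-- homogeneous generators suffice.
open AddMonoidAlgebra in
theorem exists_coaction (hβ : Γ.IsBOrbit β) (hadm : Γ.Admissible lam gam) :
    ∃ δ : V K Γ lam gam β →ₐ[K] AddMonoidAlgebra (V K Γ lam gam β) ℤ,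
      ∀ k, ∀ x ∈ grade K Γ lam gam β k, δ x = single k x := by
  have h := isRep (K := K) (lam := lam) (gam := gam) hβ hadm
  obtain ⟨δ, he, hy, hp⟩ := exists_lift hβ hadm (isRep_single hβ hadm)
  refine ⟨δ, fun k x hx => ?_⟩
  refine grade_induction (p := fun k x => δ x = single k x) (fun k => by simp)
    (fun k x x' hx hx' => by rw [map_add, hx, hx', single_add])
    (fun k c x hx => by rw [map_smul, hx, smul_single]) (fun i _ => he i) hy (fun b i hi => ?_)
    (fun k l x x' hx hx' => by rw [map_mul, hx, hx', single_mul_single]) hx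
  rw [map_mul, he, hp, Finset.sum_mul, Finset.sum_eq_single i]
  · rw [single_mul_single, mul_assoc, h.E_mul_self, add_zero]
  · intro j _ hji
    rw [single_mul_single, mul_assoc, h.E_mul_ne j i hji, mul_zero, single_zero]
  · intro hn; exact absurd (by simpa using hi) hn

theorem iSup_grade (hβ : Γ.IsBOrbit β) (hadm : Γ.Admissible lam gam) :
    ⨆ k, grade K Γ lam gam β k = ⊤ := by
  have h := isRep (K := K) (lam := lam) (gam := gam) hβ hadm
  refine Submodule.eq_top_iff'.2 fun x => ?_
  refine subalgebra_eq_top (supSubalgebra (grade K Γ lam gam β) (one_mem_grade hβ hadm)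
    fun k l x hx y hy => mul_mem_grade hx hy) (fun i _ => ?_) (fun a => ?_) (fun b => ?_) x
  · exact Submodule.mem_iSup_of_mem 0 (idem_mem_grade i)
  · exact Submodule.mem_iSup_of_mem 2 (y_mem_grade a)
  · rw [← mul_one (psi K Γ lam gam β b), ← h.sum_toFinset hβ.finite, Finset.mul_sum]
    exact Subalgebra.sum_mem _ fun i _ => Submodule.mem_iSup_of_mem _ (psi_mem_grade b i)

theorem isAlgGrading (hβ : Γ.IsBOrbit β) (hadm : Γ.Admissible lam gam) :
    IsAlgGrading (grade K Γ lam gam β) := by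
  obtain ⟨δ, hδ⟩ := exists_coaction (K := K) hβ hadm
  exact isAlgGrading_of_coaction _ δ hδ (fun k l x hx y hy => mul_mem_grade hx hy)
    (iSup_grade hβ hadm)

end V

namespace VCyc

variable {Lam : I → ℕ}

theorem mk_surjective : Function.Surjective (mk K Γ lam gam β Lam) :=
  RingQuot.mkAlgHom_surjective K _

theorem mk_rel (o : Fin n) (ho : o.val = 0) (i : Fin n → I) :
    mk K Γ lam gam β Lam (V.y K Γ lam gam β o ^ Lam (i o) * V.idem K Γ lam gam β i) = 0 := by
  by_cases hi : i ∈ β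
  · rw [V.idem_of_mem K Γ lam gam hi, ← map_zero (mk K Γ lam gam β Lam)]
    exact RingQuot.mkAlgHom_rel K (CycRel.mk o ho ⟨i, hi⟩)
  · rw [V.idem_of_notMem K Γ lam gam hi, mul_zero, map_zero]

theorem exists_lift {B : Type*} [Ring B] [Algebra K B] (f : V K Γ lam gam β →ₐ[K] B)
    (hf : ∀ o : Fin n, o.val = 0 → ∀ i ∈ β,
      f (V.y K Γ lam gam β o ^ Lam (i o) * V.idem K Γ lam gam β i) = 0) :
    ∃ g : VCyc K Γ lam gam β Lam →ₐ[K] B, ∀ x, g (mk K Γ lam gam β Lam x) = f x := by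
  refine ⟨RingQuot.liftAlgHom K ⟨f, fun x y hxy => ?_⟩, fun x =>
    RingQuot.liftAlgHom_mkAlgHom_apply K _ _ _⟩
  cases hxy with
  | mk o ho i => rw [map_zero, ← V.idem_coe, hf o ho _ i.2]

theorem mem_grade_iff {k : ℤ} {x : VCyc K Γ lam gam β Lam} :
    x ∈ grade K Γ lam gam β Lam k ↔
      ∃ x' ∈ V.grade K Γ lam gam β k, mk K Γ lam gam β Lam x' = x := Iff.rfl

-- The relators $y_1^{\Lambda_{i_1}}e(i)$ are homogeneous, so the coaction of $V_\beta$, followed by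
-- the quotient map on coefficients, annihilates them and descends.
open AddMonoidAlgebra in
theorem isAlgGrading (hβ : Γ.IsBOrbit β) (hadm : Γ.Admissible lam gam) :
    IsAlgGrading (grade K Γ lam gam β Lam) := by
  obtain ⟨δ, hδ⟩ := V.exists_coaction (K := K) hβ hadm
  obtain ⟨δ', hδ'⟩ := exists_lift (Lam := Lam) ((mapAlgHom ℤ (mk K Γ lam gam β Lam)).comp δ) (by
    intro o ho i _
    have hy : V.y K Γ lam gam β o ^ Lam (i o) * V.idem K Γ lam gam β i ∈
        V.grade K Γ lam gam β (Lam (i o) * 2 + 0) := by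
      refine V.mul_mem_grade ?_ (V.idem_mem_grade i)
      generalize Lam (i o) = m
      induction m with
      | zero => simpa using V.one_mem_grade hβ hadm
      | succ m ih =>
        rw [pow_succ]
        convert V.mul_mem_grade ih (V.y_mem_grade o) using 2
        push_cast; ring
    rw [AlgHom.comp_apply, hδ _ _ hy, mapAlgHom_single]
    simp [mk_rel o ho])
  refine isAlgGrading_of_coaction _ δ' ?_ ?_ ?_
  · rintro k _ ⟨x, hx, rfl⟩
    change δ' (mk K Γ lam gam β Lam x) = _
    rw [hδ', AlgHom.comp_apply, hδ k x hx, mapAlgHom_single]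
    rfl
  · rintro k l _ ⟨x, hx, rfl⟩ _ ⟨y, hy, rfl⟩
    exact ⟨x * y, V.mul_mem_grade hx hy, map_mul (mk K Γ lam gam β Lam) x y⟩
  · have h : (⨆ k, V.grade K Γ lam gam β k).map (mk K Γ lam gam β Lam).toLinearMap = ⊤ := by
      rw [V.iSup_grade hβ hadm, Submodule.map_top, LinearMap.range_eq_top]
      exact mk_surjective
    rw [Submodule.map_iSup] at h
    exact h

end VCyc

end Grading

/-! ### Words with given numbers of letters -/

section Words

variable {n d : ℕ}

/-- The positions of the letter `j` in the word `t`. -/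
def fiber (t : Fin n → Fin d) (j : Fin d) : Finset (Fin n) := Finset.univ.filter fun a => t a = j

theorem mem_fiber {t : Fin n → Fin d} {j : Fin d} {a : Fin n} : a ∈ fiber t j ↔ t a = j := by
  simp [fiber]

variable (n) in
/-- The words of length `n` in the letters `j < d` in which `j` occurs `c j` times. -/
abbrev Words (c : Fin d → ℕ) : Type := {t : Fin n → Fin d // ∀ j, (fiber t j).card = c j}

variable {c : Fin d → ℕ}

/-- The position of the `k`-th letter `j` in the word `t`. -/
def pos (t : Words n c) (j : Fin d) (k : Fin (c j)) : Fin n :=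
  (fiber t.1 j).orderEmbOfFin (t.2 j) k

theorem letter_pos (t : Words n c) (j : Fin d) (k : Fin (c j)) : t.1 (pos t j k) = j :=
  mem_fiber.1 (Finset.orderEmbOfFin_mem _ _ k)

theorem pos_strictMono (t : Words n c) (j : Fin d) : StrictMono (pos t j) :=
  (Finset.orderEmbOfFin (fiber t.1 j) (t.2 j)).strictMono

theorem range_pos (t : Words n c) (j : Fin d) : Set.range (pos t j) = {a | t.1 a = j} := by
  rw [show pos t j = (fiber t.1 j).orderEmbOfFin (t.2 j) from rfl, Finset.range_orderEmbOfFin]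
  ext a
  simp [mem_fiber]

theorem exists_pos (t : Words n c) {a : Fin n} {j : Fin d} (h : t.1 a = j) :
    ∃ k, pos t j k = a := by
  have : a ∈ Set.range (pos t j) := by rw [range_pos]; exact h
  exact this

theorem pos_unique (t : Words n c) {j : Fin d} {f : Fin (c j) → Fin n} (hf : ∀ k, t.1 (f k) = j)
    (hmono : StrictMono f) (k : Fin (c j)) : f k = pos t j k :=
  congrFun (Finset.orderEmbOfFin_unique (t.2 j) (fun k => mem_fiber.2 (hf k)) hmono) k

theorem pos_injective (t : Words n c) {j j' : Fin d} {k : Fin (c j)} {k' : Fin (c j')}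
    (h : pos t j k = pos t j' k') : (⟨j, k⟩ : Σ j, Fin (c j)) = ⟨j', k'⟩ := by
  obtain rfl : j = j' := by rw [← letter_pos t j k, h, letter_pos]
  rw [(pos_strictMono t j).injective h]

/-- The positions of the letters of a word. -/
def posEquiv (t : Words n c) : (Σ j, Fin (c j)) ≃ Fin n :=
  Equiv.ofBijective (fun p => pos t p.1 p.2)
    ⟨fun _ _ h => pos_injective t h, fun a => by
      obtain ⟨k, hk⟩ := exists_pos t (rfl : t.1 a = _)
      exact ⟨⟨_, k⟩, hk⟩⟩

@[simp]
theorem posEquiv_apply (t : Words n c) (p : Σ j, Fin (c j)) : posEquiv t p = pos t p.1 p.2 := rfl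

@[simp]
theorem posEquiv_symm_pos (t : Words n c) (j : Fin d) (k : Fin (c j)) :
    (posEquiv t).symm (pos t j k) = ⟨j, k⟩ :=
  (posEquiv t).symm_apply_apply ⟨j, k⟩

theorem sum_card_eq (t : Words n c) : ∑ j, c j = n := by
  have := Fintype.card_congr (posEquiv t)
  simpa using this

/-- Consecutive positions of the same letter have consecutive numbers. -/
theorem succ_of_pos_succ (t : Words n c) {j : Fin d} {k k' : Fin (c j)}
    (h : (pos t j k').val + 1 = (pos t j k).val) : k'.val + 1 = k.val := by
  have h1 : k' < k := (pos_strictMono t j).lt_iff_lt.1 (Fin.lt_def.2 (by omega))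
  by_contra h2
  have h3 : k'.val + 1 < k.val := by have := Fin.lt_def.1 h1; omega
  let k'' : Fin (c j) := ⟨k'.val + 1, by omega⟩
  have h4 : pos t j k' < pos t j k'' := pos_strictMono t j (Fin.lt_def.2 (Nat.lt_succ_self _))
  have h5 : pos t j k'' < pos t j k := pos_strictMono t j (Fin.lt_def.2 h3)
  rw [Fin.lt_def] at h4 h5
  omega

theorem card_fiber_comp (t : Fin n → Fin d) (w : Equiv.Perm (Fin n)) (j : Fin d) :
    (fiber (t ∘ w) j).card = (fiber t j).card := by
  refine Finset.card_bij (fun a _ => w a) (fun a ha => ?_) (fun a _ b _ h => w.injective h)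
    fun b hb => ⟨w.symm b, ?_, by simp⟩
  · exact mem_fiber.2 ((mem_fiber (t := t ∘ w)).1 ha)
  · exact mem_fiber.2 (by simpa using mem_fiber.1 hb)

/-- The word `t ∘ w`. -/
def permWord (w : Equiv.Perm (Fin n)) (t : Words n c) : Words n c :=
  ⟨t.1 ∘ w, fun j => by rw [card_fiber_comp, t.2 j]⟩

/-- The simple transposition `(b - 1, b)`, or `1` if `b` is the first position. -/
def swp (b : Fin n) : Equiv.Perm (Fin n) := Equiv.swap (prev b) b

theorem swp_of_succ {a b : Fin n} (hab : a.val + 1 = b.val) : swp b = Equiv.swap a b := by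
  rw [swp, prev_eq hab]

theorem swp_first {o : Fin n} (ho : o.val = 0) : swp o = 1 := by
  rw [swp, prev_first ho, Equiv.swap_self]; rfl

/-- The word obtained from `t` by exchanging the letters in the positions `b - 1` and `b`. -/
def step (b : Fin n) (t : Words n c) : Words n c := permWord (swp b) t

theorem step_apply (b : Fin n) (t : Words n c) (a : Fin n) : (step b t).1 a = t.1 (swp b a) := rfl

theorem step_step (b : Fin n) (t : Words n c) : step b (step b t) = t :=
  Subtype.ext (funext fun a => by simp [step_apply, swp])

theorem step_eq_self {b : Fin n} {t : Words n c} (h : t.1 (prev b) = t.1 b) : step b t = t := by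
  refine Subtype.ext (funext fun a => ?_)
  rw [step_apply, swp]
  by_cases h1 : a = prev b
  · rw [h1, Equiv.swap_apply_left, h]
  by_cases h2 : a = b
  · rw [h2, Equiv.swap_apply_right, h]
  rw [Equiv.swap_apply_of_ne_of_ne h1 h2]

theorem step_first {o : Fin n} (ho : o.val = 0) (t : Words n c) : step o t = t :=
  step_eq_self (by rw [prev_first ho])

/-- The exchange of two adjacent different letters keeps the relative order of the occurrences of
each letter, so every occurrence keeps its number. -/
theorem pos_step {b : Fin n} {t : Words n c} (h : t.1 (prev b) ≠ t.1 b) (j : Fin d)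
    (k : Fin (c j)) : pos (step b t) j k = swp b (pos t j k) := by
  have hb : b.val ≠ 0 := fun hb => h (by rw [prev_first hb])
  have hb' := prev_add_one hb
  refine (pos_unique (step b t) (f := fun k => swp b (pos t j k)) (fun k => ?_) ?_ k).symm
  · rw [step_apply]; simp [swp, letter_pos]
  · intro k k' hk
    have h1 := pos_strictMono t j hk
    have h2 := letter_pos t j k
    have h3 := letter_pos t j k'
    simp only [swp]
    generalize pos t j k = x at *
    generalize pos t j k' = y at *
    rw [Equiv.swap_apply_def, Equiv.swap_apply_def]
    rw [Fin.lt_def] at h1 ⊢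
    -- The only pair of positions whose order is reversed is $(b-1,b)$, and it carries different
    -- letters.
    have hx : ¬(x = prev b ∧ y = b) := fun hh => by
      rw [← hh.1, ← hh.2, h2, h3] at h; exact h rfl
    simp only [Fin.ext_iff] at *
    split_ifs <;> omega

theorem posEquiv_step_symm {b : Fin n} {t : Words n c} (h : t.1 (prev b) ≠ t.1 b) (a : Fin n) :
    (posEquiv (step b t)).symm a = (posEquiv t).symm (swp b a) := by
  rw [Equiv.symm_apply_eq, posEquiv_apply, pos_step h, ← posEquiv_apply, Equiv.apply_symm_apply]
  simp [swp]

theorem exists_perm_eq (s t : Words n c) : ∃ w : Equiv.Perm (Fin n), permWord w s = t :=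
  ⟨(posEquiv t).symm.trans (posEquiv s), Subtype.ext (funext fun a => by
    obtain ⟨p, rfl⟩ := (posEquiv t).surjective a
    simp [permWord, letter_pos])⟩

/-! ### Sorting -/

theorem exists_descent {κ : Fin d → ℕ} {t : Words n c} (h : ¬Monotone (κ ∘ t.1)) :
    ∃ b : Fin n, κ (t.1 b) < κ (t.1 (prev b)) := by
  by_contra hn
  push Not at hn
  refine h fun a b hab => ?_
  obtain ⟨m, hm⟩ := Nat.exists_eq_add_of_le (Fin.le_def.1 hab)
  induction m generalizing b with
  | zero => rw [Fin.ext (show b.val = a.val by omega)]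
  | succ m ih =>
    refine (ih (prev b) ?_ ?_).trans (hn b)
    · rw [Fin.le_def]; simp [prev]; omega
    · simp [prev]; omega

/-- Induction on words along the exchanges of adjacent letters that are in the wrong order. -/
theorem sort_induction_all (κ : Fin d → ℕ) {p : Words n c → Prop}
    (hp : ∀ t, (∀ b, κ (t.1 b) < κ (t.1 (prev b)) → p (step b t)) → p t) (t : Words n c) : p t := by
  classical
  -- Moving a larger key to the right strictly increases this weight. There are only finitely many
  -- words, so the process terminates.
  let wt : Words n c → ℕ := fun t => ∑ a, a.val * κ (t.1 a)
  have hwf : WellFounded (fun s t : Words n c => wt t < wt s) :=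
    have : IsTrans (Words n c) (fun s t => wt t < wt s) := ⟨fun _ _ _ h h' => h'.trans h⟩
    have : Std.Irrefl (fun s t : Words n c => wt t < wt s) := ⟨fun _ => lt_irrefl _⟩
    Finite.wellFounded_of_trans_of_irrefl _
  induction t using hwf.induction with
  | _ t ih =>
    refine hp t fun b hb => ih _ ?_
    have hb0 : b.val ≠ 0 := fun h0 => by rw [prev_first h0] at hb; exact lt_irrefl _ hb
    have hne : prev b ≠ b := fun h => by rw [h] at hb; exact lt_irrefl _ hb
    have key : ∀ f : Fin n → ℕ, ∑ a, f a =
        f (prev b) + f b + ∑ a ∈ (Finset.univ.erase b).erase (prev b), f a := fun f => by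
      rw [← Finset.add_sum_erase _ _ (Finset.mem_univ b), ← Finset.add_sum_erase _ _
        (Finset.mem_erase.2 ⟨hne, Finset.mem_univ (prev b)⟩)]
      ring
    change ∑ a, _ < ∑ a, _
    rw [key, key (fun a => a.val * κ ((step b t).1 a))]
    have hrest : ∑ a ∈ (Finset.univ.erase b).erase (prev b), a.val * κ ((step b t).1 a) =
        ∑ a ∈ (Finset.univ.erase b).erase (prev b), a.val * κ (t.1 a) := by
      refine Finset.sum_congr rfl fun a ha => ?_
      simp only [Finset.mem_erase] at ha
      rw [step_apply, swp, Equiv.swap_apply_of_ne_of_ne ha.1 ha.2.1]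
    rw [hrest, step_apply, step_apply, swp, Equiv.swap_apply_left, Equiv.swap_apply_right]
    have h2 := prev_add_one hb0
    rw [← h2]
    nlinarith

theorem sort_induction (κ : Fin d → ℕ) {p : Words n c → Prop}
    (hs : ∀ t, Monotone (κ ∘ t.1) → p t)
    (hstep : ∀ t b, κ (t.1 b) < κ (t.1 (prev b)) → p (step b t) → p t) (t : Words n c) : p t :=
  sort_induction_all κ (fun t ih => by
    by_cases hm : Monotone (κ ∘ t.1)
    · exact hs t hm
    · obtain ⟨b, hb⟩ := exists_descent hm
      exact hstep t b hb (ih b hb)) t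

theorem sorted_unique {κ : Fin d → ℕ} (hκ : Function.Injective κ) {s t : Words n c}
    (hs : Monotone (κ ∘ s.1)) (ht : Monotone (κ ∘ t.1)) : s = t := by
  obtain ⟨w, rfl⟩ := exists_perm_eq s t
  have := Tuple.unique_monotone (f := κ ∘ s.1) (σ := 1) (τ := w) hs ht
  refine Subtype.ext (funext fun a => hκ (congrFun this a))

theorem exists_sorted (κ : Fin d → ℕ) (t : Words n c) : ∃ s : Words n c, Monotone (κ ∘ s.1) :=
  ⟨permWord (Tuple.sort (κ ∘ t.1)) t, Tuple.monotone_sort (κ ∘ t.1)⟩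

/-- In a sorted word, the positions of a minimal letter come first. -/
theorem pos_sorted_min {κ : Fin d → ℕ} (hκ : Function.Injective κ) {s : Words n c}
    (hs : Monotone (κ ∘ s.1)) {j : Fin d} (hj : ∀ j', κ j ≤ κ j') (k : Fin (c j)) :
    (pos s j k).val = k.val := by
  have hcn : c j ≤ n := by
    rw [← s.2 j]; simpa using Finset.card_le_univ (fiber s.1 j)
  have := pos_unique s (j := j) (f := Fin.castLE hcn) (fun k => ?_) (Fin.strictMono_castLE hcn) k
  · rw [← this]; rfl
  by_contra hk
  -- If position $k$ did not carry $j$, then minimality of $j$ would force all its occurrences in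
  -- front of $k$, where there is room for only $k<c_j$ of them.
  have hsub : fiber s.1 j ⊆ Finset.Iio (Fin.castLE hcn k) := fun a ha => by
    rw [mem_fiber] at ha
    rw [Finset.mem_Iio]
    by_contra hle
    have := hs (not_lt.1 hle)
    simp only [Function.comp_apply, ha] at this
    exact hk (hκ (le_antisymm this (hj _)))
  have := Finset.card_le_card hsub
  rw [s.2 j, Fin.card_Iio] at this
  simp at this
  omega

/-- In a sorted word, equal letters are contiguous. -/
theorem pos_sorted_succ {κ : Fin d → ℕ} (hκ : Function.Injective κ) {s : Words n c}
    (hs : Monotone (κ ∘ s.1)) {j : Fin d} {k k' : Fin (c j)} (h : k'.val + 1 = k.val) :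
    (pos s j k').val + 1 = (pos s j k).val := by
  have h1 : pos s j k' < pos s j k := pos_strictMono s j (Fin.lt_def.2 (by omega))
  by_contra h2
  rw [Fin.lt_def] at h1
  let a : Fin n := ⟨(pos s j k').val + 1, by omega⟩
  have ha : s.1 a = j := by
    have e1 := hs (show pos s j k' ≤ a from Fin.le_def.2 (by simp [a]))
    have e2 := hs (show a ≤ pos s j k from Fin.le_def.2 (by simp [a]; omega))
    simp only [Function.comp_apply, letter_pos] at e1 e2
    exact hκ (le_antisymm e2 e1)
  obtain ⟨l, hl⟩ := exists_pos s ha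
  have l1 : k' < l := (pos_strictMono s j).lt_iff_lt.1 (by rw [hl, Fin.lt_def]; simp [a])
  have l2 : l < k := (pos_strictMono s j).lt_iff_lt.1 (by rw [hl, Fin.lt_def]; simp [a]; omega)
  rw [Fin.lt_def] at l1 l2
  omega

/-- An injective key for which the letter `j` is minimal. -/
def keyMin (j j' : Fin d) : ℕ := if j' = j then 0 else j'.val + 1

theorem keyMin_injective (j : Fin d) : Function.Injective (keyMin j) := fun a b h => by
  unfold keyMin at h
  split_ifs at h with h1 h2 h2
  · rw [h1, h2]
  · exact Fin.ext (by omega)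

theorem keyMin_self (j j' : Fin d) : keyMin j j ≤ keyMin j j' := by simp [keyMin]

/-- There is a word that begins with two given different letters. -/
theorem exists_word_two (t : Words n c) {j j' : Fin d} (hj : j ≠ j') (k : Fin (c j))
    (k' : Fin (c j')) : ∃ (s : Words n c) (o a : Fin n), o.val = 0 ∧ a.val = 1 ∧ s.1 o = j ∧
      s.1 a = j' := by
  have hne : pos t j k ≠ pos t j' k' := fun h => hj (by rw [← letter_pos t j k, h, letter_pos])
  have hn : 1 < n := by
    have h1 := (pos t j k).2
    have h2 := (pos t j' k').2
    by_contra hn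
    exact hne (Fin.ext (by omega))
  let o : Fin n := ⟨0, by omega⟩
  let a : Fin n := ⟨1, hn⟩
  have hoa : o ≠ a := by simp [o, a, Fin.ext_iff]
  -- After the first transposition has brought a letter $j$ to the front, the chosen letter $j'$
  -- sits at `b`, from where a second transposition takes it to position `a`.
  let b := Equiv.swap o (pos t j k) (pos t j' k')
  have hbo : b ≠ o := fun h => by
    have := congrArg (Equiv.swap o (pos t j k)) h
    simp only [b, Equiv.swap_apply_self, Equiv.swap_apply_left] at this
    exact hne this.symm
  refine ⟨permWord (Equiv.swap a b) (permWord (Equiv.swap o (pos t j k)) t), o, a, rfl, rfl, ?_, ?_⟩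
  · simp [permWord, Equiv.swap_apply_of_ne_of_ne hoa hbo.symm, letter_pos]
  · simp [permWord, b, letter_pos]

-- The symmetric group acts transitively on the words and the stabiliser of a word has order
-- $\prod_jc_j!$. Counting permutations by the word that they produce gives the multinomial
-- coefficient.
open Classical in
theorem card_words (t : Words n c) :
    Fintype.card (Words n c) = Nat.multinomial Finset.univ c := by
  have h1 : (∏ j, (c j).factorial) * Fintype.card (Words n c) = n.factorial := by
    have hst := DomMulAct.stabilizer_card t.1
    have hcard : ∀ j, Fintype.card {a // t.1 a = j} = c j := fun j => by
      rw [← t.2 j, Fintype.card_subtype]; rfl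
    simp only [hcard] at hst
    have e := Fintype.card_congr (Equiv.sigmaFiberEquiv fun w : Equiv.Perm (Fin n) => permWord w t)
    rw [Fintype.card_sigma, Fintype.card_perm, Fintype.card_fin] at e
    rw [← e, Finset.sum_congr rfl (g := fun _ => ∏ j, (c j).factorial) fun s _ => ?_,
      Finset.sum_const, Finset.card_univ, smul_eq_mul, mul_comm]
    rw [← hst]
    obtain ⟨w, rfl⟩ := exists_perm_eq t s
    refine Fintype.card_congr
      { toFun := fun g => ⟨g.1 * w⁻¹, ?_⟩
        invFun := fun g => ⟨g.1 * w, ?_⟩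
        left_inv := fun g => by simp
        right_inv := fun g => by simp }
    · have := congrArg Subtype.val g.2
      ext a
      have h2 := congrFun this (w⁻¹ a)
      simpa [permWord] using congrArg Fin.val h2
    · refine Subtype.ext (funext fun a => ?_)
      exact congrFun g.2 (w a)
  have h2 := Nat.multinomial_spec Finset.univ c
  rw [sum_card_eq t, ← h1] at h2
  exact (Nat.eq_of_mul_eq_mul_left (Finset.prod_pos fun j _ => Nat.factorial_pos _) h2).symm

end Words

/-! ### Orbits and decompositions -/

theorem exists_perm_of_card_eq {n : ℕ} {α : Type*} {f g : Fin n → α}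
    (h : ∀ x, {a | f a = x}.ncard = {a | g a = x}.ncard) :
    ∃ w : Equiv.Perm (Fin n), ∀ a, g a = f (w a) := by
  have e : ∀ x, Nonempty ({a // g a = x} ≃ {a // f a = x}) := fun x => by
    classical
    refine Fintype.card_eq.1 ?_
    have := h x
    rw [Set.ncard_eq_toFinset_card', Set.ncard_eq_toFinset_card', Set.toFinset_card,
      Set.toFinset_card] at this
    exact this.symm
  let e := fun x => (e x).some
  let w : Fin n ≃ Fin n := (Equiv.sigmaFiberEquiv g).symm.trans
    ((Equiv.sigmaCongrRight e).trans (Equiv.sigmaFiberEquiv f))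
  exact ⟨w, fun a => ((e (g a)) ⟨a, rfl⟩).2.symm⟩

namespace InvQuiver

namespace Decomposition

variable {I : Type u} {A : Type v} {Γ : InvQuiver I A} {d : ℕ} (D : Γ.Decomposition d) {n : ℕ}

theorem comp_eq_of_cls {x y : I} (h : Γ.cls x = Γ.cls y) : D.comp x = D.comp y := by
  rcases Γ.cls_eq_iff.1 h with h | h
  · rw [h]
  · rw [h, D.comp_inv]

theorem numArrows_of_ne {x y : I} (h : D.comp x ≠ D.comp y) : Γ.numArrows x y = 0 := by
  unfold numArrows
  convert Set.ncard_empty A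
  refine Set.eq_empty_of_forall_notMem fun a ha => h ?_
  rw [← ha.1, ← ha.2, D.comp_src]

theorem dot_of_ne {x y : I} (h : D.comp x ≠ D.comp y) : Γ.dot x y = 0 := by
  rw [dot, D.numArrows_of_ne h, D.numArrows_of_ne h.symm]

theorem deg₂_of_comp_ne {x y : I} (h : D.comp x ≠ D.comp y) : Γ.deg₂ x y = 0 := by
  rw [Γ.deg₂_of_ne fun h' => h (by rw [h']), D.dot_of_ne h]; rfl

theorem numArrows_part (j : Fin d) (x y : D.verts j) :
    (D.part j).numArrows x y = Γ.numArrows x.1 y.1 := by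
  refine Set.ncard_congr (fun a _ => a.1) ?_ ?_ ?_
  · rintro a ⟨rfl, rfl⟩
    exact ⟨rfl, rfl⟩
  · intro a b _ _ h
    exact Subtype.ext h
  · rintro a ⟨h1, h2⟩
    refine ⟨⟨a, by rw [h1]; exact x.2, by rw [h2]; exact y.2⟩, ⟨Subtype.ext h1, Subtype.ext h2⟩, rfl⟩

theorem dot_part (j : Fin d) (x y : D.verts j) : (D.part j).dot x y = Γ.dot x.1 y.1 := by
  simp only [dot, numArrows_part]

theorem deg₂_part (j : Fin d) (x y : D.verts j) : (D.part j).deg₂ x y = Γ.deg₂ x.1 y.1 := by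
  by_cases h : x = y
  · rw [h, deg₂_self, deg₂_self]
  · rw [deg₂_of_ne _ h, deg₂_of_ne _ fun h' => h (Subtype.ext h'), dot_part]

theorem inv_part (j : Fin d) (x : D.verts j) : ((D.part j).inv x : I) = Γ.inv x.1 := rfl

theorem deg₁_part {K : Type*} [Zero K] (lam : I → ℕ) (gam : I → K) (j : Fin d) (x : D.verts j) :
    (D.part j).deg₁ (fun i => lam i) (fun i => gam i) x = Γ.deg₁ lam gam x.1 := rfl

theorem admissible_part {K : Type*} [Zero K] {lam : I → ℕ} {gam : I → K}
    (h : Γ.Admissible lam gam) (j : Fin d) :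
    (D.part j).Admissible (fun i => lam i) (fun i => gam i) := fun x => by
  refine ⟨fun hx => (h x.1).1 fun h' => hx (Subtype.ext h'), fun hx => ?_⟩
  rcases (h x.1).2 hx with h' | h'
  · exact Or.inl fun h'' => h' (congrArg Subtype.val h'')
  · exact Or.inr h'

section Polynomials

variable {R : Type*} [Ring R]

theorem ringQ_part (j : Fin d) (x y : D.verts j) (u v : R) :
    (D.part j).ringQ x y u v = Γ.ringQ x.1 y.1 u v := by
  rcases eq_or_ne x y with rfl | h
  · simp [ringQ]
  · rw [ringQ, ringQ, if_neg h, if_neg fun h' => h (Subtype.ext h'), numArrows_part, dot_part]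

theorem divQ_part (j : Fin d) (x y : D.verts j) (u v w : R) :
    (D.part j).divQ x y u v w = Γ.divQ x.1 y.1 u v w := by
  rcases eq_or_ne x y with rfl | h
  · simp [divQ]
  · rw [divQ, divQ, if_neg h, if_neg fun h' => h (Subtype.ext h'), numArrows_part, dot_part]

theorem oddQ_part (j : Fin d) (x y : D.verts j) (u v : R) :
    (D.part j).oddQ x y u v = Γ.oddQ x.1 y.1 u v := by
  rcases eq_or_ne x y with rfl | h
  · simp [oddQ]
  · rw [oddQ, oddQ, if_neg h, if_neg fun h' => h (Subtype.ext h'), numArrows_part, dot_part]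

theorem oddQ'_part (j : Fin d) (x y : D.verts j) (u v : R) :
    (D.part j).oddQ' x y u v = Γ.oddQ' x.1 y.1 u v := by
  rcases eq_or_ne x y with rfl | h
  · simp [oddQ']
  · rw [oddQ', oddQ', if_neg h, if_neg fun h' => h (Subtype.ext h'), numArrows_part, dot_part]

/-- Across different parts $Q$ is an empty product, and for the same reason the divided differences
below are empty sums. This is where the absence of arrows between the parts enters the relations. -/
theorem ringQ_of_ne {x y : I} (h : D.comp x ≠ D.comp y) (u v : R) : Γ.ringQ x y u v = 1 := by
  rw [ringQ, if_neg fun h' => h (by rw [h']), D.dot_of_ne h, D.numArrows_of_ne h, pow_zero,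
    pow_zero, mul_one]

theorem divQ_of_ne {x y : I} (h : D.comp x ≠ D.comp y) (u v w : R) : Γ.divQ x y u v w = 0 := by
  rw [divQ, if_neg fun h' => h (by rw [h']), D.dot_of_ne h, homSum_zero, mul_zero]

theorem oddQ_of_ne {x y : I} (h : D.comp x ≠ D.comp y) (u v : R) : Γ.oddQ x y u v = 0 := by
  rw [oddQ, if_neg fun h' => h (by rw [h']), D.dot_of_ne h, homSum_zero, mul_zero]

theorem oddQ'_of_ne {x y : I} (h : D.comp x ≠ D.comp y) (u v : R) : Γ.oddQ' x y u v = 0 := by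
  rw [oddQ', if_neg fun h' => h (by rw [h']), D.dot_of_ne h, Nat.zero_div, homSum_zero, mul_zero]

end Polynomials

/-! #### Restriction and gluing of tuples -/

variable {c : Fin d → ℕ}

/-- The entries in `I^(j)` of a tuple with word `t`. -/
def restr (t : Words n c) (i : Fin n → I) (h : D.comp ∘ i = t.1) (j : Fin d) :
    Fin (c j) → D.verts j := fun k =>
  ⟨i (pos t j k), (congrFun h _).trans (letter_pos t j k)⟩

/-- The tuple with word `t` and given entries in each `I^(j)`. -/
def glue (t : Words n c) (f : ∀ j, Fin (c j) → D.verts j) : Fin n → I := fun a =>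
  f ((posEquiv t).symm a).1 ((posEquiv t).symm a).2

variable {D}

@[simp]
theorem glue_pos (t : Words n c) (f : ∀ j, Fin (c j) → D.verts j) (j : Fin d) (k : Fin (c j)) :
    D.glue t f (pos t j k) = f j k := by
  unfold glue
  rw [posEquiv_symm_pos]

theorem comp_glue (t : Words n c) (f : ∀ j, Fin (c j) → D.verts j) :
    D.comp ∘ D.glue t f = t.1 := by
  ext1 a
  obtain ⟨p, rfl⟩ := (posEquiv t).surjective a
  rw [Function.comp_apply, posEquiv_apply, glue_pos, letter_pos]
  exact (f p.1 p.2).2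

theorem restr_glue (t : Words n c) (f : ∀ j, Fin (c j) → D.verts j) :
    D.restr t (D.glue t f) (comp_glue t f) = f := by
  ext j k
  simp [restr]

theorem glue_restr (t : Words n c) (i : Fin n → I) (h : D.comp ∘ i = t.1) :
    D.glue t (D.restr t i h) = i := by
  ext1 a
  obtain ⟨p, rfl⟩ := (posEquiv t).surjective a
  rw [posEquiv_apply, glue_pos]
  rfl

variable (D) in
/-- The number of entries of `i` in `I^(j)` and in a given `θ`-orbit. -/
def count (j : Fin d) (q : Sym2 I) (i : Fin n → I) : ℕ :=
  {a | D.comp (i a) = j ∧ Γ.cls (i a) = q}.ncard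

theorem count_eq_of_same {i i' : Fin n → I} (h : Γ.SameBOrbit i i') (j : Fin d) (q : Sym2 I) :
    D.count j q i' = D.count j q i := by
  obtain ⟨w, hw⟩ := sameBOrbit_iff.1 h
  refine Set.ncard_congr (fun a _ => w a) ?_ ?_ ?_
  · rintro a ⟨h1, h2⟩
    refine ⟨?_, ?_⟩
    · rw [← D.comp_eq_of_cls (hw a), h1]
    · rw [← hw a, h2]
  · intro a b _ _ h
    exact w.injective h
  · rintro b ⟨h1, h2⟩
    refine ⟨w.symm b, ⟨?_, ?_⟩, by simp⟩
    · rw [D.comp_eq_of_cls (hw _), w.apply_symm_apply, h1]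
    · rw [hw, w.apply_symm_apply, h2]

/-- Summing over the parts gives the multiplicity of each $\theta$-class, and these multiplicities
determine the orbit. -/
theorem same_of_count_eq {i i' : Fin n → I} (h : ∀ j q, D.count j q i' = D.count j q i) :
    Γ.SameBOrbit i i' := by
  refine sameBOrbit_iff.2 (exists_perm_of_card_eq (f := fun k => Γ.cls (i k))
    (g := fun k => Γ.cls (i' k)) fun q => ?_)
  have key : ∀ i : Fin n → I, {a | Γ.cls (i a) = q}.ncard = ∑ j, D.count j q i := fun i => by
    classical
    unfold count
    simp only [Set.ncard_eq_toFinset_card', Set.toFinset_ofPred]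
    rw [← Finset.card_biUnion]
    · congr 1
      ext a
      simp
    · intro j _ j' _ hj
      rw [Function.onFun, Finset.disjoint_left]
      intro a ha ha'
      simp only [Finset.mem_filter, Finset.mem_univ, true_and] at ha ha'
      exact hj (ha.1.symm.trans ha'.1)
  rw [key, key]
  exact Finset.sum_congr rfl fun j _ => (h j q).symm

theorem count_eq (t : Words n c) (i : Fin n → I) (h : D.comp ∘ i = t.1) (j : Fin d) (q : Sym2 I) :
    D.count j q i = {k | Γ.cls (D.restr t i h j k) = q}.ncard := by
  symm
  refine Set.ncard_congr (fun k _ => pos t j k) ?_ ?_ ?_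
  · intro k hk
    exact ⟨(congrFun h _).trans (letter_pos t j k), hk⟩
  · intro a b _ _ h
    exact (pos_strictMono t j).injective h
  · rintro a ⟨h1, h2⟩
    obtain ⟨k, rfl⟩ := exists_pos t ((congrFun h a).symm.trans h1)
    exact ⟨k, h2, rfl⟩

theorem sameBOrbit_part_iff {m : ℕ} {j : Fin d} {f f' : Fin m → D.verts j} :
    (D.part j).SameBOrbit f f' ↔
      ∀ q, {k | Γ.cls (f' k) = q}.ncard = {k | Γ.cls (f k) = q}.ncard := by
  have key : (D.part j).SameBOrbit f f' ↔
      ∃ w : Equiv.Perm (Fin m), ∀ k, Γ.cls (f' k) = Γ.cls (f (w k)) := by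
    rw [sameBOrbit_iff]
    simp only [cls_eq_iff, Subtype.ext_iff, inv_part]
  rw [key]
  constructor
  · rintro ⟨w, hw⟩ q
    refine Set.ncard_congr (fun a _ => w a) (fun a ha => (hw a).symm.trans ha)
      (fun a b _ _ h => w.injective h) fun b hb => ⟨w.symm b, ?_, by simp⟩
    change _ = _
    rw [hw, w.apply_symm_apply]; exact hb
  · intro h
    exact exists_perm_of_card_eq (f := fun k => Γ.cls (f k)) (g := fun k => Γ.cls (f' k))
      fun q => (h q).symm

/-- A $\theta$-class lies in a single part, so the multiset of classes of a glued tuple splits into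
the multisets of its components. The words play no role. -/
theorem same_glue_iff {t t' : Words n c} {f f' : ∀ j, Fin (c j) → D.verts j} :
    Γ.SameBOrbit (D.glue t f) (D.glue t' f') ↔ ∀ j, (D.part j).SameBOrbit (f j) (f' j) := by
  simp only [sameBOrbit_part_iff]
  have key : ∀ (t : Words n c) (f : ∀ j, Fin (c j) → D.verts j) (j q),
      D.count j q (D.glue t f) = {k | Γ.cls (f j k) = q}.ncard := fun t f j q => by
    rw [count_eq t _ (comp_glue t f), restr_glue]
  constructor
  · intro h j q
    rw [← key t' f', ← key t f, count_eq_of_same h]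
  · intro h
    exact same_of_count_eq fun j q => by rw [key, key, h]

variable {β : Set (Fin n → I)}

theorem size_eq (hβ : Γ.IsBOrbit β) {i : Fin n → I} (hi : i ∈ β) (j : Fin d) :
    D.size β j = (fiber (D.comp ∘ i) j).card := by
  have hc : ∀ i : Fin n → I, {k | D.comp (i k) = j}.ncard = (fiber (D.comp ∘ i) j).card :=
    fun i => by
      classical
      rw [Set.ncard_eq_toFinset_card', Set.toFinset_ofPred]; rfl
  have : {m | ∃ i ∈ β, m = {k | D.comp (i k) = j}.ncard} = {(fiber (D.comp ∘ i) j).card} := by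
    ext m
    simp only [hc, Set.mem_ofPred_eq, Set.mem_singleton_iff]
    constructor
    · rintro ⟨i', hi', rfl⟩
      obtain ⟨w, hw⟩ := sameBOrbit_iff.1 ((hβ.mem_iff hi).1 hi')
      rw [show D.comp ∘ i' = (D.comp ∘ i) ∘ w from funext fun k => D.comp_eq_of_cls (hw k),
        card_fiber_comp]
    · rintro rfl
      exact ⟨i, hi, rfl⟩
  rw [size, this, csInf_singleton]

variable (D) in
/-- The word of a tuple of an orbit. -/
def word (hβ : Γ.IsBOrbit β) {i : Fin n → I} (hi : i ∈ β) : Words n (D.size β) :=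
  ⟨D.comp ∘ i, fun j => (size_eq hβ hi j).symm⟩

theorem comp_eq_word (hβ : Γ.IsBOrbit β) {i : Fin n → I} (hi : i ∈ β) :
    D.comp ∘ i = (D.word hβ hi).1 := rfl

theorem mem_sub_iff {j : Fin d} {f : Fin (D.size β j) → D.verts j} (hβ : Γ.IsBOrbit β) :
    f ∈ D.sub β j ↔ ∃ i ∈ β, ∃ (t : Words n (D.size β)) (h : D.comp ∘ i = t.1),
      D.restr t i h j = f := by
  constructor
  · rintro ⟨i, hi, g, hg, hr, hf⟩
    refine ⟨i, hi, D.word hβ hi, rfl, ?_⟩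
    ext k
    rw [hf, pos_unique (D.word hβ hi) (fun k => ?_) hg k]
    · rfl
    · have : g k ∈ Set.range g := ⟨k, rfl⟩
      rw [hr] at this
      exact this
  · rintro ⟨i, hi, t, h, rfl⟩
    refine ⟨i, hi, pos t j, pos_strictMono t j, ?_, fun k => rfl⟩
    rw [range_pos, ← h]; rfl

/-- This describes $\beta$ as the product of the set of words with the $\beta^{(j)}$; it is the
reason why the idempotents on the two sides of the isomorphism match. -/
theorem glue_mem_iff (hβ : Γ.IsBOrbit β) (t : Words n (D.size β))
    (f : ∀ j, Fin (D.size β j) → D.verts j) : D.glue t f ∈ β ↔ ∀ j, f j ∈ D.sub β j := by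
  constructor
  · intro h j
    exact (mem_sub_iff hβ).2 ⟨_, h, t, comp_glue t f, by rw [restr_glue]⟩
  · intro h
    obtain ⟨i₀, hi₀⟩ := hβ.nonempty
    rw [hβ.mem_iff hi₀, ← glue_restr (D.word hβ hi₀) i₀ (comp_eq_word hβ hi₀), same_glue_iff]
    intro j
    -- The witnesses for different $j$ may be different tuples of $\beta$. This does no harm, since
    -- each is compared with the fixed tuple `i₀` in the component $j$ alone.
    obtain ⟨i, hi, t', h', e⟩ := (mem_sub_iff hβ).1 (h j)
    rw [← e]
    have := (hβ.mem_iff hi₀).1 hi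
    rw [← glue_restr (D.word hβ hi₀) i₀ (comp_eq_word hβ hi₀), ← glue_restr t' i h', same_glue_iff] at this
    exact this j

theorem restr_mem_iff (hβ : Γ.IsBOrbit β) {t : Words n (D.size β)} {i : Fin n → I}
    {h : D.comp ∘ i = t.1} : (∀ j, D.restr t i h j ∈ D.sub β j) ↔ i ∈ β := by
  rw [← glue_mem_iff hβ t, glue_restr]

/-- Fix one tuple of $\beta$ and change only its entries in $I^{(j)}$: by `same_glue_iff` the new
tuple stays in $\beta$ exactly when the component stays in its orbit. -/
theorem isBOrbit_sub (hβ : Γ.IsBOrbit β) (j : Fin d) : (D.part j).IsBOrbit (D.sub β j) := by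
  classical
  obtain ⟨i₀, hi₀⟩ := hβ.nonempty
  refine ⟨D.restr (D.word hβ hi₀) i₀ (comp_eq_word hβ hi₀) j, ?_⟩
  have h0 : D.glue (D.word hβ hi₀) (D.restr (D.word hβ hi₀) i₀ (comp_eq_word hβ hi₀)) ∈ β := by rwa [glue_restr (D.word hβ hi₀)]
  ext f
  constructor
  · intro hf
    have hm : D.glue (D.word hβ hi₀) (Function.update (D.restr (D.word hβ hi₀) i₀ (comp_eq_word hβ hi₀)) j f) ∈ β := by
      rw [glue_mem_iff hβ]
      intro l
      by_cases hl : l = j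
      · subst hl; rwa [Function.update_self]
      · rw [Function.update_of_ne hl]; exact (glue_mem_iff hβ _ _).1 h0 l
    have := same_glue_iff.1 ((hβ.mem_iff h0).1 hm) j
    rwa [Function.update_self] at this
  · intro hf
    have : D.glue (D.word hβ hi₀) (Function.update (D.restr (D.word hβ hi₀) i₀ (comp_eq_word hβ hi₀)) j f) ∈ β := by
      rw [hβ.mem_iff h0, same_glue_iff]
      intro l
      by_cases hl : l = j
      · subst hl; rwa [Function.update_self]
      · rw [Function.update_of_ne hl]; exact SameBOrbit.refl _
    have := (glue_mem_iff hβ _ _).1 this j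
    rwa [Function.update_self] at this

theorem sum_size (hβ : Γ.IsBOrbit β) : ∑ j, D.size β j = n := by
  obtain ⟨i, hi⟩ := hβ.nonempty
  exact sum_card_eq (D.word hβ hi)

variable (D n) in
/-- The index set of the families of orbits in the parts. -/
abbrev PartOrbits : Type u :=
  Σ c : Compositions d n, ∀ j, (D.part j).BOrbit (c.1 j)

variable (D) in
/-- The family of the orbits `β^(j)`. -/
def partOrbits (β : Γ.BOrbit n) : D.PartOrbits n :=
  ⟨⟨D.size β.1, sum_size β.2⟩, fun j => ⟨D.sub β.1 j, isBOrbit_sub β.2 j⟩⟩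

theorem partOrbits_injective : Function.Injective (D.partOrbits (n := n)) := by
  -- A left inverse: it collects the tuples whose restrictions lie in the given orbits.
  let G : D.PartOrbits n → Set (Fin n → I) := fun p =>
    {i | ∃ (t : Words n p.1.1) (h : D.comp ∘ i = t.1), ∀ j, D.restr t i h j ∈ (p.2 j).1}
  have hG : ∀ β : Γ.BOrbit n, G (D.partOrbits β) = β.1 := fun β => by
    ext i
    constructor
    · rintro ⟨t, h, hm⟩
      exact (restr_mem_iff (D := D) β.2).1 hm
    · intro hi
      exact ⟨D.word β.2 hi, rfl, (restr_mem_iff (D := D) β.2).2 hi⟩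
  intro β β' h
  exact Subtype.ext (by rw [← hG β, ← hG β', h])

theorem partOrbits_eq (hβ : Γ.IsBOrbit β) {c : Fin d → ℕ} (hs : D.size β = c) {hc : ∑ j, c j = n}
    (t : Words n c) {f : ∀ j, Fin (c j) → D.verts j} (hm : D.glue t f ∈ β)
    {b : ∀ j, (D.part j).BOrbit (c j)} (hf : ∀ j, f j ∈ (b j).1) :
    D.partOrbits ⟨β, hβ⟩ = ⟨⟨c, hc⟩, b⟩ := by
  subst hs
  refine Sigma.ext rfl (heq_of_eq (funext fun j => Subtype.ext ?_))
  change D.sub β j = (b j).1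
  have h1 := (glue_mem_iff hβ t f).1 hm j
  ext x
  rw [(isBOrbit_sub hβ j).mem_iff h1, (b j).2.mem_iff (hf j)]

theorem partOrbits_surjective : Function.Surjective (D.partOrbits (n := n)) := by
  rintro ⟨⟨c, hc⟩, b⟩
  choose f hf using fun j => (b j).2.nonempty
  obtain ⟨e⟩ : Nonempty (Fin n ≃ Σ j, Fin (c j)) :=
    Fintype.card_eq.1 (by simpa using hc.symm)
  -- Any identification of the positions with the disjoint union of the index sets yields a word
  -- with the required letters; the orbit of the glued tuple does not depend on the choice.
  let t : Words n c := ⟨fun a => (e a).1, fun j => by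
    have : (fiber (fun a => (e a).1) j).card = (Finset.univ : Finset (Fin (c j))).card := by
      symm
      refine Finset.card_bij (fun k _ => e.symm ⟨j, k⟩) (fun k _ => mem_fiber.2 (by simp)) ?_ ?_
      · intro k _ k' _ h
        simpa using h
      · intro a ha
        rw [mem_fiber] at ha
        subst ha
        exact ⟨(e a).2, Finset.mem_univ _, by simp⟩
    simpa using this⟩
  let β : Set (Fin n → I) := {i | Γ.SameBOrbit (D.glue t f) i}
  have hβ : Γ.IsBOrbit β := ⟨_, rfl⟩
  have hm : D.glue t f ∈ β := SameBOrbit.refl _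
  have hs : D.size β = c := funext fun j => by
    rw [size_eq hβ hm, comp_glue, t.2]
  exact ⟨⟨β, hβ⟩, partOrbits_eq hβ hs t hm hf⟩

end Decomposition

end InvQuiver

/-! ### The homomorphism to the matrix algebra -/

section WordMoves

variable {n d : ℕ} {c : Fin d → ℕ}

/-- If the preceding letter is also $j$, it is the preceding occurrence of $j$. The first position
precedes itself by convention, so the hypothesis holds there too; this lets $\psi_0$ and the other
$\psi_b$ be treated together. -/
theorem prev_pos {t : Words n c} {j : Fin d} {k : Fin (c j)}
    (h : t.1 (prev (pos t j k)) = t.1 (pos t j k)) :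
    prev (pos t j k) = pos t j (prev k) ∧ ((pos t j k).val = 0 ↔ k.val = 0) := by
  by_cases h0 : (pos t j k).val = 0
  · have hk : k.val = 0 := by
      by_contra hk
      have : pos t j (prev k) < pos t j k :=
        pos_strictMono t j (Fin.lt_def.2 (by have := prev_add_one hk; omega))
      rw [Fin.lt_def] at this
      omega
    rw [prev_first h0, prev_first hk]
    exact ⟨rfl, by simp [h0, hk]⟩
  · obtain ⟨k', hk'⟩ := exists_pos t (h.trans (letter_pos t j k))
    have h1 := prev_add_one h0
    rw [← hk'] at h1
    have h2 := succ_of_pos_succ t h1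
    rw [prev_eq h2, hk']
    exact ⟨rfl, by omega⟩

theorem pos_swap {t : Words n c} {j : Fin d} (k k' l : Fin (c j)) :
    Equiv.swap (pos t j k) (pos t j k') (pos t j l) = pos t j (Equiv.swap k k' l) := by
  rw [← Function.Injective.swap_apply (pos_strictMono t j).injective]

theorem step_braid {a b e : Fin n} (hab : a.val + 1 = b.val) (hbe : b.val + 1 = e.val)
    (t : Words n c) : step e (step b (step e t)) = step b (step e (step b t)) := by
  have h1 : a ≠ b := fun h => by rw [h] at hab; omega
  have h2 : b ≠ e := fun h => by rw [h] at hbe; omega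
  have h3 : a ≠ e := fun h => by rw [h] at hab; omega
  refine Subtype.ext (funext fun x => ?_)
  simp only [step_apply, swp_of_succ hab, swp_of_succ hbe]
  by_cases xa : x = a
  · subst xa
    simp [Equiv.swap_apply_of_ne_of_ne, h1, h3, h2.symm, h3.symm]
  by_cases xb : x = b
  · subst xb
    simp [Equiv.swap_apply_of_ne_of_ne, h1, h3, h2.symm, h3.symm]
  by_cases xe : x = e
  · subst xe
    simp [Equiv.swap_apply_of_ne_of_ne, h1, h3, h2.symm, h3.symm]
  simp [Equiv.swap_apply_of_ne_of_ne, xa, xb, xe]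

theorem far_ne {a b : Fin n} (hab : a.val + 1 < b.val) :
    a ≠ prev b ∧ a ≠ b ∧ prev a ≠ prev b ∧ prev a ≠ b ∧ b ≠ prev a ∧ b ≠ a ∧
      prev b ≠ prev a ∧ prev b ≠ a := by
  simp only [ne_eq, Fin.ext_iff, prev]
  omega

theorem step_comm {a b : Fin n} (hab : a.val + 1 < b.val) (t : Words n c) :
    step a (step b t) = step b (step a t) := by
  obtain ⟨h1, h2, h3, h4, h5, h6, h7, h8⟩ := far_ne hab
  refine Subtype.ext (funext fun x => ?_)
  simp only [step_apply]
  by_cases xa : x = a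
  · subst xa
    simp [swp, Equiv.swap_apply_of_ne_of_ne, *]
  by_cases xb : x = b
  · subst xb
    simp [swp, Equiv.swap_apply_of_ne_of_ne, *]
  by_cases xa : x = prev a
  · subst xa
    simp [swp, Equiv.swap_apply_of_ne_of_ne, *]
  by_cases xb : x = prev b
  · subst xb
    simp [swp, Equiv.swap_apply_of_ne_of_ne, *]
  simp [swp, Equiv.swap_apply_of_ne_of_ne, *]

end WordMoves

namespace InvQuiver.Decomposition

variable {I : Type u} {A : Type v} {Γ : InvQuiver I A} {d : ℕ} {D : Γ.Decomposition d} {n : ℕ}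
  {c : Fin d → ℕ}

theorem glue_injective {t t' : Words n c} {f f' : ∀ j, Fin (c j) → D.verts j}
    (h : D.glue t f = D.glue t' f') : t = t' ∧ f = f' := by
  have h1 : t = t' := Subtype.ext (by rw [← comp_glue (D := D) t f, h, comp_glue])
  subst h1
  refine ⟨rfl, ?_⟩
  ext j k
  rw [← glue_pos t f, h, glue_pos]

theorem move_glue_ne {b : Fin n} {t : Words n c} (h : t.1 (prev b) ≠ t.1 b)
    (f : ∀ j, Fin (c j) → D.verts j) : move Γ b (D.glue t f) = D.glue (step b t) f := by
  have hb : b.val ≠ 0 := fun hb => h (by rw [prev_first hb])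
  ext1 a
  rw [move, if_neg hb, ← swp, Function.comp_apply, glue, glue, posEquiv_step_symm h]

/-- When the letters agree, the generator of $B_n$ acts inside one component, as the generator of
$B_{n_j}$ with the number of that occurrence. In the first position this uses that $\theta$
preserves the parts. -/
theorem move_glue_eq {t : Words n c} {j : Fin d} {k : Fin (c j)}
    (h : t.1 (prev (pos t j k)) = t.1 (pos t j k)) (f : ∀ j, Fin (c j) → D.verts j) :
    move Γ (pos t j k) (D.glue t f) =
      D.glue t (Function.update f j (move (D.part j) k (f j))) := by
  obtain ⟨h1, h2⟩ := prev_pos h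
  ext1 a
  obtain ⟨⟨l, m⟩, rfl⟩ := (posEquiv t).surjective a
  rw [posEquiv_apply, glue_pos]
  by_cases hl : l = j
  · subst hl
    rw [Function.update_self]
    by_cases hk : k.val = 0
    · rw [move_first hk, move_first (h2.2 hk), glue_pos]
      by_cases hm : m = k
      · subst hm
        rw [Function.update_self, Function.update_self]; rfl
      · rw [Function.update_of_ne hm, Function.update_of_ne
          ((pos_strictMono t l).injective.ne hm), glue_pos]
    · rw [move, move, if_neg hk, if_neg (h2.not.2 hk), h1, Function.comp_apply,
        Function.comp_apply, pos_swap, glue_pos]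
  · rw [Function.update_of_ne hl]
    have hne : ∀ k', pos t l m ≠ pos t j k' := fun k' h' => hl (by
      rw [← letter_pos t l m, h', letter_pos])
    unfold move
    split_ifs
    · rw [Function.update_of_ne (hne k), glue_pos]
    · rw [h1, Function.comp_apply, Equiv.swap_apply_of_ne_of_ne (hne _) (hne _), glue_pos]

/-- The case distinction behind all relations for matrices: either the tuple is glued, or its letter
counts are wrong and its idempotent matrix is zero. -/
theorem isWord_or (c : Fin d → ℕ) (i : Fin n → I) :
    (∃ (t : Words n c) (f : ∀ j, Fin (c j) → D.verts j), i = D.glue t f) ∨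
      ∀ t : Words n c, D.comp ∘ i ≠ t.1 := by
  by_cases h : ∃ t : Words n c, D.comp ∘ i = t.1
  · obtain ⟨t, ht⟩ := h
    exact Or.inl ⟨t, _, (glue_restr t i ht).symm⟩
  · push Not at h
    exact Or.inr h

theorem not_word_move {b : Fin n} {i : Fin n → I} (h : ∀ t : Words n c, D.comp ∘ i ≠ t.1)
    (t : Words n c) : D.comp ∘ move Γ b i ≠ t.1 := by
  intro ht
  by_cases hb : b.val = 0
  · refine h t ?_
    rw [← ht, move_first hb]
    ext1 a
    by_cases ha : a = b
    · subst ha; simp [D.comp_inv]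
    · simp [Function.update_of_ne ha]
  · refine h (step b t) ?_
    ext1 a
    rw [step_apply, ← ht, move, if_neg hb, ← swp]
    simp [swp]

end InvQuiver.Decomposition

open InvQuiver InvQuiver.Decomposition

/-! ### The tensor product of the algebras $V_{\beta^{(j)}}$ -/

section Tensor

variable (K : Type w) [CommRing K] {I : Type u} {A : Type v} {Γ : InvQuiver I A}
  {d : ℕ} (D : Γ.Decomposition d) (lam : I → ℕ) (gam : I → K) {n : ℕ} (β : Set (Fin n → I))

/-- `⊗_j V_{β^(j)}`. -/
abbrev TensV : Type (max u w) := ⨂[K] j, VPart K D lam gam β j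

/-- The embedding of a tensor factor. -/
def factor (j : Fin d) : VPart K D lam gam β j →ₐ[K] TensV K D lam gam β :=
  PiTensorProduct.singleAlgHom j

/-- The idempotent `⊗_j e(f_j)`. -/
def idemT (f : ∀ j, Fin (D.size β j) → D.verts j) : TensV K D lam gam β :=
  PiTensorProduct.tprod K fun j =>
    V.idem K (D.part j) (fun i => lam i) (fun i => gam i) (D.sub β j) (f j)

/-- `y_k` in the `j`-th tensor factor. -/
def yT (p : Σ j, Fin (D.size β j)) : TensV K D lam gam β :=
  factor K D lam gam β p.1 (V.y K (D.part p.1) (fun i => lam i) (fun i => gam i) (D.sub β p.1) p.2)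

/-- `ψ_k` in the `j`-th tensor factor. -/
def psiT (p : Σ j, Fin (D.size β j)) : TensV K D lam gam β :=
  factor K D lam gam β p.1
    (V.psi K (D.part p.1) (fun i => lam i) (fun i => gam i) (D.sub β p.1) p.2)

variable {K D lam gam β}

theorem factor_comm {j j' : Fin d} (h : j ≠ j') (x : VPart K D lam gam β j)
    (x' : VPart K D lam gam β j') :
    factor K D lam gam β j x * factor K D lam gam β j' x' =
      factor K D lam gam β j' x' * factor K D lam gam β j x := by
  change PiTensorProduct.tprod K _ * PiTensorProduct.tprod K _ =
    PiTensorProduct.tprod K _ * PiTensorProduct.tprod K _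
  rw [PiTensorProduct.tprod_mul_tprod, PiTensorProduct.tprod_mul_tprod]
  exact congrArg _ (Pi.mulSingle_commute h x x')

theorem idemT_mul_idemT (f g : ∀ j, Fin (D.size β j) → D.verts j) :
    idemT K D lam gam β f * idemT K D lam gam β g = PiTensorProduct.tprod K fun j =>
      V.idem K (D.part j) (fun i => lam i) (fun i => gam i) (D.sub β j) (f j) *
      V.idem K (D.part j) (fun i => lam i) (fun i => gam i) (D.sub β j) (g j) := by
  rw [idemT, idemT, PiTensorProduct.tprod_mul_tprod]; rfl

theorem idemT_of_notMem {f : ∀ j, Fin (D.size β j) → D.verts j} {j : Fin d}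
    (h : f j ∉ D.sub β j) : idemT K D lam gam β f = 0 :=
  MultilinearMap.map_coord_zero _ j (V.idem_of_notMem _ _ _ _ h)

theorem factor_mul_tprod (j : Fin d) (x : VPart K D lam gam β j)
    (z : ∀ j, VPart K D lam gam β j) :
    factor K D lam gam β j x * PiTensorProduct.tprod K z =
      PiTensorProduct.tprod K (Function.update z j (x * z j)) := by
  change PiTensorProduct.tprod K _ * PiTensorProduct.tprod K _ = _
  rw [PiTensorProduct.tprod_mul_tprod]
  congr 1
  ext1 l
  by_cases hl : l = j
  · subst hl; simp
  · simp [hl]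

theorem tprod_mul_factor (j : Fin d) (x : VPart K D lam gam β j)
    (z : ∀ j, VPart K D lam gam β j) :
    PiTensorProduct.tprod K z * factor K D lam gam β j x =
      PiTensorProduct.tprod K (Function.update z j (z j * x)) := by
  change PiTensorProduct.tprod K _ * PiTensorProduct.tprod K _ = _
  rw [PiTensorProduct.tprod_mul_tprod]
  congr 1
  ext1 l
  by_cases hl : l = j
  · subst hl; simp
  · simp [hl]

theorem factor_mul_idemT {j : Fin d} {x : VPart K D lam gam β j}
    {f : ∀ j, Fin (D.size β j) → D.verts j} {g : Fin (D.size β j) → D.verts j}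
    (h : x * V.idem K (D.part j) (fun i => lam i) (fun i => gam i) (D.sub β j) (f j) =
      V.idem K (D.part j) (fun i => lam i) (fun i => gam i) (D.sub β j) g * x) :
    factor K D lam gam β j x * idemT K D lam gam β f =
      idemT K D lam gam β (Function.update f j g) * factor K D lam gam β j x := by
  rw [idemT, idemT, factor_mul_tprod, tprod_mul_factor]
  congr 1
  ext1 l
  by_cases hl : l = j
  · subst hl; simp [h]
  · simp [hl]

variable (hβ : Γ.IsBOrbit β) (hadm : Γ.Admissible lam gam)

include hβ hadm

theorem isRep_part (j : Fin d) :
    IsRep K (D.part j) (fun i => lam i) (fun i => gam i) (D.sub β j)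
      (V.idem K (D.part j) (fun i => lam i) (fun i => gam i) (D.sub β j)) (V.y K _ _ _ _)
      (V.psi K _ _ _ _) (1 : VPart K D lam gam β j) :=
  V.isRep (isBOrbit_sub hβ j) (D.admissible_part hadm j)

theorem isRep_factor (j : Fin d) :
    IsRep K (D.part j) (fun i => lam i) (fun i => gam i) (D.sub β j)
      (fun f => factor K D lam gam β j (V.idem K _ _ _ _ f)) (fun k => yT K D lam gam β ⟨j, k⟩)
      (fun k => psiT K D lam gam β ⟨j, k⟩) (1 : TensV K D lam gam β) := by
  have := (isRep_part (K := K) (D := D) hβ hadm j).map (isBOrbit_sub hβ j).finite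
    (factor K D lam gam β j)
  rw [map_one] at this
  exact this

theorem idemT_mul_self (f : ∀ j, Fin (D.size β j) → D.verts j) :
    idemT K D lam gam β f * idemT K D lam gam β f = idemT K D lam gam β f := by
  rw [idemT_mul_idemT]
  simp only [(isRep_part (K := K) (D := D) hβ hadm _).E_mul_self]
  rfl

theorem idemT_mul_ne {f g : ∀ j, Fin (D.size β j) → D.verts j} (h : f ≠ g) :
    idemT K D lam gam β f * idemT K D lam gam β g = 0 := by
  rw [idemT_mul_idemT]
  obtain ⟨j, hj⟩ := Function.ne_iff.1 h
  exact MultilinearMap.map_coord_zero _ j ((isRep_part (K := K) (D := D) hβ hadm j).E_mul_ne _ _ hj)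

theorem factor_idem_mul (f : ∀ j, Fin (D.size β j) → D.verts j) (j : Fin d) :
    factor K D lam gam β j (V.idem K _ _ _ _ (f j)) * idemT K D lam gam β f =
      idemT K D lam gam β f := by
  rw [idemT, factor_mul_tprod]
  congr 1
  ext1 l
  by_cases hl : l = j
  · subst hl; simp [(isRep_part (K := K) (D := D) hβ hadm l).E_mul_self]
  · simp [hl]

theorem sum_idemT :
    ∑ f ∈ Fintype.piFinset fun j => (isBOrbit_sub (D := D) hβ j).finite.toFinset,
      idemT K D lam gam β f = 1 := by
  unfold idemT
  rw [← MultilinearMap.map_sum_finset]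
  simp only [(isRep_part (K := K) (D := D) hβ hadm _).sum_toFinset]
  rfl

/-- The idempotent $\bigotimes_je(f_j)$ absorbs the image of $e(f_j)$. So a relation of one tensor
factor on $e(f_j)$ becomes a relation on the full tensor idempotent. -/
theorem mul_idemT_congr {f : ∀ j, Fin (D.size β j) → D.verts j} {j : Fin d}
    {x x' : TensV K D lam gam β}
    (h : x * factor K D lam gam β j (V.idem K _ _ _ _ (f j)) =
      x' * factor K D lam gam β j (V.idem K _ _ _ _ (f j))) :
    x * idemT K D lam gam β f = x' * idemT K D lam gam β f := by
  rw [← factor_idem_mul hβ hadm f j, ← mul_assoc, h, mul_assoc]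

end Tensor

/-! ### Explicit quotients of diagonal matrices -/

section Diagonal

variable {I : Type u} {A : Type v} {Γ : InvQuiver I A} {R W : Type*} [Ring R] [Fintype W]
  [DecidableEq W]

/-- Both the diagonal embedding and the evaluation at an index are ring homomorphisms on $W\to R$,
and these commute with the polynomial expressions. -/
theorem ringQ_diagonal (i j : I) (p q : W → R) :
    Γ.ringQ i j (Matrix.diagonal p) (Matrix.diagonal q) =
      Matrix.diagonal fun t => Γ.ringQ i j (p t) (q t) := by
  have h : (fun t => Γ.ringQ i j (p t) (q t)) = Γ.ringQ i j p q :=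
    funext fun t => (Γ.map_ringQ (Pi.evalRingHom (fun _ => R) t) i j p q).symm
  rw [h]
  exact (Γ.map_ringQ (Matrix.diagonalRingHom W R) i j p q).symm

theorem divQ_diagonal (i j : I) (p q r : W → R) :
    Γ.divQ i j (Matrix.diagonal p) (Matrix.diagonal q) (Matrix.diagonal r) =
      Matrix.diagonal fun t => Γ.divQ i j (p t) (q t) (r t) := by
  have h : (fun t => Γ.divQ i j (p t) (q t) (r t)) = Γ.divQ i j p q r :=
    funext fun t => (Γ.map_divQ (Pi.evalRingHom (fun _ => R) t) i j p q r).symm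
  rw [h]
  exact (Γ.map_divQ (Matrix.diagonalRingHom W R) i j p q r).symm

theorem oddQ_diagonal (i j : I) (p q : W → R) :
    Γ.oddQ i j (Matrix.diagonal p) (Matrix.diagonal q) =
      Matrix.diagonal fun t => Γ.oddQ i j (p t) (q t) := by
  have h : (fun t => Γ.oddQ i j (p t) (q t)) = Γ.oddQ i j p q :=
    funext fun t => (Γ.map_oddQ (Pi.evalRingHom (fun _ => R) t) i j p q).symm
  rw [h]
  exact (Γ.map_oddQ (Matrix.diagonalRingHom W R) i j p q).symm

theorem oddQ'_diagonal (i j : I) (p q : W → R) :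
    Γ.oddQ' i j (Matrix.diagonal p) (Matrix.diagonal q) =
      Matrix.diagonal fun t => Γ.oddQ' i j (p t) (q t) := by
  have h : (fun t => Γ.oddQ' i j (p t) (q t)) = Γ.oddQ' i j p q :=
    funext fun t => (Γ.map_oddQ' (Pi.evalRingHom (fun _ => R) t) i j p q).symm
  rw [h]
  exact (Γ.map_oddQ' (Matrix.diagonalRingHom W R) i j p q).symm

theorem homSum_diagonal (m : ℕ) (p q : W → R) :
    homSum m (Matrix.diagonal p) (Matrix.diagonal q) =
      Matrix.diagonal fun t => homSum m (p t) (q t) := by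
  have h : (fun t => homSum m (p t) (q t)) = homSum m p q :=
    funext fun t => (map_homSum (Pi.evalRingHom (fun _ => R) t) m p q).symm
  rw [h]
  exact (map_homSum (Matrix.diagonalRingHom W R) m p q).symm

theorem neg_one_pow_mul_diagonal (m : ℕ) (p : W → R) :
    (-1) ^ m * Matrix.diagonal p = Matrix.diagonal fun t => (-1) ^ m * p t := by
  obtain h | h := Nat.even_or_odd m <;> simp [h.neg_one_pow]

end Diagonal

/-! ### The matrices that represent the generators -/

section MatrixRep

variable (K : Type w) [CommRing K] {I : Type u} {A : Type v} {Γ : InvQuiver I A}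
  {d : ℕ} (D : Γ.Decomposition d) (lam : I → ℕ) (gam : I → K) {n : ℕ} (β : Set (Fin n → I))

/-- The matrix algebra over `⊗_j V_{β^(j)}` whose rows and columns are indexed by words. -/
abbrev WordMat : Type (max u w) :=
  Matrix (Words n (D.size β)) (Words n (D.size β)) (TensV K D lam gam β)

open Classical in
/-- The image of `e(i)`. -/
def matE (i : Fin n → I) : WordMat K D lam gam β :=
  Matrix.diagonal fun t => if h : D.comp ∘ i = t.1 then idemT K D lam gam β (D.restr t i h) else 0

/-- The image of `y_a`. -/
def matY (a : Fin n) : WordMat K D lam gam β :=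
  Matrix.diagonal fun t => yT K D lam gam β ((posEquiv t).symm a)

/-- The entry of the image of `ψ_b` in the column `t`. -/
def psiEntry (b : Fin n) (t : Words n (D.size β)) : TensV K D lam gam β :=
  if t.1 (prev b) = t.1 b then psiT K D lam gam β ((posEquiv t).symm b) else 1

/-- The image of `ψ_b`. -/
def matP (b : Fin n) : WordMat K D lam gam β :=
  ∑ t, Matrix.single (step b t) t (psiEntry K D lam gam β b t)

variable {K D lam gam β}

theorem psiEntry_pos {t : Words n (D.size β)} {j : Fin d} {k : Fin (D.size β j)}
    (h : t.1 (prev (pos t j k)) = t.1 (pos t j k)) :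
    psiEntry K D lam gam β (pos t j k) t = psiT K D lam gam β ⟨j, k⟩ := by
  rw [psiEntry, if_pos h, posEquiv_symm_pos]

theorem psiEntry_of_ne {b : Fin n} {t : Words n (D.size β)} (h : t.1 (prev b) ≠ t.1 b) :
    psiEntry K D lam gam β b t = 1 := if_neg h

theorem psiEntry_of_eq {b : Fin n} {t : Words n (D.size β)} (h : t.1 (prev b) = t.1 b) :
    psiEntry K D lam gam β b t = psiT K D lam gam β ((posEquiv t).symm b) := if_pos h

theorem matE_glue (t : Words n (D.size β)) (f : ∀ j, Fin (D.size β j) → D.verts j) :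
    matE K D lam gam β (D.glue t f) = Matrix.single t t (idemT K D lam gam β f) := by
  rw [← Matrix.diagonal_single, matE]
  congr 1
  ext1 s
  by_cases hs : s = t
  · subst hs
    rw [dif_pos (comp_glue s f), restr_glue, Pi.single_eq_same]
  · rw [Pi.single_eq_of_ne hs, dif_neg]
    rw [comp_glue]
    exact fun h => hs (Subtype.ext h.symm)

theorem matE_of_not_word {i : Fin n → I} (h : ∀ t : Words n (D.size β), D.comp ∘ i ≠ t.1) :
    matE K D lam gam β i = 0 := by
  rw [matE, ← Matrix.diagonal_zero]
  congr 1
  ext1 s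
  rw [dif_neg (h s)]

theorem matP_mul_single (b : Fin n) (t u : Words n (D.size β)) (x : TensV K D lam gam β) :
    matP K D lam gam β b * Matrix.single t u x =
      Matrix.single (step b t) u (psiEntry K D lam gam β b t * x) := by
  rw [matP, Finset.sum_mul, Finset.sum_eq_single t, Matrix.single_mul_single_same]
  · intro s _ hs
    exact Matrix.single_mul_single_of_ne _ _ _ _ hs _
  · simp

theorem single_mul_matP (b : Fin n) (u s : Words n (D.size β)) (x : TensV K D lam gam β) :
    Matrix.single u s x * matP K D lam gam β b =
      Matrix.single u (step b s) (x * psiEntry K D lam gam β b (step b s)) := by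
  rw [matP, Finset.mul_sum, Finset.sum_eq_single (step b s)]
  · rw [step_step, Matrix.single_mul_single_same]
  · intro t _ ht
    exact Matrix.single_mul_single_of_ne _ _ _ _ (fun h => ht (by rw [h, step_step])) _
  · simp

theorem diagonal_mul_single {R W : Type*} [Semiring R] [Fintype W] [DecidableEq W] (v : W → R)
    (t u : W) (x : R) :
    Matrix.diagonal v * Matrix.single t u x = Matrix.single t u (v t * x) := by
  ext s s'
  rw [Matrix.diagonal_mul]
  by_cases h : t = s ∧ u = s'
  · obtain ⟨rfl, rfl⟩ := h
    simp
  · rw [Matrix.single_apply_of_ne _ _ _ _ _ h, Matrix.single_apply_of_ne _ _ _ _ _ h, mul_zero]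

theorem single_mul_diagonal {R W : Type*} [Semiring R] [Fintype W] [DecidableEq W] (v : W → R)
    (t u : W) (x : R) :
    Matrix.single t u x * Matrix.diagonal v = Matrix.single t u (x * v u) := by
  ext s s'
  rw [Matrix.mul_diagonal]
  by_cases h : t = s ∧ u = s'
  · obtain ⟨rfl, rfl⟩ := h
    simp
  · rw [Matrix.single_apply_of_ne _ _ _ _ _ h, Matrix.single_apply_of_ne _ _ _ _ _ h, zero_mul]

theorem single_sub {R W : Type*} [Ring R] [DecidableEq W] (t u : W) (x y : R) :
    Matrix.single t u (x - y) = Matrix.single t u x - Matrix.single t u y :=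
  map_sub (Matrix.singleAddMonoidHom t u) x y

theorem matY_mul_single (a : Fin n) (t u : Words n (D.size β)) (x : TensV K D lam gam β) :
    matY K D lam gam β a * Matrix.single t u x =
      Matrix.single t u (yT K D lam gam β ((posEquiv t).symm a) * x) :=
  diagonal_mul_single _ _ _ _

/-- A matrix is determined by its columns. -/
theorem matrix_ext_single {R W : Type*} [Semiring R] [Fintype W] [DecidableEq W]
    {X Y : Matrix W W R} (h : ∀ t, X * Matrix.single t t 1 = Y * Matrix.single t t 1) : X = Y := by
  ext s t
  have := congrFun (congrFun (h t) s) t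
  rwa [Matrix.mul_single_apply_same, Matrix.mul_single_apply_same, mul_one, mul_one] at this

theorem glue_step_ne {b : Fin n} {t : Words n (D.size β)} (h : t.1 (prev b) ≠ t.1 b) :
    (step b t).1 (prev b) ≠ (step b t).1 b := by
  simpa [step_apply, swp] using h.symm

section

variable (t u : Words n (D.size β)) (x : TensV K D lam gam β)

theorem ringQ_matY_mul_single (i j : I) (a b : Fin n) :
    Γ.ringQ i j (matY K D lam gam β a) (matY K D lam gam β b) * Matrix.single t u x =
      Matrix.single t u (Γ.ringQ i j (yT K D lam gam β ((posEquiv t).symm a))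
        (yT K D lam gam β ((posEquiv t).symm b)) * x) := by
  simp only [matY, ringQ_diagonal, diagonal_mul_single]

theorem divQ_matY_mul_single (i j : I) (a b c : Fin n) :
    Γ.divQ i j (matY K D lam gam β a) (matY K D lam gam β b) (matY K D lam gam β c) *
        Matrix.single t u x =
      Matrix.single t u (Γ.divQ i j (yT K D lam gam β ((posEquiv t).symm a))
        (yT K D lam gam β ((posEquiv t).symm b)) (yT K D lam gam β ((posEquiv t).symm c)) * x) := by
  simp only [matY, divQ_diagonal, diagonal_mul_single]

theorem oddQ_matY_mul_single (i j : I) (a b : Fin n) :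
    Γ.oddQ i j (matY K D lam gam β a) (matY K D lam gam β b) * Matrix.single t u x =
      Matrix.single t u (Γ.oddQ i j (yT K D lam gam β ((posEquiv t).symm a))
        (yT K D lam gam β ((posEquiv t).symm b)) * x) := by
  simp only [matY, oddQ_diagonal, diagonal_mul_single]

theorem oddQ'_matY_mul_single (i j : I) (a b : Fin n) :
    Γ.oddQ' i j (matY K D lam gam β a) (matY K D lam gam β b) * Matrix.single t u x =
      Matrix.single t u (Γ.oddQ' i j (yT K D lam gam β ((posEquiv t).symm a))
        (yT K D lam gam β ((posEquiv t).symm b)) * x) := by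
  simp only [matY, oddQ'_diagonal, diagonal_mul_single]

theorem pow_matY_mul_single (m l : ℕ) (a : Fin n) :
    (-1) ^ m * matY K D lam gam β a ^ l * Matrix.single t u x =
      Matrix.single t u ((-1) ^ m * yT K D lam gam β ((posEquiv t).symm a) ^ l * x) := by
  simp only [matY, Matrix.diagonal_pow, neg_one_pow_mul_diagonal, diagonal_mul_single, Pi.pow_apply]

theorem homSum_matY_mul_single (m l : ℕ) (a b : Fin n) :
    (-1) ^ m * homSum l (-matY K D lam gam β a) (matY K D lam gam β b) * Matrix.single t u x =
      Matrix.single t u ((-1) ^ m * homSum l (-yT K D lam gam β ((posEquiv t).symm a))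
        (yT K D lam gam β ((posEquiv t).symm b)) * x) := by
  simp only [matY, Matrix.diagonal_neg, homSum_diagonal, neg_one_pow_mul_diagonal, diagonal_mul_single]

end

end MatrixRep

theorem exists_pos_pair {n d : ℕ} {c : Fin d → ℕ} (t : Words n c) {a b : Fin n}
    (hab : a.val + 1 = b.val) (h : t.1 a = t.1 b) : ∃ (j : Fin d) (k' k : Fin (c j)),
      a = pos t j k' ∧ b = pos t j k ∧ k'.val + 1 = k.val := by
  obtain ⟨k, hk⟩ := exists_pos t (rfl : t.1 b = _)
  obtain ⟨k', hk'⟩ := exists_pos t h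
  exact ⟨_, k', k, hk'.symm, hk.symm, succ_of_pos_succ t (by rw [hk, hk']; exact hab)⟩

/-! ### The matrices satisfy the relations of $V_\beta$ -/

section MatrixRep

variable {K : Type w} [CommRing K] {I : Type u} {A : Type v} {Γ : InvQuiver I A}
  {d : ℕ} {D : Γ.Decomposition d} {lam : I → ℕ} {gam : I → K} {n : ℕ} {β : Set (Fin n → I)}

theorem comp_glue_apply {c : Fin d → ℕ} (t : Words n c) (f : ∀ j, Fin (c j) → D.verts j)
    (a : Fin n) : D.comp (D.glue t f a) = t.1 a := congrFun (comp_glue t f) a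

theorem yT_comm_idemT (hβ : Γ.IsBOrbit β) (hadm : Γ.Admissible lam gam)
    (p : Σ j, Fin (D.size β j)) (f : ∀ j, Fin (D.size β j) → D.verts j) :
    yT K D lam gam β p * idemT K D lam gam β f = idemT K D lam gam β f * yT K D lam gam β p := by
  have := factor_mul_idemT ((isRep_part (K := K) (D := D) hβ hadm p.1).y_e p.2 (f p.1))
  rwa [Function.update_eq_self] at this

theorem yT_comm (hβ : Γ.IsBOrbit β) (hadm : Γ.Admissible lam gam)
    (p q : Σ j, Fin (D.size β j)) :
    yT K D lam gam β p * yT K D lam gam β q = yT K D lam gam β q * yT K D lam gam β p := by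
  obtain ⟨j, k⟩ := p
  obtain ⟨l, m⟩ := q
  by_cases h : j = l
  · subst h
    exact (isRep_factor hβ hadm j).y_comm k m
  · exact factor_comm h _ _

variable (hβ : Γ.IsBOrbit β) (hadm : Γ.Admissible lam gam)

include hβ hadm

theorem sum_matE : ∑ᶠ i, matE K D lam gam β i = 1 := by
  classical
  let S : Finset (Words n (D.size β) × ∀ j, Fin (D.size β j) → D.verts j) :=
    Finset.univ ×ˢ Fintype.piFinset fun j => (isBOrbit_sub (D := D) hβ j).finite.toFinset
  have hinj : Function.Injective
      fun p : Words n (D.size β) × (∀ j, Fin (D.size β j) → D.verts j) => D.glue p.1 p.2 :=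
    fun p q h => Prod.ext (glue_injective h).1 (glue_injective h).2
  rw [finsum_eq_sum_of_support_subset (s := S.image fun p => D.glue p.1 p.2),
    Finset.sum_image fun p _ q _ h => hinj h, Finset.sum_product]
  · simp only [matE_glue]
    rw [← Matrix.diagonal_one]
    ext s t
    rw [Matrix.sum_apply]
    simp only [Matrix.sum_apply]
    by_cases h : s = t
    · subst h
      rw [Matrix.diagonal_apply_eq, Finset.sum_eq_single s]
      · simp only [Matrix.single_apply_same]
        exact sum_idemT hβ hadm
      · intro t _ ht
        exact Finset.sum_eq_zero fun f _ => Matrix.single_apply_of_row_ne ht _ _ _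
      · simp
    · rw [Matrix.diagonal_apply_ne _ h]
      refine Finset.sum_eq_zero fun u _ => Finset.sum_eq_zero fun f _ => ?_
      exact Matrix.single_apply_of_ne _ _ _ _ _ fun hu => h (hu.1.symm.trans hu.2)
  · intro i hi
    obtain ⟨t, f, rfl⟩ | h := isWord_or (D := D) (D.size β) i
    · refine Finset.mem_coe.2 (Finset.mem_image.2 ⟨(t, f), ?_, rfl⟩)
      refine Finset.mem_product.2 ⟨Finset.mem_univ _, Fintype.mem_piFinset.2 fun j => ?_⟩
      rw [Set.Finite.mem_toFinset]
      by_contra hn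
      exact hi (by rw [matE_glue, idemT_of_notMem hn, Matrix.single_zero])
    · exact absurd (matE_of_not_word h) hi

theorem matP_mul_matE (b : Fin n) (i : Fin n → I) :
    matP K D lam gam β b * matE K D lam gam β i =
      matE K D lam gam β (move Γ b i) * matP K D lam gam β b := by
  obtain ⟨t, f, rfl⟩ | h := isWord_or (D := D) (D.size β) i
  · by_cases ht : t.1 (prev b) = t.1 b
    · obtain ⟨⟨j, k⟩, rfl⟩ := (posEquiv t).surjective b
      simp only [posEquiv_apply] at ht ⊢
      rw [move_glue_eq ht, matE_glue, matE_glue, matP_mul_single, single_mul_matP,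
        step_eq_self ht, psiEntry_pos ht]
      congr 1
      exact factor_mul_idemT ((isRep_part (K := K) (D := D) hβ hadm j).psi_E k (f j))
    · rw [move_glue_ne ht, matE_glue, matE_glue, matP_mul_single, single_mul_matP, step_step,
        psiEntry_of_ne ht, one_mul, mul_one]
  · rw [matE_of_not_word h, matE_of_not_word (not_word_move h), mul_zero, zero_mul]

theorem psiEntry_comm {a b : Fin n} (hab : a.val + 1 < b.val) (t : Words n (D.size β)) :
    psiEntry K D lam gam β a t * psiEntry K D lam gam β b t =
      psiEntry K D lam gam β b t * psiEntry K D lam gam β a t := by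
  by_cases ha : t.1 (prev a) = t.1 a
  · by_cases hb : t.1 (prev b) = t.1 b
    · obtain ⟨⟨j, k⟩, rfl⟩ := (posEquiv t).surjective a
      obtain ⟨⟨l, m⟩, rfl⟩ := (posEquiv t).surjective b
      simp only [posEquiv_apply] at *
      rw [psiEntry_pos ha, psiEntry_pos hb]
      by_cases h : j = l
      · subst h
        refine (isRep_factor hβ hadm j).psi_comm k m ?_
        obtain ⟨h1, h2⟩ := prev_pos hb
        have hm : m.val ≠ 0 := fun hm => by have := h2.2 hm; omega
        have h3 : k < prev m := (pos_strictMono t j).lt_iff_lt.1 (by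
          rw [← h1, Fin.lt_def]; simp only [prev]; omega)
        have := prev_add_one hm
        rw [Fin.lt_def] at h3
        omega
      · exact factor_comm h _ _
    · rw [psiEntry_of_ne hb, mul_one, one_mul]
  · rw [psiEntry_of_ne ha, mul_one, one_mul]

omit hβ hadm in
theorem psiEntry_step {a b : Fin n} (h1 : a ≠ prev b) (h2 : a ≠ b) (h3 : prev a ≠ prev b)
    (h4 : prev a ≠ b) (t : Words n (D.size β)) :
    psiEntry K D lam gam β a (step b t) = psiEntry K D lam gam β a t := by
  by_cases hb : t.1 (prev b) = t.1 b
  · rw [step_eq_self hb]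
  · rw [psiEntry, psiEntry, posEquiv_step_symm hb, step_apply, step_apply, swp,
      Equiv.swap_apply_of_ne_of_ne h1 h2, Equiv.swap_apply_of_ne_of_ne h3 h4]

-- In either product each pair of the three letters is exchanged once. Unless all three letters
-- agree, at most one pair consists of equal letters, so each side has at most one entry different
-- from $1$; the numbering of occurrences shows that it is the same entry.
omit hβ hadm in
theorem matP_braid_single {a b e : Fin n} (hab : a.val + 1 = b.val) (hbe : b.val + 1 = e.val)
    {t : Words n (D.size β)} (ht : ¬(t.1 a = t.1 b ∧ t.1 b = t.1 e)) (u : Words n (D.size β))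
    (x : TensV K D lam gam β) :
    matP K D lam gam β e * matP K D lam gam β b * matP K D lam gam β e * Matrix.single t u x =
      matP K D lam gam β b * matP K D lam gam β e * matP K D lam gam β b *
        Matrix.single t u x := by
  have h1 : a ≠ b := fun h => by rw [h] at hab; omega
  have h2 : b ≠ e := fun h => by rw [h] at hbe; omega
  have h3 : a ≠ e := fun h => by rw [h] at hab; omega
  have pb := prev_eq hab
  have pe := prev_eq hbe
  have ba : swp b a = b := by rw [swp, pb, Equiv.swap_apply_left]
  have bb : swp b b = a := by rw [swp, pb, Equiv.swap_apply_right]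
  have be : swp b e = e := by rw [swp, pb, Equiv.swap_apply_of_ne_of_ne h3.symm h2.symm]
  have ea : swp e a = a := by rw [swp, pe, Equiv.swap_apply_of_ne_of_ne h1 h3]
  have eb : swp e b = e := by rw [swp, pe, Equiv.swap_apply_left]
  have ee : swp e e = b := by rw [swp, pe, Equiv.swap_apply_right]
  simp only [mul_assoc, matP_mul_single, step_braid hab hbe]
  congr 1
  simp only [psiEntry, pb, pe, step_apply, ba, bb, be, ea, eb, ee]
  have sb := fun h : t.1 a ≠ t.1 b => posEquiv_step_symm (b := b) (t := t) (by rwa [pb])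
  have se := fun h : t.1 b ≠ t.1 e => posEquiv_step_symm (b := e) (t := t) (by rwa [pe])
  by_cases q1 : t.1 a = t.1 b
  · have q2 : t.1 b ≠ t.1 e := fun h => ht ⟨q1, h⟩
    have q3 : t.1 a ≠ t.1 e := fun h => q2 (q1.symm.trans h)
    have := posEquiv_step_symm (b := b) (t := step e t)
      (by rwa [pb, step_apply, step_apply, ea, eb])
    simp only [if_pos q1, if_neg q2, if_neg q3, this, be, se q2, ee, one_mul]
  · by_cases q2 : t.1 b = t.1 e
    · have q3 : t.1 a ≠ t.1 e := fun h => q1 (h.trans q2.symm)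
      have := posEquiv_step_symm (b := e) (t := step b t)
        (by rwa [pe, step_apply, step_apply, bb, be])
      simp only [if_neg q1, if_pos q2, if_neg q3, this, eb, sb q1, be, one_mul]
    · by_cases q3 : t.1 a = t.1 e
      · simp only [if_neg q1, if_neg q2, if_pos q3, se q2, eb, sb q1, be]
      · simp only [if_neg q1, if_neg q2, if_neg q3]

/-- Each relation is examined in one column of the matrices. Where the letters involved agree, it is
the corresponding relation in one tensor factor; where they differ, the polynomials are $0$ or $1$
and it reduces to moves of words and to the commutation of different factors. -/
theorem isRep_mat :
    IsRep K Γ lam gam β (matE K D lam gam β) (matY K D lam gam β) (matP K D lam gam β) 1 where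
  E_off i hi := by
    obtain ⟨t, f, rfl⟩ | h := isWord_or (D := D) (D.size β) i
    · rw [glue_mem_iff hβ] at hi
      push Not at hi
      obtain ⟨j, hj⟩ := hi
      rw [matE_glue, idemT_of_notMem hj, Matrix.single_zero]
    · exact matE_of_not_word h
  sum_E := sum_matE hβ hadm
  E_mul_self i := by
    obtain ⟨t, f, rfl⟩ | h := isWord_or (D := D) (D.size β) i
    · rw [matE_glue, Matrix.single_mul_single_same, idemT_mul_self hβ hadm]
    · rw [matE_of_not_word h, mul_zero]
  E_mul_ne i i' hne := by
    obtain ⟨t, f, rfl⟩ | h := isWord_or (D := D) (D.size β) i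
    · obtain ⟨t', f', rfl⟩ | h' := isWord_or (D := D) (D.size β) i'
      · rw [matE_glue, matE_glue]
        by_cases ht : t = t'
        · subst ht
          rw [Matrix.single_mul_single_same, idemT_mul_ne hβ hadm fun hf => hne (by rw [hf]),
            Matrix.single_zero]
        · exact Matrix.single_mul_single_of_ne _ _ _ _ ht _
      · rw [matE_of_not_word h', mul_zero]
    · rw [matE_of_not_word h, zero_mul]
  y_comm a b := by
    simp only [matY, Matrix.diagonal_mul_diagonal, yT_comm hβ hadm]
  y_e a i := by
    obtain ⟨t, f, rfl⟩ | h := isWord_or (D := D) (D.size β) i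
    · rw [matE_glue, matY, diagonal_mul_single, single_mul_diagonal, yT_comm_idemT hβ hadm]
    · rw [matE_of_not_word h, mul_zero, zero_mul]
  psi_e a b hab i := by rw [matP_mul_matE hβ hadm, move_of_succ hab]
  psi_y_left a b hab i hi := by
    obtain ⟨t, f, rfl⟩ | h := isWord_or (D := D) (D.size β) i
    · have ht : t.1 a = t.1 b := by rw [← comp_glue_apply t f, hi, comp_glue_apply]
      obtain ⟨j, k', k, rfl, rfl, hk⟩ := exists_pos_pair t hab ht
      rw [← prev_eq hab] at ht
      simp only [glue_pos, SetCoe.ext_iff] at hi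
      simp only [matE_glue, mul_assoc, matP_mul_single, matY_mul_single, step_eq_self ht,
        psiEntry_pos ht, posEquiv_symm_pos, ← single_sub]
      have := mul_idemT_congr hβ hadm (f := f) (j := j)
        (x' := yT K D lam gam β ⟨j, k⟩ * psiT K D lam gam β ⟨j, k⟩ - 1)
        (((isRep_factor hβ hadm j).psi_y_left k' k hk (f j) hi).trans
          (by rw [sub_mul, one_mul]))
      simp only [sub_mul, one_mul, mul_assoc] at this
      rw [this]
    · simp only [matE_of_not_word h, mul_zero, sub_zero]
  psi_y_right a b hab i hi := by
    obtain ⟨t, f, rfl⟩ | h := isWord_or (D := D) (D.size β) i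
    · have ht : t.1 a = t.1 b := by rw [← comp_glue_apply t f, hi, comp_glue_apply]
      obtain ⟨j, k', k, rfl, rfl, hk⟩ := exists_pos_pair t hab ht
      rw [← prev_eq hab] at ht
      simp only [glue_pos, SetCoe.ext_iff] at hi
      simp only [matE_glue, mul_assoc, matP_mul_single, matY_mul_single, step_eq_self ht,
        psiEntry_pos ht, posEquiv_symm_pos, ← Matrix.single_add]
      have := mul_idemT_congr hβ hadm (f := f) (j := j)
        (x' := yT K D lam gam β ⟨j, k'⟩ * psiT K D lam gam β ⟨j, k⟩ + 1)
        (((isRep_factor hβ hadm j).psi_y_right k' k hk (f j) hi).trans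
          (by rw [add_mul, one_mul]))
      simp only [add_mul, one_mul, mul_assoc] at this
      rw [this]
    · simp only [matE_of_not_word h, mul_zero, add_zero]
  psi_y a b hab x i hi := by
    obtain ⟨t, f, rfl⟩ | h := isWord_or (D := D) (D.size β) i
    · by_cases ht : t.1 a = t.1 b
      · obtain ⟨j, k', k, rfl, rfl, hk⟩ := exists_pos_pair t hab ht
        rw [← prev_eq hab] at ht
        obtain ⟨⟨l, m⟩, rfl⟩ := (posEquiv t).surjective x
        simp only [posEquiv_apply] at hi ⊢
        simp only [glue_pos, SetCoe.ext_iff] at hi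
        by_cases hl : l = j
        · subst hl
          simp only [matE_glue, mul_assoc, matP_mul_single, matY_mul_single, step_eq_self ht,
            psiEntry_pos ht, posEquiv_symm_pos, pos_swap]
          have := mul_idemT_congr hβ hadm (f := f) (j := l)
            ((isRep_factor hβ hadm l).psi_y k' k hk m (f l) fun h =>
              ⟨fun e => (hi h).1 (by rw [e]), fun e => (hi h).2 (by rw [e])⟩)
          simp only [mul_assoc] at this
          rw [this]
        · have hne : ∀ k', pos t l m ≠ pos t j k' := fun k' h' => hl (by
            rw [← letter_pos t l m, h', letter_pos])
          simp only [matE_glue, mul_assoc, matP_mul_single, matY_mul_single, step_eq_self ht,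
            psiEntry_pos ht, posEquiv_symm_pos, Equiv.swap_apply_of_ne_of_ne (hne _) (hne _)]
          rw [← mul_assoc, ← mul_assoc, psiT, yT, factor_comm (Ne.symm hl)]
      · rw [← prev_eq hab] at ht
        simp only [matE_glue, mul_assoc, matP_mul_single, matY_mul_single,
          psiEntry_of_ne ht, posEquiv_step_symm ht, swp_of_succ hab, Equiv.swap_apply_self,
          one_mul]
    · simp only [matE_of_not_word h, mul_zero]
  psi_comm a b hab := by
    obtain ⟨h1, h2, h3, h4, h5, h6, h7, h8⟩ := far_ne hab
    refine matrix_ext_single fun t => ?_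
    simp only [mul_assoc, matP_mul_single, step_comm hab, mul_one, psiEntry_step h1 h2 h3 h4,
      psiEntry_step h5 h6 h7 h8, psiEntry_comm hβ hadm hab]
  psi_sq a b hab i := by
    obtain ⟨t, f, rfl⟩ | h := isWord_or (D := D) (D.size β) i
    · by_cases ht : t.1 a = t.1 b
      · obtain ⟨j, k', k, rfl, rfl, hk⟩ := exists_pos_pair t hab ht
        rw [← prev_eq hab] at ht
        simp only [matE_glue, mul_assoc, matP_mul_single, ringQ_matY_mul_single, step_eq_self ht,
          psiEntry_pos ht, posEquiv_symm_pos, glue_pos]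
        have := mul_idemT_congr hβ hadm (f := f) (j := j)
          ((isRep_factor hβ hadm j).psi_sq k' k hk (f j))
        simp only [mul_assoc, D.ringQ_part] at this
        rw [this]
      · rw [D.ringQ_of_ne (by rwa [comp_glue_apply, comp_glue_apply]), one_mul]
        rw [← prev_eq hab] at ht
        simp only [matE_glue, mul_assoc, matP_mul_single, psiEntry_of_ne ht,
          psiEntry_of_ne (glue_step_ne ht), step_step, one_mul]
    · simp only [matE_of_not_word h, mul_zero]
  braid3_eq a b e hab hbe i hi := by
    obtain ⟨t, f, rfl⟩ | h := isWord_or (D := D) (D.size β) i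
    · have hae : t.1 a = t.1 e := by rw [← comp_glue_apply t f, hi, comp_glue_apply]
      by_cases ht : t.1 a = t.1 b
      · obtain ⟨j, k₁, k₂, rfl, rfl, hk⟩ := exists_pos_pair t hab ht
        obtain ⟨k₃, rfl⟩ := exists_pos t (hae.symm.trans (letter_pos _ _ _))
        have hk' := succ_of_pos_succ t hbe
        have h1 : t.1 (prev (pos t j k₂)) = t.1 (pos t j k₂) := by rw [prev_eq hab, ht]
        have h2 : t.1 (prev (pos t j k₃)) = t.1 (pos t j k₃) := by rw [prev_eq hbe, ← ht, hae]
        simp only [glue_pos, SetCoe.ext_iff] at hi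
        have := mul_idemT_congr hβ hadm (f := f) (j := j)
          (x' := psiT K D lam gam β ⟨j, k₂⟩ * psiT K D lam gam β ⟨j, k₃⟩ *
            psiT K D lam gam β ⟨j, k₂⟩ + Γ.divQ (f j k₁) (f j k₂) (yT K D lam gam β ⟨j, k₁⟩)
              (yT K D lam gam β ⟨j, k₂⟩) (yT K D lam gam β ⟨j, k₃⟩))
          (((isRep_factor hβ hadm j).braid3_eq k₁ k₂ k₃ hk hk' (f j) hi).trans
            (by rw [add_mul, D.divQ_part]))
        simp only [glue_pos, matE_glue, mul_assoc, matP_mul_single, step_eq_self h1,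
          step_eq_self h2, psiEntry_pos h1, psiEntry_pos h2, divQ_matY_mul_single,
          posEquiv_symm_pos, ← Matrix.single_add]
        simp only [add_mul, mul_assoc] at this
        rw [this]
      -- Here the outer letters agree but the middle one differs, so the correction term is zero.
      · rw [D.divQ_of_ne (by rwa [comp_glue_apply, comp_glue_apply]), zero_mul, add_zero, matE_glue]
        exact matP_braid_single hab hbe (fun h => ht h.1) _ _
    · simp only [matE_of_not_word h, mul_zero, add_zero]
  braid3_ne a b e hab hbe i hi := by
    obtain ⟨t, f, rfl⟩ | h := isWord_or (D := D) (D.size β) i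
    · by_cases ht : t.1 a = t.1 b ∧ t.1 b = t.1 e
      · obtain ⟨j, k₁, k₂, rfl, rfl, hk⟩ := exists_pos_pair t hab ht.1
        obtain ⟨k₃, rfl⟩ := exists_pos t (ht.2.symm.trans (letter_pos _ _ _))
        have hk' := succ_of_pos_succ t hbe
        have h1 : t.1 (prev (pos t j k₂)) = t.1 (pos t j k₂) := by rw [prev_eq hab, ht.1]
        have h2 : t.1 (prev (pos t j k₃)) = t.1 (pos t j k₃) := by rw [prev_eq hbe, ht.2]
        simp only [glue_pos, ne_eq, SetCoe.ext_iff] at hi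
        have := mul_idemT_congr hβ hadm (f := f) (j := j)
          ((isRep_factor hβ hadm j).braid3_ne k₁ k₂ k₃ hk hk' (f j) hi)
        simp only [matE_glue, mul_assoc, matP_mul_single, step_eq_self h1,
          step_eq_self h2, psiEntry_pos h1, psiEntry_pos h2]
        simp only [mul_assoc] at this
        rw [this]
      · rw [matE_glue]
        exact matP_braid_single hab hbe ht _ _
    · simp only [matE_of_not_word h, mul_zero]
  psi0_e o ho i := by rw [matP_mul_matE hβ hadm, move_first ho]
  psi0_y1 o ho i := by
    obtain ⟨t, f, rfl⟩ | h := isWord_or (D := D) (D.size β) i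
    · have ht : t.1 (prev o) = t.1 o := by rw [prev_first ho]
      obtain ⟨⟨j, k⟩, rfl⟩ := (posEquiv t).surjective o
      simp only [posEquiv_apply] at ho ht ⊢
      simp only [glue_pos, matE_glue, mul_assoc, matP_mul_single, matY_mul_single, step_eq_self ht,
        psiEntry_pos ht, posEquiv_symm_pos, Matrix.smul_single, ← single_sub]
      have := mul_idemT_congr hβ hadm (f := f) (j := j)
        (x' := (2 * gam (f j k)) • 1 - yT K D lam gam β ⟨j, k⟩ * psiT K D lam gam β ⟨j, k⟩)
        (((isRep_factor hβ hadm j).psi0_y1 k ((prev_pos ht).2.1 ho) (f j)).trans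
          (by rw [sub_mul, smul_mul_assoc, one_mul]))
      simp only [sub_mul, one_mul, mul_assoc, smul_mul_assoc] at this
      rw [this]
    · simp only [matE_of_not_word h, mul_zero, smul_zero, sub_zero]
  psi0_y o ho a ha := by
    refine matrix_ext_single fun t => ?_
    have ht : t.1 (prev o) = t.1 o := by rw [prev_first ho]
    obtain ⟨⟨j, k⟩, rfl⟩ := (posEquiv t).surjective o
    obtain ⟨⟨l, m⟩, rfl⟩ := (posEquiv t).surjective a
    simp only [posEquiv_apply] at ho ht ha ⊢
    simp only [mul_assoc, matP_mul_single, matY_mul_single, step_eq_self ht, psiEntry_pos ht,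
      posEquiv_symm_pos, mul_one]
    congr 1
    by_cases h : l = j
    · subst h
      exact (isRep_factor hβ hadm l).psi0_y k ((prev_pos ht).2.1 ho) m fun e => ha (by rw [e])
    · exact factor_comm (Ne.symm h) _ _
  psi0_sq o ho i hi := by
    obtain ⟨t, f, rfl⟩ | h := isWord_or (D := D) (D.size β) i
    · have ht : t.1 (prev o) = t.1 o := by rw [prev_first ho]
      obtain ⟨⟨j, k⟩, rfl⟩ := (posEquiv t).surjective o
      simp only [posEquiv_apply] at ho ht hi ⊢
      rw [glue_pos] at hi
      simp only [glue_pos, matE_glue, pow_matY_mul_single]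
      simp only [mul_assoc, matP_mul_single, step_eq_self ht, psiEntry_pos ht, posEquiv_symm_pos]
      have := mul_idemT_congr hβ hadm (f := f) (j := j)
        ((isRep_factor hβ hadm j).psi0_sq k ((prev_pos ht).2.1 ho) (f j) hi)
      simp only [mul_assoc] at this
      rw [this]
      rfl
    · simp only [matE_of_not_word h, mul_zero]
  psi0_sq_zero o ho i hi := by
    obtain ⟨t, f, rfl⟩ | h := isWord_or (D := D) (D.size β) i
    · have ht : t.1 (prev o) = t.1 o := by rw [prev_first ho]
      obtain ⟨⟨j, k⟩, rfl⟩ := (posEquiv t).surjective o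
      simp only [posEquiv_apply] at ho ht hi ⊢
      rw [glue_pos] at hi
      simp only [matE_glue, mul_assoc, matP_mul_single, step_eq_self ht, psiEntry_pos ht]
      have := mul_idemT_congr hβ hadm (f := f) (j := j) (x' := 0)
        (((isRep_factor hβ hadm j).psi0_sq_zero k ((prev_pos ht).2.1 ho) (f j) hi).trans
          (zero_mul _).symm)
      simp only [mul_assoc, zero_mul] at this
      rw [this, Matrix.single_zero]
    · simp only [matE_of_not_word h, mul_zero]
  braid4_theta o s ho hs i hi hi' := by
    have hab : o.val + 1 = s.val := by omega
    obtain ⟨t, f, rfl⟩ | h := isWord_or (D := D) (D.size β) i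
    · have ht : t.1 o = t.1 s := by
        rw [← comp_glue_apply t f, ← comp_glue_apply t f, ← hi', D.comp_inv]
      have ho' : t.1 (prev o) = t.1 o := by rw [prev_first ho]
      obtain ⟨j, k', k, rfl, rfl, hk⟩ := exists_pos_pair t hab ht
      rw [← prev_eq hab] at ht
      have hk' : k'.val = 0 := (prev_pos ho').2.1 ho
      simp only [glue_pos] at hi hi' ⊢
      have := mul_idemT_congr hβ hadm (f := f) (j := j)
        (x' := psiT K D lam gam β ⟨j, k⟩ * psiT K D lam gam β ⟨j, k'⟩ * psiT K D lam gam β ⟨j, k⟩ *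
            psiT K D lam gam β ⟨j, k'⟩ - (-1) ^ lam (Γ.inv (f j k')) *
          homSum (lam (f j k') + lam (Γ.inv (f j k'))) (-yT K D lam gam β ⟨j, k'⟩)
            (yT K D lam gam β ⟨j, k⟩) * psiT K D lam gam β ⟨j, k⟩)
        (((isRep_factor hβ hadm j).braid4_theta k' k hk' (by omega) (f j) hi
          (Subtype.ext hi')).trans (by rw [sub_mul]; rfl))
      rw [mul_assoc (_ * homSum _ _ _) (matP K D lam gam β _), matE_glue]
      simp only [mul_assoc, matP_mul_single, step_eq_self ht, step_eq_self ho', psiEntry_pos ht,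
        psiEntry_pos ho']
      rw [← mul_assoc _ (homSum _ _ _) (Matrix.single _ _ _), homSum_matY_mul_single, ← single_sub,
        posEquiv_symm_pos, posEquiv_symm_pos]
      simp only [sub_mul, mul_assoc] at this ⊢
      rw [this]
    · simp only [matE_of_not_word h, mul_zero, sub_zero]
  braid4_other o s ho hs i hi := by
    have hab : o.val + 1 = s.val := by omega
    obtain ⟨t, f, rfl⟩ | h := isWord_or (D := D) (D.size β) i
    · have ho' : ∀ t : Words n (D.size β), t.1 (prev o) = t.1 o := fun t => by rw [prev_first ho]
      by_cases ht : t.1 o = t.1 s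
      · obtain ⟨j, k', k, rfl, rfl, hk⟩ := exists_pos_pair t hab ht
        rw [← prev_eq hab] at ht
        have hk' : k'.val = 0 := (prev_pos (ho' t)).2.1 ho
        simp only [glue_pos] at hi ⊢
        have := mul_idemT_congr hβ hadm (f := f) (j := j)
          (x' := psiT K D lam gam β ⟨j, k⟩ * psiT K D lam gam β ⟨j, k'⟩ *
            psiT K D lam gam β ⟨j, k⟩ * psiT K D lam gam β ⟨j, k'⟩ + gam (f j k) •
              (Γ.oddQ (f j k) (f j k') (yT K D lam gam β ⟨j, k'⟩) (yT K D lam gam β ⟨j, k⟩) *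
                  psiT K D lam gam β ⟨j, k'⟩ - gam (f j k') •
                Γ.oddQ' (f j k) (f j k') (yT K D lam gam β ⟨j, k'⟩) (yT K D lam gam β ⟨j, k⟩)))
          (((isRep_factor hβ hadm j).braid4_other k' k hk' (by omega) (f j)
            fun h => hi ⟨h.1, congrArg Subtype.val h.2⟩).trans
            (by rw [add_mul, D.oddQ_part, D.oddQ'_part, smul_mul_assoc]))
        simp only [matE_glue, sub_mul, smul_mul_assoc, mul_assoc, matP_mul_single,
          step_eq_self ht, step_eq_self (ho' t), psiEntry_pos ht, psiEntry_pos (ho' t), oddQ_matY_mul_single, oddQ'_matY_mul_single, posEquiv_symm_pos,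
          ← single_sub, Matrix.smul_single, ← Matrix.single_add]
        simp only [sub_mul, add_mul, smul_mul_assoc, mul_assoc] at this ⊢
        rw [this]
      -- With different first letters each side is a product of the two elements $\psi_0$ of two
      -- different tensor factors, in opposite orders; these commute.
      · have hne : D.comp (D.glue t f s) ≠ D.comp (D.glue t f o) := by
          rw [comp_glue_apply, comp_glue_apply]; exact Ne.symm ht
        have hst : t.1 (prev s) ≠ t.1 s := by rwa [prev_eq hab]
        simp only [D.oddQ_of_ne hne, D.oddQ'_of_ne hne, zero_mul, smul_zero, sub_zero, add_zero]
        simp only [matE_glue, mul_assoc, matP_mul_single, psiEntry_of_ne hst,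
          psiEntry_of_ne (glue_step_ne hst), step_step, one_mul, step_first ho]
        congr 1
        rw [← mul_assoc, ← mul_assoc, psiEntry_of_eq (ho' _), psiEntry_of_eq (ho' _),
          posEquiv_step_symm hst, swp_of_succ hab, Equiv.swap_apply_left, psiT, psiT, factor_comm]
        intro h
        refine ht ?_
        obtain ⟨p, rfl⟩ := (posEquiv t).surjective o
        obtain ⟨q, rfl⟩ := (posEquiv t).surjective s
        rw [Equiv.symm_apply_apply, Equiv.symm_apply_apply] at h
        simp only [posEquiv_apply, letter_pos]
        exact h
    · simp only [matE_of_not_word h, mul_zero, smul_zero, add_zero]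

end MatrixRep

/-! ### Matrix units -/

/-- A full system of matrix units in an algebra. -/
structure IsMatUnits {B W : Type*} [Ring B] [Fintype W] (τ : W → W → B) : Prop where
  mul : ∀ s t u, τ s t * τ t u = τ s u
  mul_ne : ∀ s t t' u, t ≠ t' → τ s t * τ t' u = 0
  sum_diag : ∑ t, τ t t = 1

namespace IsMatUnits

variable {K B C T W : Type*} [CommRing K] [Ring B] [Algebra K B] [Ring C] [Algebra K C]
  [Ring T] [Algebra K T] [Fintype W] {τ : W → W → B}

theorem map (h : IsMatUnits τ) (f : B →ₐ[K] C) : IsMatUnits fun s t => f (τ s t) where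
  mul s t u := by rw [← map_mul, h.mul]
  mul_ne s t t' u ht := by rw [← map_mul, h.mul_ne _ _ _ _ ht, map_zero]
  sum_diag := by rw [← map_sum, h.sum_diag, map_one]

theorem ext_right (h : IsMatUnits τ) {x y : B} (hxy : ∀ t, x * τ t t = y * τ t t) : x = y := by
  rw [← mul_one x, ← mul_one y, ← h.sum_diag, Finset.mul_sum, Finset.mul_sum]
  exact Finset.sum_congr rfl fun t _ => hxy t

/-- The elements that commute with the matrix units are determined by one component. -/
theorem ext_of_commute (h : IsMatUnits τ) {x y : B} (hx : ∀ s t, x * τ s t = τ s t * x)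
    (hy : ∀ s t, y * τ s t = τ s t * y) (s : W) (hxy : x * τ s s = y * τ s s) : x = y := by
  refine h.ext_right fun t => ?_
  rw [← h.mul t s t, ← mul_assoc, ← mul_assoc, hx, hy, ← h.mul s s t, ← mul_assoc, ← mul_assoc,
    mul_assoc (τ t s), hxy, ← mul_assoc (τ t s)]

variable (K) in
/-- The elements that commute with the `s`-th diagonal matrix unit. -/
abbrev corner (τ : W → W → B) (s : W) : Subalgebra K B := Subalgebra.centralizer K {τ s s}

omit [Fintype W] in
theorem mem_corner {s : W} {x : B} : x ∈ corner K τ s ↔ τ s s * x = x * τ s s := by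
  rw [Subalgebra.mem_centralizer_iff]; simp

variable (K) in
/-- The map that spreads an element of a corner along the diagonal. -/
def avg (h : IsMatUnits τ) (s : W) : corner K τ s →ₐ[K] B :=
  AlgHom.ofLinearMap
    { toFun := fun x => ∑ t, τ t s * x * τ s t
      map_add' := fun x y => by
        simp only [Subalgebra.coe_add, mul_add, add_mul, Finset.sum_add_distrib]
      map_smul' := fun c x => by
        simp only [Subalgebra.coe_smul, mul_smul_comm, smul_mul_assoc, Finset.smul_sum,
          RingHom.id_apply] }
    (by simp only [LinearMap.coe_mk, AddHom.coe_mk, OneMemClass.coe_one, mul_one, h.mul, h.sum_diag])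
    (fun x y => by
      classical
      simp only [LinearMap.coe_mk, AddHom.coe_mk, MulMemClass.coe_mul]
      rw [Finset.sum_mul_sum]
      refine Finset.sum_congr rfl fun t _ => ?_
      rw [Finset.sum_eq_single t]
      -- Since $y$ commutes with $\tau_{ss}$, the element $\tau_{ss}=\tau_{st}\tau_{ts}$ may be
      -- inserted between $x$ and $y$.
      · have hy := mem_corner.1 y.2
        calc τ t s * ((x : B) * y) * τ s t = τ t s * x * (y * τ s s) * τ s t := by
              simp only [mul_assoc, h.mul]
          _ = τ t s * x * ((τ s t * τ t s) * y) * τ s t := by rw [← hy, h.mul]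
          _ = _ := by simp only [mul_assoc]
      · intro u _ hu
        rw [mul_assoc, ← mul_assoc (τ s t), ← mul_assoc (τ s t), h.mul_ne _ _ _ _ hu.symm, zero_mul,
          zero_mul, mul_zero]
      · simp)

theorem avg_apply (h : IsMatUnits τ) (s : W) (x : corner K τ s) :
    h.avg K s x = ∑ t, τ t s * x * τ s t := rfl

theorem avg_mul (h : IsMatUnits τ) (s : W) (x : corner K τ s) (t u : W) :
    h.avg K s x * τ t u = τ t s * x * τ s u := by
  classical
  rw [avg_apply, Finset.sum_mul, Finset.sum_eq_single t]
  · rw [mul_assoc, h.mul]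
  · intro t' _ ht
    rw [mul_assoc, h.mul_ne _ _ _ _ ht, mul_zero]
  · simp

theorem mul_avg (h : IsMatUnits τ) (s : W) (x : corner K τ s) (t u : W) :
    τ t u * h.avg K s x = τ t s * x * τ s u := by
  classical
  rw [avg_apply, Finset.mul_sum, Finset.sum_eq_single u]
  · rw [← mul_assoc, ← mul_assoc, h.mul]
  · intro t' _ ht
    rw [← mul_assoc, ← mul_assoc, h.mul_ne _ _ _ _ ht.symm, zero_mul, zero_mul]
  · simp

/-- A representation whose idempotents have the sum $\tau_{ss}$ thus becomes one whose idempotents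
have the sum $1$, as the universal property requires. -/
theorem avg_diag (h : IsMatUnits τ) (s : W) :
    h.avg K s ⟨τ s s, mem_corner.2 rfl⟩ = 1 := by
  rw [avg_apply, ← h.sum_diag]
  exact Finset.sum_congr rfl fun t _ => by rw [h.mul, h.mul]

/-- The linear map from a matrix algebra that is defined by matrix units and by a linear map on the
coefficients. -/
def matLin [DecidableEq W] (τ : W → W → B) (F : T →ₗ[K] B) : Matrix W W T →ₗ[K] B :=
  Matrix.liftLinear K fun s t => (LinearMap.mulRight K (τ s t)).comp F

theorem matLin_single [DecidableEq W] (F : T →ₗ[K] B) (s t : W) (x : T) :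
    matLin τ F (Matrix.single s t x) = F x * τ s t := by
  rw [matLin, Matrix.liftLinear_single]; rfl

/-- The algebra homomorphism from a matrix algebra that is defined by matrix units and by a
homomorphism on the coefficients. -/
def matHom [DecidableEq W] (h : IsMatUnits τ) (F : T →ₐ[K] B)
    (hF : ∀ x s t, F x * τ s t = τ s t * F x) : Matrix W W T →ₐ[K] B :=
  AlgHom.ofLinearMap (matLin τ F.toLinearMap)
    (by
      rw [← Matrix.diagonal_one, ← Matrix.sum_single_eq_diagonal, map_sum, ← h.sum_diag]
      refine Finset.sum_congr rfl fun s _ => ?_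
      rw [matLin_single]
      simp)
    (fun M N => by
      induction M using Matrix.induction_on' with
      | h_zero => simp
      | h_add M M' hM hM' => rw [add_mul, map_add, hM, hM', map_add, add_mul]
      | h_std_basis s t x =>
        induction N using Matrix.induction_on' with
        | h_zero => simp
        | h_add N N' hN hN' => rw [mul_add, map_add, hN, hN', map_add, mul_add]
        | h_std_basis u v y =>
          rw [matLin_single, matLin_single]
          change _ = F x * _ * (F y * _)
          rw [mul_assoc, ← mul_assoc (τ s t), ← hF, mul_assoc (F y), ← mul_assoc (F x), ← map_mul]
          by_cases htu : t = u
          · subst htu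
            rw [Matrix.single_mul_single_same, matLin_single, h.mul]
            rfl
          · rw [Matrix.single_mul_single_of_ne _ _ _ _ htu, h.mul_ne _ _ _ _ htu, mul_zero, map_zero])

theorem matHom_single [DecidableEq W] (h : IsMatUnits τ) (F : T →ₐ[K] B)
    (hF : ∀ x s t, F x * τ s t = τ s t * F x) (s t : W) (x : T) :
    h.matHom F hF (Matrix.single s t x) = F x * τ s t :=
  matLin_single _ _ _ _

end IsMatUnits

/-- Every word is linked to the sorted one by exchanges of different adjacent letters. The exchange
is an involution, so the assumption on single steps can be used in both directions. -/
theorem words_connected {n d : ℕ} {c : Fin d → ℕ} {p : Words n c → Words n c → Prop}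
    (refl : ∀ t, p t t) (trans : ∀ s t u, p s t → p t u → p s u)
    (hstep : ∀ t b, t.1 (prev b) ≠ t.1 b → p (step b t) t) (s t : Words n c) : p s t := by
  obtain ⟨s₀, hs₀⟩ := exists_sorted Fin.val t
  have key : ∀ t, p t s₀ ∧ p s₀ t := fun t => by
    induction t using sort_induction Fin.val with
    | hs t ht =>
      rw [sorted_unique Fin.val_injective ht hs₀]
      exact ⟨refl _, refl _⟩
    | hstep t b hb ih =>
      have hne : t.1 (prev b) ≠ t.1 b := fun h => by rw [h] at hb; exact lt_irrefl _ hb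
      have h1 := hstep t b hne
      have h2 := hstep (step b t) b (by simpa [step_apply, swp] using hne.symm)
      rw [step_step] at h2
      exact ⟨trans _ _ _ h2 ih.1, trans _ _ _ ih.2 h1⟩
  exact trans _ _ _ (key s).1 (key t).2

/-! ### Idempotents and matrix units attached to words -/

section WordUnits

variable {K : Type w} [CommRing K] {I : Type u} {A : Type v} {Γ : InvQuiver I A}
  {lam : I → ℕ} {gam : I → K} {n : ℕ} {β : Set (Fin n → I)}

theorem comp_move {d : ℕ} (D : Γ.Decomposition d) (b : Fin n) (i : Fin n → I) (a : Fin n) :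
    D.comp (move Γ b i a) = D.comp (i (swp b a)) := by
  by_cases hb : b.val = 0
  · rw [move_first hb, swp_first hb]
    by_cases ha : a = b
    · subst ha; simp [D.comp_inv]
    · simp [Function.update_of_ne ha]
  · rw [move, if_neg hb, ← swp]; rfl

namespace V

section Dg

variable (K lam gam) in
open Classical in
/-- The sum of the idempotents `e(i)` with a given property. -/
def dg (hβ : Γ.IsBOrbit β) (p : (Fin n → I) → Prop) : V K Γ lam gam β :=
  ∑ i ∈ hβ.finite.toFinset with p i, idem K Γ lam gam β i

variable (hβ : Γ.IsBOrbit β) (hadm : Γ.Admissible lam gam) {p q : (Fin n → I) → Prop}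

theorem dg_mem_grade : dg K lam gam hβ p ∈ grade K Γ lam gam β 0 :=
  Submodule.sum_mem _ fun i _ => idem_mem_grade i

include hβ hadm

theorem ext_idem {x x' : V K Γ lam gam β}
    (h : ∀ i ∈ β, x * idem K Γ lam gam β i = x' * idem K Γ lam gam β i) : x = x' :=
  (V.isRep hβ hadm).ext_right hβ.finite h

open Classical in
theorem dg_mul_idem {i : Fin n → I} (hp : p i) :
    dg K lam gam hβ p * idem K Γ lam gam β i = idem K Γ lam gam β i := by
  by_cases hi : i ∈ β
  · rw [dg, Finset.sum_mul, Finset.sum_eq_single i, (V.isRep hβ hadm).E_mul_self]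
    · exact fun j _ hj => (V.isRep hβ hadm).E_mul_ne _ _ hj
    · intro h
      exact absurd (by simp [hi, hp]) h
  · rw [idem_of_notMem _ _ _ _ hi, mul_zero]

open Classical in
theorem dg_mul_idem_of_not {i : Fin n → I} (hp : ¬p i) :
    dg K lam gam hβ p * idem K Γ lam gam β i = 0 := by
  rw [dg, Finset.sum_mul]
  refine Finset.sum_eq_zero fun j hj => (V.isRep hβ hadm).E_mul_ne _ _ fun h => hp ?_
  rw [← h]
  exact (Finset.mem_filter.1 hj).2

omit hadm in
open Classical in
theorem mul_dg_congr {x x' : V K Γ lam gam β}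
    (h : ∀ i ∈ β, p i → x * idem K Γ lam gam β i = x' * idem K Γ lam gam β i) :
    x * dg K lam gam hβ p = x' * dg K lam gam hβ p := by
  rw [dg, Finset.mul_sum, Finset.mul_sum]
  refine Finset.sum_congr rfl fun i hi => h i ?_ ?_
  · exact (Set.Finite.mem_toFinset _).1 (Finset.mem_filter.1 hi).1
  · exact (Finset.mem_filter.1 hi).2

omit hadm in
theorem dg_congr (h : ∀ i ∈ β, p i ↔ q i) : dg K lam gam hβ p = dg K lam gam hβ q := by
  classical
  rw [dg, dg]
  refine Finset.sum_congr (Finset.filter_congr fun i hi => h i ?_) fun i _ => rfl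
  exact (Set.Finite.mem_toFinset _).1 hi

theorem dg_false (h : ∀ i ∈ β, ¬p i) : dg K lam gam hβ p = 0 :=
  ext_idem hβ hadm fun i hi => by rw [dg_mul_idem_of_not hβ hadm (h i hi), zero_mul]

theorem dg_mul_dg : dg K lam gam hβ p * dg K lam gam hβ q = dg K lam gam hβ fun i => p i ∧ q i := by
  refine ext_idem hβ hadm fun i _ => ?_
  by_cases hq : q i
  · rw [mul_assoc, dg_mul_idem hβ hadm hq]
    by_cases hp : p i
    · rw [dg_mul_idem hβ hadm hp, dg_mul_idem hβ hadm ⟨hp, hq⟩]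
    · rw [dg_mul_idem_of_not hβ hadm hp, dg_mul_idem_of_not hβ hadm fun h => hp h.1]
  · rw [mul_assoc, dg_mul_idem_of_not hβ hadm hq, mul_zero,
      dg_mul_idem_of_not hβ hadm fun h => hq h.2]

theorem y_mul_dg (a : Fin n) : y K Γ lam gam β a * dg K lam gam hβ p =
    dg K lam gam hβ p * y K Γ lam gam β a := by
  have R := V.isRep (K := K) hβ hadm
  rw [dg, Finset.mul_sum, Finset.sum_mul]
  exact Finset.sum_congr rfl fun i _ => R.y_e _ _

theorem psi_mul_dg (b : Fin n) : psi K Γ lam gam β b * dg K lam gam hβ p =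
    dg K lam gam hβ (fun i => p (move Γ b i)) * psi K Γ lam gam β b := by
  have R := V.isRep (K := K) hβ hadm
  refine ext_idem hβ hadm fun i _ => ?_
  rw [mul_assoc (dg _ _ _ _ _), R.psi_E, ← mul_assoc]
  by_cases hp : p i
  · rw [dg_mul_idem hβ hadm (by rwa [move_move]), mul_assoc, dg_mul_idem hβ hadm hp, R.psi_E]
  · rw [dg_mul_idem_of_not hβ hadm (by rwa [move_move]), mul_assoc,
      dg_mul_idem_of_not hβ hadm hp, mul_zero, zero_mul]

end Dg

section Word

variable {d : ℕ} {D : Γ.Decomposition d}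

variable (K lam gam) in
/-- The sum of the idempotents `e(i)` with a given word. -/
def wordIdem (hβ : Γ.IsBOrbit β) (t : Words n (D.size β)) : V K Γ lam gam β :=
  dg K lam gam hβ fun i => D.comp ∘ i = t.1

variable (hβ : Γ.IsBOrbit β) (hadm : Γ.Admissible lam gam)

include hadm

theorem wordIdem_mul_self (t : Words n (D.size β)) :
    wordIdem K lam gam hβ t * wordIdem K lam gam hβ t = wordIdem K lam gam hβ t := by
  rw [wordIdem, dg_mul_dg hβ hadm]
  exact dg_congr hβ fun i _ => and_self_iff

theorem wordIdem_mul_ne {s t : Words n (D.size β)} (h : s ≠ t) :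
    wordIdem K lam gam hβ s * wordIdem K lam gam hβ t = 0 := by
  rw [wordIdem, wordIdem, dg_mul_dg hβ hadm]
  exact dg_false hβ hadm fun i _ hi => h (Subtype.ext (hi.1.symm.trans hi.2))

theorem sum_wordIdem : ∑ t : Words n (D.size β), wordIdem K lam gam hβ t = 1 := by
  refine ext_idem hβ hadm fun i hi => ?_
  rw [Finset.sum_mul, Finset.sum_eq_single (D.word hβ hi), one_mul]
  · exact dg_mul_idem hβ hadm rfl
  · intro t _ ht
    exact dg_mul_idem_of_not hβ hadm fun h => ht (Subtype.ext h.symm)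
  · simp

omit hadm in
theorem comp_move_iff {b : Fin n} {t : Words n (D.size β)} {i : Fin n → I} :
    D.comp ∘ move Γ b i = t.1 ↔ D.comp ∘ i = (step b t).1 := by
  constructor
  · intro h
    ext1 a
    rw [step_apply, ← h, Function.comp_apply, Function.comp_apply, comp_move]
    simp [swp]
  · intro h
    ext1 a
    have := congrFun h (swp b a)
    rw [step_apply] at this
    rw [Function.comp_apply, comp_move]
    simpa [swp] using this

theorem psi_mul_wordIdem (b : Fin n) (t : Words n (D.size β)) :
    psi K Γ lam gam β b * wordIdem K lam gam hβ t =
      wordIdem K lam gam hβ (step b t) * psi K Γ lam gam β b := by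
  rw [wordIdem, psi_mul_dg hβ hadm]
  congr 1
  exact dg_congr hβ fun i _ => comp_move_iff

theorem psi_mul_wordIdem_mul (b : Fin n) (t : Words n (D.size β)) (x : V K Γ lam gam β) :
    psi K Γ lam gam β b * (wordIdem K lam gam hβ t * x) =
      wordIdem K lam gam hβ (step b t) * (psi K Γ lam gam β b * x) := by
  rw [← mul_assoc, psi_mul_wordIdem hβ hadm, mul_assoc]

/-- For different letters $\psi_b^2e(i)=Qe(i)=e(i)$: here $\psi_b$ is an isomorphism between the
components of two words. -/
theorem psi_sq_wordIdem {b : Fin n} {t : Words n (D.size β)} (h : t.1 (prev b) ≠ t.1 b) :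
    psi K Γ lam gam β b * psi K Γ lam gam β b * wordIdem K lam gam hβ t =
      wordIdem K lam gam hβ t := by
  have hb : b.val ≠ 0 := fun hb => h (by rw [prev_first hb])
  rw [← one_mul (wordIdem K lam gam hβ t), ← mul_assoc, mul_one]
  refine mul_dg_congr hβ fun i _ hi => ?_
  rw [(V.isRep hβ hadm).psi_sq _ b (prev_add_one hb), D.ringQ_of_ne]
  rw [← hi] at h
  exact h

theorem wordIdem_mul_psi_sq {b : Fin n} {t : Words n (D.size β)} (h : t.1 (prev b) ≠ t.1 b) :
    wordIdem K lam gam hβ t * (psi K Γ lam gam β b * psi K Γ lam gam β b) =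
      wordIdem K lam gam hβ t := by
  conv_rhs => rw [← psi_sq_wordIdem hβ hadm h, mul_assoc, psi_mul_wordIdem hβ hadm,
    psi_mul_wordIdem_mul hβ hadm, step_step]

/-- A correction term requires equal outer entries. Then the outer letters agree, so by assumption
the middle letter lies in another part and the divided difference is zero. -/
theorem psi_braid_wordIdem {a b e : Fin n} (hab : a.val + 1 = b.val) (hbe : b.val + 1 = e.val)
    {t : Words n (D.size β)} (ht : ¬(t.1 a = t.1 b ∧ t.1 b = t.1 e)) :
    psi K Γ lam gam β e * psi K Γ lam gam β b * psi K Γ lam gam β e * wordIdem K lam gam hβ t =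
      psi K Γ lam gam β b * psi K Γ lam gam β e * psi K Γ lam gam β b *
        wordIdem K lam gam hβ t := by
  have R := V.isRep (K := K) hβ hadm
  refine mul_dg_congr hβ fun i _ hi => ?_
  rw [← hi] at ht
  simp only [Function.comp_apply] at ht
  by_cases h : i a = i e
  · rw [R.braid3_eq a b e hab hbe i h, D.divQ_of_ne, zero_mul, add_zero]
    intro h'
    rw [← h, h'] at ht
    exact ht ⟨rfl, rfl⟩
  · exact R.braid3_ne a b e hab hbe i h

variable (K lam gam) in
/-- `x` is a product of elements `ψ_b` that sorts the word `t` by a chain of descents. -/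
inductive IsDown (hβ : Γ.IsBOrbit β) : Words n (D.size β) → V K Γ lam gam β → Prop
  | nil (t : Words n (D.size β)) (h : Monotone (Fin.val ∘ t.1)) : IsDown hβ t (wordIdem K lam gam hβ t)
  | cons (t : Words n (D.size β)) (b : Fin n) (h : (t.1 b).val < (t.1 (prev b)).val)
      (x : V K Γ lam gam β) (hx : IsDown hβ (step b t) x) : IsDown hβ t (x * psi K Γ lam gam β b)

variable {hβ}

omit hadm in
theorem exists_isDown (t : Words n (D.size β)) : ∃ x, IsDown K lam gam hβ t x := by
  induction t using sort_induction Fin.val with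
  | hs t ht => exact ⟨_, .nil t ht⟩
  | hstep t b hb ih =>
    obtain ⟨x, hx⟩ := ih
    exact ⟨_, .cons t b hb x hx⟩

theorem IsDown.mul_wordIdem {t : Words n (D.size β)} {x : V K Γ lam gam β}
    (h : IsDown K lam gam hβ t x) : x * wordIdem K lam gam hβ t = x := by
  induction h with
  | nil t _ => exact wordIdem_mul_self hβ hadm t
  | cons t b _ x _ ih => rw [mul_assoc, psi_mul_wordIdem hβ hadm, ← mul_assoc, ih]

/-- A confluence argument. Two descents of a word are equal, far apart or adjacent; in the last two
cases both chains can be continued to a common word, where commutation or the braid relation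
compares them. The induction hypothesis allows the given chains to be replaced by these
continuations. -/
theorem IsDown.unique (t : Words n (D.size β)) : ∀ x x', IsDown K lam gam hβ t x →
    IsDown K lam gam hβ t x' → x = x' := by
  have R := V.isRep (K := K) hβ hadm
  induction t using sort_induction_all Fin.val with
  | hp t ih =>
    have hns : ∀ b, (t.1 b).val < (t.1 (prev b)).val → ¬Monotone (Fin.val ∘ t.1) := fun b hb hm =>
      absurd (hm (show prev b ≤ b from Fin.le_def.2 (Nat.sub_le _ _))) (not_le.2 hb)
    have key : ∀ b b' y y', b.val ≤ b'.val → (t.1 b).val < (t.1 (prev b)).val →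
        (t.1 b').val < (t.1 (prev b')).val → IsDown K lam gam hβ (step b t) y →
        IsDown K lam gam hβ (step b' t) y' →
        y * psi K Γ lam gam β b = y' * psi K Γ lam gam β b' := by
      intro b b' y y' hle hb hb' hy hy'
      obtain h | h | h : b = b' ∨ b.val + 1 = b'.val ∨ b.val + 1 < b'.val := by
        rw [Fin.ext_iff]; omega
      · subst h
        rw [ih b hb _ _ hy hy']
      · have hb0 : b.val ≠ 0 := fun h0 => by rw [prev_first h0] at hb; exact lt_irrefl _ hb
        have hab := prev_add_one hb0
        have h1 : prev b ≠ b := fun h1 => by rw [h1] at hb; exact lt_irrefl _ hb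
        have h2 : b ≠ b' := fun h2 => by rw [← h2] at h; omega
        have h3 : prev b ≠ b' := fun h3 => by rw [h3] at hab; omega
        have pb := prev_eq h
        rw [pb] at hb'
        have ba : swp b (prev b) = b := Equiv.swap_apply_left _ _
        have bb : swp b b = prev b := Equiv.swap_apply_right _ _
        have be : swp b b' = b' := Equiv.swap_apply_of_ne_of_ne h3.symm h2.symm
        have ea : swp b' (prev b) = prev b := by
          rw [swp, pb, Equiv.swap_apply_of_ne_of_ne h1 h3]
        have eb : swp b' b = b' := by rw [swp, pb, Equiv.swap_apply_left]
        have ee : swp b' b' = b := by rw [swp, pb, Equiv.swap_apply_right]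
        -- With adjacent descents the three letters are strictly decreasing. Either order of
        -- exchanges therefore leads by descents to the reversed triple, and `z` sorts the word from
        -- there.
        obtain ⟨z, hz⟩ := exists_isDown (K := K) (lam := lam) (gam := gam) (hβ := hβ)
          (step b (step b' (step b t)))
        have e1 := IsDown.cons (step b t) b' (by
          simpa only [step_apply, pb, bb, be] using hb'.trans hb) _
          (IsDown.cons (step b' (step b t)) b (by
            simpa only [step_apply, ba, be, ea, eb] using hb') z hz)
        have e2 := IsDown.cons (step b' t) b (by
          simpa only [step_apply, ea, eb] using hb'.trans hb) _
          (IsDown.cons (step b (step b' t)) b' (by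
            simpa only [step_apply, pb, bb, be, ea, ee] using hb) z
            (by rwa [step_braid hab h]))
        rw [ih b hb _ _ hy e1, ih b' (by rwa [pb]) _ _ hy' e2, ← hz.mul_wordIdem hadm]
        have hbr := psi_braid_wordIdem (K := K) hβ hadm hab h (t := t)
          fun h' => by rw [h'.1] at hb; exact lt_irrefl _ hb
        simp only [mul_assoc, psi_mul_wordIdem hβ hadm, psi_mul_wordIdem_mul hβ hadm,
          step_braid hab h] at hbr
        simp only [mul_assoc, hbr]
      · obtain ⟨h1, h2, h3, h4, h5, h6, h7, h8⟩ := far_ne h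
        obtain ⟨z, hz⟩ := exists_isDown (K := K) (lam := lam) (gam := gam) (hβ := hβ)
          (step b (step b' t))
        have e1 := IsDown.cons (step b t) b' (by
          simp [step_apply, swp, Equiv.swap_apply_of_ne_of_ne, *]) z
          (by rwa [← step_comm h])
        have e2 := IsDown.cons (step b' t) b (by
          simp [step_apply, swp, Equiv.swap_apply_of_ne_of_ne, *]) z hz
        rw [ih b hb _ _ hy e1, ih b' hb' _ _ hy' e2, mul_assoc, mul_assoc, R.psi_comm _ _ h]
    intro x x' hx hx'
    cases hx with
    | nil _ hm =>
      cases hx' with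
      | nil => rfl
      | cons _ b hb => exact absurd hm (hns b hb)
    | cons _ b hb y hy =>
      cases hx' with
      | nil _ hm => exact absurd hm (hns b hb)
      | cons _ b' hb' y' hy' =>
        obtain h | h := le_total b.val b'.val
        · exact key b b' y y' h hb hb' hy hy'
        · exact (key b' b y' y h hb' hb hy' hy).symm

/-- Each descent exchanges different letters, so each factor is inverted by the same $\psi_b$; the
inverse is the product in reverse order. -/
theorem IsDown.exists_inverse {s t : Words n (D.size β)} (hs : Monotone (Fin.val ∘ s.1))
    {x : V K Γ lam gam β} (h : IsDown K lam gam hβ t x) :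
    ∃ x', x' * x = wordIdem K lam gam hβ t ∧ x * x' = wordIdem K lam gam hβ s ∧
      x' * wordIdem K lam gam hβ s = x' := by
  induction h with
  | nil t ht =>
    rw [sorted_unique Fin.val_injective hs ht]
    have := wordIdem_mul_self (K := K) hβ hadm t
    exact ⟨_, this, this, this⟩
  | cons t b hb x hx ih =>
    obtain ⟨x', h1, h2, h3⟩ := ih
    have hne : t.1 (prev b) ≠ t.1 b := fun h => by rw [h] at hb; exact lt_irrefl _ hb
    refine ⟨psi K Γ lam gam β b * x', ?_, ?_, ?_⟩
    · rw [mul_assoc, ← mul_assoc x', h1, ← psi_mul_wordIdem hβ hadm, ← mul_assoc,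
        psi_sq_wordIdem hβ hadm hne]
    · have := wordIdem_mul_psi_sq (K := K) (lam := lam) (gam := gam) hβ hadm (glue_step_ne hne)
      rw [← mul_assoc, mul_assoc x, ← h2]
      conv_lhs => rw [← hx.mul_wordIdem hadm, mul_assoc x, this, hx.mul_wordIdem hadm]
    · rw [mul_assoc, h3]

/-- The matrix units of `V_β` that are attached to the words. -/
theorem exists_wordUnits (hβ : Γ.IsBOrbit β) : ∃ τ : Words n (D.size β) → Words n (D.size β) → V K Γ lam gam β,
    IsMatUnits τ ∧ (∀ t, τ t t = wordIdem K lam gam hβ t) ∧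
      ∀ b t, t.1 (prev b) ≠ t.1 b →
        τ (step b t) t = psi K Γ lam gam β b * wordIdem K lam gam hβ t := by
  obtain ⟨i, hi⟩ := hβ.nonempty
  obtain ⟨s, hs⟩ := exists_sorted Fin.val (D.word hβ hi)
  -- With `T t` sorting $t$ and `U t` its inverse, the matrix unit from $u$ to $t$ goes through the
  -- sorted word: it is `U t * T u`.
  choose T hT using exists_isDown (D := D) (K := K) (lam := lam) (gam := gam) (hβ := hβ)
  choose U hUT hTU hU using fun t => (hT t).exists_inverse hadm hs
  have hT' := fun t => (hT t).mul_wordIdem hadm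
  have hU' : ∀ t, wordIdem K lam gam hβ t * U t = U t := fun t => by
    rw [← hUT, mul_assoc, hTU, hU]
  have hsT : ∀ t, wordIdem K lam gam hβ s * T t = T t := fun t => by
    rw [← hTU t, mul_assoc, hUT, hT']
  have hmul : ∀ t u v w, U t * T u * (U v * T w) = U t * (T u * U v) * T w := fun t u v w => by
    simp only [mul_assoc]
  refine ⟨fun t u => U t * T u, ⟨fun t u v => ?_, fun t u u' v hu => ?_, ?_⟩, hUT, ?_⟩
  · rw [hmul, hTU, hU]
  · rw [hmul, ← hT' u, ← hU' u', mul_assoc (T u), ← mul_assoc (wordIdem _ _ _ _ _),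
      wordIdem_mul_ne hβ hadm hu, zero_mul, mul_zero, mul_zero, zero_mul]
  · simp only [hUT]
    exact sum_wordIdem hβ hadm
  -- At a descent, uniqueness identifies the chosen sorting element with the one that begins with
  -- this exchange. At an ascent the same is applied to the exchanged word, and $\psi_b^2=1$ is
  -- used.
  · have key : ∀ t b, (t.1 b).val < (t.1 (prev b)).val → T t = T (step b t) * psi K Γ lam gam β b :=
      fun t b hb => IsDown.unique hadm t _ _ (hT t) (IsDown.cons t b hb _ (hT _))
    intro b t hne
    have hstep : T t = T (step b t) * psi K Γ lam gam β b := by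
      obtain h | h := lt_or_gt_of_ne (fun h => hne (Fin.ext h))
      · have := key (step b t) b (by simpa [step_apply, swp] using h)
        rw [step_step] at this
        rw [this, mul_assoc, ← hT' t, mul_assoc, wordIdem_mul_psi_sq hβ hadm hne]
      · exact key t b h
    change U _ * T t = _
    rw [hstep, ← mul_assoc, hUT, psi_mul_wordIdem hβ hadm]

end Word

end V

end WordUnits

/-! ### Relations of $V_{\beta^{(j)}}$ in the component of one word -/

section Parts

variable {K : Type w} [CommRing K] {I : Type u} {A : Type v} {Γ : InvQuiver I A}
  {lam : I → ℕ} {gam : I → K} {n : ℕ} {β : Set (Fin n → I)} {d : ℕ} {D : Γ.Decomposition d}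

namespace V

variable (K lam gam) in
/-- The sum of the `e(i)` such that `i` has the word `t` and the entries `f` in `I^(j)`. -/
def partIdem (hβ : Γ.IsBOrbit β) (j : Fin d) (t : Words n (D.size β))
    (f : Fin (D.size β j) → D.verts j) : V K Γ lam gam β :=
  dg K lam gam hβ fun i => D.comp ∘ i = t.1 ∧ ∀ k, i (pos t j k) = f k

variable (hβ : Γ.IsBOrbit β) (hadm : Γ.Admissible lam gam)

include hadm

theorem partIdem_of_notMem {j : Fin d} (t : Words n (D.size β))
    {f : Fin (D.size β j) → D.verts j} (hf : f ∉ D.sub β j) : partIdem K lam gam hβ j t f = 0 := by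
  refine dg_false hβ hadm fun i hi h => hf ?_
  have := (restr_mem_iff hβ (h := h.1)).2 hi j
  rwa [show f = D.restr t i h.1 j from funext fun k => Subtype.ext (h.2 k).symm]

theorem sum_partIdem (j : Fin d) (t : Words n (D.size β)) :
    ∑ᶠ f, partIdem K lam gam hβ j t f = wordIdem K lam gam hβ t := by
  rw [finsum_eq_sum_of_support_subset (s := (isBOrbit_sub (D := D) hβ j).finite.toFinset)]
  · refine ext_idem hβ hadm fun i hi => ?_
    rw [Finset.sum_mul]
    by_cases ht : D.comp ∘ i = t.1
    · rw [wordIdem, dg_mul_idem hβ hadm ht, Finset.sum_eq_single (D.restr t i ht j)]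
      · exact dg_mul_idem hβ hadm ⟨ht, fun k => rfl⟩
      · intro f _ hf
        exact dg_mul_idem_of_not hβ hadm fun h =>
          hf (funext fun k => Subtype.ext (h.2 k).symm)
      · intro h
        exact absurd ((Set.Finite.mem_toFinset _).2 ((restr_mem_iff hβ (h := ht)).2 hi j)) h
    · rw [wordIdem, dg_mul_idem_of_not hβ hadm ht]
      exact Finset.sum_eq_zero fun f _ => dg_mul_idem_of_not hβ hadm fun h => ht h.1
  · intro f hf
    rw [Set.Finite.coe_toFinset]
    by_contra hn
    exact hf (partIdem_of_notMem hβ hadm t hn)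

theorem psi_mul_partIdem {j : Fin d} {t : Words n (D.size β)} {k : Fin (D.size β j)}
    (ht : t.1 (prev (pos t j k)) = t.1 (pos t j k)) (f : Fin (D.size β j) → D.verts j) :
    psi K Γ lam gam β (pos t j k) * partIdem K lam gam hβ j t f =
      partIdem K lam gam hβ j t (move (D.part j) k f) * psi K Γ lam gam β (pos t j k) := by
  obtain ⟨h1, h2⟩ := prev_pos ht
  rw [partIdem, psi_mul_dg hβ hadm]
  congr 1
  refine dg_congr hβ fun i _ => and_congr (by rw [comp_move_iff, step_eq_self ht]) ?_
  by_cases hk : k.val = 0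
  · rw [move_first hk, move_first (h2.2 hk)]
    refine forall_congr' fun m => ?_
    by_cases hm : m = k
    · subst hm
      rw [Function.update_self, Function.update_self]
      exact ⟨fun h => by rw [← Γ.inv_inv (i _), h]; rfl, fun h => by rw [h]; exact Γ.inv_inv _⟩
    · rw [Function.update_of_ne hm, Function.update_of_ne ((pos_strictMono t j).injective.ne hm)]
  · rw [move, move, if_neg hk, if_neg (h2.not.2 hk), h1]
    refine ⟨fun h m => ?_, fun h m => ?_⟩
    · rw [Function.comp_apply, ← h, Function.comp_apply, pos_swap, Equiv.swap_apply_self]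
    · rw [Function.comp_apply, pos_swap, h, Function.comp_apply, Equiv.swap_apply_self]

/-- The relations of `V_{β^(j)}` hold in the component of a word that begins with the letters `j`. -/
theorem isRep_corner {j : Fin d} {s : Words n (D.size β)} (hs : Monotone (keyMin j ∘ s.1)) :
    IsRep K (D.part j) (fun i => lam i) (fun i => gam i) (D.sub β j) (partIdem K lam gam hβ j s)
      (fun k => y K Γ lam gam β (pos s j k)) (fun k => psi K Γ lam gam β (pos s j k))
      (wordIdem K lam gam hβ s) := by
  have R := V.isRep (K := K) hβ hadm
  -- The occurrences of $j$ fill an initial segment of positions. So first and consecutive indices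
  -- of the part are first and consecutive positions of the tuple, and the relations can be copied,
  -- those of $\psi_0$ included.
  have hv : ∀ k, (pos s j k).val = k.val := pos_sorted_min (keyMin_injective j) hs (keyMin_self j)
  have hab' : ∀ {a b : Fin (D.size β j)}, a.val + 1 = b.val →
      (pos s j a).val + 1 = (pos s j b).val := fun h => by rw [hv, hv, h]
  have hlet : ∀ k, s.1 (prev (pos s j k)) = s.1 (pos s j k) := fun k => by
    by_cases hk : k.val = 0
    · rw [prev_first (by rw [hv, hk])]
    · rw [prev_eq (hab' (prev_add_one hk)), letter_pos, letter_pos]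
  refine
    { E_off := fun f hf => partIdem_of_notMem hβ hadm s hf
      sum_E := sum_partIdem hβ hadm j s
      E_mul_self := fun f => ?_
      E_mul_ne := fun f g hfg => ?_
      y_comm := fun a b => R.y_comm _ _
      y_e := fun a f => y_mul_dg hβ hadm _
      psi_e := fun a b hab f => ?_
      psi_y_left := fun a b hab f hf => ?_
      psi_y_right := fun a b hab f hf => ?_
      psi_y := fun a b hab c f hf => ?_
      psi_comm := fun a b hab => R.psi_comm _ _ (by rw [hv, hv]; exact hab)
      psi_sq := fun a b hab f => ?_
      braid3_eq := fun a b c hab hbc f hf => ?_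
      braid3_ne := fun a b c hab hbc f hf => ?_
      psi0_e := fun o ho f => ?_
      psi0_y1 := fun o ho f => ?_
      psi0_y := fun o ho a ha => R.psi0_y _ (by rw [hv, ho]) _
        ((pos_strictMono s j).injective.ne ha)
      psi0_sq := fun o ho f hf => ?_
      psi0_sq_zero := fun o ho f hf => ?_
      braid4_theta := fun o t ho ht f hf hf' => ?_
      braid4_other := fun o t ho ht f hf => ?_ }
  · rw [partIdem, dg_mul_dg hβ hadm]
    exact dg_congr hβ fun i _ => and_self_iff
  · rw [partIdem, partIdem, dg_mul_dg hβ hadm]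
    exact dg_false hβ hadm fun i _ hi =>
      hfg (funext fun k => Subtype.ext ((hi.1.2 k).symm.trans (hi.2.2 k)))
  · rw [psi_mul_partIdem hβ hadm (hlet b), move_of_succ hab]
  · have := mul_dg_congr hβ (x' := y K Γ lam gam β (pos s j b) * psi K Γ lam gam β (pos s j b) - 1)
      fun i hi (hq : D.comp ∘ i = s.1 ∧ ∀ k, i (pos s j k) = f k) =>
        (R.psi_y_left _ _ (hab' hab) i (by rw [hq.2, hq.2, hf])).trans (by rw [sub_mul, one_mul])
    rwa [sub_mul, one_mul] at this
  · have := mul_dg_congr hβ (x' := y K Γ lam gam β (pos s j a) * psi K Γ lam gam β (pos s j b) + 1)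
      fun i hi (hq : D.comp ∘ i = s.1 ∧ ∀ k, i (pos s j k) = f k) =>
        (R.psi_y_right _ _ (hab' hab) i (by rw [hq.2, hq.2, hf])).trans (by rw [add_mul, one_mul])
    rwa [add_mul, one_mul] at this
  · refine mul_dg_congr hβ fun i hi hq => ?_
    rw [R.psi_y _ _ (hab' hab) _ i, pos_swap]
    intro h
    rw [hq.2, hq.2, SetCoe.ext_iff] at h
    exact ⟨(pos_strictMono s j).injective.ne (hf h).1, (pos_strictMono s j).injective.ne (hf h).2⟩
  · refine mul_dg_congr hβ fun i hi hq => ?_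
    rw [R.psi_sq _ _ (hab' hab), hq.2, hq.2, D.ringQ_part]
  · have := mul_dg_congr hβ
      (x' := psi K Γ lam gam β (pos s j b) * psi K Γ lam gam β (pos s j c) *
        psi K Γ lam gam β (pos s j b) + Γ.divQ (f a) (f b) (y K Γ lam gam β (pos s j a))
          (y K Γ lam gam β (pos s j b)) (y K Γ lam gam β (pos s j c)))
      fun i hi (hq : D.comp ∘ i = s.1 ∧ ∀ k, i (pos s j k) = f k) =>
        (R.braid3_eq _ _ _ (hab' hab) (hab' hbc) i (by rw [hq.2, hq.2, hf])).trans
          (by rw [add_mul, hq.2, hq.2])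
    rwa [add_mul, ← D.divQ_part] at this
  · refine mul_dg_congr hβ fun i hi hq => R.braid3_ne _ _ _ (hab' hab) (hab' hbc) i ?_
    rw [hq.2, hq.2]
    exact fun h => hf (Subtype.ext h)
  · rw [psi_mul_partIdem hβ hadm (hlet o), move_first ho]
  · have := mul_dg_congr hβ (x' := (2 * gam (f o)) • 1 - y K Γ lam gam β (pos s j o) *
        psi K Γ lam gam β (pos s j o))
      fun i hi (hq : D.comp ∘ i = s.1 ∧ ∀ k, i (pos s j k) = f k) =>
        (R.psi0_y1 _ (by rw [hv, ho]) i).trans (by rw [sub_mul, hq.2, smul_mul_assoc, one_mul])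
    rwa [sub_mul, smul_mul_assoc, one_mul] at this
  · refine mul_dg_congr hβ fun i hi hq => ?_
    rw [R.psi0_sq _ (by rw [hv, ho]) i (by rw [hq.2]; exact hf), hq.2]
    rfl
  · have := mul_dg_congr hβ (x' := 0)
      fun i hi (hq : D.comp ∘ i = s.1 ∧ ∀ k, i (pos s j k) = f k) =>
        (R.psi0_sq_zero _ (show (pos s j o).val = 0 by rw [hv, ho]) i
          (by rw [hq.2]; exact hf)).trans (zero_mul _).symm
    rwa [zero_mul] at this
  · have := mul_dg_congr hβ
      (x' := psi K Γ lam gam β (pos s j t) * psi K Γ lam gam β (pos s j o) *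
        psi K Γ lam gam β (pos s j t) * psi K Γ lam gam β (pos s j o) -
        (-1) ^ lam (Γ.inv (f o)) * homSum (lam (f o) + lam (Γ.inv (f o)))
          (-y K Γ lam gam β (pos s j o)) (y K Γ lam gam β (pos s j t)) *
            psi K Γ lam gam β (pos s j t))
      fun i hi (hq : D.comp ∘ i = s.1 ∧ ∀ k, i (pos s j k) = f k) =>
        (R.braid4_theta _ _ (show (pos s j o).val = 0 by rw [hv, ho])
          (show (pos s j t).val = 1 by rw [hv, ht]) i (by rw [hq.2]; exact hf)
          (by rw [hq.2, hq.2, ← hf']; rfl)).trans (by rw [sub_mul, hq.2])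
    rwa [sub_mul] at this
  · have := mul_dg_congr hβ
      (x' := psi K Γ lam gam β (pos s j t) * psi K Γ lam gam β (pos s j o) *
        psi K Γ lam gam β (pos s j t) * psi K Γ lam gam β (pos s j o) +
        gam (f t) • (Γ.oddQ (f t) (f o) (y K Γ lam gam β (pos s j o))
          (y K Γ lam gam β (pos s j t)) * psi K Γ lam gam β (pos s j o) -
            gam (f o) • Γ.oddQ' (f t) (f o) (y K Γ lam gam β (pos s j o))
              (y K Γ lam gam β (pos s j t))))
      fun i hi (hq : D.comp ∘ i = s.1 ∧ ∀ k, i (pos s j k) = f k) =>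
        (R.braid4_other _ _ (show (pos s j o).val = 0 by rw [hv, ho])
          (show (pos s j t).val = 1 by rw [hv, ht]) i (by
            rw [hq.2, hq.2]
            exact fun h => hf ⟨h.1, Subtype.ext h.2⟩)).trans
          (by rw [add_mul, hq.2, hq.2, smul_mul_assoc])
    rwa [add_mul, smul_mul_assoc, ← D.oddQ_part, ← D.oddQ'_part] at this

end V

end Parts

theorem letter_prev_pos_of_sorted {n d : ℕ} {c : Fin d → ℕ} {j : Fin d} {s : Words n c}
    (hs : Monotone (keyMin j ∘ s.1)) (k : Fin (c j)) :
    s.1 (prev (pos s j k)) = s.1 (pos s j k) := by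
  have hv := pos_sorted_min (keyMin_injective j) hs (keyMin_self j)
  by_cases hk : k.val = 0
  · rw [prev_first (by rw [hv, hk])]
  · rw [prev_eq (show (pos s j (prev k)).val + 1 = _ by rw [hv, hv, prev_add_one hk]),
      letter_pos, letter_pos]

/-! ### The copies of the algebras $V_{\beta^{(j)}}$ in $V_\beta$ -/

section Parts

variable {K : Type w} [CommRing K] {I : Type u} {A : Type v} {Γ : InvQuiver I A}
  {lam : I → ℕ} {gam : I → K} {n : ℕ} {β : Set (Fin n → I)} {d : ℕ} {D : Γ.Decomposition d}

namespace V

theorem partIdem_mul_wordIdem (hβ : Γ.IsBOrbit β) (hadm : Γ.Admissible lam gam) {j : Fin d}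
    (t : Words n (D.size β)) (f : Fin (D.size β j) → D.verts j) :
    partIdem K lam gam hβ j t f * wordIdem K lam gam hβ t = partIdem K lam gam hβ j t f := by
  rw [wordIdem, partIdem, dg_mul_dg hβ hadm]
  exact dg_congr hβ fun i _ => by tauto

theorem wordIdem_mul_partIdem (hβ : Γ.IsBOrbit β) (hadm : Γ.Admissible lam gam) {j : Fin d}
    (t : Words n (D.size β)) (f : Fin (D.size β j) → D.verts j) :
    wordIdem K lam gam hβ t * partIdem K lam gam hβ j t f = partIdem K lam gam hβ j t f := by
  rw [wordIdem, partIdem, dg_mul_dg hβ hadm]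
  exact dg_congr hβ fun i _ => by tauto

open Classical in
theorem mul_dg_mem_grade (hβ : Γ.IsBOrbit β) {p : (Fin n → I) → Prop} {x : V K Γ lam gam β} {k : ℤ}
    (h : ∀ i, p i → x * idem K Γ lam gam β i ∈ grade K Γ lam gam β k) :
    x * dg K lam gam hβ p ∈ grade K Γ lam gam β k := by
  rw [dg, Finset.mul_sum]
  exact Submodule.sum_mem _ fun i hi => h i (Finset.mem_filter.1 hi).2

/-- The matrix units of `V_β` that are attached to the words. -/
structure IsWordUnits (hβ : Γ.IsBOrbit β)
    (τ : Words n (D.size β) → Words n (D.size β) → V K Γ lam gam β) : Prop extends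
    IsMatUnits τ where
  diag : ∀ t, τ t t = wordIdem K lam gam hβ t
  step : ∀ b t, t.1 (prev b) ≠ t.1 b →
    τ (step b t) t = psi K Γ lam gam β b * wordIdem K lam gam hβ t

theorem exists_isWordUnits (hβ : Γ.IsBOrbit β) (hadm : Γ.Admissible lam gam) :
    ∃ τ : Words n (D.size β) → Words n (D.size β) → V K Γ lam gam β, IsWordUnits hβ τ := by
  obtain ⟨τ, h1, h2, h3⟩ := exists_wordUnits (K := K) (D := D) hadm hβ
  exact ⟨τ, ⟨h1, h2, h3⟩⟩

variable {hβ : Γ.IsBOrbit β} (hadm : Γ.Admissible lam gam)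
  {τ : Words n (D.size β) → Words n (D.size β) → V K Γ lam gam β}

namespace IsWordUnits

theorem wordIdem_mul (h : IsWordUnits hβ τ) (s t : Words n (D.size β)) :
    wordIdem K lam gam hβ s * τ s t = τ s t := by rw [← h.diag, h.mul]

/-- A property of matrix units holds if it holds for the diagonal and for the elements `ψ_b`. -/
theorem induction (h : IsWordUnits hβ τ)
    {p : Words n (D.size β) → Words n (D.size β) → V K Γ lam gam β → Prop}
    (diag : ∀ t, p t t (wordIdem K lam gam hβ t))
    (mul : ∀ s t u x x', p s t x → p t u x' → p s u (x * x'))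
    (hstep : ∀ t b, t.1 (prev b) ≠ t.1 b →
      p (QuiverHeckeB.step b t) t (psi K Γ lam gam β b * wordIdem K lam gam hβ t))
    (s t : Words n (D.size β)) : p s t (τ s t) := by
  refine words_connected (p := fun s t => p s t (τ s t)) (fun t => ?_) (fun s t u h1 h2 => ?_)
    (fun t b hb => ?_) s t
  · rw [h.diag]; exact diag t
  · rw [← h.mul s t u]; exact mul _ _ _ _ _ h1 h2
  · rw [h.step b t hb]; exact hstep t b hb

/-- The matrix units are built from exchanges of different letters, and $\psi_be(i)$ then has degree
$i_b\cdot i_{b+1}=0$. -/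
theorem mem_grade (h : IsWordUnits hβ τ) (s t : Words n (D.size β)) :
    τ s t ∈ grade K Γ lam gam β 0 := by
  refine h.induction (p := fun _ _ x => x ∈ grade K Γ lam gam β 0) (fun t => dg_mem_grade hβ)
    (fun s t u x x' hx hx' => ?_) (fun t b hb => ?_) s t
  · have := mul_mem_grade hx hx'
    rwa [add_zero] at this
  · refine mul_dg_mem_grade hβ fun i hi => ?_
    have hb0 : b.val ≠ 0 := fun h0 => hb (by rw [prev_first h0])
    have h1 := psi_mem_grade (Γ := Γ) (lam := lam) (gam := gam) (β := β) b i
    rw [← hi] at hb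
    rwa [psiDeg_of_succ lam gam (prev_add_one hb0), D.deg₂_of_comp_ne hb] at h1

include hadm

/-- Exchanges of different letters slide past the $y$'s without a correction term, and each
occurrence of a letter keeps its number. -/
theorem y_mul (h : IsWordUnits hβ τ) (s t : Words n (D.size β)) (j : Fin d)
    (k : Fin (D.size β j)) :
    y K Γ lam gam β (pos s j k) * τ s t = τ s t * y K Γ lam gam β (pos t j k) := by
  refine h.induction (p := fun s t x => y K Γ lam gam β (pos s j k) * x =
    x * y K Γ lam gam β (pos t j k)) (fun t => y_mul_dg hβ hadm _)
    (fun s t u x x' hx hx' => ?_) (fun t b hb => ?_) s t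
  · rw [← mul_assoc, hx, mul_assoc, hx', mul_assoc]
  · have hb0 : b.val ≠ 0 := fun h0 => hb (by rw [prev_first h0])
    rw [mul_assoc _ _ (y _ _ _ _ _ _), wordIdem, ← y_mul_dg hβ hadm, ← mul_assoc, ← mul_assoc]
    refine mul_dg_congr hβ fun i _ hi => ?_
    rw [(V.isRep hβ hadm).psi_y _ b (prev_add_one hb0), pos_step hb]
    · rfl
    · intro h'
      rw [← hi] at hb
      exact absurd (congrArg D.comp h') hb

theorem partIdem_mul (h : IsWordUnits hβ τ) (s t : Words n (D.size β)) (j : Fin d)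
    (f : Fin (D.size β j) → D.verts j) :
    partIdem K lam gam hβ j s f * τ s t = τ s t * partIdem K lam gam hβ j t f := by
  refine h.induction (p := fun s t x => partIdem K lam gam hβ j s f * x =
    x * partIdem K lam gam hβ j t f) (fun t => by
      rw [partIdem_mul_wordIdem hβ hadm, wordIdem_mul_partIdem hβ hadm])
    (fun s t u x x' hx hx' => ?_) (fun t b hb => ?_) s t
  · rw [← mul_assoc, hx, mul_assoc, hx', mul_assoc]
  · have hb0 : b.val ≠ 0 := fun h0 => hb (by rw [prev_first h0])
    rw [mul_assoc _ _ (partIdem _ _ _ _ _ _ _), wordIdem_mul_partIdem hβ hadm, psi_mul_wordIdem hβ hadm, ← mul_assoc,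
      partIdem_mul_wordIdem hβ hadm, partIdem, partIdem, psi_mul_dg hβ hadm]
    congr 1
    refine dg_congr hβ fun i _ => and_congr comp_move_iff.symm (forall_congr' fun k => ?_)
    rw [pos_step hb, move, if_neg hb0]
    rfl

end IsWordUnits

variable (hβ) in
/-- The conditions that determine the embedding of `V_{β^(j)}` into `V_β`: compatibility with the
matrix units and the values at the generators in the component of a word. -/
structure IsPartHom (τ : Words n (D.size β) → Words n (D.size β) → V K Γ lam gam β) (j : Fin d)
    (F : VPart K D lam gam β j →ₐ[K] V K Γ lam gam β) : Prop where
  comm : ∀ x s t, F x * τ s t = τ s t * F x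
  idem : ∀ f t, F (V.idem K _ _ _ _ f) * wordIdem K lam gam hβ t = partIdem K lam gam hβ j t f
  y : ∀ k t, F (V.y K _ _ _ _ k) * wordIdem K lam gam hβ t =
    V.y K Γ lam gam β (pos t j k) * wordIdem K lam gam hβ t
  psi : ∀ k t, t.1 (prev (pos t j k)) = t.1 (pos t j k) →
    F (V.psi K _ _ _ _ k) * wordIdem K lam gam hβ t =
      V.psi K Γ lam gam β (pos t j k) * wordIdem K lam gam hβ t

include hadm

-- An element that commutes with the matrix units is determined on the component of $t$ by its value
-- on a neighbouring component, through conjugation by $\psi_b$.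
omit hadm in
theorem IsWordUnits.mul_wordIdem_step (h : IsWordUnits hβ τ) {t : Words n (D.size β)} {b : Fin n}
    (hb : t.1 (prev b) ≠ t.1 b) {x z : V K Γ lam gam β} (hx : ∀ u v, x * τ u v = τ u v * x)
    (hz : x * wordIdem K lam gam hβ (QuiverHeckeB.step b t) =
      z * wordIdem K lam gam hβ (QuiverHeckeB.step b t)) :
    x * wordIdem K lam gam hβ t =
      psi K Γ lam gam β b * (z * (psi K Γ lam gam β b * wordIdem K lam gam hβ t)) := by
  have h1 := h.step b (QuiverHeckeB.step b t) (glue_step_ne hb)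
  rw [step_step] at h1
  have h2 : wordIdem K lam gam hβ (QuiverHeckeB.step b t) * x =
      x * wordIdem K lam gam hβ (QuiverHeckeB.step b t) := by rw [← h.diag, hx]
  rw [← h.step b t hb, ← h.diag t, ← h.mul t (QuiverHeckeB.step b t) t, ← mul_assoc, hx, h1,
    mul_assoc (psi _ _ _ _ _ _), h2, hz, mul_assoc, mul_assoc, h.wordIdem_mul]

/-- The formula is propagated from a word in which the letters $j$ come first to every word where it
makes sense. A descent disjoint from the positions that $\psi_b$ affects is conjugated away by
commutation; one that separates the pair $j,j$ is handled together with a second exchange, by the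
braid relation. -/
theorem IsWordUnits.psi_local (h : IsWordUnits hβ τ) {j : Fin d} {k : Fin (D.size β j)}
    {x : V K Γ lam gam β} (hx : ∀ u v, x * τ u v = τ u v * x)
    (hs : ∀ s : Words n (D.size β), Monotone (keyMin j ∘ s.1) → x * wordIdem K lam gam hβ s =
      psi K Γ lam gam β (pos s j k) * wordIdem K lam gam hβ s)
    (t : Words n (D.size β)) (ht : t.1 (prev (pos t j k)) = t.1 (pos t j k)) :
    x * wordIdem K lam gam hβ t =
      psi K Γ lam gam β (pos t j k) * wordIdem K lam gam hβ t := by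
  let p : Words n (D.size β) → Prop := fun t => t.1 (prev (pos t j k)) = t.1 (pos t j k) →
    x * wordIdem K lam gam hβ t = psi K Γ lam gam β (pos t j k) * wordIdem K lam gam hβ t
  -- The induction also carries the claim one descent further, because the braid case goes down two
  -- exchanges at once and the formula makes no sense at the word in between.
  suffices H : ∀ t, p t ∧ ∀ b, keyMin j (t.1 b) < keyMin j (t.1 (prev b)) →
    p (QuiverHeckeB.step b t) from (H t).1 ht
  intro t
  induction t using sort_induction_all (keyMin j) with
  | hp t ih =>
    refine ⟨fun ht => ?_, fun b hb => (ih b hb).1⟩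
    by_cases hm : Monotone (keyMin j ∘ t.1)
    · exact hs t hm
    obtain ⟨c, hc⟩ := exists_descent hm
    have R := V.isRep (K := K) hβ hadm
    have hne : t.1 (prev c) ≠ t.1 c := fun h => by rw [h] at hc; exact lt_irrefl _ hc
    have hpc : t.1 (prev c) ≠ j := fun h => by
      rw [h] at hc; exact absurd (keyMin_self j _) (not_le.2 hc)
    have hsq := psi_sq_wordIdem (K := K) (lam := lam) (gam := gam) hβ hadm hne
    have hbj := letter_pos t j k
    have hu := pos_step hne j k
    generalize hbdef : pos t j k = b at *
    have hpb : t.1 (prev b) = j := ht.trans hbj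
    have h1 : b ≠ prev c := fun h => hpc (by rw [← h, hbj])
    have h2 : prev b ≠ prev c := fun h => hpc (by rw [← h, hpb])
    have h3 : b ≠ c := fun h => h2 (by rw [h])
    have hc0 : c.val ≠ 0 := fun h0 => hne (by rw [prev_first h0])
    -- Here the positions $c-1,c,b$ carry $x,j,j$ with $x\ne j$. Exchanging at $c$ and then at $b$
    -- gives $j,j,x$, where the formula reads $\psi_c$. Conjugating back gives
    -- $\psi_c\psi_b\psi_c\psi_b\psi_c=\psi_c^2\psi_b\psi_c^2=\psi_b$ on the component of $t$.
    by_cases h4 : prev b = c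
    · have hb0 : b.val ≠ 0 := fun h0 => h3 (by rw [← h4, prev_first h0])
      have hcb := prev_add_one hb0
      rw [h4] at hcb
      have cb : swp c b = b := by rw [swp, Equiv.swap_apply_of_ne_of_ne h1 h3]
      have cc : swp c c = prev c := Equiv.swap_apply_right _ _
      have bb : swp b b = c := by rw [swp, h4, Equiv.swap_apply_right]
      have bc : swp b c = b := by rw [swp, h4, Equiv.swap_apply_left]
      have bp : swp b (prev c) = prev c := by
        rw [swp, h4, Equiv.swap_apply_of_ne_of_ne _ h1.symm]
        intro h
        rw [Fin.ext_iff] at h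
        have := prev_add_one hc0
        omega
      have cp : swp c (prev c) = c := Equiv.swap_apply_left _ _
      rw [cb] at hu
      have hub : (QuiverHeckeB.step c t).1 (prev b) ≠ (QuiverHeckeB.step c t).1 b := by
        rw [h4, step_apply, step_apply, cc, cb, hbj]; exact hpc
      have hv := pos_step hub j k
      rw [hu, bb] at hv
      have e1 := (ih c hc).2 b (by
        rw [h4, step_apply, step_apply, cc, cb, hbj]
        exact lt_of_le_of_ne (keyMin_self j _) fun h => hpc (keyMin_injective j h).symm) (by
          rw [hv, step_apply, step_apply, step_apply, step_apply, bp, bc, cp, cb, ← h4, ht])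
      rw [hv] at e1
      have e2 := h.mul_wordIdem_step hub hx e1
      have e3 := psi_braid_wordIdem (K := K) (lam := lam) (gam := gam) hβ hadm (prev_add_one hc0)
        hcb (t := QuiverHeckeB.step c t) (by
          rw [step_apply, step_apply, step_apply, cc, cb, hbj]
          exact fun h => hpc h.2)
      rw [← mul_assoc, ← mul_assoc, e3] at e2
      rw [h.mul_wordIdem_step hne hx e2]
      have e4 := psi_mul_wordIdem (K := K) (lam := lam) (gam := gam) hβ hadm b t
      rw [step_eq_self ht] at e4
      simp only [mul_assoc] at hsq ⊢
      rw [hsq, e4, ← mul_assoc, ← mul_assoc, mul_assoc (psi _ _ _ _ _ _), hsq]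
    · have cb : swp c b = b := by rw [swp, Equiv.swap_apply_of_ne_of_ne h1 h3]
      have cp : swp c (prev b) = prev b := by rw [swp, Equiv.swap_apply_of_ne_of_ne h2 h4]
      rw [cb] at hu
      have e1 := (ih c hc).1 (by rw [hu, step_apply, step_apply, cb, cp, ht])
      rw [hu] at e1
      rw [h.mul_wordIdem_step hne hx e1]
      have e2 : psi K Γ lam gam β b * psi K Γ lam gam β c =
          psi K Γ lam gam β c * psi K Γ lam gam β b := by
        have hp := prev_add_one hc0
        simp only [ne_eq, Fin.ext_iff, prev] at h1 h3 h4 hp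
        obtain h | h := lt_or_gt_of_ne h3
        · exact R.psi_comm _ _ (by omega)
        · exact (R.psi_comm _ _ (by omega)).symm
      rw [← mul_assoc, ← mul_assoc, ← e2, mul_assoc, mul_assoc, ← mul_assoc (psi _ _ _ _ _ c), hsq]

/-- At a word `s` that begins with the letters $j$ the relations hold by `isRep_corner`. Averaging
over the matrix units turns the elements at `s` into elements of $V_\beta$ that commute with all
units, and the universal property gives the homomorphism; `psi_local` describes it at other words.
-/
theorem exists_partHom (h : IsWordUnits hβ τ) (j : Fin d) : ∃ F, IsPartHom hβ τ j F := by
  obtain ⟨i, hi⟩ := hβ.nonempty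
  obtain ⟨s, hs⟩ := exists_sorted (keyMin j) (D.word hβ hi)
  have R₀ := isRep_corner (K := K) hβ hadm hs
  have hlet := letter_prev_pos_of_sorted hs
  have cE : ∀ f, τ s s * partIdem K lam gam hβ j s f = partIdem K lam gam hβ j s f * τ s s :=
    fun f => (h.partIdem_mul hadm s s j f).symm
  have cY : ∀ k, τ s s * y K Γ lam gam β (pos s j k) = y K Γ lam gam β (pos s j k) * τ s s :=
    fun k => (h.y_mul hadm s s j k).symm
  have cP : ∀ k, τ s s * psi K Γ lam gam β (pos s j k) = psi K Γ lam gam β (pos s j k) * τ s s :=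
    fun k => by rw [h.diag, psi_mul_wordIdem hβ hadm, step_eq_self (hlet k)]
  -- All elements involved commute with $\tau_{ss}$, so the relations hold inside the subalgebra on
  -- which the averaging map is multiplicative.
  have R₁ : IsRep K (D.part j) (fun i => lam i) (fun i => gam i) (D.sub β j)
      (fun f => (⟨_, IsMatUnits.mem_corner.2 (cE f)⟩ : IsMatUnits.corner K τ s))
      (fun k => ⟨_, IsMatUnits.mem_corner.2 (cY k)⟩) (fun k => ⟨_, IsMatUnits.mem_corner.2 (cP k)⟩)
      ⟨τ s s, IsMatUnits.mem_corner.2 rfl⟩ :=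
    IsRep.of_map (IsMatUnits.corner K τ s).val Subtype.val_injective
      (isBOrbit_sub (D := D) hβ j).finite (by
        rw [← h.diag] at R₀
        exact R₀)
  have R₂ := R₁.map (isBOrbit_sub (D := D) hβ j).finite (h.avg K s)
  rw [h.avg_diag] at R₂
  obtain ⟨F, hE, hY, hP⟩ := V.exists_lift (isBOrbit_sub hβ j) (D.admissible_part hadm j) R₂
  have comm : ∀ x u t, F x * τ u t = τ u t * F x := fun x u t => by
    have := V.subalgebra_eq_top (Subalgebra.comap F (Subalgebra.centralizer K {τ u t}))
      (fun f _ => ?_) (fun k => ?_) (fun k => ?_) x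
    · rw [Subalgebra.mem_comap, Subalgebra.mem_centralizer_iff] at this
      exact (this _ rfl).symm
    · rw [Subalgebra.mem_comap, Subalgebra.mem_centralizer_iff]
      rintro _ rfl
      rw [hE, h.avg_mul, h.mul_avg]
    · rw [Subalgebra.mem_comap, Subalgebra.mem_centralizer_iff]
      rintro _ rfl
      rw [hY, h.avg_mul, h.mul_avg]
    · rw [Subalgebra.mem_comap, Subalgebra.mem_centralizer_iff]
      rintro _ rfl
      rw [hP, h.avg_mul, h.mul_avg]
  refine ⟨F, comm, fun f t => ?_, fun k t => ?_, fun k => ?_⟩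
  · rw [hE, ← h.diag, h.avg_mul]
    change τ t s * partIdem K lam gam hβ j s f * τ s t = _
    rw [← h.partIdem_mul hadm, mul_assoc, h.mul, h.diag, partIdem_mul_wordIdem hβ hadm]
  · rw [hY, ← h.diag, h.avg_mul]
    change τ t s * y K Γ lam gam β _ * τ s t = _
    rw [← h.y_mul hadm, mul_assoc, h.mul]
  · refine h.psi_local hadm (comm _) fun t ht => ?_
    rw [sorted_unique (keyMin_injective j) ht hs, hP, ← h.diag, h.avg_mul]
    change τ s s * psi K Γ lam gam β _ * τ s s = _
    rw [cP, mul_assoc, h.mul]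

end V

end Parts

/-! ### Commutation of the copies for different parts -/

section Commutation

variable {K : Type w} [CommRing K] {I : Type u} {A : Type v} {Γ : InvQuiver I A}
  {lam : I → ℕ} {gam : I → K} {n : ℕ} {β : Set (Fin n → I)} {d : ℕ} {D : Γ.Decomposition d}

namespace V

section Local

variable (hβ : Γ.IsBOrbit β) (hadm : Γ.Admissible lam gam) {t : Words n (D.size β)}
  {j l : Fin d} {k : Fin (D.size β j)} {m : Fin (D.size β l)}

include hβ hadm

theorem psi_y_wordIdem (hjl : j ≠ l) (ht : t.1 (prev (pos t j k)) = t.1 (pos t j k)) :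
    psi K Γ lam gam β (pos t j k) * y K Γ lam gam β (pos t l m) * wordIdem K lam gam hβ t =
      y K Γ lam gam β (pos t l m) * psi K Γ lam gam β (pos t j k) * wordIdem K lam gam hβ t := by
  have R := V.isRep (K := K) hβ hadm
  have h1 : pos t l m ≠ pos t j k := fun h => hjl (by rw [← letter_pos t l m, h, letter_pos])
  have h2 : pos t l m ≠ prev (pos t j k) := fun h => hjl (by
    rw [← letter_pos t l m, h, ht, letter_pos])
  by_cases hb : (pos t j k).val = 0
  · rw [R.psi0_y _ hb _ h1]
  · refine mul_dg_congr hβ fun i _ _ => ?_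
    rw [R.psi_y _ _ (prev_add_one hb) _ _ fun _ => ⟨h2, h1⟩, Equiv.swap_apply_of_ne_of_ne h2 h1]

theorem psi_mul_partIdem_other (hjl : j ≠ l) (ht : t.1 (prev (pos t j k)) = t.1 (pos t j k))
    (f : Fin (D.size β l) → D.verts l) :
    psi K Γ lam gam β (pos t j k) * partIdem K lam gam hβ l t f =
      partIdem K lam gam hβ l t f * psi K Γ lam gam β (pos t j k) := by
  have h1 : ∀ m, pos t l m ≠ pos t j k := fun m h => hjl (by
    rw [← letter_pos t l m, h, letter_pos])
  have h2 : ∀ m, pos t l m ≠ prev (pos t j k) := fun m h => hjl (by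
    rw [← letter_pos t l m, h, ht, letter_pos])
  rw [partIdem, psi_mul_dg hβ hadm]
  congr 1
  refine dg_congr hβ fun i _ => and_congr (comp_move_iff.trans (by rw [step_eq_self ht]))
    (forall_congr' fun m => ?_)
  unfold move
  split_ifs
  · rw [Function.update_of_ne (h1 m)]
  · rw [Function.comp_apply, Equiv.swap_apply_of_ne_of_ne (h2 m) (h1 m)]

/-- When the first two letters differ, $\theta(i_1)\ne i_2$, so the relation is of the second type;
its correction terms vanish across parts. -/
theorem psi_psi_wordIdem_of_first {o a : Fin n} (ho : o.val = 0) (ha : a.val = 1)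
    (ht : t.1 o ≠ t.1 a) :
    psi K Γ lam gam β o * psi K Γ lam gam β a * psi K Γ lam gam β o * psi K Γ lam gam β a *
        wordIdem K lam gam hβ t =
      psi K Γ lam gam β a * psi K Γ lam gam β o * psi K Γ lam gam β a * psi K Γ lam gam β o *
        wordIdem K lam gam hβ t := by
  have R := V.isRep (K := K) hβ hadm
  refine mul_dg_congr hβ fun i _ hi => ?_
  have hne : D.comp (i o) ≠ D.comp (i a) := by
    rw [← hi] at ht; exact ht
  rw [R.braid4_other o a ho ha i fun h => hne (by rw [← h.2, D.comp_inv]),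
    D.oddQ_of_ne hne.symm, D.oddQ'_of_ne hne.symm]
  simp

/-- Two different letters, each in the first position or directly preceded by its own kind, cannot
occupy adjacent positions, so the distant commutation relation applies. -/
theorem psi_comm_of_ne (hjl : j ≠ l) (ht : t.1 (prev (pos t j k)) = t.1 (pos t j k))
    (ht' : t.1 (prev (pos t l m)) = t.1 (pos t l m)) :
    psi K Γ lam gam β (pos t j k) * psi K Γ lam gam β (pos t l m) =
      psi K Γ lam gam β (pos t l m) * psi K Γ lam gam β (pos t j k) := by
  have R := V.isRep (K := K) hβ hadm
  have h1 : pos t l m ≠ pos t j k := fun h => hjl (by rw [← letter_pos t l m, h, letter_pos])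
  have h2 : pos t l m ≠ prev (pos t j k) := fun h => hjl (by
    rw [← letter_pos t l m, h, ht, letter_pos])
  have h3 : prev (pos t l m) ≠ pos t j k := fun h => hjl (by
    rw [← letter_pos t l m, ← ht', h, letter_pos])
  simp only [ne_eq, Fin.ext_iff, prev] at h1 h2 h3
  obtain h | h := lt_or_gt_of_ne h1
  · exact (R.psi_comm _ _ (by omega)).symm
  · exact R.psi_comm _ _ (by omega)

end Local

variable {hβ : Γ.IsBOrbit β} (hadm : Γ.Admissible lam gam)
  {τ : Words n (D.size β) → Words n (D.size β) → V K Γ lam gam β}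
  {j l : Fin d} {F : VPart K D lam gam β j →ₐ[K] V K Γ lam gam β}
  {G : VPart K D lam gam β l →ₐ[K] V K Γ lam gam β}

/-- Elements that commute with the matrix units can be compared at a single word, where they may be
replaced by their local expressions `a` and `b`. Each pair of generators can therefore be tested at
a word suited to it. -/
theorem IsWordUnits.commute_of_local (h : IsWordUnits hβ τ) {x z a b : V K Γ lam gam β}
    (hx : ∀ s t, x * τ s t = τ s t * x) (hz : ∀ s t, z * τ s t = τ s t * z)
    (s : Words n (D.size β)) (ha : x * wordIdem K lam gam hβ s = a * wordIdem K lam gam hβ s)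
    (hb : z * wordIdem K lam gam hβ s = b * wordIdem K lam gam hβ s)
    (hab : a * b * wordIdem K lam gam hβ s = b * a * wordIdem K lam gam hβ s) :
    Commute x z := by
  have hc : ∀ {x z : V K Γ lam gam β}, (∀ s t, x * τ s t = τ s t * x) →
      (∀ s t, z * τ s t = τ s t * z) → ∀ s t, x * z * τ s t = τ s t * (x * z) :=
    fun hx hz s t => by rw [mul_assoc, hz, ← mul_assoc, hx, mul_assoc]
  have key : ∀ {x z a b : V K Γ lam gam β}, (∀ s t, z * τ s t = τ s t * z) →
      x * wordIdem K lam gam hβ s = a * wordIdem K lam gam hβ s →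
      z * wordIdem K lam gam hβ s = b * wordIdem K lam gam hβ s →
      x * z * wordIdem K lam gam hβ s = a * b * wordIdem K lam gam hβ s :=
    fun {x z a b} hz ha hb => by
      have hz' : z * wordIdem K lam gam hβ s = wordIdem K lam gam hβ s * z := by
        rw [← h.diag, hz]
      rw [mul_assoc, hz', ← mul_assoc, ha, mul_assoc, ← hz', hb, mul_assoc]
  refine h.ext_of_commute (hc hx hz) (hc hz hx) s ?_
  rw [h.diag, key hz ha hb, key hx hb ha, hab]

section Generators

variable (h : IsWordUnits hβ τ) (hjl : j ≠ l) (hF : IsPartHom hβ τ j F) (hG : IsPartHom hβ τ l G)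

include h hadm hjl hF hG

/-- At a sorted word with $j$ first, every occurrence of $j$ and every occurrence of $l$ except its
first satisfies the condition under which the local formula holds, and the two $\psi$'s are far
apart. -/
theorem IsPartHom.commute_psi_of_ne (k : Fin (D.size β j)) (m : Fin (D.size β l))
    (hm : m.val ≠ 0) : Commute (F (V.psi K _ _ _ _ k)) (G (V.psi K _ _ _ _ m)) := by
  obtain ⟨i, hi⟩ := hβ.nonempty
  obtain ⟨s, hs⟩ := exists_sorted (keyMin j) (D.word hβ hi)
  have ht := letter_prev_pos_of_sorted hs k
  have ht' : s.1 (prev (pos s l m)) = s.1 (pos s l m) := by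
    rw [prev_eq (pos_sorted_succ (keyMin_injective j) hs (prev_add_one hm)), letter_pos, letter_pos]
  exact h.commute_of_local (hF.comm _) (hG.comm _) s (hF.psi k s ht) (hG.psi m s ht')
    (by rw [psi_comm_of_ne hβ hadm hjl ht ht'])

/-- Both elements are a $\psi_0$ of their part. At a word that begins with $j,l$ the first acts as
$\psi_0$; the second acts as $\psi_0$ once $l$ is brought to the front, that is, as
$\psi_1\psi_0\psi_1$. Their commutation is the braid relation of length four. -/
theorem IsPartHom.commute_psi_of_first (k : Fin (D.size β j)) (m : Fin (D.size β l))
    (hk : k.val = 0) (hm : m.val = 0) :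
    Commute (F (V.psi K _ _ _ _ k)) (G (V.psi K _ _ _ _ m)) := by
  obtain ⟨i, hi⟩ := hβ.nonempty
  obtain ⟨s, o, a, ho, ha, hj, hl⟩ := exists_word_two (D.word hβ hi) hjl k m
  have hpa : prev a = o := prev_eq (by omega)
  have hne : s.1 (prev a) ≠ s.1 a := by rw [hpa, hj, hl]; exact hjl
  have pj : pos s j k = o := by
    obtain ⟨k', hk'⟩ := exists_pos s hj
    have := (pos_strictMono s j).monotone (show k ≤ k' from Fin.le_def.2 (by omega))
    rw [hk', Fin.le_def] at this
    exact Fin.ext (by omega)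
  have pl : pos s l m = a := by
    obtain ⟨m', hm'⟩ := exists_pos s hl
    have h1 := (pos_strictMono s l).monotone (show m ≤ m' from Fin.le_def.2 (by omega))
    rw [hm', Fin.le_def] at h1
    have h2 : pos s l m ≠ o := fun h => hjl (by rw [← letter_pos s l m, h, hj])
    rw [ne_eq, Fin.ext_iff] at h2
    exact Fin.ext (by omega)
  have pl' : pos (step a s) l m = o := by
    rw [pos_step hne, pl, swp, Equiv.swap_apply_right, hpa]
  have e1 := hF.psi k s (by rw [pj, prev_first ho])
  have e2 := hG.psi m (step a s) (by rw [pl', prev_first ho])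
  rw [pl'] at e2
  rw [pj] at e1
  have e3 := h.mul_wordIdem_step hne (hG.comm _) e2
  rw [← mul_assoc, ← mul_assoc] at e3
  refine h.commute_of_local (hF.comm _) (hG.comm _) s e1 e3 ?_
  have := psi_psi_wordIdem_of_first (K := K) (lam := lam) (gam := gam) hβ hadm ho ha
    (t := s) (by rw [hj, hl]; exact hjl)
  simpa only [mul_assoc] using this

omit hjl in
theorem IsPartHom.commute_idem_idem (f : Fin (D.size β j) → D.verts j)
    (g : Fin (D.size β l) → D.verts l) :
    Commute (F (V.idem K _ _ _ _ f)) (G (V.idem K _ _ _ _ g)) := by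
  obtain ⟨i, hi⟩ := hβ.nonempty
  refine h.commute_of_local (hF.comm _) (hG.comm _) (D.word hβ hi) ((hF.idem f _).trans ?_)
    ((hG.idem g _).trans ?_) ?_ (a := partIdem K lam gam hβ j (D.word hβ hi) f)
    (b := partIdem K lam gam hβ l (D.word hβ hi) g)
  · exact (partIdem_mul_wordIdem hβ hadm _ _).symm
  · exact (partIdem_mul_wordIdem hβ hadm _ _).symm
  · rw [partIdem, partIdem, dg_mul_dg hβ hadm, dg_mul_dg hβ hadm]
    congr 1
    exact dg_congr hβ fun i _ => and_comm

omit hjl in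
theorem IsPartHom.commute_y_idem (k : Fin (D.size β j)) (g : Fin (D.size β l) → D.verts l) :
    Commute (F (V.y K _ _ _ _ k)) (G (V.idem K _ _ _ _ g)) := by
  obtain ⟨i, hi⟩ := hβ.nonempty
  refine h.commute_of_local (hF.comm _) (hG.comm _) (D.word hβ hi) (hF.y k _)
    ((hG.idem g _).trans ?_) ?_ (b := partIdem K lam gam hβ l (D.word hβ hi) g)
  · exact (partIdem_mul_wordIdem hβ hadm _ _).symm
  · rw [partIdem, y_mul_dg hβ hadm]

omit hjl in
theorem IsPartHom.commute_y_y (k : Fin (D.size β j)) (m : Fin (D.size β l)) :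
    Commute (F (V.y K _ _ _ _ k)) (G (V.y K _ _ _ _ m)) := by
  obtain ⟨i, hi⟩ := hβ.nonempty
  refine h.commute_of_local (hF.comm _) (hG.comm _) (D.word hβ hi) (hF.y k _) (hG.y m _) ?_
  rw [(V.isRep (K := K) hβ hadm).y_comm]

theorem IsPartHom.commute_psi_idem (k : Fin (D.size β j)) (g : Fin (D.size β l) → D.verts l) :
    Commute (F (V.psi K _ _ _ _ k)) (G (V.idem K _ _ _ _ g)) := by
  obtain ⟨i, hi⟩ := hβ.nonempty
  obtain ⟨s, hs⟩ := exists_sorted (keyMin j) (D.word hβ hi)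
  have ht := letter_prev_pos_of_sorted hs k
  refine h.commute_of_local (hF.comm _) (hG.comm _) s (hF.psi k _ ht)
    ((hG.idem g _).trans (partIdem_mul_wordIdem hβ hadm _ _).symm) ?_
  rw [psi_mul_partIdem_other hβ hadm hjl ht]

theorem IsPartHom.commute_psi_y (k : Fin (D.size β j)) (m : Fin (D.size β l)) :
    Commute (F (V.psi K _ _ _ _ k)) (G (V.y K _ _ _ _ m)) := by
  obtain ⟨i, hi⟩ := hβ.nonempty
  obtain ⟨s, hs⟩ := exists_sorted (keyMin j) (D.word hβ hi)
  have ht := letter_prev_pos_of_sorted hs k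
  exact h.commute_of_local (hF.comm _) (hG.comm _) s (hF.psi k _ ht) (hG.y m _)
    (psi_y_wordIdem hβ hadm hjl ht)

end Generators

theorem IsPartHom.commute_psi_psi (h : IsWordUnits hβ τ) (hjl : j ≠ l) (hF : IsPartHom hβ τ j F)
    (hG : IsPartHom hβ τ l G) (hadm : Γ.Admissible lam gam) (k : Fin (D.size β j))
    (m : Fin (D.size β l)) :
    Commute (F (V.psi K _ _ _ _ k)) (G (V.psi K _ _ _ _ m)) := by
  by_cases hm : m.val = 0
  · by_cases hk : k.val = 0
    · exact hF.commute_psi_of_first hadm h hjl hG k m hk hm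
    · exact (hG.commute_psi_of_ne hadm h hjl.symm hF m k hk).symm
  · exact hF.commute_psi_of_ne hadm h hjl hG k m hm

/-- An element that commutes with the images of the generators commutes with the image. -/
theorem commute_of_generators {I' : Type*} {A' : Type*} {Γ' : InvQuiver I' A'} {lam' : I' → ℕ}
    {gam' : I' → K} {n' : ℕ} {β' : Set (Fin n' → I')} {B : Type*} [Ring B] [Algebra K B]
    (G : V K Γ' lam' gam' β' →ₐ[K] B) {z : B} (he : ∀ f, Commute z (G (idem K Γ' lam' gam' β' f)))
    (hy : ∀ k, Commute z (G (V.y K Γ' lam' gam' β' k)))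
    (hp : ∀ k, Commute z (G (V.psi K Γ' lam' gam' β' k))) (x : V K Γ' lam' gam' β') :
    Commute z (G x) := by
  have hmem : ∀ {x}, x ∈ Subalgebra.comap G (Subalgebra.centralizer K {z}) ↔ Commute z (G x) := by
    intro x
    rw [Subalgebra.mem_comap, Subalgebra.mem_centralizer_iff]
    simp [commute_iff_eq]
  exact hmem.1 (V.subalgebra_eq_top _ (fun f _ => hmem.2 (he f)) (fun k => hmem.2 (hy k))
    (fun k => hmem.2 (hp k)) x)

theorem IsPartHom.commute (h : IsWordUnits hβ τ) (hjl : j ≠ l) (hF : IsPartHom hβ τ j F)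
    (hG : IsPartHom hβ τ l G) (hadm : Γ.Admissible lam gam) (x : VPart K D lam gam β j)
    (z : VPart K D lam gam β l) : Commute (F x) (G z) := by
  refine commute_of_generators G (fun g => ?_) (fun m => ?_) (fun m => ?_) z
  all_goals
    refine (commute_of_generators F (fun f => ?_) (fun k => ?_) (fun k => ?_) x).symm
  · exact (hF.commute_idem_idem hadm h hG f g).symm
  · exact (hF.commute_y_idem hadm h hG k g).symm
  · exact (hF.commute_psi_idem hadm h hjl hG k g).symm
  · exact hG.commute_y_idem hadm h hF m f
  · exact (hF.commute_y_y hadm h hG k m).symm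
  · exact (hF.commute_psi_y hadm h hjl hG k m).symm
  · exact hG.commute_psi_idem hadm h hjl.symm hF m f
  · exact hG.commute_psi_y hadm h hjl.symm hF m k
  · exact (hF.commute_psi_psi h hjl hG hadm k m).symm

end V

end Commutation

/-! ### Algebra homomorphisms and gradings on tensor products -/

section TensorAlgebra

variable {K : Type*} [CommRing K] {d : ℕ} {B B' : Fin d → Type*} [∀ j, Ring (B j)]
  [∀ j, Algebra K (B j)] [∀ j, Ring (B' j)] [∀ j, Algebra K (B' j)] {C : Type*} [Ring C]
  [Algebra K C]

theorem tprod_insert (b : ∀ j, B j) {s : Finset (Fin d)} {j : Fin d} (hj : j ∉ s) :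
    PiTensorProduct.tprod K ((insert j s).piecewise b 1) =
      PiTensorProduct.singleAlgHom (R := K) j (b j) *
        PiTensorProduct.tprod K (s.piecewise b 1) := by
  rw [PiTensorProduct.singleAlgHom_apply, PiTensorProduct.tprod_mul_tprod]
  congr 1
  ext1 l
  by_cases hl : l = j
  · subst hl; simp [hj]
  · simp [Finset.piecewise, hl]

theorem tensor_subalgebra_eq_top (S : Subalgebra K (⨂[K] j, B j))
    (h : ∀ j x, PiTensorProduct.singleAlgHom (R := K) j x ∈ S) (x : ⨂[K] j, B j) : x ∈ S := by
  have key : ∀ (b : ∀ j, B j) (s : Finset (Fin d)),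
      PiTensorProduct.tprod K (s.piecewise b 1) ∈ S := fun b s => by
    induction s using Finset.induction_on with
    | empty => rw [Finset.piecewise_empty]; exact S.one_mem
    | insert j s hj ih => rw [tprod_insert b hj]; exact S.mul_mem (h j _) ih
  induction x using PiTensorProduct.induction_on with
  | smul_tprod r b =>
    have := key b Finset.univ
    rw [Finset.piecewise_univ] at this
    exact S.smul_mem this r
  | add x y hx hy => exact S.add_mem hx hy

/-- Algebra homomorphisms with commuting images define a homomorphism on the tensor product. -/
theorem exists_tensorHom (f : ∀ j, B j →ₐ[K] C)
    (hf : ∀ j l, j ≠ l → ∀ x y, Commute (f j x) (f l y)) :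
    ∃ F : (⨂[K] j, B j) →ₐ[K] C, ∀ j x, F (PiTensorProduct.singleAlgHom j x) = f j x := by
  let φ : (∀ j, B j) →* C := MonoidHom.noncommPiCoprod (fun j => (f j : B j →* C))
    fun j l hjl x y => hf j l hjl x y
  have φs : ∀ j x, φ (Pi.mulSingle j x) = f j x := fun j x =>
    MonoidHom.noncommPiCoprod_mulSingle _ j x
  -- Splitting one factor off the commuting product shows that it is linear in each argument.
  have hup : ∀ (i : DecidableEq (Fin d)) (m : ∀ j, B j) j x,
      φ (Function.update m j x) = f j x * φ (Function.update m j 1) := fun i m j x => by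
    rw [← φs, ← map_mul]
    congr 1
    ext1 l
    by_cases hl : l = j
    · subst hl; simp
    · simp [hl]
  let g : MultilinearMap K B C :=
    { toFun := φ
      map_update_add' := fun m j x y => by rw [hup, hup _ m j x, hup _ m j y, map_add, add_mul]
      map_update_smul' := fun m j c x => by rw [hup, hup _ m j x, map_smul, smul_mul_assoc] }
  refine ⟨PiTensorProduct.liftAlgHom g φ.map_one φ.map_mul, fun j x => ?_⟩
  rw [PiTensorProduct.singleAlgHom_apply, PiTensorProduct.liftAlgHom_apply,
    PiTensorProduct.lift.tprod]
  exact φs j x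

/-- The tensor product of algebra homomorphisms. -/
theorem exists_tensorMap (f : ∀ j, B j →ₐ[K] B' j) :
    ∃ F : (⨂[K] j, B j) →ₐ[K] ⨂[K] j, B' j,
      (∀ b, F (PiTensorProduct.tprod K b) = PiTensorProduct.tprod K fun j => f j (b j)) ∧
      (∀ j x, F (PiTensorProduct.singleAlgHom j x) = PiTensorProduct.singleAlgHom j (f j x)) ∧
      ∀ x, F x = PiTensorProduct.map (fun j => (f j).toLinearMap) x := by
  let F := PiTensorProduct.liftAlgHom
    ((PiTensorProduct.tprod K).compLinearMap fun j => (f j).toLinearMap)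
    (by
      rw [MultilinearMap.compLinearMap_apply, PiTensorProduct.one_def]
      exact congrArg _ (funext fun j => map_one (f j)))
    (fun x y => by
      simp only [MultilinearMap.compLinearMap_apply, PiTensorProduct.tprod_mul_tprod]
      exact congrArg _ (funext fun j => map_mul (f j) _ _))
  have hF : ∀ b, F (PiTensorProduct.tprod K b) = PiTensorProduct.tprod K fun j => f j (b j) :=
    fun b => by
      rw [PiTensorProduct.liftAlgHom_apply, PiTensorProduct.lift.tprod]; rfl
  refine ⟨F, hF, fun j x => ?_, fun x => rfl⟩
  rw [PiTensorProduct.singleAlgHom_apply, hF, PiTensorProduct.singleAlgHom_apply]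
  congr 1
  ext1 l
  by_cases hl : l = j
  · subst hl; simp
  · simp [hl]

theorem tensorMap_surjective {F : (⨂[K] j, B j) →ₐ[K] ⨂[K] j, B' j} {f : ∀ j, B j →ₐ[K] B' j}
    (hF : ∀ j x, F (PiTensorProduct.singleAlgHom j x) = PiTensorProduct.singleAlgHom j (f j x))
    (hf : ∀ j, Function.Surjective (f j)) : Function.Surjective F := fun x => by
  refine (tensor_subalgebra_eq_top F.range (fun j y => ?_) x)
  obtain ⟨y, rfl⟩ := hf j y
  exact ⟨_, hF j y⟩

theorem tensorGrade_mul {𝒜 : ∀ j, ℤ → Submodule K (B j)}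
    (hmul : ∀ j k l, ∀ x ∈ 𝒜 j k, ∀ y ∈ 𝒜 j l, x * y ∈ 𝒜 j (k + l)) {k l : ℤ}
    {x y : ⨂[K] j, B j} (hx : x ∈ tensorGrade 𝒜 k) (hy : y ∈ tensorGrade 𝒜 l) :
    x * y ∈ tensorGrade 𝒜 (k + l) := by
  unfold tensorGrade at hx hy
  induction hx using Submodule.span_induction with
  | zero => rw [zero_mul]; exact Submodule.zero_mem _
  | add a b _ _ ha hb => rw [add_mul]; exact Submodule.add_mem _ ha hb
  | smul c a _ ha => rw [smul_mul_assoc]; exact Submodule.smul_mem _ c ha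
  | mem x hx =>
    induction hy using Submodule.span_induction with
    | zero => rw [mul_zero]; exact Submodule.zero_mem _
    | add a b _ _ ha hb => rw [mul_add]; exact Submodule.add_mem _ ha hb
    | smul c a _ ha => rw [mul_smul_comm]; exact Submodule.smul_mem _ c ha
    | mem y hy =>
      obtain ⟨m, b, rfl, hb, rfl⟩ := hx
      obtain ⟨m', b', rfl, hb', rfl⟩ := hy
      rw [PiTensorProduct.tprod_mul_tprod]
      exact Submodule.subset_span ⟨fun j => m j + m' j, _, Finset.sum_add_distrib,
        fun j => hmul j _ _ _ (hb j) _ (hb' j), rfl⟩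

theorem single_mem_tensorGrade {𝒜 : ∀ j, ℤ → Submodule K (B j)} (h1 : ∀ j, 1 ∈ 𝒜 j 0) {k : ℤ}
    {j : Fin d} {x : B j} (hx : x ∈ 𝒜 j k) :
    PiTensorProduct.singleAlgHom (R := K) j x ∈ tensorGrade 𝒜 k := by
  refine Submodule.subset_span ⟨Pi.single j k, Pi.mulSingle j x, by simp, fun l => ?_, rfl⟩
  by_cases hl : l = j
  · subst hl; simpa using hx
  · simpa [hl] using h1 l

/-- A pure tensor is a product of images of single factors, so only these have to be checked; the
factors are inserted one at a time. -/
theorem tensorHom_mem {𝒜 : ∀ j, ℤ → Submodule K (B j)} {𝒞 : ℤ → Submodule K C}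
    (h1 : 1 ∈ 𝒞 0) (hmul : ∀ k l, ∀ x ∈ 𝒞 k, ∀ y ∈ 𝒞 l, x * y ∈ 𝒞 (k + l))
    {F : (⨂[K] j, B j) →ₐ[K] C}
    (hF : ∀ j k, ∀ x ∈ 𝒜 j k, F (PiTensorProduct.singleAlgHom j x) ∈ 𝒞 k) {k : ℤ}
    {x : ⨂[K] j, B j} (hx : x ∈ tensorGrade 𝒜 k) : F x ∈ 𝒞 k := by
  unfold tensorGrade at hx
  induction hx using Submodule.span_induction with
  | zero => rw [map_zero]; exact Submodule.zero_mem _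
  | add a b _ _ ha hb => rw [map_add]; exact Submodule.add_mem _ ha hb
  | smul c a _ ha => rw [map_smul]; exact Submodule.smul_mem _ c ha
  | mem x hx =>
    obtain ⟨l, b, rfl, hb, rfl⟩ := hx
    have key : ∀ s : Finset (Fin d),
        F (PiTensorProduct.tprod K (s.piecewise b 1)) ∈ 𝒞 (∑ j ∈ s, l j) := fun s => by
      induction s using Finset.induction_on with
      | empty =>
        rw [Finset.piecewise_empty, ← PiTensorProduct.one_def, map_one, Finset.sum_empty]
        exact h1
      | insert j s hj ih =>
        rw [tprod_insert b hj, map_mul, Finset.sum_insert hj]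
        exact hmul _ _ _ (hF j _ _ (hb j)) _ ih
    have := key Finset.univ
    rwa [Finset.piecewise_univ] at this

theorem mem_tensorGrade_map {𝒜 : ∀ j, ℤ → Submodule K (B j)}
    {F : (⨂[K] j, B j) →ₐ[K] ⨂[K] j, B' j} {f : ∀ j, B j →ₐ[K] B' j}
    (hF : ∀ b, F (PiTensorProduct.tprod K b) = PiTensorProduct.tprod K fun j => f j (b j)) {k : ℤ}
    {x : ⨂[K] j, B' j} :
    x ∈ tensorGrade (fun j k => (𝒜 j k).map (f j).toLinearMap) k ↔
      ∃ x' ∈ tensorGrade 𝒜 k, F x' = x := by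
  suffices h : tensorGrade (fun j k => (𝒜 j k).map (f j).toLinearMap) k =
      (tensorGrade 𝒜 k).map F.toLinearMap by
    rw [h]; exact Iff.rfl
  unfold tensorGrade
  rw [Submodule.map_span]
  congr 1
  ext x
  constructor
  · rintro ⟨l, b, hl, hb, rfl⟩
    choose b' hb' h using hb
    exact ⟨_, ⟨l, b', hl, hb', rfl⟩, (hF b').trans (congrArg _ (funext h))⟩
  · rintro ⟨_, ⟨l, b, hl, hb, rfl⟩, rfl⟩
    exact ⟨l, _, hl, fun j => ⟨_, hb j, rfl⟩, hF b⟩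

end TensorAlgebra

/-! ### Transport of gradings -/

section Internal

variable {K : Type*} [CommRing K] {M N : Type*} [AddCommMonoid M] [Module K M]
  [AddCommMonoid N] [Module K N] {𝒜 : ℤ → Submodule K M} {ℬ : ℤ → Submodule K N}

/-- The projections recover the components of a sum and so prove its directness. The argument uses
no multiplication, hence no unit. -/
theorem isInternal_of_proj (π : ℤ → M →ₗ[K] M) (hsame : ∀ k, ∀ x ∈ 𝒜 k, π k x = x)
    (hne : ∀ k l, k ≠ l → ∀ x ∈ 𝒜 k, π l x = 0) (htop : ⨆ k, 𝒜 k = ⊤) :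
    DirectSum.IsInternal 𝒜 := by
  classical
  have key : ∀ (x : DirectSum ℤ fun k => 𝒜 k) (k : ℤ),
      π k (DirectSum.coeAddMonoidHom 𝒜 x) = x k := by
    intro x k
    induction x using DirectSum.induction_on with
    | zero => simp
    | of i x =>
      rw [DirectSum.coeAddMonoidHom_of]
      by_cases h : i = k
      · subst h; rw [hsame _ _ x.2, DirectSum.of_eq_same]
      · rw [hne _ _ h _ x.2, DirectSum.of_eq_of_ne _ _ _ (Ne.symm h)]; rfl
    | add x y hx hy => rw [map_add, map_add, hx, hy]; rfl
  refine ⟨fun x y hxy => ?_, ?_⟩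
  · refine DFinsupp.ext fun k => Subtype.ext ?_
    rw [← key x k, ← key y k, hxy]
  · have := LinearMap.range_eq_top.1 ((Submodule.iSup_eq_range_dfinsupp_lsum 𝒜).symm.trans htop)
    intro x
    obtain ⟨y, hy⟩ := this x
    exact ⟨y, hy⟩

theorem exists_proj_of_isInternal (h : DirectSum.IsInternal 𝒜) :
    ∃ π : ℤ → M →ₗ[K] M, (∀ k, ∀ x ∈ 𝒜 k, π k x = x) ∧
      (∀ k l, k ≠ l → ∀ x ∈ 𝒜 k, π l x = 0) ∧ ∀ k x, π k x ∈ 𝒜 k := by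
  let e := LinearEquiv.ofBijective (DirectSum.coeLinearMap 𝒜) h
  have he : ∀ k (x : 𝒜 k), e.symm x = DirectSum.lof K ℤ (fun k => 𝒜 k) k x := fun k x => by
    rw [LinearEquiv.symm_apply_eq]
    exact (DirectSum.coeLinearMap_lof 𝒜 k x).symm
  refine ⟨fun k => (𝒜 k).subtype ∘ₗ DirectSum.component K ℤ (fun k => 𝒜 k) k ∘ₗ e.symm,
    fun k x hx => ?_, fun k l hkl x hx => ?_, fun k x => Subtype.prop _⟩
  · change ((e.symm x) k : M) = x
    rw [he k ⟨x, hx⟩, DirectSum.lof_eq_of, DirectSum.of_eq_same]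
  · change ((e.symm x) l : M) = 0
    rw [he k ⟨x, hx⟩, DirectSum.lof_eq_of, DirectSum.of_eq_of_ne _ _ _ hkl.symm]
    rfl

/-- This gives the directness of the gradings on matrices over tensor products from that of
$V_\beta$: only the matching of homogeneous components has to be verified. -/
theorem isInternal_map (h : DirectSum.IsInternal 𝒜) (e : M ≃ₗ[K] N)
    (he : ∀ k x, e x ∈ ℬ k ↔ x ∈ 𝒜 k) : DirectSum.IsInternal ℬ := by
  obtain ⟨π, h1, h2, -⟩ := exists_proj_of_isInternal h
  have hb : ∀ k x, x ∈ ℬ k → e.symm x ∈ 𝒜 k := fun k x hx => by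
    rwa [← he, e.apply_symm_apply]
  refine isInternal_of_proj (fun k => e ∘ₗ π k ∘ₗ e.symm) (fun k x hx => ?_)
    (fun k l hkl x hx => ?_) ?_
  · simp [h1 _ _ (hb k x hx)]
  · simp [h2 _ _ hkl _ (hb k x hx)]
  · have : ℬ = fun k => (𝒜 k).map (e : M →ₗ[K] N) := by
      ext k x
      refine ⟨fun hx => ⟨_, hb k x hx, e.apply_symm_apply x⟩, ?_⟩
      rintro ⟨x, hx, rfl⟩
      exact (he k x).2 hx
    rw [this, ← Submodule.map_iSup, h.submodule_iSup_eq_top, Submodule.map_top]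
    exact LinearEquiv.range e

end Internal

section TransportGrading

variable {K : Type*} [CommRing K] {B C : Type*} [NonUnitalNonAssocSemiring B] [Module K B]
  [NonUnitalNonAssocSemiring C] [Module K C] {𝒜 : ℤ → Submodule K B} {ℬ : ℤ → Submodule K C}

/-- A grading can be transported along an isomorphism. -/
theorem isGradedBijection_of_mem_iff (h𝒜 : IsAlgGrading 𝒜) (e : B ≃ₗ[K] C)
    (hmul : ∀ x y, e (x * y) = e x * e y) (h : ∀ k x, e x ∈ ℬ k ↔ x ∈ 𝒜 k) :
    IsGradedBijection 𝒜 ℬ e := by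
  refine ⟨h𝒜, ⟨isInternal_map h𝒜.1 e h, fun k l x hx y hy => ?_⟩, e.bijective, h⟩
  obtain ⟨x, rfl⟩ := e.surjective x
  obtain ⟨y, rfl⟩ := e.surjective y
  rw [← hmul, h]
  exact h𝒜.2 _ _ _ ((h _ _).1 hx) _ ((h _ _).1 hy)

end TransportGrading

/-! ### Gradings of direct sums -/

section DirectSumGrading

variable {K : Type*} [CommRing K] {ι : Type*} {B : ι → Type*} [∀ i, NonUnitalSemiring (B i)]
  [∀ i, Module K (B i)]

open Classical in
/-- The inclusion of a summand. -/
def dsumSingle (i : ι) : B i →ₗ[K] DSum K B where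
  toFun x := ⟨Pi.single i x, (Set.finite_singleton i).subset fun l hl => by
    by_contra h
    exact hl (Pi.single_eq_of_ne h x)⟩
  map_add' x y := Subtype.ext (Pi.single_add i x y)
  map_smul' c x := Subtype.ext (Pi.single_smul i c x)

theorem dsumSingle_same (i : ι) (x : B i) : (dsumSingle (K := K) i x).1 i = x := by
  classical
  exact Pi.single_eq_same i x

theorem dsumSingle_ne {i l : ι} (h : l ≠ i) (x : B i) : (dsumSingle (K := K) i x).1 l = 0 := by
  classical
  exact Pi.single_eq_of_ne h x

theorem iSup_dsumSingle : ⨆ i, LinearMap.range (dsumSingle (K := K) (B := B) i) = ⊤ := by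
  classical
  refine eq_top_iff.2 fun x _ => ?_
  have hx : x = ∑ i ∈ (x.2 : {i | x.1 i ≠ 0}.Finite).toFinset, dsumSingle i (x.1 i) := by
    refine Subtype.ext (funext fun l => ?_)
    let p : DSum K B →+ B l :=
      { toFun := fun y => y.1 l, map_zero' := rfl, map_add' := fun _ _ => rfl }
    change p x = p _
    rw [map_sum, Finset.sum_eq_single l]
    · exact (dsumSingle_same (K := K) l _).symm
    · exact fun i _ hi => dsumSingle_ne (K := K) hi.symm _
    · intro h
      have h : x.1 l = 0 := by_contra fun h' => h ((Set.Finite.mem_toFinset _).2 h')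
      rw [h, map_zero, map_zero]
  rw [hx]
  exact Submodule.sum_mem _ fun i _ => Submodule.mem_iSup_of_mem i ⟨_, rfl⟩

theorem isAlgGrading_dsum {𝒜 : ∀ i, ℤ → Submodule K (B i)} (h : ∀ i, IsAlgGrading (𝒜 i)) :
    IsAlgGrading (dsumGrade 𝒜) := by
  choose π h1 h2 _ using fun i => exists_proj_of_isInternal (h i).1
  let ρ : ℤ → DSum K B →ₗ[K] DSum K B := fun k =>
    { toFun := fun x => ⟨fun i => π i k (x.1 i), x.2.subset fun i hi h => hi (by
        change π i k (x.1 i) = 0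
        rw [h, map_zero])⟩
      map_add' := fun x y => Subtype.ext (funext fun i => map_add (π i k) _ _)
      map_smul' := fun c x => Subtype.ext (funext fun i => map_smul (π i k) c _) }
  refine ⟨isInternal_of_proj ρ (fun k x hx => Subtype.ext (funext fun i => h1 i k _ (hx i)))
    (fun k l hkl x hx => Subtype.ext (funext fun i => h2 i k l hkl _ (hx i))) ?_,
    fun k l x hx y hy i => (h i).2 k l _ (hx i) _ (hy i)⟩
  refine eq_top_iff.2 (iSup_dsumSingle.symm.le.trans (iSup_le fun i => ?_))
  rw [LinearMap.range_eq_map, ← (h i).1.submodule_iSup_eq_top, Submodule.map_iSup]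
  refine iSup_mono fun k => ?_
  rintro _ ⟨x, hx, rfl⟩ l
  by_cases hl : l = i
  · subst hl; rw [dsumSingle_same]; exact hx
  · rw [dsumSingle_ne hl]; exact Submodule.zero_mem _

end DirectSumGrading

/-! ### The two homomorphisms are inverse to each other -/

section WordIso

variable {K : Type w} [CommRing K] {I : Type u} {A : Type v} {Γ : InvQuiver I A}
  {lam : I → ℕ} {gam : I → K} {n : ℕ} {β : Set (Fin n → I)} {d : ℕ} {D : Γ.Decomposition d}

namespace V

variable (hβ : Γ.IsBOrbit β) (hadm : Γ.Admissible lam gam)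

/-- Data that define mutually inverse homomorphisms between `V_β` and the matrix algebra. -/
structure IsWordIso (τ : Words n (D.size β) → Words n (D.size β) → V K Γ lam gam β)
    (f : ∀ j, VPart K D lam gam β j →ₐ[K] V K Γ lam gam β)
    (F : TensV K D lam gam β →ₐ[K] V K Γ lam gam β)
    (Θ : V K Γ lam gam β →ₐ[K] WordMat K D lam gam β)
    (Ψ : WordMat K D lam gam β →ₐ[K] V K Γ lam gam β) : Prop where
  units : IsWordUnits hβ τ
  part : ∀ j, IsPartHom hβ τ j (f j)
  factor : ∀ j x, F (factor K D lam gam β j x) = f j x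
  comm : ∀ x s t, F x * τ s t = τ s t * F x
  idem : ∀ i, Θ (V.idem K Γ lam gam β i) = matE K D lam gam β i
  y : ∀ a, Θ (V.y K Γ lam gam β a) = matY K D lam gam β a
  psi : ∀ b, Θ (V.psi K Γ lam gam β b) = matP K D lam gam β b
  single : ∀ s t x, Ψ (Matrix.single s t x) = F x * τ s t

include hadm in
theorem exists_isWordIso : ∃ (τ : Words n (D.size β) → Words n (D.size β) → V K Γ lam gam β)
    (f : ∀ j, VPart K D lam gam β j →ₐ[K] V K Γ lam gam β)
    (F : TensV K D lam gam β →ₐ[K] V K Γ lam gam β)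
    (Θ : V K Γ lam gam β →ₐ[K] WordMat K D lam gam β)
    (Ψ : WordMat K D lam gam β →ₐ[K] V K Γ lam gam β), IsWordIso hβ τ f F Θ Ψ := by
  obtain ⟨τ, hτ⟩ := exists_isWordUnits (K := K) (D := D) hβ hadm
  choose f hf using fun j => exists_partHom hadm hτ j
  obtain ⟨F, hF⟩ := exists_tensorHom f fun j l hjl x z => (hf j).commute hτ hjl (hf l) hadm x z
  have hcomm : ∀ x s t, F x * τ s t = τ s t * F x := fun x s t => by
    have hmem : ∀ {x}, x ∈ Subalgebra.comap F (Subalgebra.centralizer K {τ s t}) ↔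
        τ s t * F x = F x * τ s t := by
      intro x
      rw [Subalgebra.mem_comap, Subalgebra.mem_centralizer_iff]
      simp
    refine (hmem.1 (tensor_subalgebra_eq_top _ (fun j x => hmem.2 ?_) x)).symm
    rw [hF, (hf j).comm]
  obtain ⟨Θ, h1, h2, h3⟩ := V.exists_lift hβ hadm (isRep_mat (K := K) (D := D) hβ hadm)
  exact ⟨τ, f, F, Θ, hτ.toIsMatUnits.matHom F hcomm, hτ, hf, hF, hcomm, h1, h2, h3,
    hτ.toIsMatUnits.matHom_single F hcomm⟩

namespace IsWordIso

variable {hβ} {τ : Words n (D.size β) → Words n (D.size β) → V K Γ lam gam β}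
  {f : ∀ j, VPart K D lam gam β j →ₐ[K] V K Γ lam gam β}
  {F : TensV K D lam gam β →ₐ[K] V K Γ lam gam β}
  {Θ : V K Γ lam gam β →ₐ[K] WordMat K D lam gam β}
  {Ψ : WordMat K D lam gam β →ₐ[K] V K Γ lam gam β}

theorem ext_glue (hβ : Γ.IsBOrbit β) (hadm : Γ.Admissible lam gam) {x x' : V K Γ lam gam β}
    (h : ∀ (t : Words n (D.size β)) (g : ∀ j, Fin (D.size β j) → D.verts j),
      x * V.idem K Γ lam gam β (D.glue t g) = x' * V.idem K Γ lam gam β (D.glue t g)) :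
    x = x' := by
  refine ext_idem hβ hadm fun i hi => ?_
  have hw : D.comp ∘ i = (D.word hβ hi).1 := rfl
  have := h (D.word hβ hi) (D.restr (D.word hβ hi) i hw)
  rwa [glue_restr] at this

include hadm

theorem part_idem_mul (h : IsWordIso hβ τ f F Θ Ψ) (j : Fin d) (e : Fin (D.size β j) → D.verts j)
    (t : Words n (D.size β)) (g : ∀ j, Fin (D.size β j) → D.verts j) :
    f j (V.idem K _ _ _ _ e) * V.idem K Γ lam gam β (D.glue t g) =
      partIdem K lam gam hβ j t e * V.idem K Γ lam gam β (D.glue t g) := by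
  have h1 : wordIdem K lam gam hβ t * V.idem K Γ lam gam β (D.glue t g) =
      V.idem K Γ lam gam β (D.glue t g) := dg_mul_idem hβ hadm (comp_glue t g)
  rw [← (h.part j).idem e t, mul_assoc, h1]

/-- Each $F(\bigotimes_je(g_j))$ kills the idempotents $e(i)$ with $i$ of word $t$ whose
restrictions differ from $g$. Since all these elements add up to $1$, it must fix the remaining one.
-/
theorem tens_idem_mul (h : IsWordIso hβ τ f F Θ Ψ) (t : Words n (D.size β))
    (g : ∀ j, Fin (D.size β j) → D.verts j) :
    F (idemT K D lam gam β g) * wordIdem K lam gam hβ t =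
      V.idem K Γ lam gam β (D.glue t g) := by
  have hne : ∀ e g' : ∀ j, Fin (D.size β j) → D.verts j, e ≠ g' →
      F (idemT K D lam gam β e) * V.idem K Γ lam gam β (D.glue t g') = 0 := fun e g' heg => by
    obtain ⟨j, hj⟩ := Function.ne_iff.1 heg
    have R := isRep_part (K := K) (D := D) hβ hadm j
    have h1 := factor_mul_idemT (K := K) (D := D) (lam := lam) (gam := gam) (β := β)
      (f := e) (x := V.idem K _ _ _ _ (e j)) (g := e j) rfl
    rw [factor_idem_mul hβ hadm, Function.update_eq_self] at h1
    have h2 : partIdem K lam gam hβ j t (e j) * V.idem K Γ lam gam β (D.glue t g') = 0 :=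
      dg_mul_idem_of_not hβ hadm fun h => hj (funext fun k => Subtype.ext (by
        rw [← h.2 k, glue_pos]))
    rw [h1, map_mul, h.factor, mul_assoc, h.part_idem_mul hadm, h2, mul_zero]
  have heq : ∀ g', F (idemT K D lam gam β g') * V.idem K Γ lam gam β (D.glue t g') =
      V.idem K Γ lam gam β (D.glue t g') := fun g' => by
    have h1 := congrArg (fun x => F x * V.idem K Γ lam gam β (D.glue t g'))
      (sum_idemT (K := K) (D := D) (lam := lam) (gam := gam) hβ hadm)
    simp only [map_sum, map_one, one_mul, Finset.sum_mul] at h1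
    rw [Finset.sum_eq_single g'] at h1
    · exact h1
    · exact fun e _ he => hne e g' he
    · intro hg
      simp only [Fintype.mem_piFinset, Set.Finite.mem_toFinset, not_forall] at hg
      obtain ⟨j, hj⟩ := hg
      rw [idemT_of_notMem hj, map_zero, zero_mul]
  have R := V.isRep (K := K) hβ hadm
  refine ext_glue (D := D) hβ hadm fun s g' => ?_
  by_cases hs : s = t
  · subst hs
    have h1 : wordIdem K lam gam hβ s * V.idem K Γ lam gam β (D.glue s g') =
        V.idem K Γ lam gam β (D.glue s g') := dg_mul_idem hβ hadm (comp_glue s g')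
    rw [mul_assoc, h1]
    by_cases hg : g = g'
    · subst hg
      rw [heq, R.E_mul_self]
    · rw [hne _ _ hg, R.E_mul_ne _ _ fun h => hg (glue_injective h).2]
  · have h1 : wordIdem K lam gam hβ t * V.idem K Γ lam gam β (D.glue s g') = 0 :=
      dg_mul_idem_of_not hβ hadm fun h => hs (Subtype.ext (by rw [← h, comp_glue]))
    rw [mul_assoc, h1, mul_zero, R.E_mul_ne _ _ fun h => hs (glue_injective h).1.symm]

theorem map_wordIdem (h : IsWordIso hβ τ f F Θ Ψ) (t : Words n (D.size β)) :
    Θ (wordIdem K lam gam hβ t) = Matrix.single t t 1 := by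
  have R := isRep_mat (K := K) (D := D) hβ hadm
  refine R.ext_right hβ.finite fun i _ => ?_
  obtain ⟨s, g, rfl⟩ | hi := isWord_or (D := D) (D.size β) i
  · rw [← h.idem, ← map_mul, h.idem, matE_glue]
    by_cases hs : t = s
    · subst hs
      rw [wordIdem, dg_mul_idem hβ hadm (comp_glue t g), h.idem, matE_glue,
        Matrix.single_mul_single_same, one_mul]
    · rw [wordIdem, dg_mul_idem_of_not hβ hadm fun h => hs (Subtype.ext (by
        rw [← h, comp_glue])), map_zero, Matrix.single_mul_single_of_ne _ _ _ _ hs]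
  · rw [matE_of_not_word hi, mul_zero, mul_zero]

theorem map_units (h : IsWordIso hβ τ f F Θ Ψ) (s t : Words n (D.size β)) :
    Θ (τ s t) = Matrix.single s t 1 := by
  refine h.units.induction (p := fun s t x => Θ x = Matrix.single s t 1)
    (h.map_wordIdem hadm) (fun s t u x x' hx hx' => ?_) (fun t b hb => ?_) s t
  · rw [map_mul, hx, hx', Matrix.single_mul_single_same, one_mul]
  · rw [map_mul, h.psi, h.map_wordIdem hadm, matP_mul_single, psiEntry_of_ne hb, one_mul]

omit hadm in
theorem map_units_inv (h : IsWordIso hβ τ f F Θ Ψ) (s t : Words n (D.size β)) :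
    Ψ (Matrix.single s t 1) = τ s t := by
  rw [h.single, map_one, one_mul]

theorem left_inv (h : IsWordIso hβ τ f F Θ Ψ) : Ψ.comp Θ = AlgHom.id K _ := by
  refine V.algHom_ext (fun i hi => ?_) (fun a => ?_) (fun b => ?_)
  · change Ψ (Θ _) = V.idem K Γ lam gam β i
    obtain ⟨t, g, rfl⟩ | hi' := isWord_or (D := D) (D.size β) i
    · rw [h.idem, matE_glue, h.single, h.units.diag, h.tens_idem_mul hadm]
    · exact absurd rfl (hi' (D.word hβ hi))
  · change Ψ (Θ _) = V.y K Γ lam gam β a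
    refine h.units.ext_right fun t => ?_
    obtain ⟨⟨j, k⟩, rfl⟩ := (posEquiv t).surjective a
    rw [← h.map_units_inv, ← map_mul, h.y, matY_mul_single, h.single, Equiv.symm_apply_apply,
      mul_one, yT, h.factor, h.units.diag, (h.part j).y, h.map_units_inv, h.units.diag]
    rfl
  · change Ψ (Θ _) = V.psi K Γ lam gam β b
    refine h.units.ext_right fun t => ?_
    rw [← h.map_units_inv, ← map_mul, h.psi, matP_mul_single, h.single, mul_one,
      h.map_units_inv, h.units.diag]
    -- For equal letters the entry is a $\psi$ of one factor, which the copy of $V_{\beta^{(j)}}$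
    -- takes back to $\psi_b$ at this word. For different letters the entry is $1$ and the matrix
    -- unit itself is $\psi_b$.
    by_cases hb : t.1 (prev b) = t.1 b
    · rw [step_eq_self hb, h.units.diag]
      obtain ⟨k, hk⟩ := exists_pos t (rfl : t.1 b = _)
      generalize t.1 b = j at k hk hb
      subst hk
      have hb' := hb.trans (letter_pos t j k).symm
      rw [psiEntry_pos hb', psiT, h.factor, (h.part j).psi k t hb']
    · rw [psiEntry_of_ne hb, map_one, one_mul, h.units.step b t hb]

/-- The composite with the copy of $V_{\beta^{(j)}}$ is the scalar embedding. Together with the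
images of the matrix units this shows that the explicit homomorphism is surjective and has the
constructed right inverse. -/
theorem map_factor (h : IsWordIso hβ τ f F Θ Ψ) (j : Fin d) (x : VPart K D lam gam β j) :
    Θ (f j x) = Matrix.diagonal fun _ => QuiverHeckeB.factor K D lam gam β j x := by
  have R := isRep_mat (K := K) (D := D) hβ hadm
  suffices H : Θ.comp (f j) = (Matrix.scalarAlgHom (Words n (D.size β)) K).comp
      (QuiverHeckeB.factor K D lam gam β j) from DFunLike.congr_fun H x
  refine V.algHom_ext (fun e _ => ?_) (fun k => ?_) (fun k => ?_)
  · change Θ (f j (V.idem K _ _ _ _ e)) = Matrix.diagonal fun _ => QuiverHeckeB.factor K D lam gam β j _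
    refine R.ext_right hβ.finite fun i _ => ?_
    obtain ⟨s, g, rfl⟩ | hi := isWord_or (D := D) (D.size β) i
    · rw [← h.idem, ← map_mul, h.part_idem_mul hadm, h.idem, matE_glue, diagonal_mul_single]
      by_cases hg : g j = e
      · subst hg
        rw [partIdem, dg_mul_idem hβ hadm ⟨comp_glue s g, fun k => glue_pos s g j k⟩, h.idem,
          matE_glue, factor_idem_mul hβ hadm]
      · rw [partIdem, dg_mul_idem_of_not hβ hadm fun h => hg (funext fun k => Subtype.ext (by
          rw [← h.2 k, glue_pos])), map_zero, ← factor_idem_mul hβ hadm g j, ← mul_assoc,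
          ← map_mul, (isRep_part (K := K) (D := D) hβ hadm j).E_mul_ne _ _ (Ne.symm hg),
          map_zero, zero_mul, Matrix.single_zero]
    · rw [matE_of_not_word hi, mul_zero, mul_zero]
  · change Θ (f j (V.y K _ _ _ _ k)) = Matrix.diagonal fun _ => QuiverHeckeB.factor K D lam gam β j _
    refine matrix_ext_single fun t => ?_
    rw [← h.map_units hadm, h.units.diag, ← map_mul, (h.part j).y, map_mul, h.y,
      h.map_wordIdem hadm, matY_mul_single, posEquiv_symm_pos, diagonal_mul_single]
    rfl
  · change Θ (f j (V.psi K _ _ _ _ k)) = Matrix.diagonal fun _ => QuiverHeckeB.factor K D lam gam β j _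
    obtain ⟨i, hi⟩ := hβ.nonempty
    obtain ⟨s, hs⟩ := exists_sorted (keyMin j) (D.word hβ hi)
    have hk := letter_prev_pos_of_sorted hs k
    -- The image of $\psi_k$ is given directly only at some words. Both sides commute with the
    -- matrix units, so the word that begins with the letters $j$ suffices.
    refine (h.units.toIsMatUnits.map Θ).ext_of_commute (fun u t => ?_) (fun u t => ?_) s ?_
    · rw [← map_mul, (h.part j).comm, map_mul]
    · rw [h.map_units hadm, diagonal_mul_single, single_mul_diagonal, mul_one, one_mul]
    · rw [← map_mul, h.units.diag, (h.part j).psi k s hk, map_mul, h.psi, h.map_wordIdem hadm,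
        matP_mul_single, step_eq_self hk, psiEntry_pos hk, diagonal_mul_single]
      rfl

theorem map_tens (h : IsWordIso hβ τ f F Θ Ψ) (x : TensV K D lam gam β) :
    Θ (F x) = Matrix.diagonal fun _ => x := by
  suffices H : Θ.comp F = Matrix.scalarAlgHom (Words n (D.size β)) K from DFunLike.congr_fun H x
  refine PiTensorProduct.algHom_ext fun j => AlgHom.ext fun x => ?_
  change Θ (F (QuiverHeckeB.factor K D lam gam β j x)) = _
  rw [h.factor, h.map_factor hadm]
  rfl

theorem right_inv (h : IsWordIso hβ τ f F Θ Ψ) (X : WordMat K D lam gam β) : Θ (Ψ X) = X := by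
  induction X using Matrix.induction_on' with
  | h_zero => rw [map_zero, map_zero]
  | h_add X Y hX hY => rw [map_add, map_add, hX, hY]
  | h_std_basis s t x =>
    rw [h.single, map_mul, h.map_tens hadm, h.map_units hadm, diagonal_mul_single, mul_one]

end IsWordIso

end V

end WordIso

/-! ### Compatibility of the isomorphism with the gradings -/

section MatrixGrading

variable {K : Type*} [CommRing K] {W T : Type*} [Fintype W] [DecidableEq W] [Ring T] [Algebra K T]
  {𝒯 : ℤ → Submodule K T} {k l : ℤ}

omit [Fintype W] in
theorem single_mem_matrix {x : T} (hx : x ∈ 𝒯 k) (s t : W) :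
    Matrix.single s t x ∈ (𝒯 k).matrix := fun s' t' => by
  rw [Matrix.single_apply]
  split_ifs
  · exact hx
  · exact Submodule.zero_mem _

omit [DecidableEq W] in
theorem mul_mem_matrix (hmul : ∀ k l, ∀ x ∈ 𝒯 k, ∀ y ∈ 𝒯 l, x * y ∈ 𝒯 (k + l))
    {X Y : Matrix W W T} (hX : X ∈ (𝒯 k).matrix) (hY : Y ∈ (𝒯 l).matrix) :
    X * Y ∈ (𝒯 (k + l)).matrix := fun s t => by
  rw [Matrix.mul_apply]
  exact Submodule.sum_mem _ fun u _ => hmul _ _ _ (hX s u) _ (hY u t)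

end MatrixGrading

section Grading

variable {K : Type w} [CommRing K] {I : Type u} {A : Type v} {Γ : InvQuiver I A}
  {lam : I → ℕ} {gam : I → K} {n : ℕ} {β : Set (Fin n → I)} {d : ℕ} {D : Γ.Decomposition d}

theorem psiDeg_part {t : Words n (D.size β)} {j : Fin d} {k : Fin (D.size β j)}
    (ht : t.1 (prev (pos t j k)) = t.1 (pos t j k)) {i : Fin n → I}
    {e : Fin (D.size β j) → D.verts j} (hi : ∀ k, i (pos t j k) = e k) :
    psiDeg Γ lam gam (pos t j k) i =
      psiDeg (D.part j) (fun i => lam i) (fun i => gam i) k e := by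
  obtain ⟨h1, h2⟩ := prev_pos ht
  unfold psiDeg
  rw [h1, hi, hi, deg₂_part, deg₁_part]
  exact if_congr h2 rfl rfl

namespace V

variable {hβ : Γ.IsBOrbit β} (hadm : Γ.Admissible lam gam)
  {τ : Words n (D.size β) → Words n (D.size β) → V K Γ lam gam β}
  {f : ∀ j, VPart K D lam gam β j →ₐ[K] V K Γ lam gam β}
  {F : TensV K D lam gam β →ₐ[K] V K Γ lam gam β}
  {Θ : V K Γ lam gam β →ₐ[K] WordMat K D lam gam β}
  {Ψ : WordMat K D lam gam β →ₐ[K] V K Γ lam gam β}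

include hadm

/-- An element that commutes with the matrix units is recovered from its component at `s` by
conjugation with units, which have degree $0$. So degrees can be read at a word where the generators
have explicit images. -/
theorem IsPartHom.mem_grade (hτ : IsWordUnits hβ τ) {j : Fin d}
    {f : VPart K D lam gam β j →ₐ[K] V K Γ lam gam β} (hf : IsPartHom hβ τ j f) {k : ℤ}
    {x : VPart K D lam gam β j} (hx : x ∈ V.grade K _ _ _ _ k) :
    f x ∈ V.grade K Γ lam gam β k := by
  obtain ⟨i, hi⟩ := hβ.nonempty
  obtain ⟨s, hs⟩ := exists_sorted (keyMin j) (D.word hβ hi)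
  have key : ∀ k x, f x * wordIdem K lam gam hβ s ∈ V.grade K Γ lam gam β k →
      f x ∈ V.grade K Γ lam gam β k := fun k x hx => by
    rw [← mul_one (f x), ← hτ.sum_diag, Finset.mul_sum]
    refine Submodule.sum_mem _ fun t _ => ?_
    rw [← hτ.mul t s t, ← mul_assoc, hf.comm, ← hτ.wordIdem_mul s t, ← mul_assoc,
      mul_assoc (τ t s)]
    have h := mul_mem_grade (mul_mem_grade (hτ.mem_grade t s) hx) (hτ.mem_grade s t)
    rwa [zero_add, add_zero] at h
  refine V.grade_induction (p := fun k x => f x ∈ V.grade K Γ lam gam β k)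
    (fun k => ?_) (fun k x x' hx hx' => ?_) (fun k c x hx => ?_) (fun e _ => key _ _ ?_)
    (fun k => key _ _ ?_) (fun k e _ => key _ _ ?_) (fun k l x x' hx hx' => ?_) hx
  · rw [map_zero]; exact Submodule.zero_mem _
  · rw [map_add]; exact Submodule.add_mem _ hx hx'
  · rw [map_smul]; exact Submodule.smul_mem _ c hx
  · rw [hf.idem]; exact dg_mem_grade hβ
  · rw [hf.y]
    have h := mul_mem_grade (y_mem_grade (K := K) (Γ := Γ) (lam := lam) (gam := gam) (β := β)
      (pos s j k)) (dg_mem_grade hβ (p := fun i => D.comp ∘ i = s.1))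
    rwa [add_zero] at h
  · have hk := letter_prev_pos_of_sorted hs k
    rw [map_mul, mul_assoc, hf.idem, ← wordIdem_mul_partIdem hβ hadm, ← mul_assoc, hf.psi k s hk,
      mul_assoc, wordIdem_mul_partIdem hβ hadm]
    refine mul_dg_mem_grade hβ fun i hi => ?_
    rw [← psiDeg_part hk hi.2]
    exact psi_mem_grade (Γ := Γ) _ i
  · rw [map_mul]; exact mul_mem_grade hx hx'

variable (K D lam gam β) in
/-- The grading of `⊗_j V_{β^(j)}`. -/
abbrev gradeT : ℤ → Submodule K (TensV K D lam gam β) :=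
  tensorGrade fun j => V.grade K (D.part j) (fun i => lam i) (fun i => gam i) (D.sub β j)

theorem IsWordIso.map_mem (h : IsWordIso hβ τ f F Θ Ψ) {k : ℤ} {x : V K Γ lam gam β}
    (hx : x ∈ V.grade K Γ lam gam β k) : Θ x ∈ (gradeT K lam gam β D k).matrix := by
  have h1 : ∀ j, (1 : VPart K D lam gam β j) ∈ V.grade K _ _ _ _ 0 := fun j =>
    one_mem_grade (isBOrbit_sub hβ j) (D.admissible_part hadm j)
  have hm : ∀ k l, ∀ x ∈ gradeT K lam gam β D k, ∀ y ∈ gradeT K lam gam β D l,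
      x * y ∈ gradeT K lam gam β D (k + l) := fun k l x hx y hy =>
    tensorGrade_mul (fun j k l x hx y hy => mul_mem_grade hx hy) hx hy
  have hE : ∀ g, idemT K D lam gam β g ∈ gradeT K lam gam β D 0 := fun g =>
    Submodule.subset_span ⟨fun _ => 0, _, by simp, fun j => idem_mem_grade (g j), rfl⟩
  refine V.grade_induction (p := fun k x => Θ x ∈ (gradeT K lam gam β D k).matrix)
    (fun k => ?_) (fun k x x' hx hx' => ?_) (fun k c x hx => ?_) (fun i _ => ?_)
    (fun a => ?_) (fun b i _ => ?_) (fun k l x x' hx hx' => ?_) hx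
  · rw [map_zero]; exact Submodule.zero_mem _
  · rw [map_add]; exact Submodule.add_mem _ hx hx'
  · rw [map_smul]; exact Submodule.smul_mem _ c hx
  · rw [h.idem]
    obtain ⟨t, g, rfl⟩ | hi := isWord_or (D := D) (D.size β) i
    · rw [matE_glue]
      exact single_mem_matrix (hE g) t t
    · rw [matE_of_not_word hi]; exact Submodule.zero_mem _
  · rw [h.y]
    intro s t
    rw [matY, Matrix.diagonal_apply]
    split_ifs
    · exact single_mem_tensorGrade h1 (y_mem_grade _)
    · exact Submodule.zero_mem _
  · rw [map_mul, h.idem, h.psi]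
    obtain ⟨t, g, rfl⟩ | hi := isWord_or (D := D) (D.size β) i
    · rw [matE_glue, matP_mul_single]
      refine single_mem_matrix ?_ _ t
      by_cases hb : t.1 (prev b) = t.1 b
      · obtain ⟨k, hk⟩ := exists_pos t (rfl : t.1 b = _)
        generalize t.1 b = j at k hk hb
        subst hk
        have hb' := hb.trans (letter_pos t j k).symm
        rw [psiEntry_pos hb', ← factor_idem_mul hβ hadm g j, ← mul_assoc, psiT, ← map_mul,
          psiDeg_part hb' (glue_pos t g j), ← add_zero (psiDeg _ _ _ _ _)]
        exact hm _ _ _ (single_mem_tensorGrade h1 (psi_mem_grade k (g j))) _ (hE g)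
      · have hb0 : b.val ≠ 0 := fun h0 => hb (by rw [prev_first h0])
        have hc := comp_glue (D := D) t g
        rw [psiEntry_of_ne hb, one_mul, psiDeg_of_succ lam gam (prev_add_one hb0),
          D.deg₂_of_comp_ne]
        · exact hE g
        · rw [← hc] at hb; exact hb
    · rw [matE_of_not_word hi, mul_zero]; exact Submodule.zero_mem _
  · rw [map_mul]; exact mul_mem_matrix hm hx hx'

theorem IsWordIso.inv_mem (h : IsWordIso hβ τ f F Θ Ψ) {k : ℤ} {X : WordMat K D lam gam β}
    (hX : X ∈ (gradeT K lam gam β D k).matrix) : Ψ X ∈ V.grade K Γ lam gam β k := by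
  rw [Matrix.matrix_eq_sum_single X, map_sum]
  refine Submodule.sum_mem _ fun s _ => ?_
  rw [map_sum]
  refine Submodule.sum_mem _ fun t _ => ?_
  rw [h.single]
  have h1 : F (X s t) ∈ V.grade K Γ lam gam β k :=
    tensorHom_mem (one_mem_grade hβ hadm) (fun k l x hx y hy => mul_mem_grade hx hy)
      (fun j k x hx => by
        change F (QuiverHeckeB.factor K D lam gam β j x) ∈ _
        rw [h.factor]
        exact (h.part j).mem_grade hadm h.units hx) (hX s t)
  have h2 := mul_mem_grade h1 (h.units.mem_grade s t)
  rwa [add_zero] at h2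

theorem IsWordIso.map_mem_iff (h : IsWordIso hβ τ f F Θ Ψ) {k : ℤ} {x : V K Γ lam gam β} :
    Θ x ∈ (gradeT K lam gam β D k).matrix ↔ x ∈ V.grade K Γ lam gam β k := by
  refine ⟨fun hx => ?_, h.map_mem hadm⟩
  have := h.inv_mem hadm hx
  rwa [show Ψ (Θ x) = x from DFunLike.congr_fun (h.left_inv hadm) x] at this

end V

end Grading

/-! ### Passage to the cyclotomic quotients -/

section Cyclotomic

variable {K : Type w} [CommRing K] {I : Type u} {A : Type v} {Γ : InvQuiver I A}
  {lam : I → ℕ} {gam : I → K} {n : ℕ} {β : Set (Fin n → I)} {d : ℕ} {D : Γ.Decomposition d}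
  {hβ : Γ.IsBOrbit β} (hadm : Γ.Admissible lam gam)
  {τ : Words n (D.size β) → Words n (D.size β) → V K Γ lam gam β}
  {f : ∀ j, VPart K D lam gam β j →ₐ[K] V K Γ lam gam β}
  {F : TensV K D lam gam β →ₐ[K] V K Γ lam gam β}
  {Θ : V K Γ lam gam β →ₐ[K] WordMat K D lam gam β}
  {Ψ : WordMat K D lam gam β →ₐ[K] V K Γ lam gam β} (Lam : I → ℕ)

variable (K D lam gam β) in
/-- `⊗_j V_{β^(j)}^{Λ^(j)}`. -/
abbrev TensVCyc : Type (max u w) := ⨂[K] j, VCycPart K D lam gam β Lam j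

variable (K D lam gam β) in
/-- The quotient map from `V_{β^(j)}`. -/
abbrev partMk (j : Fin d) : VPart K D lam gam β j →ₐ[K] VCycPart K D lam gam β Lam j :=
  VCyc.mk K (D.part j) (fun i => lam i) (fun i => gam i) (D.sub β j) (fun i => Lam i)

include hadm

namespace V

omit hadm in
open Classical in
theorem map_mul_dg_eq_zero {B : Type*} [Ring B] [Algebra K B] (φ : V K Γ lam gam β →ₐ[K] B)
    (hβ : Γ.IsBOrbit β) {p : (Fin n → I) → Prop} {x : V K Γ lam gam β}
    (h : ∀ i, p i → φ (x * idem K Γ lam gam β i) = 0) : φ (x * dg K lam gam hβ p) = 0 := by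
  rw [dg, Finset.mul_sum, map_sum]
  exact Finset.sum_eq_zero fun i hi => h i (Finset.mem_filter.1 hi).2

/-- The relator of the part is compared at a word that begins with $j$. There its $y_1$ is the $y_1$
of $V_\beta$, so it becomes a combination of relators; the matrix units carry its vanishing to all
words. -/
theorem exists_partCyc (hτ : IsWordUnits hβ τ) {j : Fin d}
    {f : VPart K D lam gam β j →ₐ[K] V K Γ lam gam β} (hf : IsPartHom hβ τ j f) :
    ∃ g : VCycPart K D lam gam β Lam j →ₐ[K] VCyc K Γ lam gam β Lam,
      ∀ x, g (partMk K lam gam β D Lam j x) = VCyc.mk K Γ lam gam β Lam (f x) := by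
  refine VCyc.exists_lift ((VCyc.mk K Γ lam gam β Lam).comp f) fun o ho e _ => ?_
  change VCyc.mk K Γ lam gam β Lam (f _) = 0
  obtain ⟨i, hi⟩ := hβ.nonempty
  obtain ⟨s, hs⟩ := exists_sorted (keyMin j) (D.word hβ hi)
  have hv : (pos s j o).val = 0 := by
    rw [pos_sorted_min (keyMin_injective j) hs (keyMin_self j), ho]
  refine (hτ.toIsMatUnits.map (VCyc.mk K Γ lam gam β Lam)).ext_of_commute (fun u t => ?_)
    (fun u t => by rw [zero_mul, mul_zero]) s ?_
  · rw [← map_mul, hf.comm, map_mul]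
  · have hpow : ∀ m : ℕ, f (V.y K _ _ _ _ o) ^ m * wordIdem K lam gam hβ s =
        V.y K Γ lam gam β (pos s j o) ^ m * wordIdem K lam gam hβ s := fun m => by
      induction m with
      | zero => rw [pow_zero, pow_zero]
      | succ m ih =>
        rw [pow_succ, mul_assoc, hf.y, wordIdem, y_mul_dg hβ hadm, ← mul_assoc]
        change _ * wordIdem K lam gam hβ s * _ = _
        rw [ih, mul_assoc, wordIdem, ← y_mul_dg hβ hadm, ← mul_assoc, ← pow_succ]
    rw [zero_mul, ← map_mul, hτ.diag, map_mul f, map_pow, mul_assoc, hf.idem,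
      ← wordIdem_mul_partIdem hβ hadm, ← mul_assoc, hpow, mul_assoc,
      wordIdem_mul_partIdem hβ hadm, partIdem]
    refine map_mul_dg_eq_zero _ hβ fun i hi => ?_
    rw [← hi.2 o]
    exact VCyc.mk_rel (Lam := Lam) _ hv i

/-- The isomorphism of cyclotomic quotients. -/
theorem IsWordIso.exists_cyc (h : IsWordIso hβ τ f F Θ Ψ)
    {q : TensV K D lam gam β →ₐ[K] TensVCyc K lam gam β D Lam}
    (hq : ∀ j x, q (PiTensorProduct.singleAlgHom j x) =
      PiTensorProduct.singleAlgHom j (partMk K lam gam β D Lam j x)) :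
    ∃ Φ : VCyc K Γ lam gam β Lam ≃ₐ[K]
        Matrix (Words n (D.size β)) (Words n (D.size β)) (TensVCyc K lam gam β D Lam),
      ∀ x, Φ (VCyc.mk K Γ lam gam β Lam x) = (Θ x).map q := by
  have hqs : Function.Surjective q := tensorMap_surjective hq fun j => VCyc.mk_surjective
  obtain ⟨ΘL, hΘL⟩ := VCyc.exists_lift (Lam := Lam) (q.mapMatrix.comp Θ) fun o ho i hi => by
    change q.mapMatrix (Θ _) = 0
    obtain ⟨t, g, rfl⟩ | hi' := isWord_or (D := D) (D.size β) i
    · obtain ⟨k, hk⟩ := exists_pos t (rfl : t.1 o = _)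
      generalize t.1 o = j at k hk
      subst hk
      -- The letter in the first position is the first occurrence of its kind, so
      -- $y_1^{\Lambda_{i_1}}e(i)$ becomes a multiple of the relator in that tensor factor.
      have hk0 : k.val = 0 := (prev_pos (t := t) (j := j) (k := k) (by rw [prev_first ho])).2.1 ho
      have h1 := pow_matY_mul_single (K := K) (D := D) (lam := lam) (gam := gam) t t
        (idemT K D lam gam β g) 0 (Lam (g j k)) (pos t j k)
      rw [pow_zero, one_mul, pow_zero, one_mul, posEquiv_symm_pos, yT, ← map_pow,
        ← factor_idem_mul hβ hadm g j, ← mul_assoc, ← map_mul, factor_idem_mul hβ hadm g j] at h1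
      have h2 := VCyc.mk_rel (K := K) (Γ := D.part j) (lam := fun i => lam i)
        (gam := fun i => gam i) (β := D.sub β j) (Lam := fun i => Lam i) k hk0 (g j)
      rw [map_mul, map_pow, h.y, h.idem, matE_glue, glue_pos, h1, AlgHom.mapMatrix_apply,
        Matrix.map_single, map_mul]
      change Matrix.single t t (q (PiTensorProduct.singleAlgHom j _) * _) = 0
      rw [hq, partMk, h2, map_zero, zero_mul, Matrix.single_zero]
    · exact absurd rfl (hi' (D.word hβ hi))
  choose g hg using fun j => exists_partCyc hadm Lam h.units (h.part j)
  obtain ⟨G, hG⟩ := exists_tensorHom g fun j l hjl x z => by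
    obtain ⟨x, rfl⟩ := VCyc.mk_surjective x
    obtain ⟨z, rfl⟩ := VCyc.mk_surjective z
    rw [hg, hg]
    exact ((h.part j).commute h.units hjl (h.part l) hadm x z).map _
  have hGq : ∀ x, G (q x) = VCyc.mk K Γ lam gam β Lam (F x) := fun x => by
    suffices H : G.comp q = (VCyc.mk K Γ lam gam β Lam).comp F from DFunLike.congr_fun H x
    refine PiTensorProduct.algHom_ext fun j => AlgHom.ext fun x => ?_
    change G (q (PiTensorProduct.singleAlgHom j x)) =
      VCyc.mk K Γ lam gam β Lam (F (QuiverHeckeB.factor K D lam gam β j x))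
    rw [hq, hG, hg, h.factor]
  have hu := h.units.toIsMatUnits.map (VCyc.mk K Γ lam gam β Lam)
  have hGc : ∀ x s t, G x * VCyc.mk K Γ lam gam β Lam (τ s t) =
      VCyc.mk K Γ lam gam β Lam (τ s t) * G x := fun x s t => by
    obtain ⟨x, rfl⟩ := hqs x
    rw [hGq, ← map_mul, h.comm, map_mul]
  -- The inverse on the quotients is assembled from the same matrix units; its compatibility with
  -- the quotient maps reduces both composites to those already known upstairs.
  have hΨL : ∀ X : WordMat K D lam gam β, hu.matHom G hGc (q.mapMatrix X) =
      VCyc.mk K Γ lam gam β Lam (Ψ X) := fun X => by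
    induction X using Matrix.induction_on' with
    | h_zero => simp only [map_zero]
    | h_add X Y hX hY => simp only [map_add, hX, hY]
    | h_std_basis s t x =>
      rw [AlgHom.mapMatrix_apply, Matrix.map_single, IsMatUnits.matHom_single, h.single, hGq,
        map_mul]
  refine ⟨AlgEquiv.ofAlgHom ΘL (hu.matHom G hGc) (AlgHom.ext fun X => ?_)
    (AlgHom.ext fun x => ?_), hΘL⟩
  · obtain ⟨X, rfl⟩ : ∃ X' : WordMat K D lam gam β, q.mapMatrix X' = X := by
      choose r hr using hqs
      exact ⟨X.map r, by ext s t; exact hr _⟩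
    change ΘL (hu.matHom G hGc (q.mapMatrix X)) = q.mapMatrix X
    rw [hΨL, hΘL]
    change q.mapMatrix (Θ (Ψ X)) = _
    rw [h.right_inv hadm]
  · obtain ⟨x, rfl⟩ := VCyc.mk_surjective x
    change hu.matHom G hGc (ΘL _) = _
    rw [hΘL]
    change hu.matHom G hGc (q.mapMatrix (Θ x)) = _
    rw [hΨL, show Ψ (Θ x) = x from DFunLike.congr_fun (h.left_inv hadm) x]
    rfl

variable (K D lam gam β) in
omit hadm in
/-- The grading of `⊗_j V_{β^(j)}^{Λ^(j)}`. -/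
abbrev gradeTCyc : ℤ → Submodule K (TensVCyc K lam gam β D Lam) :=
  tensorGrade fun j => VCyc.grade K (D.part j) (fun i => lam i) (fun i => gam i) (D.sub β j)
    (fun i => Lam i)

/-- On both sides the homogeneous elements are exactly the images of homogeneous elements upstairs.
Lifting the entries one by one reduces the claim to the isomorphism before passing to quotients. -/
theorem IsWordIso.cyc_mem_iff (h : IsWordIso hβ τ f F Θ Ψ)
    {q : TensV K D lam gam β →ₐ[K] TensVCyc K lam gam β D Lam}
    (hq : ∀ b, q (PiTensorProduct.tprod K b) =
      PiTensorProduct.tprod K fun j => partMk K lam gam β D Lam j (b j))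
    {Φ : VCyc K Γ lam gam β Lam ≃ₐ[K]
        Matrix (Words n (D.size β)) (Words n (D.size β)) (TensVCyc K lam gam β D Lam)}
    (hΦ : ∀ x, Φ (VCyc.mk K Γ lam gam β Lam x) = (Θ x).map q) (k : ℤ)
    (x : VCyc K Γ lam gam β Lam) :
    Φ x ∈ (gradeTCyc K lam gam β D Lam k).matrix ↔ x ∈ VCyc.grade K Γ lam gam β Lam k := by
  have hmem : ∀ {x}, x ∈ gradeTCyc K lam gam β D Lam k ↔
      ∃ x' ∈ gradeT K lam gam β D k, q x' = x := mem_tensorGrade_map hq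
  rw [VCyc.mem_grade_iff]
  constructor
  · intro hx
    choose r hr hr' using fun s t => hmem.1 (hx s t)
    obtain ⟨y, hy⟩ : ∃ y, Θ y = Matrix.of r := ⟨_, h.right_inv hadm _⟩
    refine ⟨y, (h.map_mem_iff hadm).1 (by rw [hy]; exact hr), Φ.injective ?_⟩
    rw [hΦ, hy]
    ext s t
    exact hr' s t
  · rintro ⟨y, hy, rfl⟩ s t
    rw [hΦ]
    exact hmem.2 ⟨_, h.map_mem hadm hy s t, rfl⟩

end V

end Cyclotomic

/-! ### The isomorphism for one orbit -/

section BlockIso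

variable {K : Type w} [CommRing K] {I : Type u} {A : Type v} {Γ : InvQuiver I A}
  {lam : I → ℕ} {gam : I → K} {n : ℕ} {β : Set (Fin n → I)} {d : ℕ}

/-- The isomorphism of graded algebras for a `B_n`-orbit, and its cyclotomic quotients. -/
theorem exists_blockIso (D : Γ.Decomposition d) (hβ : Γ.IsBOrbit β)
    (hadm : Γ.Admissible lam gam) :
    ∃ Θ : V K Γ lam gam β ≃ₐ[K] MatV K D lam gam β,
      IsGradedBijection (V.grade K Γ lam gam β) (MatV.grade K D lam gam β) Θ ∧
      ∀ Lam : I → ℕ, ∃ ΘL : VCyc K Γ lam gam β Lam ≃ₐ[K] MatVCyc K D lam gam β Lam,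
        IsGradedBijection (VCyc.grade K Γ lam gam β Lam) (MatVCyc.grade K D lam gam β Lam) ΘL ∧
        ∀ x, ΘL (VCyc.mk K Γ lam gam β Lam x) = MatV.toCyc K D lam gam β Lam (Θ x) := by
  classical
  obtain ⟨τ, f, F, Θ, Ψ, h⟩ := V.exists_isWordIso (K := K) (D := D) hβ hadm
  obtain ⟨i, hi⟩ := hβ.nonempty
  -- Rows and columns are renumbered by an arbitrary enumeration of the words, whose number is the
  -- multinomial coefficient.
  let ε : Words n (D.size β) ≃ Fin (Nat.multinomial Finset.univ (D.size β)) :=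
    Fintype.equivFinOfCardEq (card_words (D.word hβ hi))
  let Θ' : V K Γ lam gam β ≃ₐ[K] WordMat K D lam gam β :=
    AlgEquiv.ofAlgHom Θ Ψ (AlgHom.ext (h.right_inv hadm)) (h.left_inv hadm)
  refine ⟨Θ'.trans (Matrix.reindexAlgEquiv K _ ε), ?_, fun Lam => ?_⟩
  · refine isGradedBijection_of_mem_iff (V.isAlgGrading hβ hadm)
      (Θ'.trans (Matrix.reindexAlgEquiv K _ ε)).toLinearEquiv
      (map_mul (Θ'.trans (Matrix.reindexAlgEquiv K _ ε))) fun k x => ?_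
    rw [← h.map_mem_iff hadm]
    constructor
    · intro hx s t
      have := hx (ε s) (ε t)
      change Θ x (ε.symm (ε s)) (ε.symm (ε t)) ∈ _ at this
      rwa [ε.symm_apply_apply, ε.symm_apply_apply] at this
    · exact fun hx s t => hx _ _
  · obtain ⟨q, hq1, hq2, hq3⟩ := exists_tensorMap (partMk K lam gam β D Lam)
    obtain ⟨Φ, hΦ⟩ := h.exists_cyc hadm Lam hq2
    refine ⟨Φ.trans (Matrix.reindexAlgEquiv K _ ε), ?_, fun x => ?_⟩
    · refine isGradedBijection_of_mem_iff (VCyc.isAlgGrading hβ hadm)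
        (Φ.trans (Matrix.reindexAlgEquiv K _ ε)).toLinearEquiv
        (map_mul (Φ.trans (Matrix.reindexAlgEquiv K _ ε))) fun k x => ?_
      rw [← h.cyc_mem_iff hadm Lam hq1 hΦ]
      constructor
      · intro hx s t
        have := hx (ε s) (ε t)
        change Φ x (ε.symm (ε s)) (ε.symm (ε t)) ∈ _ at this
        rwa [ε.symm_apply_apply, ε.symm_apply_apply] at this
      · exact fun hx s t => hx _ _
    · change Matrix.reindex ε ε (Φ _) = MatV.toCyc K D lam gam β Lam (Matrix.reindex ε ε (Θ x))
      rw [hΦ]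
      ext s t
      exact hq3 _

end BlockIso

/-! ### Direct sum decompositions of modules, matrices and tensor products -/

section SumDecomposition

variable {K : Type*} [CommRing K] {ι : Type*} {M : Type*} [AddCommMonoid M] [Module K M]
  {N : ι → Type*} [∀ i, AddCommMonoid (N i)] [∀ i, Module K (N i)]

/-- Projections `π` and inclusions `J` that make a module a direct sum. -/
structure IsSumDecomp (π : ∀ i, M →ₗ[K] N i) (J : ∀ i, N i →ₗ[K] M) : Prop where
  self : ∀ i x, π i (J i x) = x
  ne : ∀ i l, i ≠ l → ∀ x, π l (J i x) = 0
  top : ⨆ i, LinearMap.range (J i) = ⊤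

namespace IsSumDecomp

variable {π : ∀ i, M →ₗ[K] N i} {J : ∀ i, N i →ₗ[K] M}

theorem mem_iSup (h : IsSumDecomp π J) (m : M) : m ∈ ⨆ i, LinearMap.range (J i) := by
  rw [h.top]; trivial

theorem finite (h : IsSumDecomp π J) (m : M) : {i | π i m ≠ 0}.Finite := by
  induction h.mem_iSup m using Submodule.iSup_induction' with
  | mem i m hm =>
    obtain ⟨x, rfl⟩ := hm
    refine (Set.finite_singleton i).subset fun l hl => ?_
    by_contra h'
    exact hl (h.ne i l (fun h'' => h' h''.symm) x)
  | zero => simp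
  | add x y _ _ hx hy =>
    refine (hx.union hy).subset fun l hl => ?_
    by_contra h'
    simp only [Set.mem_union, Set.mem_ofPred_eq, not_or, not_not] at h'
    exact hl (by rw [map_add, h'.1, h'.2, add_zero])

/-- The identity is additive and clear on each summand, and the summands span. Finiteness of the
support makes the sum meaningful for infinitely many summands. -/
theorem sum_eq (h : IsSumDecomp π J) (m : M) :
    m = ∑ i ∈ (h.finite m).toFinset, J i (π i m) := by
  have hsupp : ∀ m, (Function.support fun i => J i (π i m)) ⊆ {i | π i m ≠ 0} := fun m i hi h' =>
    hi (by
      change J i (π i m) = 0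
      rw [h', map_zero])
  rw [← finsum_eq_sum_of_support_subset _ (by
    rw [Set.Finite.coe_toFinset]; exact hsupp m)]
  induction h.mem_iSup m using Submodule.iSup_induction' with
  | mem i m hm =>
    obtain ⟨x, rfl⟩ := hm
    rw [finsum_eq_single _ i fun l hl => by rw [h.ne i l hl.symm, map_zero], h.self]
  | zero => simp
  | add x y _ _ hx hy =>
    simp only [map_add]
    rw [finsum_add_distrib ((h.finite x).subset (hsupp x)) ((h.finite y).subset (hsupp y)), ← hx,
      ← hy]

theorem ext (h : IsSumDecomp π J) {x y : M} (hxy : ∀ i, π i x = π i y) : x = y := by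
  rw [h.sum_eq x, h.sum_eq y]
  simp only [hxy]

theorem mem_of_mem (h : IsSumDecomp π J) {S : Submodule K M} {m : M}
    (hm : ∀ i, J i (π i m) ∈ S) : m ∈ S := by
  rw [h.sum_eq m]
  exact Submodule.sum_mem _ fun i _ => hm i

theorem sigma {κ : ι → Type*} {P : (Σ i, κ i) → Type*} [∀ p, AddCommMonoid (P p)]
    [∀ p, Module K (P p)] (h : IsSumDecomp π J) {ρ : ∀ i k, N i →ₗ[K] P ⟨i, k⟩}
    {L : ∀ i k, P ⟨i, k⟩ →ₗ[K] N i} (hρ : ∀ i, IsSumDecomp (ρ i) (L i)) :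
    IsSumDecomp (fun p : Σ i, κ i => ρ p.1 p.2 ∘ₗ π p.1) (fun p => J p.1 ∘ₗ L p.1 p.2) where
  self p x := by simp [h.self, (hρ p.1).self]
  ne := by
    rintro ⟨i, k⟩ ⟨i', k'⟩ hne x
    change ρ i' k' (π i' (J i (L i k x))) = 0
    by_cases hi : i = i'
    · subst hi
      rw [h.self, (hρ i).ne]
      exact fun hk => hne (by rw [hk])
    · rw [h.ne _ _ hi, map_zero]
  top := by
    rw [iSup_sigma, ← h.top]
    refine iSup_congr fun i => ?_
    simp only [LinearMap.range_comp]
    rw [← Submodule.map_iSup, (hρ i).top, Submodule.map_top]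

theorem comp_equiv {ι' : Type*} (h : IsSumDecomp π J) {e : ι' → ι} (he : Function.Bijective e)
    {P : ι' → Type*} [∀ p, AddCommMonoid (P p)] [∀ p, Module K (P p)]
    (f : ∀ i, P i ≃ₗ[K] N (e i)) :
    IsSumDecomp (fun i => ((f i).symm : N (e i) →ₗ[K] P i) ∘ₗ π (e i))
      (fun i => J (e i) ∘ₗ (f i : P i →ₗ[K] N (e i))) where
  self i x := by simp [h.self]
  ne i l hil x := by simp [h.ne _ _ (he.1.ne hil)]
  top := by
    rw [← h.top, ← he.2.iSup_comp]
    refine iSup_congr fun i => ?_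
    rw [LinearMap.range_comp, LinearEquiv.range, Submodule.map_top]

theorem matrix (h : IsSumDecomp π J) (W : Type*) [Fintype W] :
    IsSumDecomp (fun i => (π i).mapMatrix (m := W) (n := W))
      (fun i => (J i).mapMatrix (m := W) (n := W)) where
  self i x := by ext s t; exact h.self i _
  ne i l hil x := by ext s t; exact h.ne i l hil _
  top := by
    classical
    refine eq_top_iff.2 fun X _ => ?_
    induction X using Matrix.induction_on' with
    | h_zero => exact Submodule.zero_mem _
    | h_add X Y hX hY => exact Submodule.add_mem _ (hX trivial) (hY trivial)
    | h_std_basis s t m =>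
      rw [h.sum_eq m, ← Matrix.singleAddMonoidHom_apply, map_sum]
      refine Submodule.sum_mem _ fun i _ => Submodule.mem_iSup_of_mem i ⟨Matrix.single s t (π i m), ?_⟩
      exact Matrix.map_single _ _ _ _

end IsSumDecomp

/-- Tensor products distribute over direct sums: a pure tensor of finite sums expands into pure
tensors indexed by the choices of one summand in every factor. -/
theorem isSumDecomp_tensor {d : ℕ} {κ : Fin d → Type*} {M : Fin d → Type*}
    [∀ j, AddCommMonoid (M j)] [∀ j, Module K (M j)] {N : ∀ j, κ j → Type*}
    [∀ j k, AddCommMonoid (N j k)] [∀ j k, Module K (N j k)] {π : ∀ j k, M j →ₗ[K] N j k}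
    {J : ∀ j k, N j k →ₗ[K] M j} (h : ∀ j, IsSumDecomp (π j) (J j)) :
    IsSumDecomp (fun b : ∀ j, κ j => PiTensorProduct.map fun j => π j (b j))
      (fun b => PiTensorProduct.map fun j => J j (b j)) where
  self b x := by
    rw [← LinearMap.comp_apply, ← PiTensorProduct.map_comp]
    have : (fun j => π j (b j) ∘ₗ J j (b j)) = fun j => LinearMap.id :=
      funext fun j => LinearMap.ext fun x => (h j).self _ x
    rw [this, PiTensorProduct.map_id, LinearMap.id_apply]
  ne b b' hb x := by
    obtain ⟨j, hj⟩ := Function.ne_iff.1 hb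
    induction x using PiTensorProduct.induction_on with
    | smul_tprod r x =>
      rw [map_smul, map_smul, PiTensorProduct.map_tprod, PiTensorProduct.map_tprod,
        MultilinearMap.map_coord_zero _ j ((h j).ne _ _ hj _), smul_zero]
    | add x y hx hy => rw [map_add, map_add, hx, hy, add_zero]
  top := by
    classical
    refine eq_top_iff.2 fun x _ => ?_
    induction x using PiTensorProduct.induction_on with
    | smul_tprod r x =>
      refine Submodule.smul_mem _ _ ?_
      rw [show x = fun j => ∑ i ∈ ((h j).finite (x j)).toFinset, J j i (π j i (x j)) from
        funext fun j => (h j).sum_eq (x j), MultilinearMap.map_sum_finset]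
      refine Submodule.sum_mem _ fun b _ => Submodule.mem_iSup_of_mem b ?_
      exact ⟨PiTensorProduct.tprod K fun j => π j (b j) (x j), PiTensorProduct.map_tprod _ _⟩
    | add x y hx hy => exact Submodule.add_mem _ (hx trivial) (hy trivial)

theorem map_mem_tensorGrade {d : ℕ} {M N : Fin d → Type*} [∀ j, AddCommMonoid (M j)]
    [∀ j, Module K (M j)] [∀ j, AddCommMonoid (N j)] [∀ j, Module K (N j)]
    {𝒜 : ∀ j, ℤ → Submodule K (M j)} {ℬ : ∀ j, ℤ → Submodule K (N j)} {f : ∀ j, M j →ₗ[K] N j}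
    (h : ∀ j k, ∀ x ∈ 𝒜 j k, f j x ∈ ℬ j k) {k : ℤ} {x : ⨂[K] j, M j}
    (hx : x ∈ tensorGrade 𝒜 k) : PiTensorProduct.map f x ∈ tensorGrade ℬ k := by
  unfold tensorGrade at hx
  induction hx using Submodule.span_induction with
  | zero => rw [map_zero]; exact Submodule.zero_mem _
  | add x y _ _ hx hy => rw [map_add]; exact Submodule.add_mem _ hx hy
  | smul c x _ hx => rw [map_smul]; exact Submodule.smul_mem _ c hx
  | mem x hx =>
    obtain ⟨l, b, hl, hb, rfl⟩ := hx
    rw [PiTensorProduct.map_tprod]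
    exact Submodule.subset_span ⟨l, _, hl, fun j => h j _ _ (hb j), rfl⟩

theorem tensorMap_mul {d : ℕ} {M N : Fin d → Type*} [∀ j, NonUnitalNonAssocSemiring (M j)]
    [∀ j, Module K (M j)] [∀ j, SMulCommClass K (M j) (M j)] [∀ j, IsScalarTower K (M j) (M j)]
    [∀ j, NonUnitalNonAssocSemiring (N j)] [∀ j, Module K (N j)]
    [∀ j, SMulCommClass K (N j) (N j)] [∀ j, IsScalarTower K (N j) (N j)]
    {f : ∀ j, M j →ₗ[K] N j} (h : ∀ j x y, f j (x * y) = f j x * f j y) (x y : ⨂[K] j, M j) :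
    PiTensorProduct.map f (x * y) = PiTensorProduct.map f x * PiTensorProduct.map f y := by
  induction x using PiTensorProduct.induction_on with
  | add x x' hx hx' => rw [add_mul, map_add, hx, hx', map_add, add_mul]
  | smul_tprod r a =>
    induction y using PiTensorProduct.induction_on with
    | add y y' hy hy' => rw [mul_add, map_add, hy, hy', map_add, mul_add]
    | smul_tprod s b =>
      rw [PiTensorProduct.smul_tprod_mul_smul_tprod, map_smul, map_smul, map_smul,
        PiTensorProduct.map_tprod, PiTensorProduct.map_tprod, PiTensorProduct.map_tprod,
        PiTensorProduct.smul_tprod_mul_smul_tprod]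
      congr 2
      exact funext fun j => h j _ _

end SumDecomposition

/-! ### Direct sums as families with finite support -/

section DirectSums

variable {K : Type*} [CommRing K] {ι : Type*} {N : ι → Type*} [∀ i, NonUnitalSemiring (N i)]
  [∀ i, Module K (N i)]

variable (K N) in
/-- The projection onto a summand. -/
def dsumProj (i : ι) : DSum K N →ₗ[K] N i where
  toFun x := x.1 i
  map_add' _ _ := rfl
  map_smul' _ _ := rfl

theorem isSumDecomp_dsum : IsSumDecomp (dsumProj K N) dsumSingle where
  self _ x := dsumSingle_same (K := K) _ x
  ne _ _ hil x := dsumSingle_ne (K := K) hil.symm x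
  top := iSup_dsumSingle

/-- A module with inclusions and projections is a direct sum. -/
theorem IsSumDecomp.exists_equiv {M : Type*} [AddCommMonoid M] [Module K M]
    {π : ∀ i, M →ₗ[K] N i} {J : ∀ i, N i →ₗ[K] M} (h : IsSumDecomp π J) :
    ∃ e : M ≃ₗ[K] DSum K N, ∀ m i, (e m).1 i = π i m := by
  let P : M →ₗ[K] DSum K N :=
    { toFun := fun m => ⟨fun i => π i m, h.finite m⟩
      map_add' := fun x y => Subtype.ext (funext fun i => map_add (π i) x y)
      map_smul' := fun c x => Subtype.ext (funext fun i => map_smul (π i) c x) }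
  refine ⟨LinearEquiv.ofBijective P ⟨fun x y hxy => ?_, ?_⟩, fun m i => rfl⟩
  · exact h.ext fun i => congrArg (fun z : DSum K N => z.1 i) hxy
  · refine LinearMap.range_eq_top.1 (eq_top_iff.2 (iSup_dsumSingle.symm.le.trans ?_))
    refine iSup_le fun i => ?_
    rintro _ ⟨x, rfl⟩
    refine ⟨J i x, Subtype.ext (funext fun l => ?_)⟩
    change π l (J i x) = _
    by_cases hl : l = i
    · subst hl; rw [h.self, dsumSingle_same]
    · rw [h.ne _ _ (Ne.symm hl), dsumSingle_ne hl]

end DirectSums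

/-! ### Direct sums of matrix algebras -/

section SumMatrices

variable {K : Type*} [CommRing K] {k : ℤ}

theorem dsumSingle_mem {ι : Type*} {B : ι → Type*} [∀ i, NonUnitalSemiring (B i)]
    [∀ i, Module K (B i)] {𝒜 : ∀ i, ℤ → Submodule K (B i)} {i : ι} {x : B i} (hx : x ∈ 𝒜 i k) :
    dsumSingle i x ∈ dsumGrade 𝒜 k := fun l => by
  by_cases hl : l = i
  · subst hl; rw [dsumSingle_same]; exact hx
  · rw [dsumSingle_ne hl]; exact Submodule.zero_mem _

/-- Graded algebras that are isomorphic to the matrix algebras over the summands of given graded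
algebras have a direct sum that is isomorphic to the direct sum of the matrix algebras. -/
theorem exists_dsumMatIso {C : Type*} (W : C → ℕ) {κ : C → Type*} {T : C → Type*}
    [∀ c, NonUnitalSemiring (T c)] [∀ c, Module K (T c)] {P : ∀ c, κ c → Type*}
    [∀ c b, Ring (P c b)] [∀ c b, Algebra K (P c b)] {ρ : ∀ c b, T c →ₗ[K] P c b}
    {L : ∀ c b, P c b →ₗ[K] T c} (hT : ∀ c, IsSumDecomp (ρ c) (L c))
    (hρm : ∀ c b x y, ρ c b (x * y) = ρ c b x * ρ c b y) {𝒯 : ∀ c, ℤ → Submodule K (T c)}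
    {𝒬 : ∀ c b, ℤ → Submodule K (P c b)} (hρ : ∀ c b k, ∀ x ∈ 𝒯 c k, ρ c b x ∈ 𝒬 c b k)
    (hL : ∀ c b k, ∀ x ∈ 𝒬 c b k, L c b x ∈ 𝒯 c k)
    {S : Type*} {B : S → Type*} [∀ β, Ring (B β)] [∀ β, Algebra K (B β)]
    {𝒜 : ∀ β, ℤ → Submodule K (B β)} (h𝒜 : ∀ β, IsAlgGrading (𝒜 β))
    {p : S → Σ c, κ c} (hp : Function.Bijective p)
    (Θ : ∀ β, B β ≃ₐ[K] Matrix (Fin (W (p β).1)) (Fin (W (p β).1)) (P (p β).1 (p β).2))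
    (hΘ : ∀ β k x, Θ β x ∈ matGrade (𝒬 (p β).1 (p β).2) k ↔ x ∈ 𝒜 β k) :
    ∃ Φ : DSum K B →ₙₐ[K] DSum K (fun c => Matrix (Fin (W c)) (Fin (W c)) (T c)),
      IsGradedBijection (dsumGrade 𝒜) (dsumGrade fun c => matGrade (𝒯 c)) Φ := by
  let R : C → Type _ := fun c => Matrix (Fin (W c)) (Fin (W c)) (T c)
  -- Matrices over $T_c$ split into matrices over the summands $P_{c,b}$. Reindexing along the
  -- bijection `p` turns this into a decomposition of the whole target with summands $B_\beta$.
  have hdec := ((isSumDecomp_dsum (K := K) (N := R)).sigma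
    (P := fun q : Σ c, κ c => Matrix (Fin (W q.1)) (Fin (W q.1)) (P q.1 q.2))
    fun c => (hT c).matrix (Fin (W c))).comp_equiv hp (P := B) fun β => (Θ β).toLinearEquiv
  obtain ⟨e, he⟩ := hdec.exists_equiv
  have he' : ∀ m β, (e m).1 β =
      (Θ β).symm ((ρ (p β).1 (p β).2).mapMatrix (m.1 (p β).1)) := he
  have hmul : ∀ x y, e (x * y) = e x * e y := fun x y => by
    refine Subtype.ext (funext fun β => ?_)
    change (e (x * y)).1 β = (e x).1 β * (e y).1 β
    rw [he', he', he', ← map_mul]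
    congr 1
    ext s t
    change ρ _ _ ((x.1 (p β).1 * y.1 (p β).1) s t) = _
    rw [Matrix.mul_apply, Matrix.mul_apply, map_sum]
    exact Finset.sum_congr rfl fun u _ => hρm _ _ _ _
  -- Projections and inclusions both preserve degrees, so an element is homogeneous exactly when all
  -- its components are.
  have hgr : ∀ k m, m ∈ dsumGrade (fun c => matGrade (𝒯 c)) k ↔ e m ∈ dsumGrade 𝒜 k :=
    fun k m => by
      constructor
      · intro hm β
        rw [he', ← hΘ β k, AlgEquiv.apply_symm_apply]
        exact fun s t => hρ _ _ _ _ (hm (p β).1 s t)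
      · intro hm
        refine hdec.mem_of_mem fun β => ?_
        rw [← he]
        exact dsumSingle_mem (𝒜 := fun c => matGrade (𝒯 c)) fun s t =>
          hL _ _ _ _ ((hΘ β k _).2 (hm β) s t)
  have hmul' : ∀ x y, e.symm (x * y) = e.symm x * e.symm y := fun x y => by
    rw [LinearEquiv.symm_apply_eq, hmul, e.apply_symm_apply, e.apply_symm_apply]
  exact ⟨{ toFun := e.symm
           map_smul' := fun c x => map_smul e.symm c x
           map_zero' := map_zero e.symm
           map_add' := map_add e.symm
           map_mul' := hmul' },
    isGradedBijection_of_mem_iff (isAlgGrading_dsum h𝒜) e.symm hmul' fun k x => by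
      rw [hgr, e.apply_symm_apply]⟩

end SumMatrices

/-! ### The isomorphism for $V_n^\Lambda$ -/

section SumIso

variable {K : Type w} [CommRing K] {I : Type u} {A : Type v} {Γ : InvQuiver I A}
  {lam : I → ℕ} {gam : I → K} {d : ℕ}

/-- The orbits $\beta\subseteq I^n$ correspond bijectively to the choices of $n_1,\dots,n_d$ and of
one orbit in each part. These choices also index the expansion of the right-hand side, so the
isomorphisms for the single orbits can be added up. -/
theorem exists_sumIso (D : Γ.Decomposition d) (hadm : Γ.Admissible lam gam) (n : ℕ)
    (Lam : I → ℕ) :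
    ∃ Φ : VnCyc K Γ lam gam n Lam →ₙₐ[K] SumMatVnCyc K D lam gam Lam n,
      IsGradedBijection (VnCyc.grade K Γ lam gam n Lam) (SumMatVnCyc.grade K D lam gam Lam n) Φ := by
  choose Θ hΘ _ using fun β : Γ.BOrbit n => (exists_blockIso (K := K) D β.2 hadm).choose_spec.2 Lam
  let N : ∀ (c : Compositions d n) (j : Fin d), (D.part j).BOrbit (c.1 j) → Type (max u w) :=
    fun c j b => VCyc K (D.part j) (fun i => lam i) (fun i => gam i) b.1 (fun i => Lam i)
  exact exists_dsumMatIso (fun c : Compositions d n => Nat.multinomial Finset.univ c.1)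
    (T := fun c => ⨂[K] j, VnCycPart K D lam gam Lam j (c.1 j))
    (fun c => isSumDecomp_tensor fun j => isSumDecomp_dsum (K := K) (N := N c j))
    (fun c b x y => tensorMap_mul (fun j x y => rfl) x y)
    (𝒯 := fun c => tensorGrade fun j =>
      VnCyc.grade K (D.part j) (fun i => lam i) (fun i => gam i) (c.1 j) (fun i => Lam i))
    (𝒬 := fun c b => tensorGrade fun j =>
      VCyc.grade K (D.part j) (fun i => lam i) (fun i => gam i) (b j).1 (fun i => Lam i))
    (fun c b k x hx => map_mem_tensorGrade (𝒜 := fun j =>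
      VnCyc.grade K (D.part j) (fun i => lam i) (fun i => gam i) (c.1 j) (fun i => Lam i))
      (fun j k x hx => hx (b j)) hx)
    (fun c b k x hx => map_mem_tensorGrade (fun j k x hx => dsumSingle_mem (i := b j)
      (𝒜 := fun β : (D.part j).BOrbit (c.1 j) =>
        VCyc.grade K (D.part j) (fun i => lam i) (fun i => gam i) β.1 (fun i => Lam i)) hx) hx)
    (fun β => VCyc.isAlgGrading β.2 hadm)
    (p := D.partOrbits) ⟨partOrbits_injective, partOrbits_surjective⟩ Θ
    fun β k x => (hΘ β).2.2.2 k x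

end SumIso

end

end QuiverHeckeB

theorem corollary4p5 {K : Type*} [CommRing K] {I A : Type*}
    (Γ : QuiverHeckeB.InvQuiver I A) (lam : I → ℕ) (gam : I → K) (hadm : Γ.Admissible lam gam)
    {d : ℕ} (hd : 0 < d) (D : Γ.Decomposition d) (n : ℕ) :
    (∀ β : Set (Fin n → I), Γ.IsBOrbit β →
      ∃ Θ : QuiverHeckeB.V K Γ lam gam β ≃ₐ[K] QuiverHeckeB.MatV K D lam gam β,
        QuiverHeckeB.IsGradedBijection (QuiverHeckeB.V.grade K Γ lam gam β)
          (QuiverHeckeB.MatV.grade K D lam gam β) Θ ∧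
        ∀ Lam : I →₀ ℕ,
          ∃ ΘL : QuiverHeckeB.VCyc K Γ lam gam β Lam ≃ₐ[K]
              QuiverHeckeB.MatVCyc K D lam gam β Lam,
            QuiverHeckeB.IsGradedBijection (QuiverHeckeB.VCyc.grade K Γ lam gam β Lam)
              (QuiverHeckeB.MatVCyc.grade K D lam gam β Lam) ΘL ∧
            ∀ x, ΘL (QuiverHeckeB.VCyc.mk K Γ lam gam β Lam x) =
              QuiverHeckeB.MatV.toCyc K D lam gam β Lam (Θ x)) ∧
    (∀ Lam : I →₀ ℕ,
      ∃ Φ : QuiverHeckeB.VnCyc K Γ lam gam n Lam →ₙₐ[K]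
          QuiverHeckeB.SumMatVnCyc K D lam gam Lam n,
        QuiverHeckeB.IsGradedBijection (QuiverHeckeB.VnCyc.grade K Γ lam gam n Lam)
          (QuiverHeckeB.SumMatVnCyc.grade K D lam gam Lam n) Φ) := by
  refine ⟨fun β hβ => ?_, fun Lam => QuiverHeckeB.exists_sumIso D hadm n Lam⟩
  obtain ⟨Θ, hΘ, hL⟩ := QuiverHeckeB.exists_blockIso D hβ hadm
  exact ⟨Θ, hΘ, fun Lam => hL Lam⟩
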